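/- **Theorem (fundamental theorem for homotopy $K$-theory).** Rings are associative but not necessarily unital or commutative, and homomorphisms are not assumed to preserve units. Write $\tilde A=\mathbb Z\oplus A$ for the unitalization of a ring $A$. *Definitions.* For a unital ring $R$, $K_0R$ is the group completion of the monoid (under block sum) of conjugacy classes, under $GL(R)=\bigcup_m GL_m(R)$, of idempotents of $\bigcup_m M_m(R)$, and $K_1R=GL(R)_{ab}$. For an arbitrary ring, $K_0A=\ker(K_0\tilde A\to K_0\mathbb Z)$. Let $\Gamma A$ be the ring of matrices $(a_{i,j})_{i,j\in\mathbb N}$ over $A$ with finitely many distinct entries and for which there is a bound on the number of nonzero entries in each row and each column, let $M_\infty A\lhd\Gamma A$ be the ideal of matrices with finitely many nonzero entries, and put $\Sigma A=\Gamma A/M_\infty A$ and $K_{-p}A=K_0(\Sigma^pA)$ for $p\ge 0$. Let $PA=\ker(\mathrm{ev}_0:A[t]\to A)$ and $\Omega A=\ker(\mathrm{ev}_1:PA\to A)$. For an extension $0\to I\to B\to C\to 0$ with $B\to C$ a unital map of unital rings, the index map $K_1C\to K_0I$ sends the class of $g\in GL_m(C)$ to $[h\,p\,h^{-1}]-[p]$,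 where $p=\mathrm{diag}(1_m,0)$, $h=\begin{pmatrix}2x-xyx& xy-1\\ 1-yx& y\end{pmatrix}$ and $x,y\in M_m(B)$ lift $g,g^{-1}$. For an arbitrary extension $0\to I\to B\to C\to 0$, the connecting map $\partial:K_0C\to K_0(\Sigma I)=K_{-1}I$ is the composite of $K_0C\subset K_0\tilde C$, the isomorphism $K_0\tilde C\to K_1(\Sigma\tilde C)$, $[e]\mapsto[1-e+e\alpha]$ with $\alpha$ the class of $\sum_i e_{i,i+1}$, and the index map of $0\to\Sigma I\to\Sigma\tilde B\to\Sigma\tilde C\to0$. Applied to $0\to\Sigma^p\Omega A\to\Sigma^pPA\to\Sigma^pA\to0$ it gives $\partial:K_{-p}A\to K_{-p-1}\Omega A$, and for $n\in\mathbb Z$ $$KH_n(A)=\operatorname{colim}_{p\ge\max(0,-n)}K_{-p}(\Omega^{n+p}A),$$ the colimit being taken along these maps $\partial$. This is a functor from rings to abelian groups. Let $\sigma=\ker(\mathrm{ev}_1:\mathbb Z[t,t^{-1}]\to\mathbb Z)$ and $\sigma A=\sigma\otimes_{\mathbb Z}A$. *Statement.* For every $n\in\mathbb Z$ and every ring $A$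 there are isomorphisms, natural in $A$, $$KH_n(\sigma A)\cong KH_{n-1}(A),\qquad KH_n(A[t,t^{-1}])\cong KH_n(A)\oplus KH_{n-1}(A).$$ -/

import Mathlib

open CategoryTheory

universe u v w

namespace HomotopyK

section Cone

/-- The two conditions defining Karoubi's cone: finitely many distinct entries, and a uniform
bound on the number of nonzero entries in each row and in each column. -/
structure IsCone {A : Type u} [Zero A] (a : ℕ → ℕ → A) : Prop where
  finite_entries : {x : A | ∃ i j, a i j = x}.Finite
  bounded : ∃ N : ℕ, (∀ i, {j | a i j ≠ 0}.encard ≤ N) ∧ (∀ j, {i | a i j ≠ 0}.encard ≤ N)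

theorem IsCone.row_finite {A : Type u} [Zero A] {a : ℕ → ℕ → A} (h : IsCone a) (i : ℕ) :
    {j | a i j ≠ 0}.Finite := by
  obtain ⟨N, h1, -⟩ := h.bounded
  exact Set.finite_of_encard_le_coe (h1 i)

theorem IsCone.col_finite {A : Type u} [Zero A] {a : ℕ → ℕ → A} (h : IsCone a) (j : ℕ) :
    {i | a i j ≠ 0}.Finite := by
  obtain ⟨N, -, h1⟩ := h.bounded
  exact Set.finite_of_encard_le_coe (h1 j)

/-- If the entries of `c` are values of a map `f` on pairs of entries of `a` and `b`, and the
support of `c` is contained in the union of the supports, then `c` is in the cone. -/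
theorem IsCone.map₂ {A B C : Type u} [Zero A] [Zero B] [Zero C] {a : ℕ → ℕ → A} {b : ℕ → ℕ → B}
    (ha : IsCone a) (hb : IsCone b) (f : A → B → C) (hf : f 0 0 = 0) :
    IsCone (fun i j => f (a i j) (b i j)) := by
  refine ⟨?_, ?_⟩
  · refine (Set.Finite.image2 f ha.finite_entries hb.finite_entries).subset ?_
    rintro _ ⟨i, j, rfl⟩
    exact ⟨_, ⟨i, j, rfl⟩, _, ⟨i, j, rfl⟩, rfl⟩
  · obtain ⟨N, h1, h2⟩ := ha.bounded
    obtain ⟨M, h3, h4⟩ := hb.bounded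
    refine ⟨N + M, fun i => ?_, fun j => ?_⟩
    · refine (Set.encard_le_encard (t := {j | a i j ≠ 0} ∪ {j | b i j ≠ 0}) ?_).trans
        ((Set.encard_union_le _ _).trans ?_)
      · intro j hj
        by_contra hc
        simp only [Set.mem_union, Set.mem_ofPred_eq, not_or, not_not] at hc
        exact hj (by simp [hc.1, hc.2, hf])
      · push_cast
        exact add_le_add (h1 i) (h3 i)
    · refine (Set.encard_le_encard (t := {i | a i j ≠ 0} ∪ {i | b i j ≠ 0}) ?_).trans
        ((Set.encard_union_le _ _).trans ?_)
      · intro i hi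
        by_contra hc
        simp only [Set.mem_union, Set.mem_ofPred_eq, not_or, not_not] at hc
        exact hi (by simp [hc.1, hc.2, hf])
      · push_cast
        exact add_le_add (h2 j) (h4 j)

theorem IsCone.map {A B : Type u} [Zero A] [Zero B] {a : ℕ → ℕ → A}
    (ha : IsCone a) (f : A → B) (hf : f 0 = 0) : IsCone (fun i j => f (a i j)) :=
  ha.map₂ ha (fun x _ => f x) hf

theorem IsCone.zero {A : Type u} [Zero A] : IsCone (fun _ _ => (0 : A)) where
  finite_entries := (Set.finite_singleton (0 : A)).subset (by rintro _ ⟨i, j, rfl⟩; rfl)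
  bounded := ⟨0, by simp, by simp⟩

/-- A matrix supported on a partial injection and with finitely many entries is in the cone. -/
theorem IsCone.of_inj {A : Type u} [Zero A] {a : ℕ → ℕ → A}
    (hfin : {x : A | ∃ i j, a i j = x}.Finite)
    (hr : ∀ i j j', a i j ≠ 0 → a i j' ≠ 0 → j = j')
    (hc : ∀ i i' j, a i j ≠ 0 → a i' j ≠ 0 → i = i') : IsCone a where
  finite_entries := hfin
  bounded := ⟨1, fun i => by
      rw [Nat.cast_one, Set.encard_le_one_iff]; exact fun x y hx hy => hr i x y hx hy,
    fun j => by
      rw [Nat.cast_one, Set.encard_le_one_iff]; exact fun x y hx hy => hc x y j hx hy⟩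

section Mul

variable {A : Type u} [NonUnitalRing A]

/-- The product of two infinite matrices (meaningful when rows or columns are finite). -/
noncomputable def matMul (a b : ℕ → ℕ → A) : ℕ → ℕ → A := fun i j => ∑ᶠ k, a i k * b k j

theorem matMul_eq_sum_row {a : ℕ → ℕ → A} (b : ℕ → ℕ → A) (i j : ℕ) {s : Finset ℕ}
    (hs : ∀ k, a i k ≠ 0 → k ∈ s) : matMul a b i j = ∑ k ∈ s, a i k * b k j := by
  refine finsum_eq_sum_of_support_subset _ ?_
  intro k hk
  exact hs k (fun h => hk (by simp [h]))

theorem matMul_eq_sum_col (a : ℕ → ℕ → A) {b : ℕ → ℕ → A} (i j : ℕ) {s : Finset ℕ}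
    (hs : ∀ k, b k j ≠ 0 → k ∈ s) : matMul a b i j = ∑ k ∈ s, a i k * b k j := by
  refine finsum_eq_sum_of_support_subset _ ?_
  intro k hk
  exact hs k (fun h => hk (by simp [h]))

theorem IsCone.exists_rowFinset {a : ℕ → ℕ → A} (ha : IsCone a) (i : ℕ) :
    ∃ s : Finset ℕ, ∀ k, a i k ≠ 0 ↔ k ∈ s :=
  ⟨(ha.row_finite i).toFinset, fun k => by simp⟩

theorem IsCone.exists_colFinset {a : ℕ → ℕ → A} (ha : IsCone a) (j : ℕ) :
    ∃ s : Finset ℕ, ∀ k, a k j ≠ 0 ↔ k ∈ s :=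
  ⟨(ha.col_finite j).toFinset, fun k => by simp⟩

theorem matMul_ne_zero {a b : ℕ → ℕ → A} {i j : ℕ} (h : matMul a b i j ≠ 0) :
    ∃ k, a i k ≠ 0 ∧ b k j ≠ 0 := by
  by_contra hc
  push Not at hc
  refine h ?_
  have : ∀ k, a i k * b k j = 0 := fun k => by
    by_cases hk : a i k = 0
    · simp [hk]
    · simp [hc k hk]
  simp [matMul, this]

/-- The set of sums of at most `N` elements of a finite set is finite. -/
theorem finite_sums (S : Set A) (hS : S.Finite) (N : ℕ) :
    {x : A | ∃ (s : Finset ℕ) (f : ℕ → A), s.card ≤ N ∧ (∀ k ∈ s, f k ∈ S) ∧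
      x = ∑ k ∈ s, f k}.Finite := by
  induction N with
  | zero =>
    refine (Set.finite_singleton (0 : A)).subset ?_
    rintro x ⟨s, f, hs, -, rfl⟩
    have : s = ∅ := by simpa using hs
    simp [this]
  | succ N ih =>
    refine (ih.union (Set.Finite.image2 (· + ·) hS ih)).subset ?_
    rintro x ⟨s, f, hs, hf, rfl⟩
    rcases s.eq_empty_or_nonempty with rfl | ⟨k, hk⟩
    · exact Or.inl ⟨∅, f, by simp, by simp, rfl⟩
    · refine Or.inr ⟨f k, hf k hk, ∑ l ∈ s.erase k, f l,
        ⟨s.erase k, f, ?_, fun l hl => hf l (Finset.mem_of_mem_erase hl), rfl⟩, ?_⟩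
      · rw [Finset.card_erase_of_mem hk]; omega
      · exact Finset.add_sum_erase s f hk

theorem encard_comp_le {r t : ℕ → ℕ → Prop} {N M : ℕ} {i : ℕ}
    (hr : {k | r i k}.encard ≤ N) (ht : ∀ k, {j | t k j}.encard ≤ M) :
    {j | ∃ k, r i k ∧ t k j}.encard ≤ ((N * M : ℕ) : ℕ∞) := by
  classical
  have hfr : {k | r i k}.Finite := Set.finite_of_encard_le_coe hr
  have hft : ∀ k, {j | t k j}.Finite := fun k => Set.finite_of_encard_le_coe (ht k)
  have hsub : {j | ∃ k, r i k ∧ t k j} ⊆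
      ((hfr.toFinset.biUnion fun k => (hft k).toFinset : Finset ℕ) : Set ℕ) := by
    rintro j ⟨k, h1, h2⟩
    simp only [Finset.coe_biUnion, Set.mem_iUnion]
    exact ⟨k, by simpa using h1, by simpa using h2⟩
  refine (Set.encard_le_encard hsub).trans ?_
  rw [Set.encard_coe_eq_coe_finsetCard]
  refine Nat.cast_le.2 ((Finset.card_biUnion_le_card_mul _ _ M ?_).trans ?_)
  · intro k _
    have := ht k
    rw [(hft k).encard_eq_coe_toFinset_card] at this
    exact_mod_cast this
  · refine Nat.mul_le_mul_right _ ?_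
    rw [hfr.encard_eq_coe_toFinset_card] at hr
    exact_mod_cast hr

theorem IsCone.mul {a b : ℕ → ℕ → A} (ha : IsCone a) (hb : IsCone b) : IsCone (matMul a b) := by
  obtain ⟨N, h1, h2⟩ := ha.bounded
  obtain ⟨M, h3, h4⟩ := hb.bounded
  refine ⟨?_, N * M + M * N, fun i => ?_, fun j => ?_⟩
  · refine (finite_sums _ (Set.Finite.image2 (· * ·) ha.finite_entries hb.finite_entries) N).subset
      ?_
    rintro _ ⟨i, j, rfl⟩
    refine ⟨(ha.row_finite i).toFinset, fun k => a i k * b k j, ?_, ?_,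
      matMul_eq_sum_row b i j (fun k hk => by simpa using hk)⟩
    · have := h1 i
      rw [(ha.row_finite i).encard_eq_coe_toFinset_card] at this
      exact_mod_cast this
    · exact fun k _ => ⟨_, ⟨i, k, rfl⟩, _, ⟨k, j, rfl⟩, rfl⟩
  · refine (Set.encard_le_encard ?_).trans
      ((encard_comp_le (r := fun i k => a i k ≠ 0) (t := fun k j => b k j ≠ 0) (h1 i) h3).trans
        (Nat.cast_le.2 (Nat.le_add_right _ _)))
    exact fun j hj => matMul_ne_zero hj
  · refine (Set.encard_le_encard ?_).trans
      ((encard_comp_le (r := fun j k => b k j ≠ 0) (t := fun k i => a i k ≠ 0) (h4 j) h2).trans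
        (Nat.cast_le.2 (Nat.le_add_left _ _)))
    intro i hi
    obtain ⟨k, hk⟩ := matMul_ne_zero hi
    exact ⟨k, hk.2, hk.1⟩

variable (A) in
/-- The additive group of Karoubi's cone `Γ A`. -/
def coneAddSubgroup : AddSubgroup (ℕ → ℕ → A) where
  carrier := {a | IsCone a}
  zero_mem' := IsCone.zero
  add_mem' ha hb := ha.map₂ hb (· + ·) (by simp)
  neg_mem' ha := ha.map (fun x => -x) (by simp)

variable (A) in
/-- Karoubi's cone ring `Γ A`. -/
def Cone : Type u := coneAddSubgroup A

noncomputable instance : AddCommGroup (Cone A) := inferInstanceAs (AddCommGroup (coneAddSubgroup A))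

/-- Elements of `Γ A` from infinite matrices. -/
def Cone.of (a : ℕ → ℕ → A) (h : IsCone a) : Cone A := ⟨a, h⟩

/-- The entries of an element of the cone. -/
def Cone.entry (a : Cone A) : ℕ → ℕ → A := a.1

theorem Cone.isCone (a : Cone A) : IsCone a.entry := a.2

@[simp] theorem Cone.entry_of (a : ℕ → ℕ → A) (h : IsCone a) (i j : ℕ) :
    (Cone.of a h).entry i j = a i j := rfl

@[ext] theorem Cone.ext {a b : Cone A} (h : ∀ i j, a.entry i j = b.entry i j) : a = b :=
  Subtype.ext (funext fun i => funext fun j => h i j)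

noncomputable instance : Mul (Cone A) := ⟨fun a b => Cone.of (matMul a.entry b.entry) (a.isCone.mul b.isCone)⟩

@[simp] theorem Cone.entry_zero (i j : ℕ) : (0 : Cone A).entry i j = 0 := rfl
@[simp] theorem Cone.entry_add (a b : Cone A) (i j : ℕ) :
    (a + b).entry i j = a.entry i j + b.entry i j := rfl
@[simp] theorem Cone.entry_neg (a : Cone A) (i j : ℕ) : (-a).entry i j = -a.entry i j := rfl
@[simp] theorem Cone.entry_sub (a b : Cone A) (i j : ℕ) :
    (a - b).entry i j = a.entry i j - b.entry i j := rfl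
theorem Cone.entry_mul (a b : Cone A) (i j : ℕ) :
    (a * b).entry i j = ∑ᶠ k, a.entry i k * b.entry k j := rfl

theorem Cone.entry_mul_row (a b : Cone A) (i j : ℕ) {s : Finset ℕ}
    (hs : ∀ k, a.entry i k ≠ 0 → k ∈ s) :
    (a * b).entry i j = ∑ k ∈ s, a.entry i k * b.entry k j := matMul_eq_sum_row _ i j hs

theorem Cone.entry_mul_col (a b : Cone A) (i j : ℕ) {s : Finset ℕ}
    (hs : ∀ k, b.entry k j ≠ 0 → k ∈ s) :
    (a * b).entry i j = ∑ k ∈ s, a.entry i k * b.entry k j := matMul_eq_sum_col _ i j hs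

noncomputable instance : NonUnitalRing (Cone A) where
  left_distrib a b c := by
    ext i j
    obtain ⟨s, hs⟩ := a.isCone.exists_rowFinset i
    have hs' := fun k => (hs k).1
    simp [Cone.entry_mul_row _ _ i j hs', mul_add, Finset.sum_add_distrib]
  right_distrib a b c := by
    ext i j
    obtain ⟨s, hs⟩ := c.isCone.exists_colFinset j
    have hs' := fun k => (hs k).1
    simp [Cone.entry_mul_col _ _ i j hs', add_mul, Finset.sum_add_distrib]
  zero_mul a := by
    ext i j
    rw [Cone.entry_mul_row (s := ∅) _ _ i j (by simp)]
    simp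
  mul_zero a := by
    ext i j
    rw [Cone.entry_mul_col (s := ∅) _ _ i j (by simp)]
    simp
  mul_assoc a b c := by
    ext i j
    obtain ⟨s, hs⟩ := a.isCone.exists_rowFinset i
    obtain ⟨t, ht⟩ := c.isCone.exists_colFinset j
    have hs' := fun k => (hs k).1
    have ht' := fun k => (ht k).1
    rw [Cone.entry_mul_col _ _ i j ht', Cone.entry_mul_row _ _ i j hs']
    simp only [Cone.entry_mul_row a b i _ hs', Cone.entry_mul_col b c _ j ht', Finset.sum_mul,
      Finset.mul_sum, mul_assoc]
    exact Finset.sum_comm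

variable (A) in
/-- The ideal `M_∞ A` of `Γ A`: matrices with finitely many nonzero entries. -/
noncomputable def finIdeal : TwoSidedIdeal (Cone A) :=
  TwoSidedIdeal.mk' {a | {q : ℕ × ℕ | a.entry q.1 q.2 ≠ 0}.Finite}
    (by simp)
    (by
      intro x y hx hy
      refine (hx.union hy).subset fun q hq => ?_
      by_contra hc
      simp only [Set.mem_union, Set.mem_ofPred_eq, not_or, not_not] at hc
      exact hq (by simp [hc.1, hc.2]))
    (by
      intro x hx
      simpa using hx)
    (by
      intro x y hy
      have h1 : (⋃ q ∈ {q : ℕ × ℕ | y.entry q.1 q.2 ≠ 0},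
          ({i | x.entry i q.1 ≠ 0} ×ˢ {q.2} : Set (ℕ × ℕ))).Finite :=
        hy.biUnion fun q _ => (x.isCone.col_finite q.1).prod (Set.finite_singleton _)
      refine h1.subset fun q hq => ?_
      obtain ⟨k, hk1, hk2⟩ := matMul_ne_zero (a := x.entry) (b := y.entry) hq
      simp only [Set.mem_iUnion]
      exact ⟨(k, q.2), hk2, hk1, rfl⟩)
    (by
      intro x y hx
      have h1 : (⋃ q ∈ {q : ℕ × ℕ | x.entry q.1 q.2 ≠ 0},
          ({q.1} ×ˢ {j | y.entry q.2 j ≠ 0} : Set (ℕ × ℕ))).Finite :=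
        hx.biUnion fun q _ => (Set.finite_singleton _).prod (y.isCone.row_finite q.2)
      refine h1.subset fun q hq => ?_
      obtain ⟨k, hk1, hk2⟩ := matMul_ne_zero (a := x.entry) (b := y.entry) hq
      simp only [Set.mem_iUnion]
      exact ⟨(q.1, k), hk1, rfl, hk2⟩)

theorem mem_finIdeal {a : Cone A} :
    a ∈ finIdeal A ↔ {q : ℕ × ℕ | a.entry q.1 q.2 ≠ 0}.Finite := by
  simp [finIdeal]

variable (A) in
/-- The suspension `Σ A = Γ A / M_∞ A`. -/
def Susp : Type u := (finIdeal A).ringCon.Quotient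

noncomputable instance : NonUnitalRing (Susp A) :=
  inferInstanceAs (NonUnitalRing (finIdeal A).ringCon.Quotient)

/-- The quotient map `Γ A → Σ A`. -/
noncomputable def Susp.mk : Cone A →ₙ+* Susp A where
  toFun a := ((a : (finIdeal A).ringCon.Quotient))
  map_mul' _ _ := rfl
  map_zero' := rfl
  map_add' _ _ := rfl

theorem Susp.mk_surjective : Function.Surjective (Susp.mk (A := A)) := fun x =>
  Quotient.exists_rep x

theorem Susp.mk_eq_zero {a : Cone A} :
    Susp.mk a = 0 ↔ {q : ℕ × ℕ | a.entry q.1 q.2 ≠ 0}.Finite := by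
  rw [← mem_finIdeal, TwoSidedIdeal.mem_iff]
  exact RingCon.eq _

end Mul

section Functoriality

variable {A B C : Type u} [NonUnitalRing A] [NonUnitalRing B] [NonUnitalRing C]

/-- The map `Γ f : Γ A → Γ B` applying `f` to the entries. -/
noncomputable def Cone.map (f : A →ₙ+* B) : Cone A →ₙ+* Cone B where
  toFun a := Cone.of (fun i j => f (a.entry i j)) (a.isCone.map f (map_zero f))
  map_mul' a b := by
    ext i j
    obtain ⟨s, hs⟩ := a.isCone.exists_rowFinset i
    have hs' := fun k => (hs k).1
    rw [Cone.entry_mul_row (s := s)]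
    · rw [Cone.entry_of, Cone.entry_mul_row _ _ i j hs', map_sum]
      exact Finset.sum_congr rfl fun k _ => map_mul f _ _
    · intro k hk
      exact hs' k fun h => hk (by simp [h])
  map_zero' := by ext i j; exact map_zero f
  map_add' a b := by ext i j; exact map_add f _ _

@[simp] theorem Cone.entry_map (f : A →ₙ+* B) (a : Cone A) (i j : ℕ) :
    (Cone.map f a).entry i j = f (a.entry i j) := rfl

/-- The induced map `Σ f : Σ A → Σ B`. -/
noncomputable def Susp.map (f : A →ₙ+* B) : Susp A →ₙ+* Susp B where
  toFun := Quotient.lift (fun a => Susp.mk (Cone.map f a)) (by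
    intro a b hab
    have h1 : Susp.mk (a - b) = 0 := by
      have : Susp.mk a = Susp.mk b := Quotient.sound hab
      rw [map_sub, this, sub_self]
    rw [Susp.mk_eq_zero] at h1
    rw [← sub_eq_zero, ← map_sub, ← map_sub, Susp.mk_eq_zero]
    refine h1.subset fun q hq h => hq ?_
    rw [Cone.entry_map, h, map_zero])
  map_mul' x y := by
    obtain ⟨a, rfl⟩ := Susp.mk_surjective x
    obtain ⟨b, rfl⟩ := Susp.mk_surjective y
    change Susp.mk (Cone.map f (a * b)) = Susp.mk (Cone.map f a) * Susp.mk (Cone.map f b)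
    rw [map_mul, map_mul]
  map_zero' := by
    change Susp.mk (Cone.map f 0) = 0
    rw [map_zero, map_zero]
  map_add' x y := by
    obtain ⟨a, rfl⟩ := Susp.mk_surjective x
    obtain ⟨b, rfl⟩ := Susp.mk_surjective y
    change Susp.mk (Cone.map f (a + b)) = Susp.mk (Cone.map f a) + Susp.mk (Cone.map f b)
    rw [map_add, map_add]

@[simp] theorem Susp.map_mk (f : A →ₙ+* B) (a : Cone A) :
    Susp.map f (Susp.mk a) = Susp.mk (Cone.map f a) := rfl

theorem Susp.map_id : Susp.map (NonUnitalRingHom.id A) = NonUnitalRingHom.id (Susp A) := by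
  ext x
  obtain ⟨a, rfl⟩ := Susp.mk_surjective x
  rfl

theorem Susp.map_comp (g : B →ₙ+* C) (f : A →ₙ+* B) :
    Susp.map (g.comp f) = (Susp.map g).comp (Susp.map f) := by
  ext x
  obtain ⟨a, rfl⟩ := Susp.mk_surjective x
  rfl

end Functoriality

section Unital

variable {R S : Type u} [Ring R] [Ring S]

/-- The matrix with `(i, j)` entry
`r` when `i + p = j + q` and zero elsewhere. -/
noncomputable def Cone.diag (p q : ℕ) (r : R) : Cone R :=
  Cone.of (fun i j => if i + p = j + q then r else 0) (by
    refine IsCone.of_inj ?_ ?_ ?_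
    · refine (Set.toFinite {r, 0}).subset ?_
      rintro _ ⟨i, j, rfl⟩
      by_cases h : i + p = j + q <;> simp [h]
    · intro i j j' h h'
      have h1 := (ite_ne_right_iff.1 h).1
      have h2 := (ite_ne_right_iff.1 h').1
      omega
    · intro i i' j h h'
      have h1 := (ite_ne_right_iff.1 h).1
      have h2 := (ite_ne_right_iff.1 h').1
      omega)

@[simp] theorem Cone.entry_diag (p q : ℕ) (r : R) (i j : ℕ) :
    (Cone.diag p q r).entry i j = if i + p = j + q then r else 0 := rfl

theorem Cone.diag_zero_mul_entry (r : R) (a : Cone R) (i j : ℕ) :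
    (Cone.diag 0 0 r * a).entry i j = r * a.entry i j := by
  rw [Cone.entry_mul_row (s := {i})]
  · simp
  · intro k hk
    have := (ite_ne_right_iff.1 hk).1
    simp; omega

theorem Cone.mul_diag_zero_entry (r : R) (a : Cone R) (i j : ℕ) :
    (a * Cone.diag 0 0 r).entry i j = a.entry i j * r := by
  rw [Cone.entry_mul_col (s := {j})]
  · simp
  · intro k hk
    have := (ite_ne_right_iff.1 hk).1
    simp; omega

noncomputable instance : Ring (Cone R) where
  __ := (inferInstance : NonUnitalRing (Cone R))
  one := Cone.diag 0 0 1
  one_mul a := by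
    ext i j
    exact (Cone.diag_zero_mul_entry 1 a i j).trans (one_mul _)
  mul_one a := by
    ext i j
    exact (Cone.mul_diag_zero_entry 1 a i j).trans (mul_one _)

noncomputable instance : Ring (Susp R) := inferInstanceAs (Ring (finIdeal R).ringCon.Quotient)

theorem Cone.one_def : (1 : Cone R) = Cone.diag 0 0 1 := rfl
theorem Susp.one_def : (1 : Susp R) = Susp.mk (Cone.diag 0 0 1) := rfl

/-- `R → Σ R`, sending `r` to the class of the constant diagonal matrix. -/
noncomputable def Susp.const : R →+* Susp R where
  toFun r := Susp.mk (Cone.diag 0 0 r)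
  map_one' := rfl
  map_mul' r s := by
    rw [← map_mul]
    congr 1
    ext i j
    rw [Cone.diag_zero_mul_entry]
    simp
  map_zero' := by
    rw [← map_zero Susp.mk]
    congr 1
    ext i j
    simp
  map_add' r s := by
    rw [← map_add]
    congr 1
    ext i j
    by_cases h : i = j <;> simp [h]

variable (R) in
/-- The class in `Σ R` of the matrix `α = ∑ e_{i,i+1}`. -/
noncomputable def Susp.shift : Susp R := Susp.mk (Cone.diag 1 0 1)

variable (R) in
/-- The class in `Σ R` of the matrix `α* = ∑ e_{i+1,i}`. -/
noncomputable def Susp.shift' : Susp R := Susp.mk (Cone.diag 0 1 1)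

theorem Susp.shift_mul_shift' : Susp.shift R * Susp.shift' R = 1 := by
  rw [Susp.shift, Susp.shift', Susp.one_def, ← map_mul]
  congr 1
  ext i j
  rw [Cone.entry_mul_row (s := {i + 1})]
  · by_cases h : i = j <;> simp [h]
  · intro k hk
    have := (ite_ne_right_iff.1 hk).1
    simp; omega

theorem Susp.shift'_mul_shift : Susp.shift' R * Susp.shift R = 1 := by
  rw [Susp.shift, Susp.shift', Susp.one_def, ← map_mul, ← sub_eq_zero, ← map_sub, Susp.mk_eq_zero]
  refine (Set.finite_singleton ((0, 0) : ℕ × ℕ)).subset ?_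
  rintro ⟨i, j⟩ h
  by_contra hne
  refine h ?_
  have hne' : i ≠ 0 ∨ j ≠ 0 := by
    by_contra hc; push Not at hc; exact hne (by simp [hc.1, hc.2])
  rw [Cone.entry_sub, Cone.entry_mul_row (s := {i - 1})]
  · rcases Nat.eq_zero_or_pos i with rfl | hi
    · have : j ≠ 0 := by simpa using hne'
      simp [this.symm]
    · have h1 : i = i - 1 + 1 := by omega
      by_cases h : i = j
      · subst h; simp [← h1]
      · have : i - 1 + 1 ≠ j := by omega
        simp [h, this]
  · intro k hk
    have := (ite_ne_right_iff.1 hk).1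
    simp; omega

theorem Susp.shift_comm (r : R) : Susp.shift R * Susp.const r = Susp.const r * Susp.shift R := by
  change Susp.mk _ * Susp.mk _ = Susp.mk _ * Susp.mk _
  rw [← map_mul, ← map_mul]
  congr 1
  ext i j
  rw [Cone.diag_zero_mul_entry, Cone.mul_diag_zero_entry]
  by_cases h : i + 1 = j <;> simp [h]

theorem Susp.shift'_comm (r : R) :
    Susp.shift' R * Susp.const r = Susp.const r * Susp.shift' R := by
  change Susp.mk _ * Susp.mk _ = Susp.mk _ * Susp.mk _
  rw [← map_mul, ← map_mul]
  congr 1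
  ext i j
  rw [Cone.diag_zero_mul_entry, Cone.mul_diag_zero_entry]
  by_cases h : i = j + 1 <;> simp [h]

/-- The unital ring homomorphism `Σ R → Σ S` induced by a unital ring homomorphism. -/
noncomputable def Susp.mapRingHom (f : R →+* S) : Susp R →+* Susp S where
  __ := Susp.map (f : R →ₙ+* S)
  map_one' := by
    change Susp.mk (Cone.map (f : R →ₙ+* S) (Cone.diag 0 0 1)) = Susp.mk (Cone.diag 0 0 1)
    congr 1
    ext i j
    by_cases h : i = j
    · simp only [Cone.entry_map, Cone.entry_diag, h, if_true]; exact map_one f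
    · simp [h]

theorem Susp.mapRingHom_mk (f : R →+* S) (a : Cone R) :
    Susp.mapRingHom f (Susp.mk a) = Susp.mk (Cone.map (f : R →ₙ+* S) a) := rfl

theorem Susp.mapRingHom_diag (f : R →+* S) (p q : ℕ) (r : R) :
    Susp.mapRingHom f (Susp.mk (Cone.diag p q r)) = Susp.mk (Cone.diag p q (f r)) := by
  rw [Susp.mapRingHom_mk]
  congr 1
  ext i j
  by_cases h : i + p = j + q
  · simp only [Cone.entry_map, Cone.entry_diag, h, if_true]; rfl
  · simp [h]

end Unital

end Cone

section Extensions

/-- A short exact sequence of (not necessarily unital) rings `0 → I → B → C → 0`. -/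
structure Ext (I B C : Type u) [NonUnitalRing I] [NonUnitalRing B] [NonUnitalRing C] where
  incl : I →ₙ+* B
  proj : B →ₙ+* C
  incl_injective : Function.Injective incl
  proj_surjective : Function.Surjective proj
  exact : ∀ b, proj b = 0 ↔ ∃ i, incl i = b

/-- A short exact sequence of rings `0 → I → B → C → 0` where `B → C` is a unital homomorphism of
unital rings. -/
structure UExt (I B C : Type u) [NonUnitalRing I] [Ring B] [Ring C] where
  incl : I →ₙ+* B
  proj : B →+* C
  incl_injective : Function.Injective incl
  proj_surjective : Function.Surjective proj
  exact : ∀ b, proj b = 0 ↔ ∃ i, incl i = b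

section

variable {I B C : Type u} [NonUnitalRing I] [NonUnitalRing B] [NonUnitalRing C]

/-- The suspension is an exact functor: `0 → Σ I → Σ B → Σ C → 0`. -/
noncomputable def Ext.susp (E : Ext I B C) : Ext (Susp I) (Susp B) (Susp C) where
  incl := Susp.map E.incl
  proj := Susp.map E.proj
  incl_injective := by
    rw [injective_iff_map_eq_zero]
    intro x hx
    obtain ⟨a, rfl⟩ := Susp.mk_surjective x
    rw [Susp.map_mk, Susp.mk_eq_zero] at hx
    rw [Susp.mk_eq_zero]
    refine hx.subset fun q hq h => hq ?_
    rw [Cone.entry_map] at h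
    exact E.incl_injective (h.trans (map_zero E.incl).symm)
  proj_surjective := by
    classical
    intro y
    obtain ⟨c, rfl⟩ := Susp.mk_surjective y
    let s : C → B := fun c => if c = 0 then 0 else Classical.choose (E.proj_surjective c)
    have hs0 : s 0 = 0 := by simp [s]
    have hs : ∀ c, E.proj (s c) = c := by
      intro c
      by_cases h : c = 0
      · simp [s, h]
      · simp only [s, h, if_false]
        exact Classical.choose_spec (E.proj_surjective c)
    refine ⟨Susp.mk (Cone.of (fun i j => s (c.entry i j)) (c.isCone.map s hs0)), ?_⟩
    rw [Susp.map_mk]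
    congr 1
    ext i j
    simp [hs]
  exact := by
    classical
    intro b
    obtain ⟨a, rfl⟩ := Susp.mk_surjective b
    constructor
    · intro h
      rw [Susp.map_mk, Susp.mk_eq_zero] at h
      let r : B → I := fun b =>
        if hb : E.proj b = 0 then Classical.choose ((E.exact b).1 hb) else 0
      have hr : ∀ b, E.proj b = 0 → E.incl (r b) = b := by
        intro b hb
        simp only [r, hb, dif_pos]
        exact Classical.choose_spec ((E.exact b).1 hb)
      have hr0 : r 0 = 0 :=
        E.incl_injective ((hr 0 (map_zero _)).trans (map_zero E.incl).symm)
      refine ⟨Susp.mk (Cone.of (fun i j => r (a.entry i j)) (a.isCone.map r hr0)), ?_⟩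
      rw [Susp.map_mk, ← sub_eq_zero, ← map_sub, Susp.mk_eq_zero]
      refine h.subset fun q hq h0 => hq ?_
      rw [Cone.entry_map] at h0
      rw [Cone.entry_sub, Cone.entry_map, Cone.entry_of, hr _ h0, sub_self]
    · rintro ⟨x, hx⟩
      obtain ⟨c, rfl⟩ := Susp.mk_surjective x
      rw [← hx, Susp.map_mk, Susp.map_mk, Susp.mk_eq_zero]
      refine Set.finite_empty.subset fun q hq => (hq ?_).elim
      rw [Cone.entry_map, Cone.entry_map]
      exact (E.exact _).2 ⟨_, rfl⟩

end

/-- The suspension of a unital extension. -/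
noncomputable def UExt.susp {I B C : Type u} [NonUnitalRing I] [Ring B] [Ring C]
    (E : UExt I B C) : UExt (Susp I) (Susp B) (Susp C) :=
  let F : Ext (Susp I) (Susp B) (Susp C) := Ext.susp
    ⟨E.incl, (E.proj : B →ₙ+* C), E.incl_injective, E.proj_surjective, E.exact⟩
  { incl := Susp.map E.incl
    proj := Susp.mapRingHom E.proj
    incl_injective := F.incl_injective
    proj_surjective := F.proj_surjective
    exact := F.exact }

end Extensions

section Unitization

variable {A B C : Type u} [NonUnitalRing A] [NonUnitalRing B] [NonUnitalRing C]

variable (A) in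
/-- The unitalization `Ã = ℤ ⊕ A`, with product `(n, a)(m, b) = (nm, nb + ma + ab)`. -/
@[ext] structure Unital : Type u where
  fst : ℤ
  snd : A

namespace Unital

instance : Zero (Unital A) := ⟨⟨0, 0⟩⟩
instance : One (Unital A) := ⟨⟨1, 0⟩⟩
instance : Add (Unital A) := ⟨fun x y => ⟨x.fst + y.fst, x.snd + y.snd⟩⟩
instance : Neg (Unital A) := ⟨fun x => ⟨-x.fst, -x.snd⟩⟩
instance : Sub (Unital A) := ⟨fun x y => ⟨x.fst - y.fst, x.snd - y.snd⟩⟩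
instance : Mul (Unital A) :=
  ⟨fun x y => ⟨x.fst * y.fst, x.fst • y.snd + y.fst • x.snd + x.snd * y.snd⟩⟩
instance : NatCast (Unital A) := ⟨fun n => ⟨n, 0⟩⟩
instance : IntCast (Unital A) := ⟨fun n => ⟨n, 0⟩⟩

@[simp] theorem fst_zero : (0 : Unital A).fst = 0 := rfl
@[simp] theorem snd_zero : (0 : Unital A).snd = 0 := rfl
@[simp] theorem fst_one : (1 : Unital A).fst = 1 := rfl
@[simp] theorem snd_one : (1 : Unital A).snd = 0 := rfl
@[simp] theorem fst_add (x y : Unital A) : (x + y).fst = x.fst + y.fst := rfl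
@[simp] theorem snd_add (x y : Unital A) : (x + y).snd = x.snd + y.snd := rfl
@[simp] theorem fst_neg (x : Unital A) : (-x).fst = -x.fst := rfl
@[simp] theorem snd_neg (x : Unital A) : (-x).snd = -x.snd := rfl
@[simp] theorem fst_sub (x y : Unital A) : (x - y).fst = x.fst - y.fst := rfl
@[simp] theorem snd_sub (x y : Unital A) : (x - y).snd = x.snd - y.snd := rfl
@[simp] theorem fst_mul (x y : Unital A) : (x * y).fst = x.fst * y.fst := rfl
@[simp] theorem snd_mul (x y : Unital A) :
    (x * y).snd = x.fst • y.snd + y.fst • x.snd + x.snd * y.snd := rfl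
@[simp] theorem fst_natCast (n : ℕ) : (n : Unital A).fst = n := rfl
@[simp] theorem snd_natCast (n : ℕ) : (n : Unital A).snd = 0 := rfl
@[simp] theorem fst_intCast (n : ℤ) : (n : Unital A).fst = n := rfl
@[simp] theorem snd_intCast (n : ℤ) : (n : Unital A).snd = 0 := rfl

instance : Ring (Unital A) where
  add_assoc x y z := by ext <;> simp [add_assoc]
  zero_add x := by ext <;> simp
  add_zero x := by ext <;> simp
  add_comm x y := by ext <;> simp [add_comm]
  neg_add_cancel x := by ext <;> simp
  sub_eq_add_neg x y := by ext <;> simp [sub_eq_add_neg]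
  zero_mul x := by ext <;> simp
  mul_zero x := by ext <;> simp
  one_mul x := by ext <;> simp
  mul_one x := by ext <;> simp
  left_distrib x y z := by
    ext
    · simp [mul_add]
    · simp only [fst_add, snd_add, snd_mul, smul_add, add_smul, mul_add]; abel
  right_distrib x y z := by
    ext
    · simp [add_mul]
    · simp only [fst_add, snd_add, snd_mul, smul_add, add_smul, add_mul]; abel
  mul_assoc x y z := by
    ext
    · simp [mul_assoc]
    · simp only [fst_mul, snd_mul, smul_add, mul_smul, add_mul, mul_add, smul_mul_assoc,
        mul_smul_comm, mul_assoc, smul_comm z.fst x.fst, smul_comm z.fst y.fst]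
      abel
  nsmul := nsmulRec
  zsmul := zsmulRec
  natCast_zero := by ext <;> simp
  natCast_succ n := by ext <;> simp
  intCast_ofNat n := by ext <;> simp
  intCast_negSucc n := by ext <;> simp [Int.negSucc_eq]

end Unital

variable (A) in
/-- The augmentation `Ã → ℤ`. -/
def augm : Unital A →+* ℤ where
  toFun x := x.fst
  map_one' := rfl
  map_mul' _ _ := rfl
  map_zero' := rfl
  map_add' _ _ := rfl

/-- The induced map of unitalizations. -/
def Unital.map (f : A →ₙ+* B) : Unital A →+* Unital B where
  toFun x := ⟨x.fst, f x.snd⟩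
  map_one' := by ext <;> simp
  map_mul' x y := by ext <;> simp
  map_zero' := by ext <;> simp
  map_add' x y := by ext <;> simp

@[simp] theorem Unital.fst_map (f : A →ₙ+* B) (x : Unital A) : (Unital.map f x).fst = x.fst := by
  simp [Unital.map]

@[simp] theorem Unital.snd_map (f : A →ₙ+* B) (x : Unital A) :
    (Unital.map f x).snd = f x.snd := by
  simp [Unital.map]

theorem Unital.map_id : Unital.map (NonUnitalRingHom.id A) = RingHom.id _ := by
  ext x <;> simp

theorem Unital.map_comp (g : B →ₙ+* C) (f : A →ₙ+* B) :
    Unital.map (g.comp f) = (Unital.map g).comp (Unital.map f) := by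
  ext x <;> simp

/-- The unital extension `0 → I → B̃ → C̃ → 0` of an extension of rings. -/
def Ext.unitize (E : Ext A B C) : UExt A (Unital B) (Unital C) where
  incl :=
    { toFun := fun a => ⟨0, E.incl a⟩
      map_mul' := fun x y => by ext <;> simp
      map_zero' := by ext <;> simp
      map_add' := fun x y => by ext <;> simp }
  proj := Unital.map E.proj
  incl_injective x y h := E.incl_injective (congrArg Unital.snd h)
  proj_surjective y := by
    obtain ⟨b, hb⟩ := E.proj_surjective y.snd
    refine ⟨⟨y.fst, b⟩, ?_⟩
    ext <;> simp [hb]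
  exact b := by
    constructor
    · intro h
      have h1 : b.fst = 0 := by simpa using congrArg (fun x => x.fst) h
      have h2 : E.proj b.snd = 0 := by simpa using congrArg (fun x => x.snd) h
      obtain ⟨i, hi⟩ := (E.exact _).1 h2
      refine ⟨i, ?_⟩
      ext
      · exact h1.symm
      · exact hi
    · rintro ⟨i, rfl⟩
      have := (E.exact (E.incl i)).2 ⟨i, rfl⟩
      ext
      · exact Unital.fst_map _ _
      · exact (Unital.snd_map _ _).trans this

end Unitization

section K0

variable {R : Type u} {S : Type v} {T : Type w} [Ring R] [Ring S] [Ring T]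

/-- The block sum `a ⊕ b` of square matrices. -/
def dsum {n m : ℕ} (a : Matrix (Fin n) (Fin n) R) (b : Matrix (Fin m) (Fin m) R) :
    Matrix (Fin (n + m)) (Fin (n + m)) R :=
  (Matrix.fromBlocks a 0 0 b).submatrix finSumFinEquiv.symm finSumFinEquiv.symm

theorem dsum_mul {n m : ℕ} (a c : Matrix (Fin n) (Fin n) R) (b d : Matrix (Fin m) (Fin m) R) :
    dsum a b * dsum c d = dsum (a * c) (b * d) := by
  rw [dsum, dsum, Matrix.submatrix_mul_equiv, Matrix.fromBlocks_multiply]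
  simp [dsum]

theorem dsum_one {n m : ℕ} : dsum (1 : Matrix (Fin n) (Fin n) R) (1 : Matrix (Fin m) (Fin m) R) = 1 := by
  rw [dsum, Matrix.fromBlocks_one, Matrix.submatrix_one_equiv]

theorem dsum_map {n m : ℕ} (a : Matrix (Fin n) (Fin n) R) (b : Matrix (Fin m) (Fin m) R)
    (f : R →+* S) : (dsum a b).map f = dsum (a.map f) (b.map f) := by
  rw [dsum, dsum, ← Matrix.submatrix_map, Matrix.fromBlocks_map]
  simp

variable (R) in
/-- Idempotent square matrices of arbitrary finite size. -/
structure IdemMat where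
  size : ℕ
  mat : Matrix (Fin size) (Fin size) R
  idem : mat * mat = mat

/-- The conjugate `g e g⁻¹`. -/
def IdemMat.conj (x : IdemMat R) (g : (Matrix (Fin x.size) (Fin x.size) R)ˣ) : IdemMat R where
  size := x.size
  mat := g * x.mat * (↑g⁻¹ : Matrix (Fin x.size) (Fin x.size) R)
  idem := by
    have : (↑g⁻¹ : Matrix (Fin x.size) (Fin x.size) R) * g = 1 := g.inv_mul
    calc _ = g * x.mat * ((↑g⁻¹ : Matrix (Fin x.size) (Fin x.size) R) * g) * x.mat *
          (↑g⁻¹ : Matrix (Fin x.size) (Fin x.size) R) := by simp only [mul_assoc]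
      _ = _ := by rw [this, mul_one, mul_assoc _ x.mat x.mat, x.idem]

/-- The block sum `e ⊕ f` of idempotents. -/
def IdemMat.sum (x y : IdemMat R) : IdemMat R where
  size := x.size + y.size
  mat := dsum x.mat y.mat
  idem := by rw [dsum_mul, x.idem, y.idem]

variable (R) in
/-- The zero idempotent of size `m`. -/
def IdemMat.zero (m : ℕ) : IdemMat R := ⟨m, 0, zero_mul 0⟩

/-- The relations defining `K₀`: invariance under conjugation, invariance under the inclusions
`M_n ⊆ M_{n+m}`, and additivity with respect to direct sums. -/
inductive K0.Rel : FreeAbelianGroup (IdemMat R) → Prop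
  | conj (x : IdemMat R) (g : (Matrix (Fin x.size) (Fin x.size) R)ˣ) :
      K0.Rel (FreeAbelianGroup.of (x.conj g) - FreeAbelianGroup.of x)
  | stab (x : IdemMat R) (m : ℕ) :
      K0.Rel (FreeAbelianGroup.of (x.sum (IdemMat.zero R m)) - FreeAbelianGroup.of x)
  | sum (x y : IdemMat R) :
      K0.Rel (FreeAbelianGroup.of (x.sum y) - (FreeAbelianGroup.of x + FreeAbelianGroup.of y))

variable (R) in
/-- `K₀` of a unital ring: the group completion of the monoid (under direct sum) of conjugacy
classes of idempotents in `⋃ₙ M_n R`, presented by generators and relations. -/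
def K0 : Type u :=
  FreeAbelianGroup (IdemMat R) ⧸ AddSubgroup.closure {x | K0.Rel (R := R) x}

noncomputable instance : AddCommGroup (K0 R) :=
  inferInstanceAs (AddCommGroup
    (FreeAbelianGroup (IdemMat R) ⧸ AddSubgroup.closure {x | K0.Rel (R := R) x}))

variable (R) in
/-- The quotient map onto `K₀`. -/
noncomputable def K0.ofFree : FreeAbelianGroup (IdemMat R) →+ K0 R :=
  QuotientAddGroup.mk' (AddSubgroup.closure {x | K0.Rel (R := R) x})

/-- The class of an idempotent matrix. -/
noncomputable def K0.cls (x : IdemMat R) : K0 R := K0.ofFree R (FreeAbelianGroup.of x)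

theorem K0.mk'_eq_zero {x : FreeAbelianGroup (IdemMat R)} (h : K0.Rel x) : K0.ofFree R x = 0 :=
  (QuotientAddGroup.eq_zero_iff _).2 (AddSubgroup.subset_closure h)

theorem K0.cls_conj (x : IdemMat R) (g : (Matrix (Fin x.size) (Fin x.size) R)ˣ) :
    K0.cls (x.conj g) = K0.cls x := by
  have := K0.mk'_eq_zero (K0.Rel.conj x g)
  rw [map_sub, sub_eq_zero] at this
  exact this

theorem K0.cls_stab (x : IdemMat R) (m : ℕ) :
    K0.cls (x.sum (IdemMat.zero R m)) = K0.cls x := by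
  have := K0.mk'_eq_zero (K0.Rel.stab x m)
  rw [map_sub, sub_eq_zero] at this
  exact this

theorem K0.cls_sum (x y : IdemMat R) : K0.cls (x.sum y) = K0.cls x + K0.cls y := by
  have := K0.mk'_eq_zero (K0.Rel.sum x y)
  rw [map_sub, sub_eq_zero, map_add] at this
  exact this

theorem K0.cls_zero (m : ℕ) : K0.cls (IdemMat.zero R m) = 0 := by
  have h1 := K0.cls_sum (IdemMat.zero R m) (IdemMat.zero R m)
  rw [K0.cls_stab] at h1
  simpa using h1

/-- Homomorphisms out of `K₀`. -/
noncomputable def K0.lift {G : Type*} [AddCommGroup G] (F : IdemMat R → G)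
    (hconj : ∀ x g, F (IdemMat.conj x g) = F x)
    (hstab : ∀ x m, F (IdemMat.sum x (IdemMat.zero R m)) = F x)
    (hsum : ∀ x y, F (IdemMat.sum x y) = F x + F y) : K0 R →+ G :=
  QuotientAddGroup.lift _ (FreeAbelianGroup.lift F) (by
    rw [AddSubgroup.closure_le]
    rintro _ (⟨x, g⟩ | ⟨x, m⟩ | ⟨x, y⟩) <;>
      simp [AddMonoidHom.mem_ker, hconj, hstab, hsum])

@[simp] theorem K0.lift_cls {G : Type*} [AddCommGroup G] (F : IdemMat R → G) (h1 h2 h3)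
    (x : IdemMat R) : K0.lift F h1 h2 h3 (K0.cls x) = F x := by
  change FreeAbelianGroup.lift F (FreeAbelianGroup.of x) = F x
  simp

theorem K0.hom_ext {G : Type*} [AddCommGroup G] {f g : K0 R →+ G}
    (h : ∀ x, f (K0.cls x) = g (K0.cls x)) : f = g := by
  have h1 : f.comp (K0.ofFree R) = g.comp (K0.ofFree R) := FreeAbelianGroup.lift_ext _ _ h
  ext x
  obtain ⟨y, rfl⟩ : ∃ y, K0.ofFree R y = x := QuotientAddGroup.mk'_surjective _ x
  exact DFunLike.congr_fun h1 y

/-- Image of an idempotent matrix under a unital ring homomorphism. -/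
def IdemMat.map (f : R →+* S) (x : IdemMat R) : IdemMat S where
  size := x.size
  mat := x.mat.map f
  idem := by rw [← Matrix.map_mul, x.idem]

theorem IdemMat.map_conj (f : R →+* S) (x : IdemMat R)
    (g : (Matrix (Fin x.size) (Fin x.size) R)ˣ) :
    (x.conj g).map f = (x.map f).conj (Units.map f.mapMatrix.toMonoidHom g) := by
  simp only [IdemMat.map, IdemMat.conj, IdemMat.mk.injEq, heq_eq_eq, true_and]
  rw [Matrix.map_mul, Matrix.map_mul]
  rfl

theorem IdemMat.map_sum (f : R →+* S) (x y : IdemMat R) :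
    (x.sum y).map f = (x.map f).sum (y.map f) := by
  simp only [IdemMat.map, IdemMat.sum, dsum_map]

theorem IdemMat.map_zero (f : R →+* S) (m : ℕ) :
    (IdemMat.zero R m).map f = IdemMat.zero S m := by
  simp [IdemMat.map, IdemMat.zero]

/-- Functoriality of `K₀` for unital ring homomorphisms. -/
noncomputable def K0.map (f : R →+* S) : K0 R →+ K0 S :=
  K0.lift (fun x => K0.cls (x.map f))
    (fun x g => by rw [IdemMat.map_conj, K0.cls_conj])
    (fun x m => by rw [IdemMat.map_sum, IdemMat.map_zero, K0.cls_stab])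
    (fun x y => by rw [IdemMat.map_sum, K0.cls_sum])

@[simp] theorem K0.map_cls (f : R →+* S) (x : IdemMat R) :
    K0.map f (K0.cls x) = K0.cls (x.map f) := K0.lift_cls ..

theorem K0.map_id : K0.map (RingHom.id R) = AddMonoidHom.id _ :=
  K0.hom_ext fun x => by simp [IdemMat.map]

theorem K0.map_comp (g : S →+* T) (f : R →+* S) :
    K0.map (g.comp f) = (K0.map g).comp (K0.map f) :=
  K0.hom_ext fun x => by simp [IdemMat.map]

theorem K0.cls_eq_of_mul {x y : IdemMat R} (a : Matrix (Fin x.size) (Fin y.size) R)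
    (b : Matrix (Fin y.size) (Fin x.size) R) (hab : a * b = x.mat) (hba : b * a = y.mat) :
    K0.cls x = K0.cls y := by
  obtain ⟨n, e, he⟩ := x
  obtain ⟨m, f, hf⟩ := y
  dsimp only at a b hab hba
  have hea : e * a = a * f := by simp only [← hab, ← hba, Matrix.mul_assoc]
  have hfb : f * b = b * e := by simp only [← hab, ← hba, Matrix.mul_assoc]
  let a' := e * a
  let b' := b * e
  have h1 : a' * b' = e := by
    change e * a * (b * e) = e
    rw [Matrix.mul_assoc, ← Matrix.mul_assoc a, hab, he, he]
  have h2 : b' * a' = f := by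
    change b * e * (e * a) = f
    rw [Matrix.mul_assoc, ← Matrix.mul_assoc e, he, hea, ← Matrix.mul_assoc, hba, hf]
  have h3 : e * a' = a' := by change e * (e * a) = e * a; rw [← Matrix.mul_assoc, he]
  have h4 : a' * f = a' := by
    change e * a * f = e * a; rw [Matrix.mul_assoc, ← hea, ← Matrix.mul_assoc, he]
  have h5 : b' * e = b' := by change b * e * e = b * e; rw [Matrix.mul_assoc, he]
  have h6 : f * b' = b' := by
    change f * (b * e) = b * e; rw [← Matrix.mul_assoc, hfb, Matrix.mul_assoc, he]
  let z : Matrix (Fin n ⊕ Fin m) (Fin n ⊕ Fin m) R := Matrix.fromBlocks (1 - e) a' b' (1 - f)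
  have hz : z * z = 1 := by
    simp only [z, Matrix.fromBlocks_multiply, ← Matrix.fromBlocks_one, Matrix.fromBlocks_inj]
    refine ⟨?_, ?_, ?_, ?_⟩
    · simp [mul_sub, sub_mul, he, h1]
    · simp [Matrix.mul_sub, Matrix.sub_mul, h3, h4]
    · simp [Matrix.mul_sub, Matrix.sub_mul, h5, h6]
    · simp [mul_sub, sub_mul, hf, h2]
  let σ := (finSumFinEquiv (m := n) (n := m)).symm
  let g : (Matrix (Fin (n + m)) (Fin (n + m)) R)ˣ :=
    ⟨z.submatrix σ σ, z.submatrix σ σ,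
      by rw [Matrix.submatrix_mul_equiv, hz, Matrix.submatrix_one_equiv],
      by rw [Matrix.submatrix_mul_equiv, hz, Matrix.submatrix_one_equiv]⟩
  have hg : ((⟨n, e, he⟩ : IdemMat R).sum (IdemMat.zero R m)).conj g =
      (IdemMat.zero R n).sum ⟨m, f, hf⟩ := by
    simp only [IdemMat.conj, IdemMat.sum, IdemMat.zero, IdemMat.mk.injEq, heq_eq_eq, true_and]
    change z.submatrix σ σ * (Matrix.fromBlocks e 0 0 0).submatrix σ σ * z.submatrix σ σ =
      (Matrix.fromBlocks 0 0 0 f).submatrix σ σ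
    rw [Matrix.submatrix_mul_equiv, Matrix.submatrix_mul_equiv]
    congr 1
    simp only [z, Matrix.fromBlocks_multiply, Matrix.fromBlocks_inj]
    refine ⟨?_, ?_, ?_, ?_⟩
    · simp [Matrix.sub_mul, he]
    · simp [Matrix.sub_mul, he]
    · simp [Matrix.mul_sub, h5]
    · simp [h5, h2]
  rw [← K0.cls_stab ⟨n, e, he⟩ m, ← K0.cls_conj _ g, hg, K0.cls_sum, K0.cls_zero, zero_add]

/-- The class of an idempotent matrix indexed by an arbitrary finite type. -/
noncomputable def K0.mk {ι : Type*} [Fintype ι] [DecidableEq ι] (e : Matrix ι ι R)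
    (he : e * e = e) : K0 R :=
  K0.cls ⟨Fintype.card ι, e.submatrix (Fintype.equivFin ι).symm (Fintype.equivFin ι).symm,
    by rw [Matrix.submatrix_mul_equiv, he]⟩

theorem K0.mk_eq_of_mul {ι κ : Type*} [Fintype ι] [DecidableEq ι] [Fintype κ] [DecidableEq κ]
    {e : Matrix ι ι R} {he : e * e = e} {f : Matrix κ κ R} {hf : f * f = f}
    (a : Matrix ι κ R) (b : Matrix κ ι R) (hab : a * b = e) (hba : b * a = f) :
    K0.mk e he = K0.mk f hf := by
  refine K0.cls_eq_of_mul (x := ⟨_, _, _⟩) (y := ⟨_, _, _⟩)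
    (a.submatrix (Fintype.equivFin ι).symm (Fintype.equivFin κ).symm)
    (b.submatrix (Fintype.equivFin κ).symm (Fintype.equivFin ι).symm) ?_ ?_
  · rw [Matrix.submatrix_mul_equiv, hab]
  · rw [Matrix.submatrix_mul_equiv, hba]

theorem K0.mk_submatrix {ι κ : Type*} [Fintype ι] [DecidableEq ι] [Fintype κ] [DecidableEq κ]
    {e : Matrix ι ι R} (he : e * e = e) (σ : κ ≃ ι)
    (h : e.submatrix σ σ * e.submatrix σ σ = e.submatrix σ σ) :
    K0.mk (e.submatrix σ σ) h = K0.mk e he := by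
  refine K0.mk_eq_of_mul (e.submatrix σ id) (e.submatrix id σ) ?_ ?_
  · rw [← Matrix.submatrix_mul _ _ _ _ _ Function.bijective_id, he]
  · rw [Matrix.submatrix_mul_equiv, he, Matrix.submatrix_id_id]

theorem K0.mk_fin {n : ℕ} (e : Matrix (Fin n) (Fin n) R) (he : e * e = e) :
    K0.mk e he = K0.cls ⟨n, e, he⟩ := by
  refine K0.cls_eq_of_mul (x := ⟨_, _, _⟩) (y := ⟨_, _, _⟩)
    (e.submatrix (Fintype.equivFin (Fin n)).symm id)
    (e.submatrix id (Fintype.equivFin (Fin n)).symm) ?_ ?_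
  · rw [← Matrix.submatrix_mul _ _ _ _ _ Function.bijective_id, he]
  · rw [Matrix.submatrix_mul_equiv, he, Matrix.submatrix_id_id]

theorem fromBlocks_idem {ι κ : Type*} [Fintype ι] [Fintype κ] {e : Matrix ι ι R} (he : e * e = e)
    {f : Matrix κ κ R} (hf : f * f = f) :
    Matrix.fromBlocks e 0 0 f * Matrix.fromBlocks e 0 0 f = Matrix.fromBlocks e 0 0 f := by
  simp [Matrix.fromBlocks_multiply, he, hf]

theorem K0.mk_congr {ι : Type*} [Fintype ι] [DecidableEq ι] {e f : Matrix ι ι R} (h : e = f)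
    (he : e * e = e) (hf : f * f = f) : K0.mk e he = K0.mk f hf := by
  subst h
  rfl

theorem K0.mk_sum {ι κ : Type*} [Fintype ι] [DecidableEq ι] [Fintype κ] [DecidableEq κ]
    {e : Matrix ι ι R} (he : e * e = e) {f : Matrix κ κ R} (hf : f * f = f) :
    K0.mk (Matrix.fromBlocks e 0 0 f) (fromBlocks_idem he hf) = K0.mk e he + K0.mk f hf := by
  have h := fromBlocks_idem he hf
  have h0 : K0.mk e he + K0.mk f hf = K0.mk _ (IdemMat.sum ⟨_, _, _⟩ ⟨_, _, _⟩).idem :=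
    (K0.cls_sum _ _).symm.trans (K0.mk_fin _ _).symm
  rw [h0, ← K0.mk_submatrix h (finSumFinEquiv.symm.trans
    (Equiv.sumCongr (Fintype.equivFin ι).symm (Fintype.equivFin κ).symm))]
  · congr 1
    ext i j
    obtain ⟨i, rfl⟩ := finSumFinEquiv.surjective i
    obtain ⟨j, rfl⟩ := finSumFinEquiv.surjective j
    rcases i with i | i <;> rcases j with j | j <;> simp [IdemMat.sum, dsum]
  · rw [Matrix.submatrix_mul_equiv, h]

theorem K0.map_mk {ι : Type*} [Fintype ι] [DecidableEq ι] (f : R →+* S) {e : Matrix ι ι R}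
    (he : e * e = e) (h : e.map f * e.map f = e.map f) :
    K0.map f (K0.mk e he) = K0.mk (e.map f) h := by
  rw [K0.mk, K0.map_cls]
  rfl

end K0

section K1

variable {R : Type u} {S : Type v} {T : Type w} [Ring R] [Ring S] [Ring T]

variable (R) in
/-- Invertible square matrices of arbitrary finite size. -/
structure InvMat where
  size : ℕ
  mat : (Matrix (Fin size) (Fin size) R)ˣ

/-- The block sum of invertible matrices. -/
def unitsDsum {n m : ℕ} (g : (Matrix (Fin n) (Fin n) R)ˣ) (h : (Matrix (Fin m) (Fin m) R)ˣ) :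
    (Matrix (Fin (n + m)) (Fin (n + m)) R)ˣ where
  val := dsum (g : Matrix _ _ R) (h : Matrix _ _ R)
  inv := dsum (↑g⁻¹ : Matrix _ _ R) (↑h⁻¹ : Matrix _ _ R)
  val_inv := by rw [dsum_mul, g.mul_inv, h.mul_inv, dsum_one]
  inv_val := by rw [dsum_mul, g.inv_mul, h.inv_mul, dsum_one]

/-- The block sum `g ⊕ 1` with the identity matrix of size `m`. -/
def InvMat.stab (x : InvMat R) (m : ℕ) : InvMat R := ⟨x.size + m, unitsDsum x.mat 1⟩

/-- The relations defining `K₁`: multiplicativity and invariance under the inclusions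
`GL_n ⊆ GL_{n+m}`. -/
inductive K1.Rel : FreeAbelianGroup (InvMat R) → Prop
  | mul (n : ℕ) (g h : (Matrix (Fin n) (Fin n) R)ˣ) :
      K1.Rel (FreeAbelianGroup.of ⟨n, g * h⟩ -
        (FreeAbelianGroup.of ⟨n, g⟩ + FreeAbelianGroup.of ⟨n, h⟩))
  | stab (x : InvMat R) (m : ℕ) :
      K1.Rel (FreeAbelianGroup.of (x.stab m) - FreeAbelianGroup.of x)

variable (R) in
/-- `K₁` of a unital ring: the abelianization of `GL R = ⋃ₙ GL_n R`, written additively and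
presented by generators and relations. -/
def K1 : Type u :=
  FreeAbelianGroup (InvMat R) ⧸ AddSubgroup.closure {x | K1.Rel (R := R) x}

noncomputable instance : AddCommGroup (K1 R) :=
  inferInstanceAs (AddCommGroup
    (FreeAbelianGroup (InvMat R) ⧸ AddSubgroup.closure {x | K1.Rel (R := R) x}))

variable (R) in
/-- The quotient map onto `K₁`. -/
noncomputable def K1.ofFree : FreeAbelianGroup (InvMat R) →+ K1 R :=
  QuotientAddGroup.mk' (AddSubgroup.closure {x | K1.Rel (R := R) x})

/-- The class of an invertible matrix. -/
noncomputable def K1.cls (x : InvMat R) : K1 R := K1.ofFree R (FreeAbelianGroup.of x)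

theorem K1.mk'_eq_zero {x : FreeAbelianGroup (InvMat R)} (h : K1.Rel x) : K1.ofFree R x = 0 :=
  (QuotientAddGroup.eq_zero_iff _).2 (AddSubgroup.subset_closure h)

theorem K1.cls_mul {n : ℕ} (g h : (Matrix (Fin n) (Fin n) R)ˣ) :
    K1.cls ⟨n, g * h⟩ = K1.cls ⟨n, g⟩ + K1.cls ⟨n, h⟩ := by
  have := K1.mk'_eq_zero (K1.Rel.mul n g h)
  rw [map_sub, sub_eq_zero, map_add] at this
  exact this

theorem K1.cls_stab (x : InvMat R) (m : ℕ) : K1.cls (x.stab m) = K1.cls x := by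
  have := K1.mk'_eq_zero (K1.Rel.stab x m)
  rw [map_sub, sub_eq_zero] at this
  exact this

theorem K1.cls_conj {n : ℕ} (g h : (Matrix (Fin n) (Fin n) R)ˣ) :
    K1.cls ⟨n, h * g * h⁻¹⟩ = K1.cls ⟨n, g⟩ := by
  have h1 := K1.cls_mul (h * g * h⁻¹) h
  rw [inv_mul_cancel_right, K1.cls_mul, add_comm] at h1
  exact (add_right_cancel h1).symm

/-- Homomorphisms out of `K₁`. -/
noncomputable def K1.lift {G : Type*} [AddCommGroup G] (F : InvMat R → G)
    (hmul : ∀ n g h, F ⟨n, g * h⟩ = F ⟨n, g⟩ + F ⟨n, h⟩)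
    (hstab : ∀ x m, F (InvMat.stab x m) = F x) : K1 R →+ G :=
  QuotientAddGroup.lift _ (FreeAbelianGroup.lift F) (by
    rw [AddSubgroup.closure_le]
    rintro _ (⟨x, g⟩ | ⟨x, m⟩) <;>
      simp [AddMonoidHom.mem_ker, hmul, hstab])

@[simp] theorem K1.lift_cls {G : Type*} [AddCommGroup G] (F : InvMat R → G) (h1 h2)
    (x : InvMat R) : K1.lift F h1 h2 (K1.cls x) = F x := by
  change FreeAbelianGroup.lift F (FreeAbelianGroup.of x) = F x
  simp

theorem K1.cls_reindex {n m : ℕ} (g : (Matrix (Fin n) (Fin n) R)ˣ)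
    (h : (Matrix (Fin m) (Fin m) R)ˣ) (σ : Fin m ≃ Fin n)
    (hgh : (h : Matrix _ _ R) = (g : Matrix _ _ R).submatrix σ σ) :
    K1.cls ⟨m, h⟩ = K1.cls ⟨n, g⟩ := by
  obtain rfl : m = n := by simpa using Fintype.card_congr σ
  let P : (Matrix (Fin m) (Fin m) R)ˣ :=
    ⟨(1 : Matrix _ _ R).submatrix σ id, (1 : Matrix _ _ R).submatrix id σ,
      by rw [← Matrix.submatrix_mul _ _ _ _ _ Function.bijective_id]; simp,
      by rw [Matrix.submatrix_mul_equiv]; simp⟩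
  have hP : h = P * g * P⁻¹ := by
    ext1
    change (h : Matrix (Fin m) (Fin m) R) = (1 : Matrix (Fin m) (Fin m) R).submatrix σ id *
      (g : Matrix (Fin m) (Fin m) R) * (1 : Matrix (Fin m) (Fin m) R).submatrix id σ
    rw [hgh]
    ext i j
    simp [Matrix.mul_apply, Matrix.submatrix_apply, Matrix.one_apply]
  rw [hP, K1.cls_conj]

theorem K1.cls_dsum {n m : ℕ} (g : (Matrix (Fin n) (Fin n) R)ˣ)
    (h : (Matrix (Fin m) (Fin m) R)ˣ) :
    K1.cls ⟨n + m, unitsDsum g h⟩ = K1.cls ⟨n, g⟩ + K1.cls ⟨m, h⟩ := by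
  have h1 : unitsDsum g h = unitsDsum g 1 * unitsDsum 1 h := by
    ext1
    change dsum _ _ = dsum _ _ * dsum _ _
    rw [dsum_mul]
    simp
  have h2 : K1.cls ⟨n + m, unitsDsum 1 h⟩ = K1.cls ⟨m + n, unitsDsum h 1⟩ := by
    refine K1.cls_reindex _ _ (finSumFinEquiv.symm.trans
      ((Equiv.sumComm _ _).trans finSumFinEquiv)) ?_
    change dsum _ _ = (dsum _ _).submatrix _ _
    ext i j
    obtain ⟨i, rfl⟩ := finSumFinEquiv.surjective i
    obtain ⟨j, rfl⟩ := finSumFinEquiv.surjective j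
    rcases i with i | i <;> rcases j with j | j <;> simp [dsum]
  rw [h1, K1.cls_mul, h2]
  exact congrArg₂ _ (K1.cls_stab ⟨n, g⟩ m) (K1.cls_stab ⟨m, h⟩ n)

/-- Image of an invertible matrix under a unital ring homomorphism. -/
def InvMat.map (f : R →+* S) (x : InvMat R) : InvMat S :=
  ⟨x.size, Units.map f.mapMatrix.toMonoidHom x.mat⟩

/-- Functoriality of `K₁` for unital ring homomorphisms. -/
noncomputable def K1.map (f : R →+* S) : K1 R →+ K1 S :=
  K1.lift (fun x => K1.cls (x.map f))
    (fun n g h => by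
      rw [InvMat.map, map_mul]
      exact K1.cls_mul _ _)
    (fun x m => by
      rw [← K1.cls_stab (x.map f) m]
      congr 1
      change InvMat.mk _ _ = InvMat.mk _ _
      congr 1
      ext1
      change (dsum _ _).map f = dsum (Matrix.map _ f) _
      rw [dsum_map]
      simp)

@[simp] theorem K1.map_cls (f : R →+* S) (x : InvMat R) :
    K1.map f (K1.cls x) = K1.cls (x.map f) := K1.lift_cls ..

theorem K1.hom_ext {G : Type*} [AddCommGroup G] {f g : K1 R →+ G}
    (h : ∀ x, f (K1.cls x) = g (K1.cls x)) : f = g := by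
  have h1 : f.comp (K1.ofFree R) = g.comp (K1.ofFree R) := FreeAbelianGroup.lift_ext _ _ h
  ext x
  obtain ⟨y, rfl⟩ : ∃ y, K1.ofFree R y = x := QuotientAddGroup.mk'_surjective _ x
  exact DFunLike.congr_fun h1 y

end K1

section Index

variable {I B C : Type u} [NonUnitalRing I] [Ring B] [Ring C]

namespace UExt

variable (E : UExt I B C)

/-- The unital homomorphism `Ĩ → B`, `n + x ↦ n·1 + x`. -/
def toMid : Unital I →+* B where
  toFun x := (x.fst : B) + E.incl x.snd
  map_one' := by simp
  map_mul' x y := by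
    simp only [Unital.fst_mul, Unital.snd_mul, Int.cast_mul, map_add, map_mul, map_zsmul,
      add_mul, mul_add, zsmul_eq_mul]
    rw [(Int.cast_commute y.fst (E.incl x.snd)).eq]
    abel
  map_zero' := by simp
  map_add' x y := by simp; abel

theorem toMid_apply (x : Unital I) : E.toMid x = (x.fst : B) + E.incl x.snd := rfl

theorem eq_of_toMid {x y : Unital I} (h1 : x.fst = y.fst) (h2 : E.toMid x = E.toMid y) : x = y := by
  rw [toMid_apply, toMid_apply, h1, add_right_inj] at h2
  ext
  · exact h1
  · exact E.incl_injective h2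

theorem mat_ext {m n : Type*} {X Y : Matrix m n (Unital I)} (h1 : X.map (augm I) = Y.map (augm I))
    (h2 : X.map E.toMid = Y.map E.toMid) : X = Y := by
  ext1 i j
  exact E.eq_of_toMid (congrFun (congrFun h1 i) j) (congrFun (congrFun h2 i) j)

/-- For an integer matrix `P` and a matrix `Q` over `B` which agree modulo `I`, the unique matrix
over `Ĩ` whose augmentation is `P` and whose image over `B` is `Q`. -/
noncomputable def pull {m n : Type*} (P : Matrix m n ℤ) (Q : Matrix m n B) :
    Matrix m n (Unital I) :=
  Matrix.of fun i j => ⟨P i j, Function.invFun E.incl (Q i j - (P i j : B))⟩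

theorem pull_augm {m n : Type*} (P : Matrix m n ℤ) (Q : Matrix m n B) :
    (E.pull P Q).map (augm I) = P := rfl

/-- `P` and `Q` agree modulo `I`. -/
def Agree {m n : Type*} (P : Matrix m n ℤ) (Q : Matrix m n B) : Prop :=
  Q.map E.proj = P.map (Int.castRingHom C)

variable {E}

theorem pull_toMid {m n : Type*} {P : Matrix m n ℤ} {Q : Matrix m n B} (h : E.Agree P Q) :
    (E.pull P Q).map E.toMid = Q := by
  ext1 i j
  have h1 : E.proj (Q i j) = (P i j : C) := congrFun (congrFun h i) j
  have h2 : E.proj (Q i j - (P i j : B)) = 0 := by simp [h1]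
  have h3 : E.incl (Function.invFun E.incl (Q i j - (P i j : B))) = Q i j - (P i j : B) :=
    Function.invFun_eq ((E.exact _).1 h2)
  change (P i j : B) + E.incl (Function.invFun E.incl (Q i j - (P i j : B))) = Q i j
  rw [h3]
  abel

theorem pull_eq {m n : Type*} {P : Matrix m n ℤ} {Q : Matrix m n B} {X : Matrix m n (Unital I)}
    (h1 : X.map (augm I) = P) (h2 : X.map E.toMid = Q) (h : E.Agree P Q) : E.pull P Q = X :=
  E.mat_ext (by rw [pull_augm, h1]) (by rw [pull_toMid h, h2])

theorem Agree.mul {l m n : Type*} [Fintype m] {P : Matrix l m ℤ} {Q : Matrix l m B}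
    {P' : Matrix m n ℤ} {Q' : Matrix m n B} (h : E.Agree P Q) (h' : E.Agree P' Q') :
    E.Agree (P * P') (Q * Q') := by
  unfold Agree at *
  rw [Matrix.map_mul, Matrix.map_mul, h, h']

theorem Agree.int {m n : Type*} (P : Matrix m n ℤ) : E.Agree P (P.map (Int.castRingHom B)) := by
  unfold Agree
  ext i j
  simp

theorem pull_mul {l m n : Type*} [Fintype m] {P : Matrix l m ℤ} {Q : Matrix l m B}
    {P' : Matrix m n ℤ} {Q' : Matrix m n B} (h : E.Agree P Q) (h' : E.Agree P' Q') :
    E.pull P Q * E.pull P' Q' = E.pull (P * P') (Q * Q') := by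
  symm
  refine pull_eq ?_ ?_ (h.mul h')
  · rw [Matrix.map_mul, pull_augm, pull_augm]
  · rw [Matrix.map_mul, pull_toMid h, pull_toMid h']

theorem pull_int {m n : Type*} (P : Matrix m n ℤ) :
    E.pull P (P.map (Int.castRingHom B)) = P.map (Int.castRingHom (Unital I)) := by
  refine pull_eq ?_ ?_ (Agree.int P)
  · ext i j
    simp
  · ext i j
    simp

theorem pull_one {n : Type*} [DecidableEq n] : E.pull (1 : Matrix n n ℤ) (1 : Matrix n n B) = 1 := by
  have h := pull_int (E := E) (1 : Matrix n n ℤ)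
  simpa using h

theorem Agree.blocks {m n m' n' : Type*} {P : Matrix m n ℤ} {Q : Matrix m n B}
    {P' : Matrix m' n' ℤ} {Q' : Matrix m' n' B} (h : E.Agree P Q) (h' : E.Agree P' Q') :
    E.Agree (Matrix.fromBlocks P 0 0 P') (Matrix.fromBlocks Q 0 0 Q') := by
  unfold Agree at *
  rw [Matrix.fromBlocks_map, Matrix.fromBlocks_map, h, h']
  simp

theorem pull_blocks {m n m' n' : Type*} {P : Matrix m n ℤ} {Q : Matrix m n B}
    {P' : Matrix m' n' ℤ} {Q' : Matrix m' n' B} (h : E.Agree P Q) (h' : E.Agree P' Q') :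
    E.pull (Matrix.fromBlocks P 0 0 P') (Matrix.fromBlocks Q 0 0 Q') =
      Matrix.fromBlocks (E.pull P Q) 0 0 (E.pull P' Q') := by
  refine pull_eq ?_ ?_ (h.blocks h')
  · rw [Matrix.fromBlocks_map, pull_augm, pull_augm]
    simp
  · rw [Matrix.fromBlocks_map, pull_toMid h, pull_toMid h']
    simp

end UExt

section HMat

variable {n : Type*} [Fintype n] [DecidableEq n] {R : Type u} {S : Type v} [Ring R] [Ring S]

/-- The invertible matrix `h(x, y)` with first column `(2x - xyx, 1 - yx)` and second column
`(xy - 1, y)`. If `x`, `y` lift mutually inverse matrices `g`, `g⁻¹`, then `h(x, y)` lifts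
`diag(g, g⁻¹)`. -/
def hMat (x y : Matrix n n R) : Matrix (n ⊕ n) (n ⊕ n) R :=
  Matrix.fromBlocks 1 x 0 1 * Matrix.fromBlocks 1 0 (-y) 1 * Matrix.fromBlocks 1 x 0 1 *
    Matrix.fromBlocks 0 (-1) 1 0

/-- The inverse of `h(x, y)`. -/
def hInv (x y : Matrix n n R) : Matrix (n ⊕ n) (n ⊕ n) R :=
  Matrix.fromBlocks 0 1 (-1) 0 * Matrix.fromBlocks 1 (-x) 0 1 * Matrix.fromBlocks 1 0 y 1 *
    Matrix.fromBlocks 1 (-x) 0 1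

theorem hMat_eq (x y : Matrix n n R) :
    hMat x y = Matrix.fromBlocks (2 * x - x * y * x) (x * y - 1) (1 - y * x) y := by
  simp only [hMat, Matrix.fromBlocks_multiply, Matrix.fromBlocks_inj]
  refine ⟨?_, ?_, ?_, ?_⟩ <;> noncomm_ring

theorem hInv_eq (x y : Matrix n n R) :
    hInv x y = Matrix.fromBlocks y (1 - y * x) (x * y - 1) (2 * x - x * y * x) := by
  simp only [hInv, Matrix.fromBlocks_multiply, Matrix.fromBlocks_inj]
  refine ⟨?_, ?_, ?_, ?_⟩ <;> noncomm_ring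

theorem hMat_mul_hInv (x y : Matrix n n R) : hMat x y * hInv x y = 1 := by
  rw [hMat_eq, hInv_eq, Matrix.fromBlocks_multiply, ← Matrix.fromBlocks_one, Matrix.fromBlocks_inj]
  refine ⟨?_, ?_, ?_, ?_⟩ <;> noncomm_ring

theorem hInv_mul_hMat (x y : Matrix n n R) : hInv x y * hMat x y = 1 := by
  rw [hMat_eq, hInv_eq, Matrix.fromBlocks_multiply, ← Matrix.fromBlocks_one, Matrix.fromBlocks_inj]
  refine ⟨?_, ?_, ?_, ?_⟩ <;> noncomm_ring

theorem hMat_map (x y : Matrix n n R) (f : R →+* S) {g g' : Matrix n n S} (hx : x.map f = g)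
    (hy : y.map f = g') (h1 : g * g' = 1) (h2 : g' * g = 1) :
    (hMat x y).map f = Matrix.fromBlocks g 0 0 g' := by
  rw [hMat_eq, Matrix.fromBlocks_map, Matrix.fromBlocks_inj]
  have e1 : (x * y).map f = 1 := by rw [Matrix.map_mul, hx, hy, h1]
  have e2 : (y * x).map f = 1 := by rw [Matrix.map_mul, hx, hy, h2]
  have e3 : (x * y * x).map f = g := by rw [Matrix.map_mul, e1, hx, one_mul]
  have e4 : (1 : Matrix n n R).map f = 1 := by simp
  refine ⟨?_, ?_, ?_, hy⟩
  · rw [two_mul, Matrix.map_sub f (map_sub f), Matrix.map_add f (map_add f), hx, e3]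
    abel
  · rw [Matrix.map_sub f (map_sub f), e1, e4, sub_self]
  · rw [Matrix.map_sub f (map_sub f), e2, e4, sub_self]

theorem hInv_map (x y : Matrix n n R) (f : R →+* S) {g g' : Matrix n n S} (hx : x.map f = g)
    (hy : y.map f = g') (h1 : g * g' = 1) (h2 : g' * g = 1) :
    (hInv x y).map f = Matrix.fromBlocks g' 0 0 g := by
  rw [hInv_eq, Matrix.fromBlocks_map, Matrix.fromBlocks_inj]
  have e1 : (x * y).map f = 1 := by rw [Matrix.map_mul, hx, hy, h1]
  have e2 : (y * x).map f = 1 := by rw [Matrix.map_mul, hx, hy, h2]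
  have e3 : (x * y * x).map f = g := by rw [Matrix.map_mul, e1, hx, one_mul]
  have e4 : (1 : Matrix n n R).map f = 1 := by simp
  refine ⟨hy, ?_, ?_, ?_⟩
  · rw [Matrix.map_sub f (map_sub f), e2, e4, sub_self]
  · rw [Matrix.map_sub f (map_sub f), e1, e4, sub_self]
  · rw [two_mul, Matrix.map_sub f (map_sub f), Matrix.map_add f (map_add f), hx, e3]
    abel

variable (n R) in
/-- The idempotent `p = diag(1, 0)`. -/
def pMat : Matrix (n ⊕ n) (n ⊕ n) R := Matrix.fromBlocks 1 0 0 0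

variable (n R) in
/-- The column `(1, 0)`. -/
def colOne : Matrix (n ⊕ n) n R := Matrix.fromRows 1 0

variable (n R) in
/-- The row `(1, 0)`. -/
def rowOne : Matrix n (n ⊕ n) R := Matrix.fromCols 1 0

theorem rowOne_mul_colOne : rowOne n R * colOne n R = 1 := by
  rw [rowOne, colOne, Matrix.fromCols_mul_fromRows]
  simp

theorem colOne_mul_rowOne : colOne n R * rowOne n R = pMat n R := by
  ext i j
  rcases i with i | i <;> rcases j with j | j <;>
    simp [rowOne, colOne, pMat, Matrix.mul_apply, Matrix.one_apply]

theorem blocks_mul_colOne (a d : Matrix n n R) :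
    Matrix.fromBlocks a 0 0 d * colOne n R = colOne n R * a := by
  ext i j
  rcases i with i | i <;> simp [colOne, Matrix.mul_apply, Matrix.one_apply]

theorem rowOne_mul_blocks (a d : Matrix n n R) :
    rowOne n R * Matrix.fromBlocks a 0 0 d = a * rowOne n R := by
  ext i j
  rcases j with j | j <;> simp [rowOne, Matrix.mul_apply, Matrix.one_apply]

set_option linter.unusedSectionVars false in
theorem colOne_map (f : R →+* S) : (colOne n R).map f = colOne n S := by
  ext i j
  rcases i with i | i
  · by_cases h : i = j <;> simp [colOne, h]
  · simp [colOne]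

set_option linter.unusedSectionVars false in
theorem rowOne_map (f : R →+* S) : (rowOne n R).map f = rowOne n S := by
  ext i j
  rcases j with j | j
  · by_cases h : i = j <;> simp [rowOne, h]
  · simp [rowOne]

theorem pMat_idem : pMat n R * pMat n R = pMat n R := by
  simp [pMat, Matrix.fromBlocks_multiply]

end HMat

namespace UExt

variable (E : UExt I B C)

/-- A choice of a lift to `B` of a matrix over `C`. -/
noncomputable def liftMat {m n : Type*} (g : Matrix m n C) : Matrix m n B :=
  g.map (Function.surjInv E.proj_surjective)

theorem liftMat_map {m n : Type*} (g : Matrix m n C) : (E.liftMat g).map E.proj = g := by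
  ext i j
  exact Function.surjInv_eq E.proj_surjective _

section

variable {n : Type*} [Fintype n] [DecidableEq n]

/-- The idempotent `h p h⁻¹`, as a matrix over `Ĩ`, where `h = h(x, y)` for chosen lifts `x`, `y` of
`g` and `g⁻¹`, and `p = diag(1, 0)`. -/
noncomputable def indexMat (g : (Matrix n n C)ˣ) : Matrix (n ⊕ n) (n ⊕ n) (Unital I) :=
  E.pull (pMat n ℤ)
    (hMat (E.liftMat (g : Matrix n n C)) (E.liftMat (↑g⁻¹ : Matrix n n C)) * pMat n B *
      hInv (E.liftMat (g : Matrix n n C)) (E.liftMat (↑g⁻¹ : Matrix n n C)))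

/-- A factorization `q = a b` of an idempotent representing the index of `g` (auxiliary). -/
structure IsDatum {k : Type*} [Fintype k] [DecidableEq k] (g : (Matrix n n C)ˣ) (a : Matrix k n B)
    (b : Matrix n k B) (p : Matrix k n ℤ) (p' : Matrix n k ℤ) : Prop where
  ba : b * a = 1
  pp : p' * p = 1
  ha : a.map E.proj = p.map (Int.castRingHom C) * (g : Matrix n n C)
  hb : b.map E.proj = (↑g⁻¹ : Matrix n n C) * p'.map (Int.castRingHom C)

variable {E}

section

variable {k l : Type*} [Fintype k] [DecidableEq k] [Fintype l] [DecidableEq l]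
  {g : (Matrix n n C)ˣ} {a : Matrix k n B} {b : Matrix n k B} {p : Matrix k n ℤ}
  {p' : Matrix n k ℤ} {a₂ : Matrix l n B} {b₂ : Matrix n l B} {q : Matrix l n ℤ}
  {q' : Matrix n l ℤ}

theorem IsDatum.agree (d : E.IsDatum g a b p p') (d₂ : E.IsDatum g a₂ b₂ q q') :
    E.Agree (p * q') (a * b₂) := by
  unfold Agree
  rw [Matrix.map_mul, Matrix.map_mul, d.ha, d₂.hb, Matrix.mul_assoc, ← Matrix.mul_assoc _ _ (q'.map _),
    g.mul_inv, Matrix.one_mul]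

theorem IsDatum.mul_mul (d : E.IsDatum g a b p p') (d₂ : E.IsDatum g a₂ b₂ q q') :
    E.pull (p * q') (a * b₂) * E.pull (q * p') (a₂ * b) = E.pull (p * p') (a * b) := by
  rw [pull_mul (d.agree d₂) (d₂.agree d)]
  congr 1
  · rw [Matrix.mul_assoc, ← Matrix.mul_assoc q', d₂.pp, Matrix.one_mul]
  · rw [Matrix.mul_assoc, ← Matrix.mul_assoc b₂, d₂.ba, Matrix.one_mul]

theorem IsDatum.idem (d : E.IsDatum g a b p p') :
    E.pull (p * p') (a * b) * E.pull (p * p') (a * b) = E.pull (p * p') (a * b) := d.mul_mul d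

/-- The class of the idempotent `a b` (auxiliary). -/
noncomputable def IsDatum.cls (d : E.IsDatum g a b p p') : K0 (Unital I) :=
  K0.mk (E.pull (p * p') (a * b)) d.idem

theorem IsDatum.cls_eq (d : E.IsDatum g a b p p') (d₂ : E.IsDatum g a₂ b₂ q q') :
    d.cls = d₂.cls :=
  K0.mk_eq_of_mul (E.pull (p * q') (a * b₂)) (E.pull (q * p') (a₂ * b)) (d.mul_mul d₂)
    (d₂.mul_mul d)

end

theorem IsDatum.std (g : (Matrix n n C)ˣ) :
    E.IsDatum g
      (hMat (E.liftMat (g : Matrix n n C)) (E.liftMat (↑g⁻¹ : Matrix n n C)) * colOne n B)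
      (rowOne n B * hInv (E.liftMat (g : Matrix n n C)) (E.liftMat (↑g⁻¹ : Matrix n n C)))
      (colOne n ℤ) (rowOne n ℤ) where
  ba := by
    rw [Matrix.mul_assoc, ← Matrix.mul_assoc (hInv _ _), hInv_mul_hMat, Matrix.one_mul,
      rowOne_mul_colOne]
  pp := rowOne_mul_colOne
  ha := by
    rw [Matrix.map_mul, hMat_map _ _ _ (E.liftMat_map _) (E.liftMat_map _) g.mul_inv g.inv_mul,
      colOne_map, colOne_map (Int.castRingHom C), blocks_mul_colOne]
  hb := by
    rw [Matrix.map_mul, hInv_map _ _ _ (E.liftMat_map _) (E.liftMat_map _) g.mul_inv g.inv_mul,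
      rowOne_map, rowOne_map (Int.castRingHom C), rowOne_mul_blocks]

theorem indexMat_eq (g : (Matrix n n C)ˣ) : E.indexMat g =
    E.pull (colOne n ℤ * rowOne n ℤ)
      (hMat (E.liftMat (g : Matrix n n C)) (E.liftMat (↑g⁻¹ : Matrix n n C)) * colOne n B *
      (rowOne n B * hInv (E.liftMat (g : Matrix n n C)) (E.liftMat (↑g⁻¹ : Matrix n n C)))) := by
  rw [indexMat, Matrix.mul_assoc _ (colOne n B), ← Matrix.mul_assoc (colOne n B),
    colOne_mul_rowOne, colOne_mul_rowOne, ← Matrix.mul_assoc]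

theorem indexMat_idem (g : (Matrix n n C)ˣ) : E.indexMat g * E.indexMat g = E.indexMat g := by
  rw [indexMat_eq]
  exact (IsDatum.std g).idem

variable (E) in
/-- The element `[h p h⁻¹] - [p]` of `K₀ Ĩ`. -/
noncomputable def indexFun (g : (Matrix n n C)ˣ) : K0 (Unital I) :=
  K0.mk (E.indexMat g) (indexMat_idem g) - K0.mk (pMat n (Unital I)) pMat_idem

theorem indexFun_eq {k : Type*} [Fintype k] [DecidableEq k] {g : (Matrix n n C)ˣ}
    {a : Matrix k n B} {b : Matrix n k B} {p : Matrix k n ℤ} {p' : Matrix n k ℤ}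
    (d : E.IsDatum g a b p p') :
    E.indexFun g = d.cls - K0.mk (1 : Matrix n n (Unital I)) (one_mul 1) := by
  rw [indexFun, d.cls_eq (IsDatum.std g), IsDatum.cls]
  congr 1
  · simp only [indexMat_eq]
  · exact K0.mk_eq_of_mul (colOne n (Unital I)) (rowOne n (Unital I)) colOne_mul_rowOne
      rowOne_mul_colOne

/-- Block sum of invertible matrices indexed by arbitrary finite types (auxiliary). -/
def unitsBlocks {m : Type*} [Fintype m] [DecidableEq m] (g : (Matrix n n C)ˣ) (h : (Matrix m m C)ˣ) :
    (Matrix (n ⊕ m) (n ⊕ m) C)ˣ where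
  val := Matrix.fromBlocks (g : Matrix n n C) 0 0 (h : Matrix m m C)
  inv := Matrix.fromBlocks (↑g⁻¹ : Matrix n n C) 0 0 (↑h⁻¹ : Matrix m m C)
  val_inv := by simp [Matrix.fromBlocks_multiply]
  inv_val := by simp [Matrix.fromBlocks_multiply]

theorem unitsBlocks_val {m : Type*} [Fintype m] [DecidableEq m] (g : (Matrix n n C)ˣ)
    (h : (Matrix m m C)ˣ) : (unitsBlocks g h : Matrix (n ⊕ m) (n ⊕ m) C) =
      Matrix.fromBlocks (g : Matrix n n C) 0 0 (h : Matrix m m C) := rfl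

theorem unitsBlocks_inv {m : Type*} [Fintype m] [DecidableEq m] (g : (Matrix n n C)ˣ)
    (h : (Matrix m m C)ˣ) : (↑(unitsBlocks g h)⁻¹ : Matrix (n ⊕ m) (n ⊕ m) C) =
      Matrix.fromBlocks (↑g⁻¹ : Matrix n n C) 0 0 (↑h⁻¹ : Matrix m m C) := rfl

theorem IsDatum.blocks {k m l : Type*} [Fintype k] [DecidableEq k] [Fintype m] [DecidableEq m]
    [Fintype l] [DecidableEq l] {g : (Matrix n n C)ˣ} {a : Matrix k n B} {b : Matrix n k B}
    {p : Matrix k n ℤ} {p' : Matrix n k ℤ} {h : (Matrix m m C)ˣ} {a₂ : Matrix l m B}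
    {b₂ : Matrix m l B} {q : Matrix l m ℤ} {q' : Matrix m l ℤ}
    (d : E.IsDatum g a b p p') (d₂ : E.IsDatum h a₂ b₂ q q') :
    E.IsDatum (unitsBlocks g h) (Matrix.fromBlocks a 0 0 a₂) (Matrix.fromBlocks b 0 0 b₂)
      (Matrix.fromBlocks p 0 0 q) (Matrix.fromBlocks p' 0 0 q') where
  ba := by simp [Matrix.fromBlocks_multiply, d.ba, d₂.ba]
  pp := by simp [Matrix.fromBlocks_multiply, d.pp, d₂.pp]
  ha := by
    rw [unitsBlocks_val]
    simp [Matrix.fromBlocks_map, Matrix.fromBlocks_multiply, d.ha, d₂.ha]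
  hb := by
    rw [unitsBlocks_inv]
    simp [Matrix.fromBlocks_map, Matrix.fromBlocks_multiply, d.hb, d₂.hb]

theorem IsDatum.one : E.IsDatum (1 : (Matrix n n C)ˣ) (1 : Matrix n n B) 1 1 1 where
  ba := one_mul 1
  pp := one_mul 1
  ha := by simp
  hb := by simp

theorem IsDatum.blocks_cls {k m l : Type*} [Fintype k] [DecidableEq k] [Fintype m] [DecidableEq m]
    [Fintype l] [DecidableEq l] {g : (Matrix n n C)ˣ} {a : Matrix k n B} {b : Matrix n k B}
    {p : Matrix k n ℤ} {p' : Matrix n k ℤ} {h : (Matrix m m C)ˣ} {a₂ : Matrix l m B}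
    {b₂ : Matrix m l B} {q : Matrix l m ℤ} {q' : Matrix m l ℤ}
    (d : E.IsDatum g a b p p') (d₂ : E.IsDatum h a₂ b₂ q q') :
    (d.blocks d₂).cls = d.cls + d₂.cls := by
  have h1 : E.pull (Matrix.fromBlocks p 0 0 q * Matrix.fromBlocks p' 0 0 q')
      (Matrix.fromBlocks a 0 0 a₂ * Matrix.fromBlocks b 0 0 b₂) =
      Matrix.fromBlocks (E.pull (p * p') (a * b)) 0 0 (E.pull (q * q') (a₂ * b₂)) := by
    rw [← pull_blocks (d.agree d) (d₂.agree d₂)]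
    simp [Matrix.fromBlocks_multiply]
  exact (K0.mk_congr h1 _ _).trans (K0.mk_sum (e := E.pull (p * p') (a * b))
    (f := E.pull (q * q') (a₂ * b₂)) d.idem d₂.idem)

theorem IsDatum.one_cls : (IsDatum.one (E := E) (n := n)).cls =
    K0.mk (1 : Matrix n n (Unital I)) (one_mul 1) := by
  simp only [IsDatum.cls, one_mul, pull_one]

theorem IsDatum.conj {k : Type*} [Fintype k] [DecidableEq k] {g h : (Matrix n n C)ˣ}
    {a : Matrix k (n ⊕ n) B} {b : Matrix (n ⊕ n) k B} {p : Matrix k (n ⊕ n) ℤ}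
    {p' : Matrix (n ⊕ n) k ℤ} (d : E.IsDatum (unitsBlocks g h) a b p p') (x y : Matrix n n B)
    (hx : x.map E.proj = h) (hy : y.map E.proj = (↑h⁻¹ : Matrix n n C)) :
    E.IsDatum (unitsBlocks (g * h) 1) (a * hMat x y) (hInv x y * b) p p' where
  ba := by
    rw [Matrix.mul_assoc, ← Matrix.mul_assoc b, d.ba, Matrix.one_mul, hInv_mul_hMat]
  pp := d.pp
  ha := by
    rw [Matrix.map_mul, d.ha, Matrix.mul_assoc, hMat_map x y E.proj hx hy h.mul_inv h.inv_mul]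
    congr 1
    rw [unitsBlocks_val, unitsBlocks_val]
    simp [Matrix.fromBlocks_multiply]
  hb := by
    rw [Matrix.map_mul, d.hb, ← Matrix.mul_assoc, hInv_map x y E.proj hx hy h.mul_inv h.inv_mul]
    congr 1
    rw [unitsBlocks_inv, unitsBlocks_inv]
    simp [Matrix.fromBlocks_multiply]

theorem IsDatum.conj_cls {k : Type*} [Fintype k] [DecidableEq k] {g h : (Matrix n n C)ˣ}
    {a : Matrix k (n ⊕ n) B} {b : Matrix (n ⊕ n) k B} {p : Matrix k (n ⊕ n) ℤ}
    {p' : Matrix (n ⊕ n) k ℤ} (d : E.IsDatum (unitsBlocks g h) a b p p') (x y : Matrix n n B)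
    (hx : x.map E.proj = h) (hy : y.map E.proj = (↑h⁻¹ : Matrix n n C)) :
    (d.conj x y hx hy).cls = d.cls := by
  have h1 : a * hMat x y * (hInv x y * b) = a * b := by
    rw [Matrix.mul_assoc, ← Matrix.mul_assoc (hMat x y), hMat_mul_hInv, Matrix.one_mul]
  simp only [IsDatum.cls, h1]

theorem IsDatum.reindex {m k : Type*} [Fintype m] [DecidableEq m] [Fintype k] [DecidableEq k]
    {g : (Matrix n n C)ˣ} {g₂ : (Matrix m m C)ˣ} {a : Matrix k n B} {b : Matrix n k B}
    {p : Matrix k n ℤ} {p' : Matrix n k ℤ} (d : E.IsDatum g a b p p') (σ : m ≃ n)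
    (h1 : (g₂ : Matrix m m C) = (g : Matrix n n C).submatrix σ σ)
    (h2 : (↑g₂⁻¹ : Matrix m m C) = (↑g⁻¹ : Matrix n n C).submatrix σ σ) :
    E.IsDatum g₂ (a.submatrix id σ) (b.submatrix σ id) (p.submatrix id σ) (p'.submatrix σ id) where
  ba := by
    rw [← Matrix.submatrix_mul _ _ _ _ _ Function.bijective_id, d.ba, Matrix.submatrix_one_equiv]
  pp := by
    rw [← Matrix.submatrix_mul _ _ _ _ _ Function.bijective_id, d.pp, Matrix.submatrix_one_equiv]
  ha := by
    rw [← Matrix.submatrix_map, d.ha, ← Matrix.submatrix_map, h1, Matrix.submatrix_mul_equiv]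
  hb := by
    rw [← Matrix.submatrix_map, d.hb, ← Matrix.submatrix_map, h2, Matrix.submatrix_mul_equiv]

theorem IsDatum.reindex_cls {m k : Type*} [Fintype m] [DecidableEq m] [Fintype k] [DecidableEq k]
    {g : (Matrix n n C)ˣ} {g₂ : (Matrix m m C)ˣ} {a : Matrix k n B} {b : Matrix n k B}
    {p : Matrix k n ℤ} {p' : Matrix n k ℤ} (d : E.IsDatum g a b p p') (σ : m ≃ n)
    (h1 : (g₂ : Matrix m m C) = (g : Matrix n n C).submatrix σ σ)
    (h2 : (↑g₂⁻¹ : Matrix m m C) = (↑g⁻¹ : Matrix n n C).submatrix σ σ) :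
    (d.reindex σ h1 h2).cls = d.cls := by
  simp only [IsDatum.cls, Matrix.submatrix_mul_equiv, Matrix.submatrix_id_id]

theorem indexFun_mul (g h : (Matrix n n C)ˣ) :
    E.indexFun (g * h) = E.indexFun g + E.indexFun h := by
  have d₁ := IsDatum.std (E := E) g
  have d₂ := IsDatum.std (E := E) h
  have d₃ := IsDatum.std (E := E) (g * h)
  have d₄ := d₃.blocks (IsDatum.one (n := n))
  have d₁₂ := d₁.blocks d₂
  let x := E.liftMat (h : Matrix n n C)
  let y := E.liftMat (↑h⁻¹ : Matrix n n C)
  have hx : x.map E.proj = h := E.liftMat_map _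
  have hy : y.map E.proj = (↑h⁻¹ : Matrix n n C) := E.liftMat_map _
  have d₅ := d₁₂.conj x y hx hy
  have e1 : d₅.cls = d₄.cls := d₅.cls_eq d₄
  have e2 : d₅.cls = d₁₂.cls := d₁₂.conj_cls x y hx hy
  rw [d₃.blocks_cls IsDatum.one, e2, d₁.blocks_cls d₂, IsDatum.one_cls] at e1
  rw [indexFun_eq d₁, indexFun_eq d₂, indexFun_eq d₃, eq_sub_of_add_eq e1.symm]
  abel

end

theorem indexFun_dsum_one {n m : ℕ} (g : (Matrix (Fin n) (Fin n) C)ˣ) :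
    E.indexFun (unitsDsum g (1 : (Matrix (Fin m) (Fin m) C)ˣ)) = E.indexFun g := by
  have d₁ := IsDatum.std (E := E) g
  have d₂ := d₁.blocks (IsDatum.one (n := Fin m))
  have d₃ := d₂.reindex (finSumFinEquiv (m := n) (n := m)).symm
    (g₂ := unitsDsum g (1 : (Matrix (Fin m) (Fin m) C)ˣ)) rfl rfl
  have e1 : d₃.cls = d₂.cls := d₂.reindex_cls _ rfl rfl
  rw [indexFun_eq d₁, indexFun_eq d₃]
  have e4 : K0.mk (1 : Matrix (Fin (n + m)) (Fin (n + m)) (Unital I)) (one_mul 1) =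
      K0.mk (1 : Matrix (Fin n) (Fin n) (Unital I)) (one_mul 1) +
      K0.mk (1 : Matrix (Fin m) (Fin m) (Unital I)) (one_mul 1) := by
    rw [K0.mk_fin, K0.mk_fin (1 : Matrix (Fin n) (Fin n) (Unital I)),
      K0.mk_fin (1 : Matrix (Fin m) (Fin m) (Unital I)), ← K0.cls_sum]
    congr 1
    simp only [IdemMat.sum, IdemMat.mk.injEq, heq_eq_eq, true_and]
    exact (dsum_one (R := Unital I)).symm
  rw [e1, d₁.blocks_cls IsDatum.one, IsDatum.one_cls, e4]
  abel

end UExt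

end Index

section NonUnitalK0

variable {A B C : Type u} [NonUnitalRing A] [NonUnitalRing B] [NonUnitalRing C]

theorem augm_comp_map (f : A →ₙ+* B) : (augm B).comp (Unital.map f) = augm A := by
  ext x
  exact Unital.fst_map f x

variable (A) in
/-- `K₀` of an arbitrary ring: `K₀ A = ker (K₀ Ã → K₀ ℤ)`. -/
noncomputable def K0nu : AddSubgroup (K0 (Unital A)) := (K0.map (augm A)).ker

/-- Functoriality of `K₀` for arbitrary ring homomorphisms. -/
noncomputable def K0nu.map (f : A →ₙ+* B) : K0nu A →+ K0nu B :=
  ((K0.map (Unital.map f)).comp (K0nu A).subtype).codRestrict (K0nu B) (by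
    rintro ⟨x, hx⟩
    change K0.map (augm B) (K0.map (Unital.map f) x) = 0
    rw [← AddMonoidHom.comp_apply, ← K0.map_comp, augm_comp_map]
    exact hx)

theorem K0nu.coe_map (f : A →ₙ+* B) (x : K0nu A) :
    (K0nu.map f x : K0 (Unital B)) = K0.map (Unital.map f) x := rfl

theorem K0nu.map_id : K0nu.map (NonUnitalRingHom.id A) = AddMonoidHom.id _ := by
  ext x
  rw [K0nu.coe_map, Unital.map_id, K0.map_id]
  rfl

theorem K0nu.map_comp (g : B →ₙ+* C) (f : A →ₙ+* B) :
    K0nu.map (g.comp f) = (K0nu.map g).comp (K0nu.map f) := by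
  ext x
  rw [K0nu.coe_map, Unital.map_comp, K0.map_comp]
  rfl

end NonUnitalK0

section IndexHom

namespace UExt

variable {I B C : Type u} [NonUnitalRing I] [Ring B] [Ring C] (E : UExt I B C)

theorem indexFun_mem {n : ℕ} (g : (Matrix (Fin n) (Fin n) C)ˣ) : E.indexFun g ∈ K0nu I := by
  change K0.map (augm I) _ = 0
  have h2 : (pMat (Fin n) (Unital I)).map (augm I) = pMat (Fin n) ℤ := by
    rw [← colOne_mul_rowOne, Matrix.map_mul, colOne_map, rowOne_map, colOne_mul_rowOne]
  rw [indexFun, map_sub, K0.map_mk (augm I) _ (by rw [← Matrix.map_mul, indexMat_idem]),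
    K0.map_mk (augm I) _ (by rw [← Matrix.map_mul, pMat_idem]), sub_eq_zero]
  exact K0.mk_congr (h2.symm ▸ rfl) _ _

/-- The connecting homomorphism `K₁ C → K₀ I` of a unital extension: it sends the class of
`g ∈ GL_n C` to `[h p h⁻¹] - [p]`, where `h = h(x, y)` for lifts `x`, `y` of `g`, `g⁻¹`. -/
noncomputable def index : K1 C →+ K0nu I :=
  K1.lift (fun x => (⟨E.indexFun x.mat, E.indexFun_mem x.mat⟩ : K0nu I))
    (fun _ g h => Subtype.ext (indexFun_mul g h))
    (fun x _ => Subtype.ext (indexFun_dsum_one (E := E) x.mat))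

theorem coe_index_cls (x : InvMat C) : (E.index (K1.cls x) : K0 (Unital I)) = E.indexFun x.mat := by
  rw [index, K1.lift_cls]

variable {I' B' C' : Type u} [NonUnitalRing I'] [Ring B'] [Ring C'] (E' : UExt I' B' C')

variable {E E'}

theorem IsDatum.map {n k : Type*} [Fintype n] [DecidableEq n] [Fintype k] [DecidableEq k]
    {g : (Matrix n n C)ˣ} {a : Matrix k n B} {a' : Matrix n k B} {p : Matrix k n ℤ}
    {p' : Matrix n k ℤ} (d : E.IsDatum g a a' p p') (b : B →+* B') (c : C →+* C')
    (h2 : ∀ x, E'.proj (b x) = c (E.proj x)) :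
    E'.IsDatum (Units.map c.mapMatrix.toMonoidHom g) (a.map b) (a'.map b) p p' where
  ba := by rw [← Matrix.map_mul, d.ba, Matrix.map_one b (map_zero b) (map_one b)]
  pp := d.pp
  ha := by
    have h3 : (a.map b).map E'.proj = (a.map E.proj).map c := by ext i j; exact h2 _
    rw [h3, d.ha, Matrix.map_mul]
    congr 1
    ext i j
    simp
  hb := by
    have h3 : (a'.map b).map E'.proj = (a'.map E.proj).map c := by ext i j; exact h2 _
    rw [h3, d.hb, Matrix.map_mul]
    congr 1
    ext i j
    simp

theorem IsDatum.map_cls {n k : Type*} [Fintype n] [DecidableEq n] [Fintype k] [DecidableEq k]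
    {g : (Matrix n n C)ˣ} {a : Matrix k n B} {a' : Matrix n k B} {p : Matrix k n ℤ}
    {p' : Matrix n k ℤ} (d : E.IsDatum g a a' p p') (i : I →ₙ+* I') (b : B →+* B') (c : C →+* C')
    (h1 : ∀ x, E'.incl (i x) = b (E.incl x)) (h2 : ∀ x, E'.proj (b x) = c (E.proj x)) :
    K0.map (Unital.map i) d.cls = (d.map (E' := E') b c h2).cls := by
  rw [cls, K0.map_mk (Unital.map i) _ (by rw [← Matrix.map_mul, d.idem])]
  refine K0.mk_congr ?_ _ _
  symm
  refine pull_eq ?_ ?_ ((d.map b c h2).agree (d.map b c h2))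
  · ext k l
    rfl
  · rw [← Matrix.map_mul]
    conv_rhs => rw [← pull_toMid (d.agree d)]
    ext k l
    simp [toMid_apply, h1]

theorem indexFun_natural {n : ℕ} (g : (Matrix (Fin n) (Fin n) C)ˣ) (i : I →ₙ+* I') (b : B →+* B')
    (c : C →+* C') (h1 : ∀ x, E'.incl (i x) = b (E.incl x))
    (h2 : ∀ x, E'.proj (b x) = c (E.proj x)) :
    K0.map (Unital.map i) (E.indexFun g) =
      E'.indexFun (Units.map c.mapMatrix.toMonoidHom g) := by
  have d := IsDatum.std (E := E) g
  rw [indexFun_eq d, indexFun_eq (d.map (E' := E') b c h2), map_sub, d.map_cls i b c h1 h2,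
    K0.map_mk (Unital.map i) _ (by rw [← Matrix.map_mul, one_mul])]
  congr 1
  exact K0.mk_congr (Matrix.map_one _ (map_zero _) (map_one _)) _ _

variable (E E')

theorem index_natural (i : I →ₙ+* I') (b : B →+* B') (c : C →+* C')
    (h1 : ∀ x, E'.incl (i x) = b (E.incl x)) (h2 : ∀ x, E'.proj (b x) = c (E.proj x)) :
    (K0nu.map i).comp E.index = E'.index.comp (K1.map c) := by
  refine K1.hom_ext fun x => Subtype.ext ?_
  rw [AddMonoidHom.comp_apply, AddMonoidHom.comp_apply, K0nu.coe_map, coe_index_cls, K1.map_cls,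
    coe_index_cls]
  exact indexFun_natural x.mat i b c h1 h2

end UExt

end IndexHom

section Shift

variable {R : Type u} {S : Type v} [Ring R] [Ring S]

theorem one_sub_add_mul {M : Type*} [Ring M] {e s t : M} (he : e * e = e) (hs : s * e = e * s)
    (hst : s * t = 1) : (1 - e + e * s) * (1 - e + e * t) = 1 := by
  have h1 : (1 - e) * (1 - e) = 1 - e := by simp [mul_sub, sub_mul, he]
  have h2 : (1 - e) * (e * t) = 0 := by rw [← mul_assoc, sub_mul, he]; simp
  have h3 : e * s * (1 - e) = 0 := by rw [mul_sub, mul_assoc e s e, hs, ← mul_assoc, he]; simp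
  have h4 : e * s * (e * t) = e := by
    rw [mul_assoc, ← mul_assoc s, hs, mul_assoc e s t, hst, mul_one, he]
  rw [add_mul, mul_add, mul_add, h1, h2, h3, h4]
  simp

theorem diag_comm {n : ℕ} (e : Matrix (Fin n) (Fin n) R) {s : Susp R}
    (hs : ∀ r, s * Susp.const r = Susp.const r * s) :
    (Matrix.diagonal fun _ => s) * e.map Susp.const =
      e.map Susp.const * Matrix.diagonal fun _ => s := by
  ext i j
  rw [Matrix.diagonal_mul, Matrix.mul_diagonal]
  exact hs _

theorem diag_mul_diag {n : ℕ} {s t : Susp R} (h : s * t = 1) :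
    (Matrix.diagonal fun _ => s : Matrix (Fin n) (Fin n) (Susp R)) *
      (Matrix.diagonal fun _ => t) = 1 := by
  rw [Matrix.diagonal_mul_diagonal, h, Matrix.diagonal_one]

theorem map_const_idem {n : ℕ} {e : Matrix (Fin n) (Fin n) R} (he : e * e = e) :
    e.map Susp.const * e.map Susp.const = e.map Susp.const := by
  rw [← Matrix.map_mul, he]

/-- For an idempotent matrix `e` over `R`, the invertible matrix `1 - e + e α` over `Σ R`, with
inverse `1 - e + e α*`. -/
noncomputable def shiftUnit {n : ℕ} (e : Matrix (Fin n) (Fin n) R) (he : e * e = e) :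
    (Matrix (Fin n) (Fin n) (Susp R))ˣ where
  val := 1 - e.map Susp.const + e.map Susp.const * Matrix.diagonal fun _ => Susp.shift R
  inv := 1 - e.map Susp.const + e.map Susp.const * Matrix.diagonal fun _ => Susp.shift' R
  val_inv := one_sub_add_mul (map_const_idem he) (diag_comm e Susp.shift_comm)
    (diag_mul_diag Susp.shift_mul_shift')
  inv_val := one_sub_add_mul (map_const_idem he) (diag_comm e Susp.shift'_comm)
    (diag_mul_diag Susp.shift'_mul_shift)

theorem shiftUnit_val {n : ℕ} (e : Matrix (Fin n) (Fin n) R) (he : e * e = e) :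
    (shiftUnit e he : Matrix (Fin n) (Fin n) (Susp R)) =
      1 - e.map Susp.const + e.map Susp.const * Matrix.diagonal fun _ => Susp.shift R := rfl

theorem shiftUnit_dsum {n m : ℕ} (e : Matrix (Fin n) (Fin n) R) (he : e * e = e)
    (f : Matrix (Fin m) (Fin m) R) (hf : f * f = f) (h : dsum e f * dsum e f = dsum e f) :
    shiftUnit (dsum e f) h = unitsDsum (shiftUnit e he) (shiftUnit f hf) := by
  ext1
  change 1 - (dsum e f).map Susp.const + (dsum e f).map Susp.const * _ = dsum _ _
  rw [shiftUnit_val, shiftUnit_val]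
  ext i j
  obtain ⟨i, rfl⟩ := finSumFinEquiv.surjective i
  obtain ⟨j, rfl⟩ := finSumFinEquiv.surjective j
  rcases i with i | i <;> rcases j with j | j <;>
    simp [dsum, Matrix.mul_diagonal, Matrix.one_apply, -finSumFinEquiv_apply_left,
      -finSumFinEquiv_apply_right]

theorem shiftUnit_zero {m : ℕ} (h : (0 : Matrix (Fin m) (Fin m) R) * 0 = 0) :
    shiftUnit (0 : Matrix (Fin m) (Fin m) R) h = 1 := by
  ext1
  rw [shiftUnit_val]
  simp

theorem shiftUnit_conj {n : ℕ} (e : Matrix (Fin n) (Fin n) R) (he : e * e = e)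
    (g : (Matrix (Fin n) (Fin n) R)ˣ)
    (h : g * e * (↑g⁻¹ : Matrix (Fin n) (Fin n) R) * (g * e * (↑g⁻¹ : Matrix (Fin n) (Fin n) R)) =
      g * e * (↑g⁻¹ : Matrix (Fin n) (Fin n) R)) :
    shiftUnit _ h = Units.map (Susp.const (R := R)).mapMatrix.toMonoidHom g * shiftUnit e he *
      (Units.map (Susp.const (R := R)).mapMatrix.toMonoidHom g)⁻¹ := by
  ext1
  rw [Units.val_mul, Units.val_mul, shiftUnit_val, shiftUnit_val, ← map_inv]
  change _ = (g : Matrix (Fin n) (Fin n) R).map Susp.const * _ *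
    (↑g⁻¹ : Matrix (Fin n) (Fin n) R).map Susp.const
  rw [Matrix.map_mul, Matrix.map_mul]
  have h1 : (g : Matrix (Fin n) (Fin n) R).map Susp.const *
      (↑g⁻¹ : Matrix (Fin n) (Fin n) R).map Susp.const = 1 := by
    rw [← Matrix.map_mul, g.mul_inv, Matrix.map_one _ (map_zero _) (map_one _)]
  have h2 := diag_comm (↑g⁻¹ : Matrix (Fin n) (Fin n) R) Susp.shift_comm
  rw [mul_assoc _ _ (Matrix.diagonal _), ← h2, mul_add, mul_sub, mul_one, add_mul, sub_mul, h1]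
  simp only [mul_assoc]

/-- The homomorphism `K₀ R → K₁ Σ R`, `[e] ↦ [1 - e + e α]`. It is the inverse of the connecting
map of the extension `0 → M_∞ R → Γ R → Σ R → 0`. -/
noncomputable def shiftHom : K0 R →+ K1 (Susp R) :=
  K0.lift (fun x => K1.cls ⟨x.size, shiftUnit x.mat x.idem⟩)
    (fun x g => by
      rw [← K1.cls_conj (shiftUnit x.mat x.idem)
        (Units.map (Susp.const (R := R)).mapMatrix.toMonoidHom g), ← shiftUnit_conj]
      rfl)
    (fun x m => by
      rw [← K1.cls_stab ⟨x.size, shiftUnit x.mat x.idem⟩ m]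
      exact congrArg (fun u => K1.cls ⟨x.size + m, u⟩)
        ((shiftUnit_dsum x.mat x.idem 0 (zero_mul 0) _).trans
          (congrArg _ (shiftUnit_zero _))))
    (fun x y => by
      rw [← K1.cls_dsum, ← shiftUnit_dsum]
      rfl)

theorem shiftHom_cls (x : IdemMat R) :
    shiftHom (K0.cls x) = K1.cls ⟨x.size, shiftUnit x.mat x.idem⟩ := K0.lift_cls ..

theorem shiftHom_natural {R S : Type u} [Ring R] [Ring S] (f : R →+* S) :
    (K1.map (Susp.mapRingHom f)).comp shiftHom = shiftHom.comp (K0.map f) := by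
  refine K0.hom_ext fun x => ?_
  rw [AddMonoidHom.comp_apply, AddMonoidHom.comp_apply, shiftHom_cls, K1.map_cls, K0.map_cls,
    shiftHom_cls]
  refine congrArg (fun u => K1.cls ⟨x.size, u⟩) ?_
  ext1
  change (1 - x.mat.map Susp.const + x.mat.map Susp.const *
    Matrix.diagonal fun _ => Susp.shift R).map (Susp.mapRingHom f) =
    1 - (x.mat.map f).map Susp.const + (x.mat.map f).map Susp.const *
    Matrix.diagonal fun _ => Susp.shift S
  have h1 : Susp.mapRingHom f (Susp.shift R) = Susp.shift S :=
    (Susp.mapRingHom_diag f 1 0 1).trans (by rw [map_one]; rfl)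
  have h2 : ∀ r, Susp.mapRingHom f (Susp.const r) = Susp.const (f r) :=
    fun r => Susp.mapRingHom_diag f 0 0 r
  ext i j
  by_cases hij : i = j
  · subst hij
    simp [Matrix.mul_diagonal, h1, h2]
  · simp [Matrix.mul_diagonal, h1, h2, hij]

end Shift

section Boundary

variable {I B C I' B' C' : Type u} [NonUnitalRing I] [NonUnitalRing B] [NonUnitalRing C]
  [NonUnitalRing I'] [NonUnitalRing B'] [NonUnitalRing C']

/-- The connecting homomorphism `∂ : K₀ C → K₋₁ I = K₀ Σ I` of an extension of rings: the composite
of `K₀ C ⊆ K₀ C̃`, the isomorphism `K₀ C̃ ≅ K₁ Σ C̃` and the connecting map of the unital extension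
`0 → Σ I → Σ B̃ → Σ C̃ → 0`. -/
noncomputable def Ext.bdry (E : Ext I B C) : K0nu C →+ K0nu (Susp I) :=
  (E.unitize.susp.index.comp shiftHom).comp (K0nu C).subtype

theorem Ext.bdry_natural (E : Ext I B C) (E' : Ext I' B' C') (i : I →ₙ+* I') (b : B →ₙ+* B')
    (c : C →ₙ+* C') (h1 : ∀ x, E'.incl (i x) = b (E.incl x))
    (h2 : ∀ x, E'.proj (b x) = c (E.proj x)) :
    (K0nu.map (Susp.map i)).comp E.bdry = E'.bdry.comp (K0nu.map c) := by
  have h3 := UExt.index_natural E.unitize.susp E'.unitize.susp (Susp.map i)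
    (Susp.mapRingHom (Unital.map b)) (Susp.mapRingHom (Unital.map c))
    (by
      intro x
      obtain ⟨a, rfl⟩ := Susp.mk_surjective x
      refine congrArg Susp.mk ?_
      ext k l
      · rfl
      · exact h1 _)
    (by
      intro x
      obtain ⟨a, rfl⟩ := Susp.mk_surjective x
      refine congrArg Susp.mk ?_
      ext k l
      · rfl
      · exact h2 _)
  have h4 := shiftHom_natural (Unital.map c)
  ext1 x
  have h5 := DFunLike.congr_fun h3 (shiftHom (x : K0 (Unital C)))
  have h6 := DFunLike.congr_fun h4 (x : K0 (Unital C))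
  refine h5.trans ?_
  exact congrArg E'.unitize.susp.index h6

end Boundary

section PolynomialRings

variable {A B C : Type u} [NonUnitalRing A] [NonUnitalRing B] [NonUnitalRing C]

theorem augm_map_eq_zero {f : Polynomial (Unital A)} :
    Polynomial.mapRingHom (augm A) f = 0 ↔ ∀ i, (f.coeff i).fst = 0 := by
  rw [Polynomial.ext_iff]
  simp [augm]

variable (A) in
/-- The polynomial ring `A[t]` of an arbitrary ring: the polynomials over `Ã` with all coefficients
in `A`. -/
def polyRing : NonUnitalSubring (Polynomial (Unital A)) where
  carrier := {f | ∀ i, (f.coeff i).fst = 0}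
  mul_mem' {f g} hf hg := by
    change ∀ i, _ at hf
    change ∀ i, _
    rw [← augm_map_eq_zero] at hf ⊢
    rw [map_mul, hf, zero_mul]
  zero_mem' i := by simp
  add_mem' hf hg i := by simp [hf i, hg i]
  neg_mem' hf i := by simp [hf i]

/-- Evaluation of polynomials at `1`. -/
noncomputable def evalOne (R : Type u) [Ring R] : Polynomial R →+* R :=
  Polynomial.eval₂RingHom' (RingHom.id R) 1 fun a => Commute.one_right a

theorem evalOne_map {R : Type u} {S : Type v} [Ring R] [Ring S] (φ : R →+* S)
    (f : Polynomial R) :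
    evalOne S (Polynomial.mapRingHom φ f) = φ (evalOne R f) := by
  simp [evalOne, Polynomial.eval₂_map]

variable (A) in
/-- The path ring `P A = ker (ev₀ : A[t] → A)`. -/
def pathRing : NonUnitalSubring (Polynomial (Unital A)) where
  carrier := {f | f ∈ polyRing A ∧ f.coeff 0 = 0}
  mul_mem' hf hg := ⟨mul_mem hf.1 hg.1, by simp [Polynomial.mul_coeff_zero, hf.2]⟩
  zero_mem' := ⟨zero_mem _, by simp⟩
  add_mem' hf hg := ⟨add_mem hf.1 hg.1, by simp [hf.2, hg.2]⟩
  neg_mem' hf := ⟨neg_mem hf.1, by simp [hf.2]⟩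

variable (A) in
/-- The loop ring `Ω A = ker (ev₁ : P A → A)`. -/
noncomputable def loopRing : NonUnitalSubring (Polynomial (Unital A)) where
  carrier := {f | f ∈ pathRing A ∧ evalOne _ f = 0}
  mul_mem' hf hg := ⟨mul_mem hf.1 hg.1, by rw [map_mul, hf.2, zero_mul]⟩
  zero_mem' := ⟨zero_mem _, map_zero _⟩
  add_mem' hf hg := ⟨add_mem hf.1 hg.1, by rw [map_add, hf.2, hg.2, add_zero]⟩
  neg_mem' hf := ⟨neg_mem hf.1, by rw [map_neg, hf.2, neg_zero]⟩

theorem fst_evalOne {f : Polynomial (Unital A)} (hf : f ∈ polyRing A) :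
    (evalOne _ f).fst = 0 := by
  have h1 := evalOne_map (augm A) f
  rw [augm_map_eq_zero.2 hf, map_zero] at h1
  exact h1.symm

variable (A) in
/-- The extension `0 → Ω A → P A → A → 0`, with projection `ev₁`. -/
noncomputable def loopExt : Ext (loopRing A) (pathRing A) A where
  incl := NonUnitalSubring.inclusion fun _ h => h.1
  proj :=
    { toFun := fun f => (evalOne _ f.1).snd
      map_mul' := fun f g => by
        change (evalOne _ (f.1 * g.1)).snd = _
        rw [map_mul, Unital.snd_mul, fst_evalOne f.2.1, fst_evalOne g.2.1]
        simp
      map_zero' := by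
        change (evalOne (Unital A) 0).snd = 0
        rw [map_zero, Unital.snd_zero]
      map_add' := fun f g => by
        change (evalOne _ (f.1 + g.1)).snd = _
        rw [map_add, Unital.snd_add] }
  incl_injective f g h := Subtype.ext (congrArg (fun x => x.1) h)
  proj_surjective a := by
    refine ⟨⟨Polynomial.monomial 1 ⟨0, a⟩, fun i => ?_, ?_⟩, ?_⟩
    · rw [Polynomial.coeff_monomial]
      split_ifs <;> rfl
    · simp [Polynomial.coeff_monomial]
    · change (evalOne (Unital A) (Polynomial.monomial 1 ⟨0, a⟩)).snd = a
      simp [evalOne]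
  exact f := by
    constructor
    · intro h
      exact ⟨⟨f.1, f.2, Unital.ext (fst_evalOne f.2.1) h⟩, rfl⟩
    · rintro ⟨g, rfl⟩
      exact congrArg Unital.snd g.2.2

theorem polyRing_map_mem (φ : A →ₙ+* B) {f : Polynomial (Unital A)} (hf : f ∈ polyRing A) :
    Polynomial.mapRingHom (Unital.map φ) f ∈ polyRing B := by
  intro i
  simp only [Polynomial.coe_mapRingHom, Polynomial.coeff_map, Unital.fst_map]
  exact hf i

theorem pathRing_map_mem (φ : A →ₙ+* B) {f : Polynomial (Unital A)} (hf : f ∈ pathRing A) :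
    Polynomial.mapRingHom (Unital.map φ) f ∈ pathRing B :=
  ⟨polyRing_map_mem φ hf.1, by
    rw [Polynomial.coe_mapRingHom, Polynomial.coeff_map, hf.2, map_zero]⟩

theorem loopRing_map_mem (φ : A →ₙ+* B) {f : Polynomial (Unital A)} (hf : f ∈ loopRing A) :
    Polynomial.mapRingHom (Unital.map φ) f ∈ loopRing B :=
  ⟨pathRing_map_mem φ hf.1, by rw [evalOne_map, hf.2, map_zero]⟩

/-- The map `P φ : P A → P B`. -/
noncomputable def pathRing.map (φ : A →ₙ+* B) : pathRing A →ₙ+* pathRing B where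
  toFun f := ⟨Polynomial.mapRingHom (Unital.map φ) f.1, pathRing_map_mem φ f.2⟩
  map_mul' f g := Subtype.ext (map_mul (Polynomial.mapRingHom (Unital.map φ)) f.1 g.1)
  map_zero' := Subtype.ext (map_zero (Polynomial.mapRingHom (Unital.map φ)))
  map_add' f g := Subtype.ext (map_add (Polynomial.mapRingHom (Unital.map φ)) f.1 g.1)

/-- The map `Ω φ : Ω A → Ω B`. -/
noncomputable def loopRing.map (φ : A →ₙ+* B) : loopRing A →ₙ+* loopRing B where
  toFun f := ⟨Polynomial.mapRingHom (Unital.map φ) f.1, loopRing_map_mem φ f.2⟩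
  map_mul' f g := Subtype.ext (map_mul (Polynomial.mapRingHom (Unital.map φ)) f.1 g.1)
  map_zero' := Subtype.ext (map_zero (Polynomial.mapRingHom (Unital.map φ)))
  map_add' f g := Subtype.ext (map_add (Polynomial.mapRingHom (Unital.map φ)) f.1 g.1)

theorem loopRing.map_id : loopRing.map (NonUnitalRingHom.id A) = NonUnitalRingHom.id _ := by
  ext1 f
  refine Subtype.ext ?_
  change Polynomial.mapRingHom (Unital.map (NonUnitalRingHom.id A)) f.1 = f.1
  rw [Unital.map_id, Polynomial.mapRingHom_id, RingHom.id_apply]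

theorem loopRing.map_comp (ψ : B →ₙ+* C) (φ : A →ₙ+* B) :
    loopRing.map (ψ.comp φ) = (loopRing.map ψ).comp (loopRing.map φ) := by
  ext1 f
  refine Subtype.ext ?_
  change Polynomial.mapRingHom (Unital.map (ψ.comp φ)) f.1 =
    Polynomial.mapRingHom (Unital.map ψ) (Polynomial.mapRingHom (Unital.map φ) f.1)
  rw [Unital.map_comp, ← Polynomial.mapRingHom_comp, RingHom.comp_apply]

theorem loopExt_incl_natural (φ : A →ₙ+* B) (x : loopRing A) :
    (loopExt B).incl (loopRing.map φ x) = pathRing.map φ ((loopExt A).incl x) := rfl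

theorem loopExt_proj_natural (φ : A →ₙ+* B) (x : pathRing A) :
    (loopExt B).proj (pathRing.map φ x) = φ ((loopExt A).proj x) := by
  change (evalOne _ (Polynomial.mapRingHom (Unital.map φ) x.1)).snd = φ (evalOne _ x.1).snd
  rw [evalOne_map, Unital.snd_map]

theorem augm_mapLaurent_eq_zero {f : LaurentPolynomial (Unital A)} :
    AddMonoidAlgebra.mapRingHom ℤ (augm A) f = 0 ↔ ∀ i, (f.coeff i).fst = 0 := by
  constructor
  · intro h i
    have := congrArg (fun g => g.coeff i) h
    simpa [augm] using this
  · intro h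
    ext i
    simpa [augm] using h i

variable (A) in
/-- The Laurent polynomial ring `A[t, t⁻¹]` of an arbitrary ring: the Laurent polynomials over `Ã`
with all coefficients in `A`. -/
def laurentRing : NonUnitalSubring (LaurentPolynomial (Unital A)) where
  carrier := {f | ∀ i, (f.coeff i).fst = 0}
  mul_mem' {f g} hf hg := by
    change ∀ i, _ at hf
    change ∀ i, _
    rw [← augm_mapLaurent_eq_zero] at hf ⊢
    rw [map_mul, hf, zero_mul]
  zero_mem' i := by simp
  add_mem' hf hg i := by simp [hf i, hg i]
  neg_mem' hf i := by simp [hf i]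

/-- The map `A[t, t⁻¹] → B[t, t⁻¹]` applying `φ` to the coefficients. -/
noncomputable def laurentRing.map (φ : A →ₙ+* B) : laurentRing A →ₙ+* laurentRing B where
  toFun f := ⟨AddMonoidAlgebra.mapRingHom ℤ (Unital.map φ) f.1, fun i => by
    rw [AddMonoidAlgebra.coeff_mapRingHom, Unital.fst_map]
    exact f.2 i⟩
  map_mul' f g := Subtype.ext (map_mul (AddMonoidAlgebra.mapRingHom ℤ (Unital.map φ)) f.1 g.1)
  map_zero' := Subtype.ext (map_zero (AddMonoidAlgebra.mapRingHom ℤ (Unital.map φ)))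
  map_add' f g := Subtype.ext (map_add (AddMonoidAlgebra.mapRingHom ℤ (Unital.map φ)) f.1 g.1)

theorem laurentRing.map_id : laurentRing.map (NonUnitalRingHom.id A) = NonUnitalRingHom.id _ := by
  ext1 f
  refine Subtype.ext ?_
  change AddMonoidAlgebra.mapRingHom ℤ (Unital.map (NonUnitalRingHom.id A)) f.1 = f.1
  rw [Unital.map_id, AddMonoidAlgebra.mapRingHom_id, RingHom.id_apply]

theorem laurentRing.map_comp (ψ : B →ₙ+* C) (φ : A →ₙ+* B) :
    laurentRing.map (ψ.comp φ) = (laurentRing.map ψ).comp (laurentRing.map φ) := by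
  ext1 f
  refine Subtype.ext ?_
  change AddMonoidAlgebra.mapRingHom ℤ (Unital.map (ψ.comp φ)) f.1 =
    AddMonoidAlgebra.mapRingHom ℤ (Unital.map ψ) (AddMonoidAlgebra.mapRingHom ℤ (Unital.map φ) f.1)
  rw [Unital.map_comp, AddMonoidAlgebra.mapRingHom_comp, RingHom.comp_apply]

/-- The ring `σ = ker (ev₁ : ℤ[t, t⁻¹] → ℤ)`. -/
noncomputable def sigmaRing : NonUnitalSubring (LaurentPolynomial ℤ) where
  carrier := {f | LaurentPolynomial.eval₂ (RingHom.id ℤ) 1 f = 0}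
  mul_mem' {f g} hf hg := by
    change _ = _ at hf
    change _ = _
    rw [map_mul, hf, zero_mul]
  zero_mem' := map_zero _
  add_mem' {f g} hf hg := by
    change _ = _ at hf hg
    change _ = _
    rw [map_add, hf, hg, add_zero]
  neg_mem' {f} hf := by
    change _ = _ at hf
    change _ = _
    rw [map_neg, hf, neg_zero]

open TensorProduct in
/-- The map `σ ⊗ φ : σ ⊗ A → σ ⊗ B`. -/
noncomputable def sigmaMap (φ : A →ₙ+* B) : sigmaRing ⊗[ℤ] A →ₙ+* sigmaRing ⊗[ℤ] B where
  toFun := LinearMap.lTensor sigmaRing φ.toAddMonoidHom.toIntLinearMap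
  map_mul' x y := by
    set L := LinearMap.lTensor sigmaRing φ.toAddMonoidHom.toIntLinearMap with hL
    induction x with
    | zero => exact (congrArg L (zero_mul y)).trans ((map_zero L).trans
        ((zero_mul (L y)).symm.trans (congrArg (fun z => z * L y) (map_zero L).symm)))
    | add x x' hx hx' => rw [add_mul, map_add, hx, hx', map_add, add_mul]
    | tmul s a =>
      induction y with
      | zero => exact (congrArg L (mul_zero (s ⊗ₜ[ℤ] a))).trans ((map_zero L).trans
          ((mul_zero (L (s ⊗ₜ[ℤ] a))).symm.trans
            (congrArg (fun z => L (s ⊗ₜ[ℤ] a) * z) (map_zero L).symm)))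
      | add y y' hy hy' => rw [mul_add, map_add, hy, hy', map_add, mul_add]
      | tmul t b => simp [hL]
  map_zero' := map_zero _
  map_add' := map_add _

theorem sigmaMap_id : sigmaMap (NonUnitalRingHom.id A) = NonUnitalRingHom.id _ := by
  ext1 x
  change LinearMap.lTensor _ _ x = x
  exact DFunLike.congr_fun (LinearMap.lTensor_id sigmaRing A) x

theorem sigmaMap_comp (ψ : B →ₙ+* C) (φ : A →ₙ+* B) :
    sigmaMap (ψ.comp φ) = (sigmaMap ψ).comp (sigmaMap φ) := by
  ext1 x
  exact LinearMap.lTensor_comp_apply sigmaRing ψ.toAddMonoidHom.toIntLinearMap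
    φ.toAddMonoidHom.toIntLinearMap x

end PolynomialRings

/-- The category of (not necessarily unital) rings and ring homomorphisms. -/
structure Rng : Type (u + 1) where
  carrier : Type u
  [ring : NonUnitalRing carrier]

namespace Rng

instance : CoeSort Rng.{u} (Type u) := ⟨Rng.carrier⟩

attribute [instance] Rng.ring

instance : Category Rng.{u} where
  Hom A B := A →ₙ+* B
  id A := NonUnitalRingHom.id A
  comp f g := NonUnitalRingHom.comp g f

/-- The ring homomorphism underlying a morphism of `Rng`. -/
def hom {A B : Rng.{u}} (f : A ⟶ B) : A →ₙ+* B := f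

/-- The suspension functor `A ↦ Σ A`. -/
noncomputable def susp : Rng.{u} ⥤ Rng.{u} where
  obj A := ⟨Susp A⟩
  map f := Susp.map f
  map_id _ := Susp.map_id
  map_comp f g := Susp.map_comp g f

/-- The loop functor `A ↦ Ω A`. -/
noncomputable def loop : Rng.{u} ⥤ Rng.{u} where
  obj A := ⟨loopRing A⟩
  map f := loopRing.map f
  map_id _ := loopRing.map_id
  map_comp f g := loopRing.map_comp g f

/-- The functor `A ↦ A[t, t⁻¹]`. -/
noncomputable def laurent : Rng.{u} ⥤ Rng.{u} where
  obj A := ⟨laurentRing A⟩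
  map f := laurentRing.map f
  map_id _ := laurentRing.map_id
  map_comp f g := laurentRing.map_comp g f

/-- The functor `A ↦ σ A = σ ⊗ A`. -/
noncomputable def sigma : Rng.{u} ⥤ Rng.{u} where
  obj A := ⟨TensorProduct ℤ sigmaRing A⟩
  map f := sigmaMap f
  map_id _ := sigmaMap_id
  map_comp f g := sigmaMap_comp g f

/-- The functor `A ↦ K₀ A` on arbitrary rings. -/
noncomputable def K0 : Rng.{u} ⥤ AddCommGrpCat.{u} where
  obj A := AddCommGrpCat.of (K0nu A)
  map f := AddCommGrpCat.ofHom (K0nu.map f)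
  map_id A := by
    change AddCommGrpCat.ofHom (K0nu.map (NonUnitalRingHom.id A)) = _
    rw [K0nu.map_id]
    rfl
  map_comp f g := by
    change AddCommGrpCat.ofHom (K0nu.map (NonUnitalRingHom.comp g f)) = _
    rw [K0nu.map_comp]
    rfl

end Rng

/-- The `p`-fold iterate of an endofunctor. -/
def iter (F : Rng.{u} ⥤ Rng.{u}) : ℕ → (Rng.{u} ⥤ Rng.{u})
  | 0 => 𝟭 _
  | p + 1 => iter F p ⋙ F

/-- The functor `A ↦ K₋ₚ A = K₀ Σᵖ A`. -/
noncomputable def negK (p : ℕ) : Rng.{u} ⥤ AddCommGrpCat.{u} := iter Rng.susp p ⋙ Rng.K0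

/-- The extension `0 → Σᵖ Ω A → Σᵖ P A → Σᵖ A → 0`. -/
noncomputable def suspLoopExt (A : Rng.{u}) : (p : ℕ) →
    Ext ((iter Rng.susp p).obj (Rng.loop.obj A)) ((iter Rng.susp p).obj ⟨pathRing A⟩)
      ((iter Rng.susp p).obj A)
  | 0 => loopExt A
  | p + 1 => (suspLoopExt A p).susp

theorem Ext.susp_incl_natural {I B C I' B' C' : Type u} [NonUnitalRing I] [NonUnitalRing B]
    [NonUnitalRing C] [NonUnitalRing I'] [NonUnitalRing B'] [NonUnitalRing C'] (E : Ext I B C)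
    (E' : Ext I' B' C') (i : I →ₙ+* I') (b : B →ₙ+* B')
    (h1 : ∀ x, E'.incl (i x) = b (E.incl x)) (x : Susp I) :
    E'.susp.incl (Susp.map i x) = Susp.map b (E.susp.incl x) := by
  obtain ⟨a, rfl⟩ := Susp.mk_surjective x
  refine congrArg Susp.mk ?_
  ext k l
  exact h1 _

theorem Ext.susp_proj_natural {I B C I' B' C' : Type u} [NonUnitalRing I] [NonUnitalRing B]
    [NonUnitalRing C] [NonUnitalRing I'] [NonUnitalRing B'] [NonUnitalRing C'] (E : Ext I B C)
    (E' : Ext I' B' C') (b : B →ₙ+* B') (c : C →ₙ+* C')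
    (h2 : ∀ x, E'.proj (b x) = c (E.proj x)) (x : Susp B) :
    E'.susp.proj (Susp.map b x) = Susp.map c (E.susp.proj x) := by
  obtain ⟨a, rfl⟩ := Susp.mk_surjective x
  refine congrArg Susp.mk ?_
  ext k l
  exact h2 _

/-- The map `P f`, as a morphism of `Rng`. -/
noncomputable def pathMap {A B : Rng.{u}} (f : A ⟶ B) :
    (⟨pathRing A⟩ : Rng.{u}) ⟶ ⟨pathRing B⟩ := pathRing.map f

theorem suspLoopExt_incl_natural {A B : Rng.{u}} (f : A ⟶ B) : (p : ℕ) → ∀ x,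
    (suspLoopExt B p).incl (Rng.hom ((iter Rng.susp p).map (Rng.loop.map f)) x) =
      Rng.hom ((iter Rng.susp p).map (pathMap f)) ((suspLoopExt A p).incl x)
  | 0, x => loopExt_incl_natural f x
  | p + 1, x => Ext.susp_incl_natural (suspLoopExt A p) (suspLoopExt B p) _ _
      (suspLoopExt_incl_natural f p) x

theorem suspLoopExt_proj_natural {A B : Rng.{u}} (f : A ⟶ B) : (p : ℕ) → ∀ x,
    (suspLoopExt B p).proj (Rng.hom ((iter Rng.susp p).map (pathMap f)) x) =
      Rng.hom ((iter Rng.susp p).map f) ((suspLoopExt A p).proj x)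
  | 0, x => loopExt_proj_natural f x
  | p + 1, x => Ext.susp_proj_natural (suspLoopExt A p) (suspLoopExt B p) _ _
      (suspLoopExt_proj_natural f p) x

/-- The connecting homomorphism `∂ : K₋ₚ A → K₋ₚ₋₁ Ω A` of the extension
`0 → Ω A → P A → A → 0`, as a natural transformation. -/
noncomputable def bdry (p : ℕ) : negK.{u} p ⟶ Rng.loop ⋙ negK (p + 1) where
  app A := AddCommGrpCat.ofHom (suspLoopExt A p).bdry
  naturality A B f := by
    refine AddCommGrpCat.hom_ext ?_
    exact ((suspLoopExt A p).bdry_natural (suspLoopExt B p)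
      (Rng.hom ((iter Rng.susp p).map (Rng.loop.map f)))
      (Rng.hom ((iter Rng.susp p).map (pathMap f))) (Rng.hom ((iter Rng.susp p).map f))
      (suspLoopExt_incl_natural f p) (suspLoopExt_proj_natural f p)).symm

/-- Weibel's homotopy `K`-theory `KHₙ A = colim K₋ₚ Ω^{n+p} A`, the colimit being taken over the
`p ≥ 0` with `n + p ≥ 0` along the connecting homomorphisms `∂ : K₋ₚ X → K₋ₚ₋₁ Ω X`. The index `k`
below corresponds to `p = k + max (-n) 0`, so that `n + p = k + max n 0`. -/
noncomputable def KH (n : ℤ) : Rng.{u} ⥤ AddCommGrpCat.{u} :=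
  Limits.colimit (Functor.ofSequence
    (X := fun k : ℕ => iter Rng.loop (n.toNat + k) ⋙ negK ((-n).toNat + k))
    (fun k => Functor.whiskerLeft (iter Rng.loop (n.toNat + k)) (bdry ((-n).toNat + k))))

end HomotopyK

/-! The isomorphisms are induced by evaluation at `1`, `evHom : A[t, t⁻¹] → A`, and by `lamHom :
A[t, t⁻¹] → Σ A`, which sends `t` to the shift `α` and is called `λ` below. Two facts suffice.
First, `KHₙ(Σ A) ≅ KHₙ₋₁(A)`, because an additional suspension commutes with `Ω` and with the
connecting maps (`nonempty_susp_KH_iso`). Second, the pair `(ev₁, λ)` induces a bijection from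
`KHₙ(A[t, t⁻¹])` to `KHₙ(A) ⊕ KHₙ(Σ A)`. Since `0 → σA → A[t, t⁻¹] → A → 0` is split, `σA` accounts
for the second summand.

The second fact is proved stage by stage in the colimit. On `K₀` the pair is surjective
(`exists_evHom_lamHom`), and a class in its kernel lifts along `ev₁ : P(A[t, t⁻¹]) → A[t, t⁻¹]`
(`exists_path_of_evHom_lamHom`), hence is killed by the next connecting map. The input, for unital
`R`, is that `K₀ R[t, t⁻¹] → K₀ ΣR` is onto and that its kernel consists of sums of classes from
`R[t]` and `R[t⁻¹]` (`K0.map_lam_surjective`, `K0.exists_of_map_lam_eq_zero`). With `p = t - 1` or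
`p = t⁻¹ - 1`, the homotopy `s ↦ x p` deforms such classes to constant ones, and the condition on
`ev₁` makes the constants cancel.

The statement on `K₀` is deduced from one on `K₁`. Higman linearization and the splitting of a
matrix `b` with `b(1 - b)` nilpotent show that `K₁ R[T, T⁻¹]` is generated by the classes `[1 - e +
eT]` and by the images of `K₁ R[T]` and `K₁ R[T⁻¹]` (`mem_laurentGen`). The homomorphism `λ` carries
the first kind to the isomorphism `shiftHom : K₀ R → K₁ ΣR` and kills the other two, which factor
through the cone `ΓR`, where `K₁` vanishes by a swindle. Applied to `ΣR`, with `(ΣR)[T, T⁻¹] ≅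
Σ(R[T, T⁻¹])`, this becomes the statement on `K₀`. That `shiftHom` is bijective follows from
exactness of the index sequence of `M_∞ R → ΓR → ΣR` and from truncating matrices of finite support.

Two devices carry these results to all rings and all stages. The functors `Σ`, `Ω`, `P`, Laurent
polynomials and `σ` all have the form `V ⊗ A` for a fixed ring `V` (`Coeff`), so any two of them
commute. Excision for split extensions passes from `Ã` to `A`. -/

section

namespace HomotopyK

/-! ### Functors of the form `A ↦ V ⊗ A` and their interchange -/

section Coefficients

open TensorProduct

/-- A multiplicative biadditive pairing `V × A → X` which identifies `X` with `V ⊗ A`. -/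
structure Coeff (V : Type v) (A : Type u) (X : Type w) [NonUnitalRing V] [NonUnitalRing A]
    [NonUnitalRing X] where
  smul : V →+ A →+ X
  smul_mul_smul : ∀ v w a b, smul v a * smul w b = smul (v * w) (a * b)
  bijective : Function.Bijective (liftAddHom smul (fun r v a => by simp) : V ⊗[ℤ] A →+ X)

namespace Coeff

variable {V : Type v} {A : Type u} {X : Type w} [NonUnitalRing V] [NonUnitalRing A]
  [NonUnitalRing X]

/-- Induction on sums of elements `v • a`. -/
theorem induction (c : Coeff V A X) {p : X → Prop} (h0 : p 0) (h1 : ∀ v a, p (c.smul v a))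
    (h2 : ∀ x y, p x → p y → p (x + y)) (x : X) : p x := by
  obtain ⟨z, rfl⟩ := c.bijective.2 x
  induction z with
  | zero => rw [map_zero]; exact h0
  | tmul v a => exact h1 v a
  | add y z hy hz => rw [map_add]; exact h2 _ _ hy hz

theorem addHom_ext (c : Coeff V A X) {Y : Type*} [AddCommMonoid Y] {f g : X →+ Y}
    (h : ∀ v a, f (c.smul v a) = g (c.smul v a)) : f = g := by
  ext x
  induction x using c.induction with
  | h0 => simp
  | h1 v a => exact h v a
  | h2 x y hx hy => simp [hx, hy]

theorem hom_ext (c : Coeff V A X) {Y : Type*} [NonUnitalRing Y] {f g : X →ₙ+* Y}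
    (h : ∀ v a, f (c.smul v a) = g (c.smul v a)) : f = g := by
  have := c.addHom_ext (f := f.toAddMonoidHom) (g := g.toAddMonoidHom) h
  ext x
  exact DFunLike.congr_fun this x

/-- The underlying additive isomorphism `V ⊗ A ≃ X`. -/
noncomputable def equiv (c : Coeff V A X) : V ⊗[ℤ] A ≃+ X :=
  AddEquiv.ofBijective _ c.bijective

@[simp] theorem equiv_tmul (c : Coeff V A X) (v : V) (a : A) :
    c.equiv (v ⊗ₜ a) = c.smul v a := rfl

/-- The additive map on `X` determined by a biadditive map on `V × A`. -/
noncomputable def addHom (c : Coeff V A X) {Y : Type*} [AddCommGroup Y] (f : V →+ A →+ Y) :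
    X →+ Y :=
  (liftAddHom f (fun r v a => by simp) : V ⊗[ℤ] A →+ Y).comp c.equiv.symm.toAddMonoidHom

@[simp] theorem addHom_smul (c : Coeff V A X) {Y : Type*} [AddCommGroup Y] (f : V →+ A →+ Y)
    (v : V) (a : A) : c.addHom f (c.smul v a) = f v a := by
  have : c.equiv.symm (c.smul v a) = v ⊗ₜ a := by
    rw [← equiv_tmul, AddEquiv.symm_apply_apply]
  simp [addHom, this]

/-- The ring homomorphism on `X` determined by a multiplicative biadditive map on `V × A`. -/
noncomputable def hom (c : Coeff V A X) {Y : Type*} [NonUnitalRing Y] (f : V →+ A →+ Y)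
    (hf : ∀ v w a b, f v a * f w b = f (v * w) (a * b)) : X →ₙ+* Y where
  toFun := c.addHom f
  map_mul' x y := by
    induction x using c.induction with
    | h0 => simp
    | h2 x x' hx hx' => simp [add_mul, hx, hx']
    | h1 v a =>
      induction y using c.induction with
      | h0 => simp
      | h2 x x' hx hx' => simp [mul_add, hx, hx']
      | h1 w b => simp [c.smul_mul_smul, hf]
  map_zero' := map_zero _
  map_add' := map_add _

@[simp] theorem hom_smul (c : Coeff V A X) {Y : Type*} [NonUnitalRing Y] (f : V →+ A →+ Y) (hf)
    (v : V) (a : A) : c.hom f hf (c.smul v a) = f v a := c.addHom_smul f v a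

section Change

variable {V' A' X' : Type*} [NonUnitalRing V'] [NonUnitalRing A'] [NonUnitalRing X']

/-- The homomorphism `v • a ↦ φ v • ψ a`. -/
noncomputable def map (c : Coeff V A X) (c' : Coeff V' A' X') (φ : V →ₙ+* V') (ψ : A →ₙ+* A') :
    X →ₙ+* X' :=
  c.hom ((AddMonoidHom.compHom' ψ.toAddMonoidHom).comp (c'.smul.comp φ.toAddMonoidHom))
    (fun v w a b => by simp [c'.smul_mul_smul])

@[simp] theorem map_smul (c : Coeff V A X) (c' : Coeff V' A' X') (φ : V →ₙ+* V')
    (ψ : A →ₙ+* A') (v : V) (a : A) : c.map c' φ ψ (c.smul v a) = c'.smul (φ v) (ψ a) := by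
  simp [map]

/-- The additive map `v • a ↦ φ v • ψ a`. -/
noncomputable def addMap (c : Coeff V A X) (c' : Coeff V' A' X') (φ : V →+ V') (ψ : A →+ A') :
    X →+ X' :=
  c.addHom ((AddMonoidHom.compHom' ψ).comp (c'.smul.comp φ))

@[simp] theorem addMap_smul (c : Coeff V A X) (c' : Coeff V' A' X') (φ : V →+ V')
    (ψ : A →+ A') (v : V) (a : A) : c.addMap c' φ ψ (c.smul v a) = c'.smul (φ v) (ψ a) := by
  simp [addMap]

end Change

section Retract

variable {V' A' X' : Type*} [NonUnitalRing V'] [NonUnitalRing A'] [NonUnitalRing X']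

/-- A pairing restricts to retracts. -/
noncomputable def retract (c : Coeff V A X) (s : V' →+ A' →+ X')
    (hs : ∀ v w a b, s v a * s w b = s (v * w) (a * b)) (ι : V' →+ V) (ρ : V →+ V')
    (ι' : A' →+ A) (ρ' : A →+ A')
    (j : X' →+ X) (r : X →+ X') (hι : ∀ v, ρ (ι v) = v) (hι' : ∀ a, ρ' (ι' a) = a)
    (hj : ∀ x, r (j x) = x)
    (h1 : ∀ v a, j (s v a) = c.smul (ι v) (ι' a)) (h2 : ∀ v a, r (c.smul v a) = s (ρ v) (ρ' a)) :
    Coeff V' A' X' where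
  smul := s
  smul_mul_smul := hs
  bijective := by
    let L : V' ⊗[ℤ] A' →+ X' := liftAddHom s (fun r v a => by simp)
    let I : V' ⊗[ℤ] A' →ₗ[ℤ] V ⊗[ℤ] A := TensorProduct.map ι.toIntLinearMap ι'.toIntLinearMap
    let P : V ⊗[ℤ] A →ₗ[ℤ] V' ⊗[ℤ] A' := TensorProduct.map ρ.toIntLinearMap ρ'.toIntLinearMap
    -- `e1`, `e2` and `e3` exhibit `L` as a retract of the bijection `c.equiv`, and a retract of a
    -- bijection is bijective. The retractions need only be additive.
    have e1 : ∀ x, j (L x) = c.equiv (I x) := by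
      intro x
      induction x with
      | zero => simp
      | add x y hx hy => simp only [map_add, hx, hy]
      | tmul v a => exact h1 v a
    have e2 : ∀ x, r (c.equiv x) = L (P x) := by
      intro x
      induction x with
      | zero => simp
      | add x y hx hy => simp only [map_add, hx, hy]
      | tmul v a => exact h2 v a
    have e3 : ∀ x, P (I x) = x := by
      intro x
      induction x with
      | zero => simp
      | add x y hx hy => simp only [map_add, hx, hy]
      | tmul v a => exact congrArg₂ (fun v a => v ⊗ₜ[ℤ] a) (hι v) (hι' a)
    constructor
    · rw [injective_iff_map_eq_zero]
      intro x hx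
      have h := e1 x
      rw [hx, map_zero] at h
      rw [← e3 x, c.equiv.map_eq_zero_iff.1 h.symm, map_zero]
    · intro y
      obtain ⟨x, hx⟩ := c.equiv.surjective (j y)
      exact ⟨P x, by rw [← e2, hx, hj]⟩

end Retract

section Swap

variable {W X₁ Y X₂ Y' : Type*} [NonUnitalRing W] [NonUnitalRing X₁] [NonUnitalRing Y]
  [NonUnitalRing X₂] [NonUnitalRing Y']

/-- The homomorphism `w • (v • a) ↦ v • (w • a)`. -/
noncomputable def swapHom (c₁ : Coeff V A X₁) (d₁ : Coeff W X₁ Y) (c₂ : Coeff W A X₂)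
    (d₂ : Coeff V X₂ Y') : Y →ₙ+* Y' :=
  d₁.hom
    { toFun := fun w => c₁.addHom ((AddMonoidHom.compHom' (c₂.smul w)).comp d₂.smul)
      map_zero' := c₁.addHom_ext fun v a => by simp
      map_add' := fun w w' => c₁.addHom_ext fun v a => by simp }
    (by
      intro w w' x x'
      induction x using c₁.induction with
      | h0 => simp
      | h2 x y hx hy =>
        simp only [AddMonoidHom.coe_mk, ZeroHom.coe_mk] at hx hy ⊢
        simp only [map_add, add_mul, hx, hy]
      | h1 v a =>
        induction x' using c₁.induction with
        | h0 => simp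
        | h2 x y hx hy =>
          simp only [AddMonoidHom.coe_mk, ZeroHom.coe_mk] at hx hy ⊢
          simp only [map_add, mul_add, hx, hy]
        | h1 v' a' => simp [c₁.smul_mul_smul, c₂.smul_mul_smul, d₂.smul_mul_smul])

@[simp] theorem swapHom_smul (c₁ : Coeff V A X₁) (d₁ : Coeff W X₁ Y) (c₂ : Coeff W A X₂)
    (d₂ : Coeff V X₂ Y') (w : W) (v : V) (a : A) :
    swapHom c₁ d₁ c₂ d₂ (d₁.smul w (c₁.smul v a)) = d₂.smul v (c₂.smul w a) := by
  simp [swapHom]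

/-- Additive maps out of an iterated pairing are determined by their values on `w • (v • a)`. -/
theorem hom_ext₂ (c₁ : Coeff V A X₁) (d₁ : Coeff W X₁ Y) {Z : Type*} [NonUnitalRing Z]
    {f g : Y →ₙ+* Z}
    (h : ∀ w v a, f (d₁.smul w (c₁.smul v a)) = g (d₁.smul w (c₁.smul v a))) : f = g := by
  refine d₁.hom_ext fun w x => ?_
  exact DFunLike.congr_fun (c₁.addHom_ext (f := f.toAddMonoidHom.comp (d₁.smul w))
    (g := g.toAddMonoidHom.comp (d₁.smul w)) (h w)) x

theorem swapHom_swapHom (c₁ : Coeff V A X₁) (d₁ : Coeff W X₁ Y) (c₂ : Coeff W A X₂)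
    (d₂ : Coeff V X₂ Y') (y : Y) :
    swapHom c₂ d₂ c₁ d₁ (swapHom c₁ d₁ c₂ d₂ y) = y :=
  DFunLike.congr_fun (hom_ext₂ c₁ d₁ (f := (swapHom c₂ d₂ c₁ d₁).comp (swapHom c₁ d₁ c₂ d₂))
    (g := NonUnitalRingHom.id Y) (by simp)) y

/-- The isomorphism `w • (v • a) ↦ v • (w • a)`. -/
noncomputable def swap (c₁ : Coeff V A X₁) (d₁ : Coeff W X₁ Y) (c₂ : Coeff W A X₂)
    (d₂ : Coeff V X₂ Y') : Y ≃+* Y' where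
  __ := swapHom c₁ d₁ c₂ d₂
  invFun := swapHom c₂ d₂ c₁ d₁
  left_inv := swapHom_swapHom c₁ d₁ c₂ d₂
  right_inv := swapHom_swapHom c₂ d₂ c₁ d₁

@[simp] theorem swap_smul (c₁ : Coeff V A X₁) (d₁ : Coeff W X₁ Y) (c₂ : Coeff W A X₂)
    (d₂ : Coeff V X₂ Y') (w : W) (v : V) (a : A) :
    swap c₁ d₁ c₂ d₂ (d₁.smul w (c₁.smul v a)) = d₂.smul v (c₂.smul w a) :=
  swapHom_smul c₁ d₁ c₂ d₂ w v a

end Swap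

end Coeff

end Coefficients

end HomotopyK

end

section

namespace HomotopyK

/-! ### Laurent polynomials, polynomials, paths and loops as tensor products -/

section CoefficientRings

open TensorProduct

/-- A pairing with an inverse to `V ⊗ A → X`. -/
def Coeff.ofInverse {V : Type v} {A : Type u} {X : Type w} [NonUnitalRing V] [NonUnitalRing A]
    [NonUnitalRing X] (s : V →+ A →+ X)
    (hs : ∀ v w a b, s v a * s w b = s (v * w) (a * b)) (N : X →+ V ⊗[ℤ] A)
    (h1 : ∀ v a, N (s v a) = v ⊗ₜ a)
    (h2 : ∀ x, (liftAddHom s (fun r v a => by simp) : V ⊗[ℤ] A →+ X) (N x) = x) :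
    Coeff V A X where
  smul := s
  smul_mul_smul := hs
  bijective := by
    refine ⟨fun x y h => ?_, fun x => ⟨N x, h2 x⟩⟩
    have e : ∀ x, N ((liftAddHom s (fun r v a => by simp) : V ⊗[ℤ] A →+ X) x) = x := by
      intro x
      induction x with
      | zero => simp
      | add x y hx hy => rw [map_add, map_add, hx, hy]
      | tmul v a => exact h1 v a
    rw [← e x, h, e y]

section Laurent

open LaurentPolynomial

variable (R : Type u) [Ring R]

/-- The pairing `f • r = f r` of integral Laurent polynomials with elements of a ring. -/
noncomputable def laurentSmul : ℤ[T;T⁻¹] →+ R →+ R[T;T⁻¹] :=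
  AddMonoidHom.mk' (fun f => AddMonoidHom.mk'
    (fun r => AddMonoidAlgebra.mapRingHom ℤ (Int.castRingHom R) f * C r)
    (fun r s => by rw [map_add, mul_add])) (fun f g => by ext1 r; simp [add_mul])

variable {R}

theorem laurentSmul_apply (f : ℤ[T;T⁻¹]) (r : R) :
    laurentSmul R f r = AddMonoidAlgebra.mapRingHom ℤ (Int.castRingHom R) f * C r := rfl

theorem coeff_laurentSmul (f : ℤ[T;T⁻¹]) (r : R) (i : ℤ) :
    (laurentSmul R f r).coeff i = f.coeff i • r := by
  rw [laurentSmul_apply, ← single_eq_C, AddMonoidAlgebra.coeff_mul_single_zero]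
  simp

theorem laurentSmul_T (n : ℤ) (r : R) : laurentSmul R (T n) r = C r * T n := by
  ext i
  rw [coeff_laurentSmul, ← single_eq_C_mul_T, T_apply, AddMonoidAlgebra.coeff_single, Finsupp.single_apply]
  split_ifs <;> simp

theorem laurentSmul_mul (f g : ℤ[T;T⁻¹]) (r s : R) :
    laurentSmul R f r * laurentSmul R g s = laurentSmul R (f * g) (r * s) := by
  -- Integers are central in `R`, so integral Laurent polynomials commute with constants; this is
  -- what makes the pairing multiplicative.
  have h : Commute (C r) (AddMonoidAlgebra.mapRingHom ℤ (Int.castRingHom R) g) := by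
    rw [← single_eq_C]
    induction g using AddMonoidAlgebra.induction_linear with
    | zero => simp
    | add f g hf hg => rw [map_add]; exact hf.add_right hg
    | single i n =>
      rw [AddMonoidAlgebra.mapRingHom_single]
      refine AddMonoidAlgebra.single_commute_single (by simp [AddCommute]) ?_
      exact (Int.cast_commute n r).symm
  rw [laurentSmul_apply, laurentSmul_apply, laurentSmul_apply, map_mul, map_mul,
    mul_assoc, ← mul_assoc (C r), h.eq]
  simp only [mul_assoc]

variable (R) in
/-- `R[t, t⁻¹] = ℤ[t, t⁻¹] ⊗ R` for a unital ring. -/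
noncomputable def coeffLaurentU : Coeff ℤ[T;T⁻¹] R R[T;T⁻¹] :=
  Coeff.ofInverse (laurentSmul R) (fun f g r s => laurentSmul_mul f g r s)
    -- The inverse sends `∑ Tⁱ rᵢ` to `∑ Tⁱ ⊗ rᵢ`.
    ((Finsupp.liftAddHom fun i => (TensorProduct.mk ℤ ℤ[T;T⁻¹] R (T i)).toAddMonoidHom).comp
      AddMonoidAlgebra.coeffAddEquiv.toAddMonoidHom)
    (by
      intro f a
      induction f using AddMonoidAlgebra.induction_linear with
      | zero => simp
      | add f g hf hg => rw [map_add, AddMonoidHom.add_apply, map_add, hf, hg, add_tmul]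
      | single i n =>
        have h : laurentSmul R (AddMonoidAlgebra.single i n) a =
            AddMonoidAlgebra.single i (n • a) := by
          ext j
          rw [coeff_laurentSmul, AddMonoidAlgebra.coeff_single, AddMonoidAlgebra.coeff_single,
            Finsupp.single_apply, Finsupp.single_apply]
          split_ifs <;> simp
        have h' : (AddMonoidAlgebra.single i n : ℤ[T;T⁻¹]) = n • T i := by
          rw [T, AddMonoidAlgebra.smul_single, smul_eq_mul, mul_one]
        rw [h, h', smul_tmul]
        exact Finsupp.liftAddHom_apply_single _ _ _)
    (by
      intro f
      induction f using AddMonoidAlgebra.induction_linear with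
      | zero => simp
      | add f g hf hg => rw [map_add, map_add, hf, hg]
      | single i r =>
        have h : ((Finsupp.liftAddHom fun i =>
            (TensorProduct.mk ℤ ℤ[T;T⁻¹] R (T i)).toAddMonoidHom).comp
            AddMonoidAlgebra.coeffAddEquiv.toAddMonoidHom) (AddMonoidAlgebra.single i r) =
            T i ⊗ₜ[ℤ] r := Finsupp.liftAddHom_apply_single _ _ _
        rw [h, single_eq_C_mul_T, ← laurentSmul_T]
        rfl)

@[simp] theorem coeffLaurentU_smul (f : ℤ[T;T⁻¹]) (r : R) :
    (coeffLaurentU R).smul f r = laurentSmul R f r := rfl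

variable (A : Type u) [NonUnitalRing A]

/-- The inclusion `A → Ã`. -/
def Unital.inr : A →ₙ+* Unital A where
  toFun a := ⟨0, a⟩
  map_mul' a b := by ext <;> simp
  map_zero' := rfl
  map_add' a b := by ext <;> simp

@[simp] theorem Unital.fst_inr (a : A) : (Unital.inr A a).fst = 0 := rfl
@[simp] theorem Unital.snd_inr (a : A) : (Unital.inr A a).snd = a := rfl
@[simp] theorem Unital.fst_zsmul (n : ℤ) (x : Unital A) : (n • x).fst = n • x.fst :=
  map_zsmul (augm A) n x
@[simp] theorem Unital.snd_zsmul (n : ℤ) (x : Unital A) : (n • x).snd = n • x.snd :=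
  map_zsmul (⟨⟨Unital.snd, rfl⟩, fun _ _ => rfl⟩ : Unital A →+ A) n x

variable {A} in
theorem laurentSmul_inr_mem (f : ℤ[T;T⁻¹]) (a : A) :
    laurentSmul (Unital A) f (Unital.inr A a) ∈ laurentRing A := fun i => by
  rw [coeff_laurentSmul]; simp

/-- The projection `Ã → A`. -/
def Unital.sndHom : Unital A →+ A := ⟨⟨Unital.snd, rfl⟩, fun _ _ => rfl⟩

variable {A} in
theorem Unital.sub_intCast_fst (x : Unital A) : x - ((augm A x : ℤ) : Unital A) = Unital.inr A x.snd := by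
  ext <;> simp [augm]

/-- The projection of `Ã[t, t⁻¹]` onto `A[t, t⁻¹]`. -/
noncomputable def laurentRetract : LaurentPolynomial (Unital A) →+ laurentRing A :=
  AddMonoidHom.mk' (fun f => ⟨f - AddMonoidAlgebra.mapRingHom ℤ
    ((Int.castRingHom (Unital A)).comp (augm A)) f, fun i => by
      simp [augm]⟩) (fun f g => Subtype.ext (by
        change f + g - _ = f - _ + (g - _)
        rw [map_add]; abel))

variable {A} in
theorem coeff_laurentRetract (f : LaurentPolynomial (Unital A)) (i : ℤ) :
    (laurentRetract A f).1.coeff i = Unital.inr A (f.coeff i).snd := by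
  rw [← Unital.sub_intCast_fst]
  simp [laurentRetract]

variable {A} in
/-- The coefficients of an element of `A[t, t⁻¹]` (as elements of `Ã`) are determined by their
component in `A`. -/
theorem laurentRing.ext {f g : laurentRing A} (h : ∀ i, (f.1.coeff i).snd = (g.1.coeff i).snd) :
    f = g :=
  Subtype.ext (LaurentPolynomial.ext fun i => Unital.ext ((f.2 i).trans (g.2 i).symm) (h i))

/-- The pairing `f • a = f a` of integral Laurent polynomials with elements of a ring. -/
noncomputable def laurentRingSmul : ℤ[T;T⁻¹] →+ A →+ laurentRing A :=
  AddMonoidHom.mk' (fun f => AddMonoidHom.mk' (fun a => ⟨_, laurentSmul_inr_mem f a⟩)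
    (fun a b => Subtype.ext (by simp))) (fun f g => by ext1 a; exact Subtype.ext (by simp))

/-- `A[t, t⁻¹] = ℤ[t, t⁻¹] ⊗ A`. -/
noncomputable def coeffLaurent : Coeff ℤ[T;T⁻¹] A (laurentRing A) :=
  (coeffLaurentU (Unital A)).retract (laurentRingSmul A)
    (fun v w a b => Subtype.ext ((laurentSmul_mul _ _ _ _).trans (by rw [← map_mul]; rfl)))
    (AddMonoidHom.id _) (AddMonoidHom.id _) (Unital.inr A).toAddMonoidHom (Unital.sndHom A)
    (laurentRing A).toAddSubgroup.subtype (laurentRetract A) (fun _ => rfl) (fun _ => rfl)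
    (fun f => laurentRing.ext fun i => by
      rw [coeff_laurentRetract]; rfl)
    (fun v a => rfl) (fun v a => laurentRing.ext fun i => by
      rw [coeff_laurentRetract]
      change (((laurentSmul (Unital A)) v a).coeff i).snd =
        ((laurentSmul (Unital A) v (Unital.inr A a.snd)).coeff i).snd
      rw [coeff_laurentSmul, coeff_laurentSmul]
      simp)

variable {A} in
theorem coeffLaurent_smul_val (f : ℤ[T;T⁻¹]) (a : A) :
    ((coeffLaurent A).smul f a).1 = laurentSmul (Unital A) f (Unital.inr A a) := rfl

variable {A} in
theorem coeff_coeffLaurent_smul (f : ℤ[T;T⁻¹]) (a : A) (i : ℤ) :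
    (((coeffLaurent A).smul f a).1.coeff i).snd = f.coeff i • a := by
  rw [coeffLaurent_smul_val, coeff_laurentSmul]
  simp

theorem laurentRing.map_smul {A B : Type u} [NonUnitalRing A] [NonUnitalRing B] (φ : A →ₙ+* B)
    (f : ℤ[T;T⁻¹]) (a : A) :
    laurentRing.map φ ((coeffLaurent A).smul f a) = (coeffLaurent B).smul f (φ a) := by
  refine laurentRing.ext fun i => ?_
  rw [coeff_coeffLaurent_smul, ← map_zsmul, ← coeff_coeffLaurent_smul]
  change ((AddMonoidAlgebra.mapRingHom ℤ (Unital.map φ) ((coeffLaurent A).smul f a).1).coeff i).snd = _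
  rw [AddMonoidAlgebra.coeff_mapRingHom]
  exact Unital.snd_map _ _

end Laurent

section Poly

open Polynomial

variable (A : Type u) [NonUnitalRing A]

variable {A} in
theorem polyRing.ext {f g : polyRing A} (h : ∀ i, (f.1.coeff i).snd = (g.1.coeff i).snd) :
    f = g :=
  Subtype.ext (Polynomial.ext fun i => Unital.ext ((f.2 i).trans (g.2 i).symm) (h i))

/-- The element `f a` of `Ã[t]`, for an integral polynomial `f`. -/
noncomputable def polySmul : ℤ[X] →+ A →+ (Unital A)[X] :=
  AddMonoidHom.mk' (fun f => AddMonoidHom.mk'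
    (fun a => f.map (Int.castRingHom (Unital A)) * C (Unital.inr A a))
    (fun a b => by rw [map_add, map_add, mul_add]))
    (fun f g => by ext1 a; simp [add_mul])

variable {A}

theorem polySmul_apply (f : ℤ[X]) (a : A) :
    polySmul A f a = f.map (Int.castRingHom (Unital A)) * C (Unital.inr A a) := rfl

theorem coeff_polySmul (f : ℤ[X]) (a : A) (i : ℕ) :
    (polySmul A f a).coeff i = Unital.inr A (f.coeff i • a) := by
  rw [polySmul_apply, coeff_mul_C, coeff_map, map_zsmul, zsmul_eq_mul]
  rfl

theorem polySmul_mul (f g : ℤ[X]) (a b : A) :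
    polySmul A f a * polySmul A g b = polySmul A (f * g) (a * b) := by
  have h : Commute (C (Unital.inr A a)) (g.map (Int.castRingHom (Unital A))) := by
    refine Polynomial.ext fun i => ?_
    rw [coeff_C_mul, coeff_mul_C, coeff_map]
    exact (Int.cast_commute _ _).symm.eq
  rw [polySmul_apply, polySmul_apply, polySmul_apply, Polynomial.map_mul, map_mul, map_mul,
    mul_assoc, ← mul_assoc (C _), h.eq]
  simp only [mul_assoc]

theorem polySmul_mem (f : ℤ[X]) (a : A) : polySmul A f a ∈ polyRing A := fun i => by
  rw [coeff_polySmul]; rfl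

theorem evalOne_polySmul (f : ℤ[X]) (a : A) :
    evalOne _ (polySmul A f a) = Unital.inr A (f.eval 1 • a) := by
  rw [polySmul_apply, map_mul, ← Polynomial.coe_mapRingHom, evalOne_map, map_zsmul, zsmul_eq_mul]
  simp [evalOne, Polynomial.eval₂_eq_eval_map]

variable (A)

/-- The pairing `f • a = f a` of integral polynomials with elements of a ring. -/
noncomputable def polyRingSmul : ℤ[X] →+ A →+ polyRing A :=
  AddMonoidHom.mk' (fun f => AddMonoidHom.mk' (fun a => ⟨_, polySmul_mem f a⟩)
    (fun a b => Subtype.ext (by simp))) (fun f g => by ext1 a; exact Subtype.ext (by simp))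

/-- The projection of `Ã[t]` onto `A[t]`. -/
noncomputable def polyRetract : (Unital A)[X] →+ polyRing A :=
  AddMonoidHom.mk' (fun f => ⟨f - f.map ((Int.castRingHom (Unital A)).comp (augm A)), fun i => by
      simp [augm]⟩) (fun f g => Subtype.ext (by
        change f + g - _ = f - _ + (g - _)
        rw [Polynomial.map_add]; abel))

variable {A} in
theorem coeff_polyRetract (f : (Unital A)[X]) (i : ℕ) :
    (polyRetract A f).1.coeff i = Unital.inr A (f.coeff i).snd := by
  rw [← Unital.sub_intCast_fst]
  simp [polyRetract]

/-- `A[t] = ℤ[t] ⊗ A`. -/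
noncomputable def coeffPoly : Coeff ℤ[X] A (polyRing A) :=
  -- Polynomials are a retract of Laurent polynomials through truncation to nonnegative exponents,
  -- and `A` is a retract of `Ã`. Truncation is additive but not multiplicative, which is enough for
  -- `retract`.
  (coeffLaurentU (Unital A)).retract (polyRingSmul A)
    (fun f g a b => Subtype.ext (polySmul_mul f g a b))
    (toLaurent (R := ℤ)).toAddMonoidHom LaurentPolynomial.trunc
    (Unital.inr A).toAddMonoidHom (Unital.sndHom A)
    ((toLaurent (R := Unital A)).toAddMonoidHom.comp (polyRing A).toAddSubgroup.subtype)
    ((polyRetract A).comp LaurentPolynomial.trunc)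
    trunc_toLaurent (fun _ => rfl)
    (fun f => polyRing.ext fun i => by
      change ((polyRetract A (LaurentPolynomial.trunc (toLaurent f.1))).1.coeff i).snd = _
      rw [coeff_polyRetract, trunc_toLaurent]; rfl)
    (fun f a => by
      change toLaurent (f.map _ * C _) = laurentSmul (Unital A) (toLaurent f) (Unital.inr A a)
      rw [map_mul, toLaurent_C, laurentSmul_apply]
      congr 1
      induction f using Polynomial.induction_on' with
      | add p q hp hq => rw [Polynomial.map_add, map_add, hp, hq, map_add, map_add]
      | monomial n c =>
        have h : AddMonoidAlgebra.mapRingHom ℤ (Int.castRingHom (Unital A))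
            (LaurentPolynomial.T n) = LaurentPolynomial.T n := by
          rw [LaurentPolynomial.T, AddMonoidAlgebra.mapRingHom_single, map_one]
          rfl
        simp [← C_mul_X_pow_eq_monomial, h])
    (fun f a => polyRing.ext fun i => by
      change ((polyRetract A (LaurentPolynomial.trunc (laurentSmul (Unital A) f a))).1.coeff i).snd =
        ((polySmul A (LaurentPolynomial.trunc f) a.snd).coeff i).snd
      rw [coeff_polyRetract, coeff_polySmul]
      change ((laurentSmul (Unital A) f a).coeff i).snd = f.coeff i • a.snd
      rw [coeff_laurentSmul, Unital.snd_zsmul])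

variable {A} in
theorem coeffPoly_smul_val (f : ℤ[X]) (a : A) : ((coeffPoly A).smul f a).1 = polySmul A f a := rfl

/-- The ring `P = ker (ev₀ : ℤ[t] → ℤ)`. -/
def intPath : NonUnitalSubring ℤ[X] where
  carrier := {f | f.coeff 0 = 0}
  mul_mem' hf hg := by simp_all [Polynomial.mul_coeff_zero]
  zero_mem' := by simp
  add_mem' hf hg := by simp_all
  neg_mem' hf := by simp_all

/-- The ring `Ω = ker (ev₁ : P → ℤ)`. -/
def intLoop : NonUnitalSubring ℤ[X] where
  carrier := {f | f.coeff 0 = 0 ∧ f.eval 1 = 0}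
  mul_mem' hf hg := by simp_all [Polynomial.mul_coeff_zero]
  zero_mem' := by simp
  add_mem' hf hg := by simp_all
  neg_mem' hf := by simp_all

variable {A} in
theorem polySmul_mem_path {f : ℤ[X]} (hf : f ∈ intPath) (a : A) : polySmul A f a ∈ pathRing A :=
  ⟨polySmul_mem f a, by rw [coeff_polySmul, show f.coeff 0 = 0 from hf, zero_smul, map_zero]⟩

variable {A} in
theorem polySmul_mem_loop {f : ℤ[X]} (hf : f ∈ intLoop) (a : A) : polySmul A f a ∈ loopRing A :=
  ⟨polySmul_mem_path hf.1 a, by rw [evalOne_polySmul, hf.2, zero_smul, map_zero]⟩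

/-- `P A = P ⊗ A`. -/
noncomputable def coeffPath : Coeff intPath A (pathRing A) :=
  (coeffPoly A).retract
    (AddMonoidHom.mk' (fun f => AddMonoidHom.mk' (fun a => ⟨_, polySmul_mem_path f.2 a⟩)
      (fun a b => Subtype.ext (by simp))) (fun f g => by ext1 a; exact Subtype.ext (by simp)))
    (fun f g a b => Subtype.ext (polySmul_mul f.1 g.1 a b))
    intPath.toAddSubgroup.subtype
    -- Subtracting the constant term retracts polynomials onto those vanishing at `0`, both over `ℤ`
    -- and with coefficients in `A`.
    (AddMonoidHom.mk' (fun f => ⟨f - C (f.coeff 0), by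
        change (f - C (f.coeff 0)).coeff 0 = 0
        simp⟩)
      (fun f g => Subtype.ext (by
        change f + g - C _ = f - C _ + (g - C _)
        rw [coeff_add, C_add]; abel)))
    (AddMonoidHom.id _) (AddMonoidHom.id _)
    (NonUnitalSubring.inclusion fun _ h => h.1 : pathRing A →ₙ+* polyRing A).toAddMonoidHom
    (AddMonoidHom.mk' (fun f => ⟨f.1 - C (f.1.coeff 0), fun i => by
        rw [coeff_sub, Unital.fst_sub, f.2 i, coeff_C]
        split_ifs <;> simp [f.2 0], by simp⟩)
      (fun f g => Subtype.ext (by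
        change f.1 + g.1 - C _ = f.1 - C _ + (g.1 - C _)
        change f.1 + g.1 - C ((f.1 + g.1).coeff 0) = _
        rw [coeff_add, C_add]; abel)))
    (fun f => Subtype.ext (by
      change f.1 - C (f.1.coeff 0) = f.1
      rw [show f.1.coeff 0 = 0 from f.2, C_0, sub_zero]))
    (fun _ => rfl)
    (fun f => Subtype.ext (by
      change f.1 - C (f.1.coeff 0) = f.1
      rw [f.2.2, C_0, sub_zero]))
    (fun f a => rfl)
    (fun f a => Subtype.ext (by
      change polySmul A f a - C ((polySmul A f a).coeff 0) = polySmul A (f - C (f.coeff 0)) a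
      ext1 i
      rw [coeff_sub, coeff_polySmul, coeff_polySmul, coeff_polySmul, coeff_sub, coeff_C, coeff_C,
        sub_smul, map_sub]
      split_ifs <;> simp))

/-- `Ω A = Ω ⊗ A`. -/
noncomputable def coeffLoop : Coeff intLoop A (loopRing A) :=
  (coeffPath A).retract
    (AddMonoidHom.mk' (fun f => AddMonoidHom.mk' (fun a => ⟨_, polySmul_mem_loop f.2 a⟩)
      (fun a b => Subtype.ext (by simp))) (fun f g => by ext1 a; exact Subtype.ext (by simp)))
    (fun f g a b => Subtype.ext (polySmul_mul f.1 g.1 a b))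
    (NonUnitalSubring.inclusion fun _ h => h.1 : intLoop →ₙ+* intPath).toAddMonoidHom
    -- Subtracting `f(1) X` kills the value at `1` and keeps the value at `0`, because `X` runs from
    -- `0` to `1`.
    (AddMonoidHom.mk' (fun f => ⟨f.1 - C (f.1.eval 1) * X, by
        simp [show f.1.coeff 0 = 0 from f.2], by simp⟩)
      (fun f g => Subtype.ext (by
        change f.1 + g.1 - C ((f.1 + g.1).eval 1) * X = f.1 - C _ * X + (g.1 - C _ * X)
        rw [eval_add, C_add, add_mul]; abel)))
    (AddMonoidHom.id _) (AddMonoidHom.id _)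
    (loopExt A).incl.toAddMonoidHom
    (AddMonoidHom.mk' (fun f => ⟨f.1 - C (evalOne _ f.1) * X, ⟨fun i => by
        rw [coeff_sub, Unital.fst_sub, f.2.1 i, coeff_C_mul, Unital.fst_mul, fst_evalOne f.2.1]
        simp, by simp [f.2.2]⟩, by rw [map_sub, map_mul]; simp [evalOne]⟩)
      (fun f g => Subtype.ext (by
        change f.1 + g.1 - C (evalOne _ (f.1 + g.1)) * X = f.1 - C _ * X + (g.1 - C _ * X)
        rw [map_add, C_add, add_mul]; abel)))
    (fun f => Subtype.ext (by
      change f.1 - C (f.1.eval 1) * X = f.1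
      rw [f.2.2]; simp))
    (fun _ => rfl)
    (fun f => Subtype.ext (by
      change f.1 - C (evalOne _ f.1) * X = f.1
      rw [f.2.2]; simp))
    (fun f a => rfl)
    (fun f a => Subtype.ext (by
      change polySmul A f.1 a - C (evalOne _ (polySmul A f.1 a)) * X =
        polySmul A (f.1 - C (f.1.eval 1) * X) a
      ext1 i
      rw [evalOne_polySmul, coeff_sub, coeff_polySmul, coeff_polySmul, coeff_C_mul, coeff_sub,
        coeff_C_mul, sub_smul, map_sub, coeff_X, coeff_X]
      split_ifs <;> simp))

variable {A}

theorem loopExt_proj_smul (f : intPath) (a : A) :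
    (loopExt A).proj ((coeffPath A).smul f a) = f.1.eval 1 • a := by
  change (evalOne _ (polySmul A f.1 a)).snd = _
  rw [evalOne_polySmul]
  rfl

theorem loopExt_incl_smul (f : intLoop) (a : A) :
    (loopExt A).incl ((coeffLoop A).smul f a) = (coeffPath A).smul ⟨f.1, f.2.1⟩ a := rfl

theorem mapRingHom_polySmul {B : Type u} [NonUnitalRing B] (φ : A →ₙ+* B) (f : ℤ[X]) (a : A) :
    Polynomial.mapRingHom (Unital.map φ) (polySmul A f a) = polySmul B f (φ a) := by
  ext1 i
  rw [coe_mapRingHom, coeff_map, coeff_polySmul, coeff_polySmul, ← map_zsmul]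
  ext
  · rw [Unital.fst_map]; rfl
  · rw [Unital.snd_map]; rfl

theorem loopRing.map_smul {B : Type u} [NonUnitalRing B] (φ : A →ₙ+* B) (f : intLoop) (a : A) :
    loopRing.map φ ((coeffLoop A).smul f a) = (coeffLoop B).smul f (φ a) :=
  Subtype.ext (mapRingHom_polySmul φ f.1 a)

end Poly

end CoefficientRings
end HomotopyK

end

section

namespace HomotopyK

/-! ### The suspension as a tensor product with `Σ ℤ` -/

section CoefficientSuspension

open TensorProduct

variable {A : Type u} [NonUnitalRing A]

/-- A matrix with finitely many entries whose support is contained in that of a matrix in the cone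
is in the cone. -/
theorem IsCone.of_support {B C : Type*} [Zero B] [Zero C] {a : ℕ → ℕ → B} {m : ℕ → ℕ → C}
    (hm : IsCone m) (hfin : {x | ∃ i j, a i j = x}.Finite) (h : ∀ i j, m i j = 0 → a i j = 0) :
    IsCone a := by
  obtain ⟨N, h1, h2⟩ := hm.bounded
  refine ⟨hfin, N, fun i => (Set.encard_le_encard ?_).trans (h1 i),
    fun j => (Set.encard_le_encard ?_).trans (h2 j)⟩
  · exact fun j hj h0 => hj (h i j h0)
  · exact fun i hi h0 => hi (h i j h0)

/-- The matrix `m a` with entries `mᵢⱼ a`. -/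
noncomputable def coneSmul (m : Cone ℤ) (a : A) : Cone A :=
  Cone.of (fun i j => m.entry i j • a) (m.isCone.of_support
    ((m.isCone.finite_entries.image fun n => n • a).subset (by
      rintro _ ⟨i, j, rfl⟩
      exact ⟨_, ⟨i, j, rfl⟩, rfl⟩)) (fun i j h => by simp [h]))

@[simp] theorem entry_coneSmul (m : Cone ℤ) (a : A) (i j : ℕ) :
    (coneSmul m a).entry i j = m.entry i j • a := rfl

theorem coneSmul_mul (m n : Cone ℤ) (a b : A) :
    coneSmul m a * coneSmul n b = coneSmul (m * n) (a * b) := by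
  ext i j
  obtain ⟨s, hs⟩ := m.isCone.exists_rowFinset i
  have hs' := fun k => (hs k).1
  rw [entry_coneSmul, Cone.entry_mul_row m n i j hs', Cone.entry_mul_row (s := s), Finset.sum_smul]
  · refine Finset.sum_congr rfl fun k _ => ?_
    simp only [entry_coneSmul, smul_mul_assoc, mul_smul_comm, mul_smul]
    exact smul_comm _ _ _
  · intro k hk
    exact hs' k fun h => hk (by simp [h])

variable (A) in
/-- The pairing `[m] • a = [m a]` of `Σ ℤ` with `A`. -/
noncomputable def suspSmul : Susp ℤ →+ A →+ Susp A :=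
  AddMonoidHom.mk' (Quotient.lift (fun m => AddMonoidHom.mk' (fun a => Susp.mk (coneSmul m a))
      (fun a b => by
        rw [← map_add]
        congr 1
        ext i j
        simp)) (by
      intro m n hmn
      ext1 a
      have h1 : Susp.mk (m - n) = 0 := by
        have : Susp.mk m = Susp.mk n := Quotient.sound hmn
        rw [map_sub, this, sub_self]
      rw [Susp.mk_eq_zero] at h1
      change Susp.mk _ = Susp.mk _
      rw [← sub_eq_zero, ← map_sub, Susp.mk_eq_zero]
      refine h1.subset fun q hq h => hq ?_
      rw [Cone.entry_sub, entry_coneSmul, entry_coneSmul, ← sub_smul, ← Cone.entry_sub, h,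
        zero_smul])) (by
    intro x y
    obtain ⟨m, rfl⟩ := Susp.mk_surjective x
    obtain ⟨n, rfl⟩ := Susp.mk_surjective y
    ext1 a
    change Susp.mk (coneSmul (m + n) a) = Susp.mk (coneSmul m a) + Susp.mk (coneSmul n a)
    rw [← map_add]
    congr 1
    ext i j
    simp [add_smul])

theorem suspSmul_mk (m : Cone ℤ) (a : A) :
    suspSmul A (Susp.mk m) a = Susp.mk (coneSmul m a) := rfl

/-- The indicator matrix of the fibre over `c ≠ 0` of a finite family of matrices in `Γ ℤ`. -/
noncomputable def fibreMatrix {ι : Type*} [Finite ι] (m : ι → Cone ℤ) (c : ι → ℤ) : Cone ℤ :=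
  open Classical in
  if hc : c = 0 then 0 else
  Cone.of (fun i j => if (fun l => (m l).entry i j) = c then 1 else 0) (by
    obtain ⟨l, hl⟩ := Function.ne_iff.1 hc
    refine (m l).isCone.of_support ((Set.toFinite {0, 1}).subset ?_) fun i j h => if_neg fun h' => hl ?_
    · rintro _ ⟨i, j, rfl⟩
      split_ifs <;> simp
    · rw [← h']; exact h)

open Classical in
theorem entry_fibreMatrix {ι : Type*} [Finite ι] (m : ι → Cone ℤ) {c : ι → ℤ} (hc : c ≠ 0)
    (i j : ℕ) : (fibreMatrix m c).entry i j = if (fun l => (m l).entry i j) = c then 1 else 0 := by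
  rw [fibreMatrix, dif_neg hc]
  rfl

theorem finite_fibres {ι : Type*} [Finite ι] (m : ι → Cone ℤ) :
    {c : ι → ℤ | ∃ i j, (fun l => (m l).entry i j) = c}.Finite := by
  refine (Set.Finite.pi fun l => (m l).isCone.finite_entries).subset ?_
  rintro _ ⟨i, j, rfl⟩ l -
  exact ⟨i, j, rfl⟩

/-- The finitely many integral matrices occurring in a tensor take finitely many joint values.
Splitting `ℕ × ℕ` into the level sets of these values rewrites the tensor as `∑ [χ_c] ⊗ b_c`, the
indicator matrices `χ_c` having disjoint supports. If the image has finite support, every `χ_c` with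
`b_c ≠ 0` has finite support and is therefore zero in `Σ ℤ`. -/
theorem suspSmul_lift_injective :
    Function.Injective (liftAddHom (suspSmul A) (fun r v a => by rw [map_zsmul, map_zsmul]; rfl) : Susp ℤ ⊗[ℤ] A →+ Susp A) := by
  classical
  rw [injective_iff_map_eq_zero]
  intro x hx
  obtain ⟨k, y, a, rfl⟩ : ∃ (k : ℕ) (y : Fin k → Susp ℤ) (a : Fin k → A),
      x = ∑ l, y l ⊗ₜ a l := TensorProduct.exists_sum_tmul_eq x
  choose m hm using fun l => Susp.mk_surjective (y l)
  obtain rfl : (fun l => Susp.mk (m l)) = y := funext hm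
  -- The value `0` is left out: its level set need not satisfy the row and column bounds, and it
  -- contributes nothing.
  set F := (finite_fibres m).toFinset.erase 0 with hF
  have e1 : ∀ l, m l = ∑ c ∈ F, c l • fibreMatrix m c := by
    intro l
    ext i j
    have hsum : ∀ G : Finset (Fin k → ℤ), (∑ c ∈ G, c l • fibreMatrix m c).entry i j =
        ∑ c ∈ G, c l • (fibreMatrix m c).entry i j := by
      intro G
      let φ : Cone ℤ →+ ℤ := ⟨⟨fun x => x.entry i j, rfl⟩, fun _ _ => rfl⟩
      have : ∀ (n : ℤ) x, φ (n • x) = n • φ x := fun n x => map_zsmul φ n x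
      exact (map_sum φ _ _).trans (Finset.sum_congr rfl fun c _ => this _ _)
    rw [hsum]
    by_cases h0 : (fun l => (m l).entry i j) = 0
    · rw [Finset.sum_eq_zero]
      · exact congrFun h0 l
      · intro c hc
        rw [entry_fibreMatrix m (Finset.ne_of_mem_erase hc), if_neg, smul_zero]
        rw [h0]
        exact (Finset.ne_of_mem_erase hc).symm
    · rw [Finset.sum_eq_single (fun l => (m l).entry i j)]
      · rw [entry_fibreMatrix m h0, if_pos rfl, smul_eq_mul, mul_one]
      · intro c hc hne
        rw [entry_fibreMatrix m (Finset.ne_of_mem_erase hc), if_neg hne.symm, smul_zero]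
      · intro h
        exact absurd (Finset.mem_erase.2 ⟨h0, (finite_fibres m).mem_toFinset.2 ⟨i, j, rfl⟩⟩) h
  let b : (Fin k → ℤ) → A := fun c => ∑ l, c l • a l
  have e2 : ∑ l, Susp.mk (m l) ⊗ₜ[ℤ] a l = ∑ c ∈ F, Susp.mk (fibreMatrix m c) ⊗ₜ[ℤ] b c := by
    have : ∀ l, Susp.mk (m l) ⊗ₜ[ℤ] a l =
        ∑ c ∈ F, Susp.mk (fibreMatrix m c) ⊗ₜ[ℤ] (c l • a l) := by
      intro l
      conv_lhs => rw [e1 l, map_sum, sum_tmul]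
      exact Finset.sum_congr rfl fun c _ => by rw [map_zsmul, smul_tmul]
    simp only [this, b, tmul_sum]
    exact Finset.sum_comm
  have e3 : Susp.mk (∑ c ∈ F, coneSmul (fibreMatrix m c) (b c)) = 0 := by
    rw [e2, map_sum] at hx
    rw [map_sum, ← hx]
    rfl
  rw [Susp.mk_eq_zero] at e3
  rw [e2]
  refine Finset.sum_eq_zero fun c hc => ?_
  have hc0 := Finset.ne_of_mem_erase hc
  by_cases hb : b c = 0
  · rw [hb, tmul_zero]
  -- At a position in the level set of `c` the whole sum has entry `b c ≠ 0`, since the other level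
  -- sets avoid that position.
  · have : Susp.mk (fibreMatrix m c) = 0 := by
      rw [Susp.mk_eq_zero]
      refine e3.subset fun q hq => ?_
      have hq' : (fun l => (m l).entry q.1 q.2) = c := by
        by_contra h
        refine hq ?_
        rw [entry_fibreMatrix m hc0, if_neg h]
      let φ : Cone A →+ A := ⟨⟨fun x => x.entry q.1 q.2, rfl⟩, fun _ _ => rfl⟩
      have h4 : (∑ c ∈ F, coneSmul (fibreMatrix m c) (b c)).entry q.1 q.2 = b c := by
        refine (map_sum φ _ _).trans ?_
        rw [Finset.sum_eq_single c]
        · change (fibreMatrix m c).entry q.1 q.2 • b c = b c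
          rw [entry_fibreMatrix m hc0, if_pos hq', one_smul]
        · intro d hd hne
          change (fibreMatrix m d).entry q.1 q.2 • b d = 0
          rw [entry_fibreMatrix m (Finset.ne_of_mem_erase hd), if_neg, zero_smul]
          rw [hq']
          exact hne.symm
        · exact fun h => absurd hc h
      change (∑ c ∈ F, coneSmul (fibreMatrix m c) (b c)).entry q.1 q.2 ≠ 0
      rw [h4]
      exact hb
    rw [this, zero_tmul]

/-- The indicator matrix of the entry `x ≠ 0` of a matrix in `Γ A`. -/
noncomputable def entryMatrix (y : Cone A) (x : A) : Cone ℤ :=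
  open Classical in
  Cone.of (fun i j => if x ≠ 0 ∧ y.entry i j = x then 1 else 0) (by
    refine y.isCone.of_support ((Set.toFinite {0, 1}).subset ?_) fun i j h =>
      if_neg fun h' => h'.1 (h'.2.symm.trans h)
    rintro _ ⟨i, j, rfl⟩
    split_ifs <;> simp)

theorem entry_entryMatrix_self {y : Cone A} {i j : ℕ} (h : y.entry i j ≠ 0) :
    (entryMatrix y (y.entry i j)).entry i j = 1 := if_pos ⟨h, rfl⟩

theorem entry_entryMatrix_ne {y : Cone A} {x : A} {i j : ℕ} (h : y.entry i j ≠ x) :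
    (entryMatrix y x).entry i j = 0 := if_neg fun h' => h h'.2

/-- Finiteness of the set of entries is what allows a matrix in `Γ A` to be written as a finite sum
of `0`-`1` matrices times its entries. -/
theorem suspSmul_lift_surjective :
    Function.Surjective (liftAddHom (suspSmul A) (fun r v a => by rw [map_zsmul, map_zsmul]; rfl) : Susp ℤ ⊗[ℤ] A →+ Susp A) := by
  classical
  intro x
  obtain ⟨y, rfl⟩ := Susp.mk_surjective x
  set F := y.isCone.finite_entries.toFinset with hF
  refine ⟨∑ a ∈ F, Susp.mk (entryMatrix y a) ⊗ₜ a, ?_⟩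
  rw [map_sum]
  have : y = ∑ a ∈ F, coneSmul (entryMatrix y a) a := by
    ext i j
    let φ : Cone A →+ A := ⟨⟨fun x => x.entry i j, rfl⟩, fun _ _ => rfl⟩
    symm
    refine (map_sum φ _ _).trans ?_
    rw [Finset.sum_eq_single (y.entry i j)]
    · change (entryMatrix y (y.entry i j)).entry i j • y.entry i j = y.entry i j
      by_cases h : y.entry i j = 0
      · rw [h, smul_zero]
      · rw [entry_entryMatrix_self h, one_smul]
    · intro b _ hb
      change (entryMatrix y b).entry i j • b = 0
      rw [entry_entryMatrix_ne hb.symm, zero_smul]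
    · intro h
      exact absurd (y.isCone.finite_entries.mem_toFinset.2 ⟨i, j, rfl⟩) h
  conv_rhs => rw [this, map_sum]
  rfl

variable (A) in
/-- `Σ A = Σ ℤ ⊗ A`. -/
noncomputable def coeffSusp : Coeff (Susp ℤ) A (Susp A) where
  smul := suspSmul A
  smul_mul_smul v w a b := by
    obtain ⟨m, rfl⟩ := Susp.mk_surjective v
    obtain ⟨n, rfl⟩ := Susp.mk_surjective w
    rw [← map_mul, suspSmul_mk, suspSmul_mk, suspSmul_mk, ← map_mul, coneSmul_mul]
  bijective := ⟨suspSmul_lift_injective, suspSmul_lift_surjective⟩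

theorem coeffSusp_smul_mk (m : Cone ℤ) (a : A) :
    (coeffSusp A).smul (Susp.mk m) a = Susp.mk (coneSmul m a) := rfl

theorem Susp.map_smul {B : Type u} [NonUnitalRing B] (φ : A →ₙ+* B) (v : Susp ℤ) (a : A) :
    Susp.map φ ((coeffSusp A).smul v a) = (coeffSusp B).smul v (φ a) := by
  obtain ⟨m, rfl⟩ := Susp.mk_surjective v
  rw [coeffSusp_smul_mk, coeffSusp_smul_mk, Susp.map_mk]
  congr 1
  ext i j
  simp

theorem coeffSusp_one_smul {R : Type u} [Ring R] (r : R) :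
    (coeffSusp R).smul 1 r = Susp.const r := by
  refine congrArg Susp.mk ?_
  ext i j
  change (Cone.entry (Cone.diag 0 0 1) i j : ℤ) • r = _
  by_cases h : i = j <;> simp [h]

theorem coeffSusp_shift_smul {R : Type u} [Ring R] :
    (coeffSusp R).smul (Susp.shift ℤ) 1 = Susp.shift R := by
  refine congrArg Susp.mk ?_
  ext i j
  by_cases h : i + 1 = j <;> simp [h]

end CoefficientSuspension

end HomotopyK

end

namespace HomotopyK

/-! ### Equivalence of idempotents and equality in `K₀` -/

section MurrayVonNeumann

variable {R : Type u} [Ring R] {ι κ μ ν : Type*} [Fintype ι] [Fintype κ] [Fintype μ] [Fintype ν]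

/-- Murray–von Neumann equivalence of idempotent matrices. -/
def MvN (e : Matrix ι ι R) (f : Matrix κ κ R) : Prop :=
  ∃ (a : Matrix ι κ R) (b : Matrix κ ι R), a * b = e ∧ b * a = f

theorem MvN.refl {e : Matrix ι ι R} (he : e * e = e) : MvN e e := ⟨e, e, he, he⟩

theorem MvN.symm {e : Matrix ι ι R} {f : Matrix κ κ R} : MvN e f → MvN f e
  | ⟨a, b, h1, h2⟩ => ⟨b, a, h2, h1⟩

/-- The composite factorization multiplies to `(a b)²` in one order and `(d c)²` in the other, which
is why `e` and `g` have to be idempotent. -/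
theorem MvN.trans {e : Matrix ι ι R} {f : Matrix κ κ R} {g : Matrix μ μ R} (he : e * e = e)
    (hg : g * g = g) : MvN e f → MvN f g → MvN e g
  | ⟨a, b, h1, h2⟩, ⟨c, d, h3, h4⟩ => ⟨a * c, d * b, by
      rw [Matrix.mul_assoc, ← Matrix.mul_assoc c, h3, ← h2, Matrix.mul_assoc b, h1,
        ← Matrix.mul_assoc, h1, he], by
      rw [Matrix.mul_assoc, ← Matrix.mul_assoc b, h2, ← h3, Matrix.mul_assoc c, h4,
        ← Matrix.mul_assoc, h4, hg]⟩

theorem MvN.blocks {e : Matrix ι ι R} {f : Matrix κ κ R} {e' : Matrix μ μ R} {f' : Matrix ν ν R} :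
    MvN e f → MvN e' f' → MvN (Matrix.fromBlocks e 0 0 e') (Matrix.fromBlocks f 0 0 f')
  | ⟨a, b, h1, h2⟩, ⟨c, d, h3, h4⟩ =>
    ⟨Matrix.fromBlocks a 0 0 c, Matrix.fromBlocks b 0 0 d,
      by simp [Matrix.fromBlocks_multiply, h1, h3], by simp [Matrix.fromBlocks_multiply, h2, h4]⟩

theorem MvN.submatrix {e : Matrix ι ι R} (he : e * e = e) (σ : κ ≃ ι) :
    MvN (e.submatrix σ σ) e :=
  ⟨e.submatrix σ id, e.submatrix id σ, by
    rw [← Matrix.submatrix_mul _ _ _ _ _ Function.bijective_id, he], by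
    rw [Matrix.submatrix_mul_equiv, he, Matrix.submatrix_id_id]⟩

theorem MvN.of_submatrix {e : Matrix ι ι R} {f : Matrix κ κ R} (he : e * e = e) (σ : κ ≃ ι)
    (h : f = e.submatrix σ σ) : MvN f e := h ▸ MvN.submatrix he σ

theorem MvN.comm {e : Matrix ι ι R} {f : Matrix κ κ R} (he : e * e = e) (hf : f * f = f) :
    MvN (Matrix.fromBlocks e 0 0 f) (Matrix.fromBlocks f 0 0 e) :=
  MvN.of_submatrix (fromBlocks_idem hf he) (Equiv.sumComm _ _) (by
    ext i j
    rcases i with i | i <;> rcases j with j | j <;> rfl)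

theorem MvN.assoc {e : Matrix ι ι R} {f : Matrix κ κ R} {g : Matrix μ μ R} (he : e * e = e)
    (hf : f * f = f) (hg : g * g = g) :
    MvN (Matrix.fromBlocks (Matrix.fromBlocks e 0 0 f) 0 0 g)
      (Matrix.fromBlocks e 0 0 (Matrix.fromBlocks f 0 0 g)) :=
  MvN.of_submatrix (fromBlocks_idem he (fromBlocks_idem hf hg)) (Equiv.sumAssoc _ _ _) (by
    ext i j
    rcases i with (i | i) | i <;> rcases j with (j | j) | j <;> rfl)

theorem MvN.zero_right {e : Matrix ι ι R} (he : e * e = e) :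
    MvN (Matrix.fromBlocks e 0 0 (0 : Matrix κ κ R)) e := by
  classical
  exact ⟨Matrix.fromRows e 0, Matrix.fromCols e 0, by
    rw [Matrix.fromRows_mul_fromCols]; simp [he], by
    rw [Matrix.fromCols_mul_fromRows]; simp [he]⟩

theorem one_sub_idem {M : Type*} [Ring M] {e : M} (he : e * e = e) :
    (1 - e) * (1 - e) = 1 - e := by simp [mul_sub, sub_mul, he]

/-- Every idempotent is thus a summand of an identity matrix. Consequently identity matrices suffice
both for stabilizing and as the negative part of a class in `K₀`. -/
theorem MvN.compl [DecidableEq ι] {e : Matrix ι ι R} (he : e * e = e) :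
    MvN (Matrix.fromBlocks e 0 0 (1 - e)) (1 : Matrix ι ι R) := by
  refine ⟨Matrix.fromRows e (1 - e), Matrix.fromCols e (1 - e), ?_, ?_⟩
  · rw [Matrix.fromRows_mul_fromCols, one_sub_idem he, he]
    simp [mul_sub, sub_mul, he]
  · rw [Matrix.fromCols_mul_fromRows, one_sub_idem he, he]
    abel

theorem MvN.mk_eq [DecidableEq ι] [DecidableEq κ] {e : Matrix ι ι R} {f : Matrix κ κ R}
    {he : e * e = e} {hf : f * f = f} : MvN e f → K0.mk e he = K0.mk f hf
  | ⟨a, b, h1, h2⟩ => K0.mk_eq_of_mul a b h1 h2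

variable (R) in
/-- Idempotent matrices up to Murray–von Neumann equivalence. -/
def IdemMat.setoid : Setoid (IdemMat R) where
  r x y := MvN x.mat y.mat
  iseqv := ⟨fun x => MvN.refl x.idem, fun h => h.symm, fun {x _ z} h h' => h.trans x.idem z.idem h'⟩

theorem MvN.dsum {n m : ℕ} {e : Matrix (Fin n) (Fin n) R} {f : Matrix (Fin m) (Fin m) R}
    (he : e * e = e) (hf : f * f = f) : MvN (dsum e f) (Matrix.fromBlocks e 0 0 f) :=
  MvN.submatrix (fromBlocks_idem he hf) finSumFinEquiv.symm

theorem MvN.dsum_congr {n m n' m' : ℕ} {e : Matrix (Fin n) (Fin n) R}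
    {f : Matrix (Fin m) (Fin m) R} {e' : Matrix (Fin n') (Fin n') R}
    {f' : Matrix (Fin m') (Fin m') R} (he : e * e = e) (hf : f * f = f) (he' : e' * e' = e')
    (hf' : f' * f' = f') (h : MvN e e') (h' : MvN f f') :
    MvN (HomotopyK.dsum e f) (HomotopyK.dsum e' f') := by
  have i1 : HomotopyK.dsum e f * HomotopyK.dsum e f = HomotopyK.dsum e f := by
    rw [dsum_mul, he, hf]
  have i2 : HomotopyK.dsum e' f' * HomotopyK.dsum e' f' = HomotopyK.dsum e' f' := by
    rw [dsum_mul, he', hf']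
  exact ((MvN.dsum he hf).trans i1 (fromBlocks_idem he' hf') (h.blocks h')).trans i1 i2
    (MvN.dsum he' hf').symm

variable (R) in
/-- The monoid of equivalence classes of idempotent matrices. -/
def IdemClasses : Type u := Quotient (IdemMat.setoid R)

/-- The class of an idempotent matrix up to equivalence. -/
def IdemClasses.mk (x : IdemMat R) : IdemClasses R := Quotient.mk (IdemMat.setoid R) x

instance : Add (IdemClasses R) where
  add := Quotient.map₂ IdemMat.sum fun x x' h y y' h' =>
    MvN.dsum_congr x.idem y.idem x'.idem y'.idem h h'

instance : Zero (IdemClasses R) := ⟨IdemClasses.mk (IdemMat.zero R 0)⟩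

instance : AddCommMonoid (IdemClasses R) where
  nsmul := nsmulRec
  add_zero := by
    rintro ⟨x⟩
    exact Quotient.sound ((MvN.dsum x.idem (zero_mul 0)).trans (x.sum (IdemMat.zero R 0)).idem
      x.idem (MvN.zero_right x.idem))
  zero_add := by
    rintro ⟨x⟩
    have h0 : (0 : Matrix (Fin 0) (Fin 0) R) * 0 = 0 := zero_mul 0
    exact Quotient.sound ((MvN.dsum h0 x.idem).trans ((IdemMat.zero R 0).sum x).idem x.idem
      ((MvN.comm h0 x.idem).trans (fromBlocks_idem h0 x.idem) x.idem (MvN.zero_right x.idem)))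
  add_comm := by
    rintro ⟨x⟩ ⟨y⟩
    exact Quotient.sound (((MvN.dsum x.idem y.idem).trans (x.sum y).idem
      (fromBlocks_idem y.idem x.idem) (MvN.comm x.idem y.idem)).trans (x.sum y).idem
      (y.sum x).idem (MvN.dsum y.idem x.idem).symm)
  add_assoc := by
    rintro ⟨x⟩ ⟨y⟩ ⟨z⟩
    have h1 : MvN ((x.sum y).sum z).mat _ := MvN.dsum (x.sum y).idem z.idem
    have h2 : MvN (x.sum (y.sum z)).mat _ := MvN.dsum x.idem (y.sum z).idem
    have h3 := (MvN.dsum x.idem y.idem).blocks (MvN.refl z.idem)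
    have h4 := (MvN.refl x.idem).blocks (MvN.dsum y.idem z.idem)
    have i1 := fromBlocks_idem (fromBlocks_idem x.idem y.idem) z.idem
    have i2 := fromBlocks_idem x.idem (fromBlocks_idem y.idem z.idem)
    have j1 := ((x.sum y).sum z).idem
    have j2 := (x.sum (y.sum z)).idem
    exact Quotient.sound (((h1.trans j1 i1 h3).trans j1 i2 (MvN.assoc x.idem y.idem z.idem)).trans
      j1 j2 (h2.trans j2 i2 h4).symm)

theorem IdemClasses.mk_add (x y : IdemMat R) :
    IdemClasses.mk (x.sum y) = IdemClasses.mk x + IdemClasses.mk y := rfl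

theorem MvN.conj (x : IdemMat R) (g : (Matrix (Fin x.size) (Fin x.size) R)ˣ) :
    MvN (x.conj g).mat x.mat := by
  have h : (↑g⁻¹ : Matrix (Fin x.size) (Fin x.size) R) * g = 1 := g.inv_mul
  refine ⟨(g : Matrix (Fin x.size) (Fin x.size) R) * x.mat,
    x.mat * (↑g⁻¹ : Matrix (Fin x.size) (Fin x.size) R), ?_, ?_⟩
  · calc (g : Matrix (Fin x.size) (Fin x.size) R) * x.mat *
          (x.mat * (↑g⁻¹ : Matrix (Fin x.size) (Fin x.size) R))
        = (g : Matrix (Fin x.size) (Fin x.size) R) * (x.mat * x.mat) *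
          (↑g⁻¹ : Matrix (Fin x.size) (Fin x.size) R) := by simp only [Matrix.mul_assoc]
      _ = (g : Matrix (Fin x.size) (Fin x.size) R) * x.mat *
          (↑g⁻¹ : Matrix (Fin x.size) (Fin x.size) R) := by rw [x.idem]
  · calc x.mat * (↑g⁻¹ : Matrix (Fin x.size) (Fin x.size) R) *
          ((g : Matrix (Fin x.size) (Fin x.size) R) * x.mat)
        = x.mat * ((↑g⁻¹ : Matrix (Fin x.size) (Fin x.size) R) * g) * x.mat := by
          simp only [Matrix.mul_assoc]
      _ = x.mat := by rw [h, Matrix.mul_one, x.idem]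

variable (R) in
/-- The comparison of `K₀` with the Grothendieck group of the monoid of classes. -/
noncomputable def K0.toGrothendieck : K0 R →+ Algebra.GrothendieckAddGroup (IdemClasses R) :=
  K0.lift (fun x => Algebra.GrothendieckAddGroup.of (IdemClasses.mk x))
    (fun x g => congrArg _ (Quotient.sound (s := IdemMat.setoid R)
      (MvN.conj x g)))
    (fun x m => congrArg _ (Quotient.sound (s := IdemMat.setoid R)
      ((MvN.dsum x.idem (zero_mul 0)).trans (x.sum (IdemMat.zero R m)).idem x.idem
        (MvN.zero_right x.idem))))
    (fun x y => by rw [IdemClasses.mk_add, map_add])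

/-- `K0.toGrothendieck` sends the presented group to the Grothendieck group of the commutative
monoid of equivalence classes, where two elements agree exactly when they do so after adding a
common one. -/
theorem K0.exists_of_cls_eq {x y : IdemMat R} (h : K0.cls x = K0.cls y) :
    ∃ z : IdemMat R, MvN (x.sum z).mat (y.sum z).mat := by
  have h1 := congrArg (K0.toGrothendieck R) h
  rw [K0.toGrothendieck, K0.lift_cls, K0.lift_cls] at h1
  obtain ⟨⟨c, _⟩, hc⟩ := (AddLocalization.addMonoidOf
    (⊤ : AddSubmonoid (IdemClasses R))).eq_iff_exists.1 h1
  obtain ⟨z, rfl⟩ := Quotient.exists_rep c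
  refine ⟨z, ?_⟩
  have : IdemClasses.mk (x.sum z) = IdemClasses.mk (y.sum z) := by
    rw [IdemClasses.mk_add, IdemClasses.mk_add, add_comm, add_comm (IdemClasses.mk y)]
    exact hc
  exact Quotient.exact this

/-- Decomposing `1` as `f ⊕ (1 - f)` allows an arbitrary stabilizing idempotent `f` to be replaced
by an identity matrix. The reindexing of `e` is the one built into `K0.mk`. -/
theorem MvN.one_dsum [DecidableEq ι] {e : Matrix ι ι R} (he : e * e = e) {n : ℕ}
    {f : Matrix (Fin n) (Fin n) R} (hf : f * f = f) :
    MvN (Matrix.fromBlocks e 0 0 (1 : Matrix (Fin n) (Fin n) R))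
      (Matrix.fromBlocks (HomotopyK.dsum
        (e.submatrix (Fintype.equivFin ι).symm (Fintype.equivFin ι).symm) f) 0 0 (1 - f)) := by
  have i0 : e.submatrix (Fintype.equivFin ι).symm (Fintype.equivFin ι).symm *
      e.submatrix (Fintype.equivFin ι).symm (Fintype.equivFin ι).symm =
      e.submatrix (Fintype.equivFin ι).symm (Fintype.equivFin ι).symm := by
    rw [Matrix.submatrix_mul_equiv, he]
  have i1 := fromBlocks_idem he (one_mul (1 : Matrix (Fin n) (Fin n) R))
  have i2 := fromBlocks_idem (fromBlocks_idem he hf) (one_sub_idem hf)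
  have i4 : HomotopyK.dsum (e.submatrix (Fintype.equivFin ι).symm (Fintype.equivFin ι).symm) f *
      HomotopyK.dsum (e.submatrix (Fintype.equivFin ι).symm (Fintype.equivFin ι).symm) f =
      HomotopyK.dsum (e.submatrix (Fintype.equivFin ι).symm (Fintype.equivFin ι).symm) f := by
    rw [dsum_mul, i0, hf]
  have i3 := fromBlocks_idem i4 (one_sub_idem hf)
  refine ((((MvN.refl he).blocks (MvN.compl hf).symm).trans i1 i2
    (MvN.assoc he hf (one_sub_idem hf)).symm)).trans i1 i3 ?_
  refine MvN.blocks ?_ (MvN.refl (one_sub_idem hf))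
  exact ((MvN.dsum i0 hf).trans i4 (fromBlocks_idem he hf)
    ((MvN.submatrix he _).blocks (MvN.refl hf))).symm

/-- Idempotents with the same class in `K₀` are stably equivalent. -/
theorem K0.exists_of_mk_eq [DecidableEq ι] [DecidableEq κ] {e : Matrix ι ι R} {f : Matrix κ κ R}
    {he : e * e = e} {hf : f * f = f} (h : K0.mk e he = K0.mk f hf) :
    ∃ k : ℕ, MvN (Matrix.fromBlocks e 0 0 (1 : Matrix (Fin k) (Fin k) R))
      (Matrix.fromBlocks f 0 0 (1 : Matrix (Fin k) (Fin k) R)) := by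
  obtain ⟨z, hz⟩ := K0.exists_of_cls_eq h
  refine ⟨z.size, ?_⟩
  have i1 := fromBlocks_idem he (one_mul (1 : Matrix (Fin z.size) (Fin z.size) R))
  have i2 := fromBlocks_idem hf (one_mul (1 : Matrix (Fin z.size) (Fin z.size) R))
  have i3 := fromBlocks_idem (IdemMat.sum ⟨Fintype.card κ, f.submatrix (Fintype.equivFin κ).symm
    (Fintype.equivFin κ).symm, by rw [Matrix.submatrix_mul_equiv, hf]⟩ z).idem
    (one_sub_idem z.idem)
  exact ((MvN.one_dsum he z.idem).trans i1 i3 (hz.blocks (MvN.refl (one_sub_idem z.idem)))).trans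
    i1 i2 (MvN.one_dsum hf z.idem).symm

/-- A class is a difference `[x] - [y]`; adding the complement of `y` to both terms turns the
subtrahend into an identity matrix. -/
theorem K0.mk_surjective (ξ : K0 R) : ∃ (n : ℕ) (e : Matrix (Fin n) (Fin n) R) (he : e * e = e)
    (k : ℕ), ξ = K0.mk e he - K0.mk (1 : Matrix (Fin k) (Fin k) R) (one_mul 1) := by
  let S : AddSubgroup (K0 R) := AddSubgroup.closure (Set.range K0.cls)
  have hS : S = ⊤ := by
    -- The projection onto `K₀ / S` vanishes on classes of idempotents, hence on all of `K₀`, so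
    -- these classes generate.
    have : (QuotientAddGroup.mk' S).comp (AddMonoidHom.id (K0 R)) = 0 := by
      refine K0.hom_ext fun x => ?_
      exact (QuotientAddGroup.eq_zero_iff _).2 (AddSubgroup.subset_closure ⟨x, rfl⟩)
    refine eq_top_iff.2 fun x _ => ?_
    exact (QuotientAddGroup.eq_zero_iff _).1 (DFunLike.congr_fun this x)
  have h1 : ∀ x : IdemMat R, ∃ y : IdemMat R, K0.cls x + K0.cls y =
      K0.mk (1 : Matrix (Fin x.size) (Fin x.size) R) (one_mul 1) := by
    intro x
    refine ⟨⟨x.size, 1 - x.mat, one_sub_idem x.idem⟩, ?_⟩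
    rw [← (MvN.compl x.idem).mk_eq (he := fromBlocks_idem x.idem (one_sub_idem x.idem)),
      K0.mk_sum x.idem (one_sub_idem x.idem), K0.mk_fin, K0.mk_fin]
  have h2 : ∀ ξ ∈ S, ∃ x y : IdemMat R, ξ = K0.cls x - K0.cls y := by
    intro ξ hξ
    induction hξ using AddSubgroup.closure_induction with
    | mem _ h =>
      obtain ⟨x, rfl⟩ := h
      exact ⟨x, IdemMat.zero R 0, by rw [K0.cls_zero, sub_zero]⟩
    | zero => exact ⟨IdemMat.zero R 0, IdemMat.zero R 0, by simp⟩
    | add a b _ _ ha hb =>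
      obtain ⟨x, y, rfl⟩ := ha
      obtain ⟨x', y', rfl⟩ := hb
      exact ⟨x.sum x', y.sum y', by rw [K0.cls_sum, K0.cls_sum]; abel⟩
    | neg a _ ha =>
      obtain ⟨x, y, rfl⟩ := ha
      exact ⟨y, x, by abel⟩
  obtain ⟨x, y, rfl⟩ := h2 ξ (hS ▸ AddSubgroup.mem_top ξ)
  obtain ⟨z, hz⟩ := h1 y
  refine ⟨_, (x.sum z).mat, (x.sum z).idem, y.size, ?_⟩
  rw [K0.mk_fin, ← hz]
  change _ = K0.cls (x.sum z) - _
  rw [K0.cls_sum]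
  abel

end MurrayVonNeumann

end HomotopyK

namespace HomotopyK

/-! ### `K₁` over arbitrary finite index types and elementary matrices -/

section KOne

variable {R : Type u} [Ring R] {ι κ μ : Type*} [Fintype ι] [Fintype κ] [Fintype μ]
  [DecidableEq ι] [DecidableEq κ] [DecidableEq μ]

/-- Reindexing of invertible matrices. -/
def unitsReindex (σ : κ ≃ ι) (g : (Matrix ι ι R)ˣ) : (Matrix κ κ R)ˣ where
  val := (g : Matrix ι ι R).submatrix σ σ
  inv := (↑g⁻¹ : Matrix ι ι R).submatrix σ σ
  val_inv := by rw [Matrix.submatrix_mul_equiv, g.mul_inv, Matrix.submatrix_one_equiv]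
  inv_val := by rw [Matrix.submatrix_mul_equiv, g.inv_mul, Matrix.submatrix_one_equiv]

theorem unitsReindex_val (σ : κ ≃ ι) (g : (Matrix ι ι R)ˣ) :
    (unitsReindex σ g : Matrix κ κ R) = (g : Matrix ι ι R).submatrix σ σ := rfl

theorem unitsReindex_mul (σ : κ ≃ ι) (g h : (Matrix ι ι R)ˣ) :
    unitsReindex σ (g * h) = unitsReindex σ g * unitsReindex σ h := by
  ext1
  rw [Units.val_mul, unitsReindex_val, unitsReindex_val, unitsReindex_val, Units.val_mul,
    Matrix.submatrix_mul_equiv]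

/-- The class in `K₁` of an invertible matrix indexed by an arbitrary finite type. -/
noncomputable def K1.mk (g : (Matrix ι ι R)ˣ) : K1 R :=
  K1.cls ⟨Fintype.card ι, unitsReindex (Fintype.equivFin ι).symm g⟩

theorem K1.mk_mul (g h : (Matrix ι ι R)ˣ) : K1.mk (g * h) = K1.mk g + K1.mk h := by
  rw [K1.mk, unitsReindex_mul, K1.cls_mul]
  rfl

theorem K1.mk_one : K1.mk (1 : (Matrix ι ι R)ˣ) = 0 := by
  have h := K1.mk_mul (1 : (Matrix ι ι R)ˣ) 1
  rw [one_mul] at h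
  exact left_eq_add.1 h

theorem K1.mk_inv (g : (Matrix ι ι R)ˣ) : K1.mk g⁻¹ = -K1.mk g := by
  rw [eq_neg_iff_add_eq_zero, ← K1.mk_mul, inv_mul_cancel, K1.mk_one]

theorem K1.mk_fin {n : ℕ} (g : (Matrix (Fin n) (Fin n) R)ˣ) : K1.mk g = K1.cls ⟨n, g⟩ :=
  K1.cls_reindex _ _ (Fintype.equivFin (Fin n)).symm rfl

theorem K1.mk_reindex (σ : κ ≃ ι) (g : (Matrix ι ι R)ˣ) :
    K1.mk (unitsReindex σ g) = K1.mk g := by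
  refine K1.cls_reindex _ _
    ((Fintype.equivFin κ).symm.trans (σ.trans (Fintype.equivFin ι))) ?_
  rw [unitsReindex_val, unitsReindex_val, unitsReindex_val, Matrix.submatrix_submatrix,
    Matrix.submatrix_submatrix]
  congr 1 <;> · ext i; simp

theorem K1.mk_conj (g h : (Matrix ι ι R)ˣ) : K1.mk (h * g * h⁻¹) = K1.mk g := by
  rw [K1.mk_mul, K1.mk_mul, K1.mk_inv]
  abel

theorem K1.mk_congr {g h : (Matrix ι ι R)ˣ} (e : (g : Matrix ι ι R) = h) : K1.mk g = K1.mk h := by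
  rw [Units.ext e]

theorem K1.mk_blocks (g : (Matrix ι ι R)ˣ) (h : (Matrix κ κ R)ˣ) :
    K1.mk (UExt.unitsBlocks g h) = K1.mk g + K1.mk h := by
  rw [K1.mk, K1.mk, K1.mk, ← K1.cls_dsum]
  refine K1.cls_reindex _ _ ((Fintype.equivFin (ι ⊕ κ)).symm.trans
    ((Equiv.sumCongr (Fintype.equivFin ι) (Fintype.equivFin κ)).trans finSumFinEquiv)) ?_
  rw [unitsReindex_val]
  change _ = (dsum _ _).submatrix _ _
  rw [dsum, Matrix.submatrix_submatrix]
  ext i j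
  obtain ⟨i, rfl⟩ := (Fintype.equivFin (ι ⊕ κ)).surjective i
  obtain ⟨j, rfl⟩ := (Fintype.equivFin (ι ⊕ κ)).surjective j
  rcases i with i | i <;> rcases j with j | j <;>
    simp [UExt.unitsBlocks_val, unitsReindex_val]

theorem K1.map_mk {S : Type v} [Ring S] (f : R →+* S) (g : (Matrix ι ι R)ˣ) :
    K1.map f (K1.mk g) = K1.mk (Units.map f.mapMatrix.toMonoidHom g) := by
  rw [K1.mk, K1.map_cls]
  refine (K1.mk_fin _).symm.trans ((K1.mk_congr ?_).trans (K1.mk_fin _))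
  rfl

theorem K1.map_id_apply (x : K1 R) : K1.map (RingHom.id R) x = x := by
  have : K1.map (RingHom.id R) = AddMonoidHom.id (K1 R) := by
    refine K1.hom_ext fun y => ?_
    rw [K1.map_cls, AddMonoidHom.id_apply, ← K1.mk_fin, ← K1.mk_fin y.mat]
    refine K1.mk_congr ?_
    ext i j
    rfl
  rw [this, AddMonoidHom.id_apply]

theorem K1.map_comp {S : Type v} {T : Type w} [Ring S] [Ring T] (g : S →+* T) (f : R →+* S) :
    K1.map (g.comp f) = (K1.map g).comp (K1.map f) := by
  refine K1.hom_ext fun y => ?_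
  rw [AddMonoidHom.comp_apply, K1.map_cls, K1.map_cls, K1.map_cls]
  rfl

/-- Sums are represented by block sums and negatives by inverses, so a single matrix suffices. -/
theorem K1.exists_cls (x : K1 R) :
    ∃ (n : ℕ) (g : (Matrix (Fin n) (Fin n) R)ˣ), x = K1.mk g := by
  obtain ⟨y, rfl⟩ : ∃ y, K1.ofFree R y = x := QuotientAddGroup.mk'_surjective _ x
  induction y using FreeAbelianGroup.induction_on with
  | zero => exact ⟨0, 1, by rw [map_zero, K1.mk_one]⟩
  | of y => exact ⟨y.size, y.mat, (K1.mk_fin y.mat).symm⟩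
  | neg y _ => exact ⟨y.size, y.mat⁻¹, by rw [map_neg, K1.mk_inv, K1.mk_fin]; rfl⟩
  | add y z hy hz =>
    obtain ⟨n, g, hg⟩ := hy
    obtain ⟨m, h, hh⟩ := hz
    refine ⟨n + m, unitsReindex finSumFinEquiv.symm (UExt.unitsBlocks g h), ?_⟩
    rw [map_add, hg, hh, K1.mk_reindex, K1.mk_blocks]

/-- The invertible matrix `[[1, x], [0, 1]]`. -/
def upperUnit (x : Matrix ι κ R) : (Matrix (ι ⊕ κ) (ι ⊕ κ) R)ˣ where
  val := Matrix.fromBlocks 1 x 0 1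
  inv := Matrix.fromBlocks 1 (-x) 0 1
  val_inv := by simp [Matrix.fromBlocks_multiply]
  inv_val := by simp [Matrix.fromBlocks_multiply]

/-- The invertible matrix `[[1, 0], [x, 1]]`. -/
def lowerUnit (x : Matrix κ ι R) : (Matrix (ι ⊕ κ) (ι ⊕ κ) R)ˣ where
  val := Matrix.fromBlocks 1 0 x 1
  inv := Matrix.fromBlocks 1 0 (-x) 1
  val_inv := by simp [Matrix.fromBlocks_multiply]
  inv_val := by simp [Matrix.fromBlocks_multiply]

theorem upperUnit_val (x : Matrix ι κ R) :
    (upperUnit x : Matrix (ι ⊕ κ) (ι ⊕ κ) R) = Matrix.fromBlocks 1 x 0 1 := rfl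

theorem lowerUnit_val (x : Matrix κ ι R) :
    (lowerUnit x : Matrix (ι ⊕ κ) (ι ⊕ κ) R) = Matrix.fromBlocks 1 0 x 1 := rfl

/-- With `X = (x, 0)` and `Y = (0, x)`, the product of the unipotents of `X` and `Y` is that of `(x,
x)`, and conjugation by the elementary matrix `D` in the last two blocks carries it to that of `(0,
x)`. Hence `[X] + [Y] = [Y]`, so `[X] = 0`, and `X` is a stabilization of `x`. -/
theorem K1.mk_upperUnit (x : Matrix ι κ R) : K1.mk (upperUnit x) = 0 := by
  let D : (Matrix (ι ⊕ (κ ⊕ κ)) (ι ⊕ (κ ⊕ κ)) R)ˣ :=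
    UExt.unitsBlocks (1 : (Matrix ι ι R)ˣ) (lowerUnit (1 : Matrix κ κ R))
  let X : Matrix ι (κ ⊕ κ) R := Matrix.fromCols x 0
  let Y : Matrix ι (κ ⊕ κ) R := Matrix.fromCols 0 x
  have h1 : D * (upperUnit X * upperUnit Y) * D⁻¹ = upperUnit Y := by
    rw [mul_inv_eq_iff_eq_mul]
    ext1
    simp only [Units.val_mul, upperUnit_val, D, UExt.unitsBlocks_val, Units.val_one]
    rw [Matrix.fromBlocks_multiply, Matrix.fromBlocks_multiply, Matrix.fromBlocks_multiply,
      lowerUnit_val]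
    have : Y * (Matrix.fromBlocks 1 0 1 1 : Matrix (κ ⊕ κ) (κ ⊕ κ) R) = X + Y := by
      change Matrix.fromCols 0 x * (Matrix.fromBlocks 1 0 1 1 : Matrix (κ ⊕ κ) (κ ⊕ κ) R) = _
      rw [Matrix.fromCols_mul_fromBlocks]
      ext i j
      rcases j with j | j <;> simp [X, Y]
    simp [this, add_comm]
  have h2 := K1.mk_conj (upperUnit X * upperUnit Y) D
  rw [h1, K1.mk_mul] at h2
  have h3 : K1.mk (upperUnit X) = 0 := (right_eq_add.1 h2)
  have h4 : K1.mk (UExt.unitsBlocks (upperUnit x) (1 : (Matrix κ κ R)ˣ)) = K1.mk (upperUnit X) := by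
    rw [← K1.mk_reindex (Equiv.sumAssoc ι κ κ) (upperUnit X)]
    refine K1.mk_congr ?_
    rw [unitsReindex_val, UExt.unitsBlocks_val, upperUnit_val, upperUnit_val]
    ext i j
    rcases i with (i | i) | i <;> rcases j with (j | j) | j <;> simp [X, Matrix.one_apply]
  rw [h3, K1.mk_blocks, K1.mk_one, add_zero] at h4
  exact h4

theorem K1.mk_lowerUnit (x : Matrix κ ι R) : K1.mk (lowerUnit x) = 0 := by
  rw [← K1.mk_upperUnit x, ← K1.mk_reindex (Equiv.sumComm ι κ) (upperUnit x)]
  refine K1.mk_congr ?_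
  rw [unitsReindex_val, upperUnit_val, lowerUnit_val]
  ext i j
  rcases i with i | i <;> rcases j with j | j <;> simp [Matrix.one_apply]

/-- The involution with off-diagonal blocks `W` and `W'` conjugates `g ⊕ 1` to `1 ⊕ h`. The two
sizes may differ: the swindle uses a rectangular isomorphism between one and two copies of a free
module. -/
theorem K1.mk_rect {g : (Matrix ι ι R)ˣ} {h : (Matrix κ κ R)ˣ} (W : Matrix ι κ R)
    (W' : Matrix κ ι R) (h1 : W * W' = 1) (h2 : W' * W = 1)
    (e : (h : Matrix κ κ R) = W' * (g : Matrix ι ι R) * W) : K1.mk h = K1.mk g := by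
  let Z : (Matrix (ι ⊕ κ) (ι ⊕ κ) R)ˣ :=
    ⟨Matrix.fromBlocks 0 W W' 0, Matrix.fromBlocks 0 W W' 0,
      by simp [Matrix.fromBlocks_multiply, h1, h2], by simp [Matrix.fromBlocks_multiply, h1, h2]⟩
  have hZ : (Z : Matrix (ι ⊕ κ) (ι ⊕ κ) R) = Matrix.fromBlocks 0 W W' 0 := rfl
  have h3 : Z * UExt.unitsBlocks g (1 : (Matrix κ κ R)ˣ) * Z⁻¹ =
      UExt.unitsBlocks (1 : (Matrix ι ι R)ˣ) h := by
    rw [mul_inv_eq_iff_eq_mul]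
    ext1
    rw [Units.val_mul, Units.val_mul, UExt.unitsBlocks_val, UExt.unitsBlocks_val, hZ,
      Matrix.fromBlocks_multiply, Matrix.fromBlocks_multiply, e, Matrix.mul_assoc _ W W', h1]
    simp
  have h4 := K1.mk_conj (UExt.unitsBlocks g (1 : (Matrix κ κ R)ˣ)) Z
  rw [h3, K1.mk_blocks, K1.mk_blocks, K1.mk_one, K1.mk_one, zero_add, add_zero] at h4
  exact h4

end KOne

end HomotopyK

namespace HomotopyK

/-! ### Exactness of the index sequence and excision for split extensions -/

section Exactness

namespace UExt

variable {I B C : Type u} [NonUnitalRing I] [Ring B] [Ring C] {E : UExt I B C}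

theorem proj_toMid (E : UExt I B C) (x : Unital I) : E.proj (E.toMid x) = (x.fst : C) := by
  rw [toMid_apply, map_add, map_intCast, (E.exact _).2 ⟨_, rfl⟩, add_zero]

theorem map_proj_toMid {m n : Type*} (X : Matrix m n (Unital I)) :
    (X.map E.toMid).map E.proj = (X.map (augm I)).map (Int.castRingHom C) := by
  ext i j
  exact E.proj_toMid _

/-- An equivalence `(α, β)` of the idempotent with `1` satisfies `α β = a b` over `B`, so that `b α`
is invertible there. It lifts `g⁻¹` times the integral invertible matrix obtained from `p'` and the
augmentation of `α`. Integral matrices lift to `B` as scalars, so the class of `g` comes from `K₁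
B`. -/
theorem IsDatum.exists_lift {n k : Type*} [Fintype n] [DecidableEq n] [Fintype k] [DecidableEq k]
    {g : (Matrix n n C)ˣ} {a : Matrix k n B} {b : Matrix n k B} {p : Matrix k n ℤ}
    {p' : Matrix n k ℤ} (d : E.IsDatum g a b p p')
    (h : MvN (E.pull (p * p') (a * b)) (1 : Matrix n n (Unital I))) :
    ∃ y, K1.map E.proj y = K1.mk g := by
  obtain ⟨α, β, h1, h2⟩ := h
  have e1 : α.map E.toMid * β.map E.toMid = a * b := by
    rw [← Matrix.map_mul, h1, pull_toMid (d.agree d)]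
  have e2 : β.map E.toMid * α.map E.toMid = 1 := by
    rw [← Matrix.map_mul, h2, Matrix.map_one _ (map_zero _) (map_one _)]
  have f1 : α.map (augm I) * β.map (augm I) = p * p' := by
    rw [← Matrix.map_mul, h1, pull_augm]
  have f2 : β.map (augm I) * α.map (augm I) = 1 := by
    rw [← Matrix.map_mul, h2, Matrix.map_one _ (map_zero _) (map_one _)]
  let G : (Matrix n n B)ˣ := ⟨b * α.map E.toMid, β.map E.toMid * a, by
      rw [Matrix.mul_assoc, ← Matrix.mul_assoc (α.map _), e1, Matrix.mul_assoc a, d.ba,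
        Matrix.mul_one, d.ba], by
      rw [Matrix.mul_assoc, ← Matrix.mul_assoc a, ← e1, Matrix.mul_assoc (α.map _), e2,
        Matrix.mul_one, e2]⟩
  let N : (Matrix n n ℤ)ˣ := ⟨p' * α.map (augm I), β.map (augm I) * p, by
      rw [Matrix.mul_assoc, ← Matrix.mul_assoc (α.map _), f1, Matrix.mul_assoc p, d.pp,
        Matrix.mul_one, d.pp], by
      rw [Matrix.mul_assoc, ← Matrix.mul_assoc p, ← f1, Matrix.mul_assoc (α.map _), f2,
        Matrix.mul_one, f2]⟩
  refine ⟨K1.map (Int.castRingHom B) (K1.mk N) - K1.mk G, ?_⟩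
  have h3 : K1.map E.proj (K1.mk G) = K1.mk g⁻¹ + K1.map (Int.castRingHom C) (K1.mk N) := by
    rw [K1.map_mk, K1.map_mk, ← K1.mk_mul]
    refine K1.mk_congr ?_
    change (b * α.map E.toMid).map E.proj =
      (↑g⁻¹ : Matrix n n C) * (p' * α.map (augm I)).map (Int.castRingHom C)
    rw [Matrix.map_mul, d.hb, map_proj_toMid, Matrix.map_mul, Matrix.mul_assoc]
  have h4 : K1.map E.proj (K1.map (Int.castRingHom B) (K1.mk N)) =
      K1.map (Int.castRingHom C) (K1.mk N) := by
    rw [← AddMonoidHom.comp_apply, ← K1.map_comp, RingHom.ext_int (E.proj.comp _)]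
  rw [map_sub, h3, h4, K1.mk_inv]
  abel

/-- Exactness at `K₁ C`. A vanishing index gives an equivalence of idempotents only after adding an
identity matrix; replacing `g` by `g ⊕ 1` absorbs it. -/
theorem exists_of_index_eq_zero (E : UExt I B C) {x : K1 C} (h : E.index x = 0) :
    ∃ y, K1.map E.proj y = x := by
  obtain ⟨n, g, rfl⟩ := K1.exists_cls x
  have h1 : E.indexFun g = 0 := by
    rw [K1.mk_fin] at h
    rw [← E.coe_index_cls ⟨n, g⟩, h]
    rfl
  have d := IsDatum.std (E := E) g
  rw [indexFun_eq d, sub_eq_zero] at h1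
  obtain ⟨j, hj⟩ := K0.exists_of_mk_eq h1
  have d' := d.blocks (IsDatum.one (n := Fin j))
  obtain ⟨y, hy⟩ := d'.exists_lift (by
    rw [Matrix.fromBlocks_multiply, Matrix.fromBlocks_multiply]
    simp only [Matrix.mul_zero, Matrix.zero_mul, add_zero, zero_add]
    rw [pull_blocks (d.agree d) ((IsDatum.one (E := E)).agree IsDatum.one), one_mul, one_mul, pull_one, ← Matrix.fromBlocks_one]
    exact hj)
  exact ⟨y, by rw [hy, K1.mk_blocks, K1.mk_one, add_zero]⟩

end UExt

/-- An element of `K₀` killed by two homomorphisms is a formal difference `[w] - [1]` such that the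
images of `w` are equivalent to `1`. -/
theorem K0.exists_of_map_eq_zero {R : Type u} {S : Type v} {T : Type w} [Ring R] [Ring S] [Ring T]
    (φ : R →+* S) (ψ : R →+* T) {ξ : K0 R} (h1 : K0.map φ ξ = 0) (h2 : K0.map ψ ξ = 0) :
    ∃ (κ ν : Type) (_ : Fintype κ) (_ : Fintype ν) (_ : DecidableEq κ) (_ : DecidableEq ν)
      (w : Matrix κ κ R) (hw : w * w = w),
      ξ = K0.mk w hw - K0.mk (1 : Matrix ν ν R) (one_mul 1) ∧
      MvN (w.map φ) (1 : Matrix ν ν S) ∧ MvN (w.map ψ) (1 : Matrix ν ν T) := by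
  obtain ⟨n, e, he, k, rfl⟩ := K0.mk_surjective ξ
  have i1 : (1 : Matrix (Fin k) (Fin k) R) * 1 = 1 := one_mul 1
  rw [map_sub, K0.map_mk φ he (by rw [← Matrix.map_mul, he]),
    K0.map_mk φ i1 (by rw [← Matrix.map_mul, i1]), sub_eq_zero] at h1
  obtain ⟨j, hj⟩ := K0.exists_of_mk_eq h1
  -- Identity blocks are added twice, of size `j` for the equivalence over `S` and of size `l` for
  -- the one over `T`; the second enlargement preserves the first equivalence.
  let e' := Matrix.fromBlocks e 0 0 (1 : Matrix (Fin j) (Fin j) R)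
  let f' := Matrix.fromBlocks (1 : Matrix (Fin k) (Fin k) R) 0 0 (1 : Matrix (Fin j) (Fin j) R)
  have he' : e' * e' = e' := fromBlocks_idem he (one_mul 1)
  have hf' : f' * f' = f' := fromBlocks_idem i1 (one_mul 1)
  have h3 : K0.mk e he - K0.mk (1 : Matrix (Fin k) (Fin k) R) i1 = K0.mk e' he' - K0.mk f' hf' := by
    rw [K0.mk_sum he (one_mul 1), K0.mk_sum i1 (one_mul 1)]
    abel
  rw [h3] at h2 ⊢
  rw [map_sub, K0.map_mk ψ he' (by rw [← Matrix.map_mul, he']),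
    K0.map_mk ψ hf' (by rw [← Matrix.map_mul, hf']), sub_eq_zero] at h2
  obtain ⟨l, hl⟩ := K0.exists_of_mk_eq h2
  refine ⟨(Fin n ⊕ Fin j) ⊕ Fin l, (Fin k ⊕ Fin j) ⊕ Fin l, inferInstance, inferInstance,
    inferInstance, inferInstance, Matrix.fromBlocks e' 0 0 1, fromBlocks_idem he' (one_mul 1),
    ?_, ?_, ?_⟩
  · have h4 : K0.mk (1 : Matrix ((Fin k ⊕ Fin j) ⊕ Fin l) ((Fin k ⊕ Fin j) ⊕ Fin l) R) (one_mul 1) =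
        K0.mk (Matrix.fromBlocks f' 0 0 (1 : Matrix (Fin l) (Fin l) R))
          (fromBlocks_idem hf' (one_mul 1)) :=
      K0.mk_congr (by simp only [f', Matrix.fromBlocks_one]) _ _
    rw [h4, K0.mk_sum he' (one_mul 1), K0.mk_sum hf' (one_mul 1)]
    abel
  · have := hj.blocks (MvN.refl (one_mul (1 : Matrix (Fin l) (Fin l) S)))
    simp only [e', Matrix.fromBlocks_map, Matrix.map_zero _ (_root_.map_zero φ),
      Matrix.map_one φ (_root_.map_zero φ) (map_one φ), Matrix.fromBlocks_one] at this ⊢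
    exact this
  · simp only [e', f', Matrix.fromBlocks_map, Matrix.map_zero _ (_root_.map_zero ψ),
      Matrix.map_one ψ (_root_.map_zero ψ) (map_one ψ), Matrix.fromBlocks_one] at hl ⊢
    exact hl

theorem K0.mk_zero {R : Type u} [Ring R] {ι : Type*} [Fintype ι] [DecidableEq ι]
    (h : (0 : Matrix ι ι R) * 0 = 0) : K0.mk (0 : Matrix ι ι R) h = 0 := by
  have h1 := K0.mk_sum h h
  rw [MvN.mk_eq (hf := h) (MvN.zero_right h)] at h1
  exact left_eq_add.1 h1

namespace UExt

variable {I B C : Type u} [NonUnitalRing I] [Ring B] [Ring C] (E : UExt I B C)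

/-- Excision for split extensions, injectivity. -/
theorem eq_zero_of_split (s : C →+* B) (hs : ∀ c, E.proj (s c) = c) {ξ : K0 (Unital I)}
    (h1 : K0.map (augm I) ξ = 0) (h2 : K0.map E.toMid ξ = 0) : ξ = 0 := by
  obtain ⟨κ, ν, _, _, _, _, w, hw, rfl, ⟨p, p', hp1, hp2⟩, ⟨a, b, ha1, ha2⟩⟩ :=
    K0.exists_of_map_eq_zero (augm I) E.toMid h1 h2
  have cp : p'.map (Int.castRingHom C) * p.map (Int.castRingHom C) = 1 := by
    rw [← Matrix.map_mul, hp2, Matrix.map_one _ (map_zero _) (map_one _)]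
  have cab : a.map E.proj * b.map E.proj =
      p.map (Int.castRingHom C) * p'.map (Int.castRingHom C) := by
    rw [← Matrix.map_mul, ha1, map_proj_toMid, ← hp1, Matrix.map_mul]
  have cba : b.map E.proj * a.map E.proj = 1 := by
    rw [← Matrix.map_mul, ha2, Matrix.map_one _ (map_zero _) (map_one _)]
  -- Over `C` the trivialization of `w` defined over `ℤ` by `p`, `p'` and the one defined over `B`
  -- by `a`, `b` differ by the automorphism `g`. Lifting `g` through the section and correcting `a`,
  -- `b` by it makes the two agree modulo `I`, so that they glue to a trivialization over `Ĩ`.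
  let g := p'.map (Int.castRingHom C) * a.map E.proj
  let g' := b.map E.proj * p.map (Int.castRingHom C)
  have gg' : g * g' = 1 := by
    simp only [g, g']
    rw [Matrix.mul_assoc, ← Matrix.mul_assoc (a.map _), cab, Matrix.mul_assoc, cp, Matrix.mul_one,
      cp]
  have g'g : g' * g = 1 := by
    simp only [g, g']
    rw [Matrix.mul_assoc, ← Matrix.mul_assoc (p.map _), ← cab, Matrix.mul_assoc, cba,
      Matrix.mul_one, cba]
  have sgg' : g.map s * g'.map s = 1 := by
    rw [← Matrix.map_mul, gg', Matrix.map_one _ (map_zero _) (map_one _)]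
  have sg'g : g'.map s * g.map s = 1 := by
    rw [← Matrix.map_mul, g'g, Matrix.map_one _ (map_zero _) (map_one _)]
  have ps : ∀ X : Matrix ν ν C, (X.map s).map E.proj = X := fun X => by
    ext i j
    exact hs _
  have A1 : E.Agree p (a * g'.map s) := by
    unfold Agree
    rw [Matrix.map_mul, ps, ← Matrix.mul_assoc, cab, Matrix.mul_assoc, cp, Matrix.mul_one]
  have A2 : E.Agree p' (g.map s * b) := by
    unfold Agree
    rw [Matrix.map_mul, ps, Matrix.mul_assoc, cab, ← Matrix.mul_assoc, cp, Matrix.one_mul]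
  rw [sub_eq_zero]
  refine MvN.mk_eq ⟨E.pull p (a * g'.map s), E.pull p' (g.map s * b), ?_, ?_⟩
  · rw [pull_mul A1 A2]
    refine pull_eq hp1.symm ?_ (A1.mul A2)
    rw [Matrix.mul_assoc, ← Matrix.mul_assoc (g'.map s), sg'g, Matrix.one_mul, ha1]
  · rw [pull_mul A2 A1, hp2, Matrix.mul_assoc, ← Matrix.mul_assoc b, ha2, Matrix.one_mul, sgg',
      pull_one]

/-- Excision for split extensions, surjectivity. -/
theorem exists_of_split (s : C →+* B) (hs : ∀ c, E.proj (s c) = c) {η : K0 B}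
    (h : K0.map E.proj η = 0) : ∃ ξ : K0nu I, K0.map E.toMid ξ = η := by
  obtain ⟨κ, ν, _, _, _, _, w, hw, rfl, ⟨a, b, h1, h2⟩, -⟩ :=
    K0.exists_of_map_eq_zero E.proj E.proj h h
  have ps : ∀ {m n : Type} (X : Matrix m n C), (X.map s).map E.proj = X := fun X => by
    ext i j
    exact hs _
  have sba : b.map s * a.map s = 1 := by
    rw [← Matrix.map_mul, h2, Matrix.map_one _ (map_zero _) (map_one _)]
  -- The section carries `a` and `b` to `B` without losing `b a = 1`. The involution `z` built from
  -- them conjugates `w ⊕ 0` to an idempotent `v` that reduces over `C` to the integral matrix `0 ⊕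
  -- 1`, so that `v` is defined over `Ĩ`.
  let z : Matrix (κ ⊕ ν) (κ ⊕ ν) B :=
    Matrix.fromBlocks (1 - a.map s * b.map s) (a.map s) (b.map s) 0
  have e1 : (1 - a.map s * b.map s) * a.map s = 0 := by
    rw [Matrix.sub_mul, Matrix.mul_assoc, sba, Matrix.mul_one, Matrix.one_mul, sub_self]
  have e2 : b.map s * (1 - a.map s * b.map s) = 0 := by
    rw [Matrix.mul_sub, ← Matrix.mul_assoc, sba, Matrix.mul_one, Matrix.one_mul, sub_self]
  have hz : z * z = 1 := by
    rw [Matrix.fromBlocks_multiply, e1, e2, sba, ← Matrix.fromBlocks_one]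
    simp only [Matrix.mul_zero, add_zero, Matrix.mul_sub, Matrix.mul_one,
      ← Matrix.mul_assoc, e1, Matrix.zero_mul, sub_zero, sub_add_cancel]
  have hw0 := fromBlocks_idem hw (zero_mul (0 : Matrix ν ν B))
  let v := z * Matrix.fromBlocks w 0 0 0 * z
  have hv : v * v = v := by
    calc v * v = z * (Matrix.fromBlocks w 0 0 0 * (z * z) * Matrix.fromBlocks w 0 0 0) * z := by
          simp only [v, Matrix.mul_assoc]
      _ = v := by rw [hz, Matrix.mul_one, hw0]
  have hvw : K0.mk v hv = K0.mk w hw := by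
    refine (MvN.mk_eq (he := hv) (hf := hw0) ⟨z * Matrix.fromBlocks w 0 0 0,
      Matrix.fromBlocks w 0 0 0 * z, ?_, ?_⟩).trans (MvN.mk_eq (MvN.zero_right hw))
    · rw [Matrix.mul_assoc, ← Matrix.mul_assoc _ _ z, hw0, ← Matrix.mul_assoc]
    · rw [Matrix.mul_assoc, ← Matrix.mul_assoc z, hz, Matrix.one_mul, hw0]
  have A : E.Agree (Matrix.fromBlocks (0 : Matrix κ κ ℤ) 0 0 (1 : Matrix ν ν ℤ)) v := by
    have hzp : z.map E.proj = Matrix.fromBlocks (1 - a * b) a b 0 := by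
      rw [Matrix.fromBlocks_map, ps, ps, Matrix.map_zero _ (map_zero _),
        Matrix.map_sub _ (map_sub _), Matrix.map_mul, ps, ps,
        Matrix.map_one _ (map_zero _) (map_one _)]
    have hwp : (Matrix.fromBlocks w 0 0 (0 : Matrix ν ν B)).map E.proj =
        Matrix.fromBlocks (a * b) 0 0 0 := by
      rw [Matrix.fromBlocks_map, h1]
      simp
    have c1 : (1 - a * b) * (a * b) = 0 := by
      rw [Matrix.sub_mul, Matrix.mul_assoc, ← Matrix.mul_assoc b, h2, Matrix.one_mul,
        Matrix.one_mul, sub_self]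
    have c2 : b * (a * b) = b := by rw [← Matrix.mul_assoc, h2, Matrix.one_mul]
    have c3 : b * (1 - a * b) = 0 := by rw [Matrix.mul_sub, c2, Matrix.mul_one, sub_self]
    unfold Agree
    rw [Matrix.map_mul, Matrix.map_mul, hzp, hwp, Matrix.fromBlocks_multiply,
      Matrix.fromBlocks_multiply, c1, c2]
    simp [Matrix.fromBlocks_map, c3, h2]
  have hP := fromBlocks_idem (zero_mul (0 : Matrix κ κ ℤ)) (one_mul (1 : Matrix ν ν ℤ))
  have hu : E.pull (Matrix.fromBlocks (0 : Matrix κ κ ℤ) 0 0 (1 : Matrix ν ν ℤ)) v *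
      E.pull (Matrix.fromBlocks (0 : Matrix κ κ ℤ) 0 0 (1 : Matrix ν ν ℤ)) v =
      E.pull (Matrix.fromBlocks (0 : Matrix κ κ ℤ) 0 0 (1 : Matrix ν ν ℤ)) v := by
    rw [pull_mul A A, hP, hv]
  refine ⟨⟨K0.mk _ hu - K0.mk (1 : Matrix ν ν (Unital I)) (one_mul 1), ?_⟩, ?_⟩
  · change K0.map (augm I) _ = 0
    rw [map_sub, K0.map_mk (augm I) hu (by rw [pull_augm, hP]),
      K0.map_mk (augm I) _ (by rw [← Matrix.map_mul, one_mul]), sub_eq_zero]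
    refine (K0.mk_congr (E.pull_augm _ _) _ hP).trans (((K0.mk_sum (zero_mul _) (one_mul _)).trans ?_).trans
      (K0.mk_congr (Matrix.map_one _ (map_zero _) (map_one _)).symm (one_mul _) _))
    rw [K0.mk_zero, zero_add]
  · change K0.map E.toMid (_ - _) = _
    rw [map_sub, K0.map_mk E.toMid hu (by rw [pull_toMid A, hv]),
      K0.map_mk E.toMid _ (by rw [← Matrix.map_mul, one_mul]),
      K0.mk_congr (pull_toMid A) _ hv, hvw,
      K0.mk_congr (Matrix.map_one _ (map_zero _) (map_one _)) _ (one_mul 1)]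

end UExt

namespace Ext

variable {I B C : Type u} [NonUnitalRing I] [NonUnitalRing B] [NonUnitalRing C] (E : Ext I B C)

theorem toMid_unitize : E.unitize.toMid = Unital.map E.incl := by
  ext x
  · simp only [UExt.toMid_apply, Unital.fst_add, Unital.fst_intCast, Unital.fst_map]
    exact add_zero _
  · simp only [UExt.toMid_apply, Unital.snd_add, Unital.snd_intCast, Unital.snd_map]
    exact zero_add _

theorem map_incl_injective (s : C →ₙ+* B) (hs : ∀ c, E.proj (s c) = c) :
    Function.Injective (K0nu.map E.incl) := by
  rw [injective_iff_map_eq_zero]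
  intro x hx
  refine Subtype.ext (E.unitize.eq_zero_of_split (Unital.map s) (fun c => ?_) x.2 ?_)
  · ext
    · simp [unitize]
    · simp [unitize, hs]
  · rw [toMid_unitize, ← K0nu.coe_map, hx]
    rfl

theorem exists_map_incl (s : C →ₙ+* B) (hs : ∀ c, E.proj (s c) = c) {y : K0nu B}
    (hy : K0nu.map E.proj y = 0) : ∃ x, K0nu.map E.incl x = y := by
  obtain ⟨x, hx⟩ := E.unitize.exists_of_split (Unital.map s) (η := (y : K0 (Unital B)))
    (fun c => by
      ext
      · simp [unitize]
      · simp [unitize, hs]) (congrArg Subtype.val hy)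
  exact ⟨x, Subtype.ext (by rw [K0nu.coe_map, ← toMid_unitize, hx])⟩

end Ext

/-- After unitalizing, the zero map factors through the augmentation to `ℤ`, which kills `K₀` of a
nonunital ring by definition. -/
theorem K0nu.map_zero (A B : Type u) [NonUnitalRing A] [NonUnitalRing B] :
    K0nu.map (0 : A →ₙ+* B) = 0 := by
  ext x
  have h : Unital.map (0 : A →ₙ+* B) = (Int.castRingHom (Unital B)).comp (augm A) := by
    ext x <;> simp [augm]
  rw [K0nu.coe_map, h, K0.map_comp, AddMonoidHom.comp_apply, x.2, _root_.map_zero]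
  rfl

/-- By naturality with respect to the trivial extension `0 → 0 → B → B → 0`, the boundary of a class
coming from `B` lies in the image of the map induced by the zero homomorphism into `Σ I`. -/
theorem Ext.bdry_map_proj {I B C : Type u} [NonUnitalRing I] [NonUnitalRing B] [NonUnitalRing C]
    (E : Ext I B C) (x : K0nu B) : E.bdry (K0nu.map E.proj x) = 0 := by
  let E₀ : Ext PUnit.{u + 1} B B :=
    { incl := 0
      proj := NonUnitalRingHom.id B
      incl_injective := fun _ _ _ => rfl
      proj_surjective := fun b => ⟨b, rfl⟩
      exact := fun b => ⟨fun h => ⟨0, h.symm⟩, fun ⟨_, h⟩ => h.symm⟩ }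
  have h := E₀.bdry_natural E 0 (NonUnitalRingHom.id B) E.proj (fun _ => map_zero E.incl)
    (fun _ => rfl)
  have h0 : Susp.map (0 : PUnit.{u + 1} →ₙ+* I) = 0 := by
    ext x
    obtain ⟨a, rfl⟩ := Susp.mk_surjective x
    exact map_zero Susp.mk
  rw [h0, K0nu.map_zero] at h
  exact (DFunLike.congr_fun h x).symm

end Exactness

end HomotopyK

namespace HomotopyK

/-! ### The Eilenberg swindle -/

section Swindle

/-- A ring in which every module is absorbed by an infinite sum of copies has no `K₀`. -/
theorem K0.eq_zero_of_swindle {R : Type u} [Ring R] (φ : R →+* R) {v₀ v₁ w₀ w₁ : R}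
    (h00 : w₀ * v₀ = 1) (h11 : w₁ * v₁ = 1) (h01 : w₀ * v₁ = 0) (h10 : w₁ * v₀ = 0)
    (h : v₀ * w₀ + v₁ * w₁ = 1) (h0 : ∀ a, φ a * v₀ = v₀ * a) (h1 : ∀ a, φ a * v₁ = v₁ * φ a)
    (ξ : K0 R) : ξ = 0 := by
  have : AddMonoidHom.id (K0 R) = 0 := by
    refine K0.hom_ext fun x => ?_
    obtain ⟨n, e, he⟩ := x
    rw [← K0.mk_fin, AddMonoidHom.id_apply, AddMonoidHom.zero_apply]
    have hφ : e.map φ * e.map φ = e.map φ := by rw [← Matrix.map_mul, he]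
    let d : R → Matrix (Fin n) (Fin n) R := fun r => Matrix.diagonal fun _ => r
    have dd : ∀ r s, d r * d s = d (r * s) := fun r s => Matrix.diagonal_mul_diagonal _ _
    have d0 : d 0 = 0 := Matrix.diagonal_zero
    have d1 : d 1 = 1 := Matrix.diagonal_one
    have e0 : e.map φ * d v₀ = d v₀ * e := by
      ext i j
      simp [d, Matrix.mul_diagonal, Matrix.diagonal_mul, h0]
    have e1 : e.map φ * d v₁ = d v₁ * e.map φ := by
      ext i j
      simp [d, Matrix.mul_diagonal, Matrix.diagonal_mul, h1]
    -- The row `(v₀, v₁)` is an isomorphism from two copies of the module to one, and it matches `e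
    -- ⊕ φ(e)` with `φ(e)`; hence `[φ(e)] = [e] + [φ(e)]`.
    have key : MvN (e.map φ) (Matrix.fromBlocks e 0 0 (e.map φ)) := by
      refine ⟨e.map φ * Matrix.fromCols (d v₀) (d v₁), Matrix.fromRows (d w₀) (d w₁) * e.map φ,
        ?_, ?_⟩
      · rw [Matrix.mul_assoc, ← Matrix.mul_assoc (Matrix.fromCols _ _), Matrix.fromCols_mul_fromRows,
          dd, dd]
        have : d (v₀ * w₀) + d (v₁ * w₁) = 1 := by
          rw [← d1, ← h]
          exact Matrix.diagonal_add _ _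
        rw [this, Matrix.one_mul, hφ]
      · rw [Matrix.mul_assoc, ← Matrix.mul_assoc _ _ (Matrix.fromCols _ _), hφ,
          Matrix.mul_fromCols, e0, e1, Matrix.fromRows_mul_fromCols, ← Matrix.mul_assoc,
          ← Matrix.mul_assoc, ← Matrix.mul_assoc, ← Matrix.mul_assoc, dd, dd, dd, dd, h00, h01,
          h10, h11, d0, d1]
        simp
    have := MvN.mk_eq (he := hφ) (hf := fromBlocks_idem he hφ) key
    rw [K0.mk_sum he hφ] at this
    exact right_eq_add.1 this
  exact DFunLike.congr_fun this ξ

/-- Conjugation by the rectangular isomorphism `(v₀, v₁)` turns `φ(g)` into `g ⊕ φ(g)`, so `[g] +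
[φ(g)] = [φ(g)]`. -/
theorem K1.eq_zero_of_swindle {R : Type u} [Ring R] (φ : R →+* R) {v₀ v₁ w₀ w₁ : R}
    (h00 : w₀ * v₀ = 1) (h11 : w₁ * v₁ = 1) (h01 : w₀ * v₁ = 0) (h10 : w₁ * v₀ = 0)
    (h : v₀ * w₀ + v₁ * w₁ = 1) (h0 : ∀ a, φ a * v₀ = v₀ * a) (h1 : ∀ a, φ a * v₁ = v₁ * φ a)
    (ξ : K1 R) : ξ = 0 := by
  obtain ⟨n, g, rfl⟩ := K1.exists_cls ξ
  let d : R → Matrix (Fin n) (Fin n) R := fun r => Matrix.diagonal fun _ => r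
  have dd : ∀ r s, d r * d s = d (r * s) := fun r s => Matrix.diagonal_mul_diagonal _ _
  have d0 : d 0 = 0 := Matrix.diagonal_zero
  have d1 : d 1 = 1 := Matrix.diagonal_one
  have e0 : ∀ e : Matrix (Fin n) (Fin n) R, e.map φ * d v₀ = d v₀ * e := by
    intro e
    ext i j
    simp [d, Matrix.mul_diagonal, Matrix.diagonal_mul, h0]
  have e1 : ∀ e : Matrix (Fin n) (Fin n) R, e.map φ * d v₁ = d v₁ * e.map φ := by
    intro e
    ext i j
    simp [d, Matrix.mul_diagonal, Matrix.diagonal_mul, h1]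
  have key : K1.mk (UExt.unitsBlocks g (Units.map φ.mapMatrix.toMonoidHom g)) =
      K1.mk (Units.map φ.mapMatrix.toMonoidHom g) := by
    refine K1.mk_rect (Matrix.fromCols (d v₀) (d v₁)) (Matrix.fromRows (d w₀) (d w₁)) ?_ ?_ ?_
    · rw [Matrix.fromCols_mul_fromRows, dd, dd, ← d1, ← h]
      exact Matrix.diagonal_add _ _
    · rw [Matrix.fromRows_mul_fromCols, dd, dd, dd, dd, h00, h01, h10, h11, d0, d1,
        Matrix.fromBlocks_one]
    · change Matrix.fromBlocks (g : Matrix (Fin n) (Fin n) R) 0 0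
        ((g : Matrix (Fin n) (Fin n) R).map φ) =
        Matrix.fromRows (d w₀) (d w₁) * (g : Matrix (Fin n) (Fin n) R).map φ * _
      rw [Matrix.mul_assoc, Matrix.mul_fromCols, e0, e1, Matrix.fromRows_mul_fromCols,
        ← Matrix.mul_assoc, ← Matrix.mul_assoc, ← Matrix.mul_assoc, ← Matrix.mul_assoc, dd, dd, dd,
        dd, h00, h01, h10, h11, d0, d1]
      simp
  rw [K1.mk_blocks] at key
  exact add_eq_right.1 key

end Swindle

/-! ### Vanishing of `K₀` and `K₁` of the cone -/

section ConeRing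

variable {R : Type u} [Ring R]

/-- The matrix of an injection `f : ℕ → ℕ`, with a one in position `(f j, j)`. -/
noncomputable def Cone.inj (R : Type u) [Ring R] (f : ℕ → ℕ) (hf : Function.Injective f) : Cone R :=
  Cone.of (fun i j => if i = f j then 1 else 0) (by
    refine IsCone.of_inj ?_ ?_ ?_
    · refine (Set.toFinite {1, 0}).subset ?_
      rintro _ ⟨i, j, rfl⟩
      by_cases h : i = f j <;> simp [h]
    · intro i j j' h h'
      exact hf ((ite_ne_right_iff.1 h).1.symm.trans (ite_ne_right_iff.1 h').1)
    · intro i i' j h h'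
      exact (ite_ne_right_iff.1 h).1.trans (ite_ne_right_iff.1 h').1.symm)

/-- The transpose of `Cone.inj`. -/
noncomputable def Cone.inj' (R : Type u) [Ring R] (f : ℕ → ℕ) (hf : Function.Injective f) :
    Cone R :=
  Cone.of (fun i j => if j = f i then 1 else 0) (by
    refine IsCone.of_inj ?_ ?_ ?_
    · refine (Set.toFinite {1, 0}).subset ?_
      rintro _ ⟨i, j, rfl⟩
      by_cases h : j = f i <;> simp [h]
    · intro i j j' h h'
      exact (ite_ne_right_iff.1 h).1.trans (ite_ne_right_iff.1 h').1.symm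
    · intro i i' j h h'
      exact hf ((ite_ne_right_iff.1 h).1.symm.trans (ite_ne_right_iff.1 h').1))

section

variable (f : ℕ → ℕ) (hf : Function.Injective f) (a : Cone R) (i j : ℕ)

theorem Cone.entry_inj : (Cone.inj R f hf).entry i j = if i = f j then 1 else 0 := rfl

theorem Cone.entry_inj' : (Cone.inj' R f hf).entry i j = if j = f i then 1 else 0 := rfl

theorem Cone.mul_inj_entry : (a * Cone.inj R f hf).entry i j = a.entry i (f j) := by
  rw [Cone.entry_mul_col (s := {f j})]
  · simp [Cone.entry_inj]
  · intro k hk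
    simpa using (ite_ne_right_iff.1 hk).1

theorem Cone.inj_mul_entry : (Cone.inj R f hf * a).entry (f i) j = a.entry i j := by
  rw [Cone.entry_mul_row (s := {i})]
  · simp [Cone.entry_inj]
  · intro k hk
    simpa using (hf (ite_ne_right_iff.1 hk).1).symm

theorem Cone.inj_mul_entry_of_notMem (h : ∀ k, i ≠ f k) :
    (Cone.inj R f hf * a).entry i j = 0 := by
  rw [Cone.entry_mul_row (s := ∅)]
  · simp
  · intro k hk
    exact absurd (ite_ne_right_iff.1 hk).1 (h k)

end

/-- The matrix `a ⊗ 1` with infinitely many copies of `a` on the diagonal. -/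
noncomputable def Cone.amplify : Cone R →+* Cone R where
  -- Under `ℕ ≅ ℕ × ℕ` the second coordinate labels the copy of `a`. Each row or column of the
  -- result has as many nonzero entries as one row or column of `a`, so the same bound serves.
  toFun a := Cone.of (fun i j => if i.unpair.2 = j.unpair.2 then a.entry i.unpair.1 j.unpair.1
      else 0) (by
    refine ⟨?_, ?_⟩
    · refine (a.isCone.finite_entries.union (Set.finite_singleton 0)).subset ?_
      rintro _ ⟨i, j, rfl⟩
      by_cases h : i.unpair.2 = j.unpair.2
      · exact Or.inl ⟨_, _, (if_pos h).symm⟩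
      · exact Or.inr (if_neg h)
    · obtain ⟨N, h1, h2⟩ := a.isCone.bounded
      refine ⟨N, fun i => ?_, fun j => ?_⟩
      · refine (Set.encard_le_encard (t := (fun k => Nat.pair k i.unpair.2) ''
          {k | a.entry i.unpair.1 k ≠ 0}) ?_).trans ((Set.encard_image_le _ _).trans (h1 _))
        intro j hj
        have hj' := ite_ne_right_iff.1 hj
        refine ⟨j.unpair.1, hj'.2, ?_⟩
        simp [hj'.1]
      · refine (Set.encard_le_encard (t := (fun k => Nat.pair k j.unpair.2) ''
          {k | a.entry k j.unpair.1 ≠ 0}) ?_).trans ((Set.encard_image_le _ _).trans (h2 _))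
        intro i hi
        have hi' := ite_ne_right_iff.1 hi
        refine ⟨i.unpair.1, hi'.2, ?_⟩
        simp [← hi'.1])
  map_one' := by
    ext i j
    change (if i.unpair.2 = j.unpair.2 then (if i.unpair.1 + 0 = j.unpair.1 + 0 then (1 : R) else 0)
      else 0) = if i + 0 = j + 0 then 1 else 0
    by_cases h : i = j
    · simp [h]
    · have : ¬(i.unpair.2 = j.unpair.2 ∧ i.unpair.1 = j.unpair.1) := by
        rintro ⟨h1, h2⟩
        exact h (by rw [← Nat.pair_unpair i, ← Nat.pair_unpair j, h1, h2])
      by_cases h1 : i.unpair.2 = j.unpair.2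
      · have h2 : ¬ i.unpair.1 = j.unpair.1 := fun h2 => this ⟨h1, h2⟩
        simp [h, h1, h2]
      · simp [h, h1]
  map_mul' a b := by
    ext i j
    obtain ⟨s, hs⟩ := a.isCone.exists_rowFinset i.unpair.1
    rw [Cone.entry_mul_row (s := s.image fun k => Nat.pair k i.unpair.2)]
    · rw [Finset.sum_image (by
        intro x _ y _ hxy
        exact (Nat.pair_eq_pair.1 hxy).1)]
      simp only [Cone.entry_of, Nat.unpair_pair, if_true]
      rw [Cone.entry_mul_row _ _ _ _ fun k => (hs k).1]
      by_cases h : i.unpair.2 = j.unpair.2 <;> simp [h]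
    · intro k hk
      have hk' := ite_ne_right_iff.1 hk
      rw [Finset.mem_image]
      exact ⟨k.unpair.1, (hs _).1 hk'.2, by simp [hk'.1]⟩
  map_zero' := by
    ext i j
    simp
  map_add' a b := by
    ext i j
    by_cases h : i.unpair.2 = j.unpair.2 <;> simp [h]

theorem Cone.amplify_entry (a : Cone R) (i j : ℕ) : (Cone.amplify a).entry i j =
    if i.unpair.2 = j.unpair.2 then a.entry i.unpair.1 j.unpair.1 else 0 := rfl

theorem pair_zero_injective : Function.Injective fun i => Nat.pair i 0 := fun _ _ h =>
  (Nat.pair_eq_pair.1 h).1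

theorem pair_succ_injective :
    Function.Injective fun i : ℕ => Nat.pair i.unpair.1 (i.unpair.2 + 1) := fun i j h => by
  have h' := Nat.pair_eq_pair.1 h
  rw [← Nat.pair_unpair i, ← Nat.pair_unpair j, h'.1, Nat.succ_injective h'.2]

/-- The matrix `v₀` includes `ℕ` as the copy numbered `0`, `v₁` moves each copy to the next one, and
`w₀`, `w₁` are the transposes. An infinite sum of copies of `a` is then one copy of `a` followed by
the same infinite sum. -/
theorem Cone.swindle : ∃ v₀ v₁ w₀ w₁ : Cone R, w₀ * v₀ = 1 ∧ w₁ * v₁ = 1 ∧ w₀ * v₁ = 0 ∧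
    w₁ * v₀ = 0 ∧ v₀ * w₀ + v₁ * w₁ = 1 ∧ (∀ a, Cone.amplify a * v₀ = v₀ * a) ∧
    ∀ a, Cone.amplify a * v₁ = v₁ * Cone.amplify a := by
  have cases : ∀ i : ℕ, (∃ k, i = Nat.pair k 0) ∨
      ∃ k : ℕ, i = Nat.pair k.unpair.1 (k.unpair.2 + 1) := by
    intro i
    rcases h : i.unpair.2 with _ | l
    · exact Or.inl ⟨i.unpair.1, by rw [← h, Nat.pair_unpair]⟩
    · exact Or.inr ⟨Nat.pair i.unpair.1 l, by rw [Nat.unpair_pair, ← h, Nat.pair_unpair]⟩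
  refine ⟨inj R _ pair_zero_injective, inj R _ pair_succ_injective,
    inj' R _ pair_zero_injective, inj' R _ pair_succ_injective, ?_, ?_, ?_, ?_, ?_, ?_, ?_⟩
  · ext i j
    rw [mul_inj_entry, entry_inj', one_def, entry_diag]
    simp [Nat.pair_eq_pair, eq_comm]
  · ext i j
    rw [mul_inj_entry, entry_inj', one_def, entry_diag]
    simp [pair_succ_injective.eq_iff, eq_comm]
  · ext i j
    rw [mul_inj_entry, entry_inj', entry_zero]
    simp [Nat.pair_eq_pair]
  · ext i j
    rw [mul_inj_entry, entry_inj', entry_zero]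
    simp [Nat.pair_eq_pair]
  · ext i j
    rw [entry_add]
    rcases cases i with ⟨k, rfl⟩ | ⟨k, rfl⟩
    · rw [inj_mul_entry (f := fun i => Nat.pair i 0), inj_mul_entry_of_notMem, entry_inj', one_def,
        entry_diag]
      · simp [eq_comm]
      · intro l
        simp [Nat.pair_eq_pair]
    · rw [inj_mul_entry (f := fun i => Nat.pair i.unpair.1 (i.unpair.2 + 1)),
        inj_mul_entry_of_notMem, entry_inj', one_def, entry_diag]
      · simp [eq_comm]
      · intro l
        simp [Nat.pair_eq_pair]
  · intro a
    ext i j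
    rw [mul_inj_entry]
    rcases cases i with ⟨k, rfl⟩ | ⟨k, rfl⟩
    · rw [inj_mul_entry (f := fun i => Nat.pair i 0), amplify_entry]
      simp
    · rw [inj_mul_entry_of_notMem, amplify_entry]
      · simp
      · intro l
        simp [Nat.pair_eq_pair]
  · intro a
    ext i j
    rw [mul_inj_entry]
    rcases cases i with ⟨k, rfl⟩ | ⟨k, rfl⟩
    · rw [inj_mul_entry_of_notMem, amplify_entry]
      · simp
      · intro l
        simp [Nat.pair_eq_pair]
    · rw [inj_mul_entry (f := fun i => Nat.pair i.unpair.1 (i.unpair.2 + 1)), amplify_entry,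
        amplify_entry]
      simp

theorem K0.cone_eq_zero (ξ : K0 (Cone R)) : ξ = 0 := by
  obtain ⟨v₀, v₁, w₀, w₁, h00, h11, h01, h10, h, h0, h1⟩ := Cone.swindle (R := R)
  exact K0.eq_zero_of_swindle Cone.amplify h00 h11 h01 h10 h h0 h1 ξ

theorem K1.cone_eq_zero (ξ : K1 (Cone R)) : ξ = 0 := by
  obtain ⟨v₀, v₁, w₀, w₁, h00, h11, h01, h10, h, h0, h1⟩ := Cone.swindle (R := R)
  exact K1.eq_zero_of_swindle Cone.amplify h00 h11 h01 h10 h h0 h1 ξ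

end ConeRing

end HomotopyK

/-! ### The index map of the cone extension on shift classes -/

namespace HomotopyK

theorem K0.mk_add_of_orthogonal {R : Type u} [Ring R] {ι : Type*} [Fintype ι] [DecidableEq ι]
    {e f : Matrix ι ι R} (he : e * e = e) (hf : f * f = f) (hef : e * f = 0) (hfe : f * e = 0)
    (h : (e + f) * (e + f) = e + f) : K0.mk (e + f) h = K0.mk e he + K0.mk f hf := by
  rw [← K0.mk_sum he hf]
  refine MvN.mk_eq ⟨Matrix.fromCols e f, Matrix.fromRows e f, ?_, ?_⟩
  · rw [Matrix.fromCols_mul_fromRows, he, hf]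
  · rw [Matrix.fromRows_mul_fromCols, he, hf, hef, hfe]

section ConeExt

variable (R : Type u) [Ring R]

/-- The ring `M_∞ R` of matrices with finitely many nonzero entries. -/
noncomputable def finRing : NonUnitalSubring (Cone R) where
  carrier := {a | a ∈ finIdeal R}
  mul_mem' ha _ := (finIdeal R).mul_mem_right _ _ ha
  zero_mem' := (finIdeal R).zero_mem
  add_mem' ha hb := (finIdeal R).add_mem ha hb
  neg_mem' ha := (finIdeal R).neg_mem ha

/-- The extension `0 → M_∞ R → Γ R → Σ R → 0`. -/
noncomputable def coneExt : UExt (finRing R) (Cone R) (Susp R) where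
  incl := NonUnitalSubringClass.subtype (finRing R)
  proj := { (Susp.mk : Cone R →ₙ+* Susp R) with map_one' := rfl }
  incl_injective := Subtype.val_injective
  proj_surjective := Susp.mk_surjective
  exact b := by
    refine (Susp.mk_eq_zero (a := b)).trans ((mem_finIdeal (a := b)).symm.trans ?_)
    exact ⟨fun h => ⟨⟨b, h⟩, rfl⟩, fun ⟨i, hi⟩ => hi ▸ i.2⟩

variable {R}

/-- `R → Γ R`, sending `r` to the constant diagonal matrix. -/
noncomputable def Cone.const : R →+* Cone R where
  toFun r := Cone.diag 0 0 r
  map_one' := rfl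
  map_mul' r s := by
    ext i j
    rw [Cone.diag_zero_mul_entry]
    simp
  map_zero' := by
    ext i j
    simp
  map_add' r s := by
    ext i j
    by_cases h : i = j <;> simp [h]

theorem coneExt_proj_const (r : R) : (coneExt R).proj (Cone.const r) = Susp.const r := rfl

/-- The matrix with the single nonzero entry `r` in position `(i, j)`. -/
noncomputable def Cone.single (i j : ℕ) (r : R) : Cone R :=
  Cone.of (fun k l => if k = i ∧ l = j then r else 0) (by
    refine IsCone.of_inj ?_ ?_ ?_
    · refine (Set.toFinite {r, 0}).subset ?_
      rintro _ ⟨k, l, rfl⟩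
      by_cases h : k = i ∧ l = j <;> simp [h]
    · intro k l l' h h'
      exact (ite_ne_right_iff.1 h).1.2.trans (ite_ne_right_iff.1 h').1.2.symm
    · intro k k' l h h'
      exact (ite_ne_right_iff.1 h).1.1.trans (ite_ne_right_iff.1 h').1.1.symm)

theorem Cone.entry_single (i j : ℕ) (r : R) (k l : ℕ) :
    (Cone.single i j r).entry k l = if k = i ∧ l = j then r else 0 := rfl

theorem Cone.single_mem (i j : ℕ) (r : R) : Cone.single i j r ∈ finRing R := by
  refine mem_finIdeal.2 ((Set.finite_singleton (i, j)).subset ?_)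
  rintro ⟨k, l⟩ h
  exact Prod.ext (ite_ne_right_iff.1 h).1.1 (ite_ne_right_iff.1 h).1.2

theorem Cone.single_mul_entry (i j : ℕ) (r : R) (a : Cone R) (k l : ℕ) :
    (Cone.single i j r * a).entry k l = if k = i then r * a.entry j l else 0 := by
  rw [Cone.entry_mul_row (s := {j})]
  · by_cases h : k = i <;> simp [Cone.entry_single, h]
  · intro m hm
    simpa using (ite_ne_right_iff.1 hm).1.2

theorem Cone.mul_single_entry (i j : ℕ) (r : R) (a : Cone R) (k l : ℕ) :
    (a * Cone.single i j r).entry k l = if l = j then a.entry k i * r else 0 := by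
  rw [Cone.entry_mul_col (s := {i})]
  · by_cases h : l = j <;> simp [Cone.entry_single, h]
  · intro m hm
    simpa using (ite_ne_right_iff.1 hm).1.1

/-- The matrix unit `r e_{ij}` in `M_∞ R`. -/
noncomputable def finSingle (i j : ℕ) (r : R) : finRing R := ⟨Cone.single i j r, Cone.single_mem i j r⟩

theorem Cone.one_sub_shift : 1 - Cone.diag 0 1 (1 : R) * Cone.diag 1 0 1 = Cone.single 0 0 1 := by
  ext i j
  rw [Cone.entry_sub, Cone.entry_single, Cone.one_def, Cone.entry_diag]
  rcases i with _ | i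
  · rw [Cone.entry_mul_row (s := ∅)]
    · simp [eq_comm]
    · intro k hk
      rw [Cone.entry_diag] at hk
      have := (ite_ne_right_iff.1 hk).1
      omega
  · rw [Cone.entry_mul_row (s := {i})]
    · simp
    · intro k hk
      have := (ite_ne_right_iff.1 hk).1
      simp; omega

theorem Cone.shift_mul : Cone.diag 1 0 (1 : R) * Cone.diag 0 1 1 = 1 := by
  ext i j
  rw [Cone.entry_mul_row (s := {i + 1}), Cone.one_def]
  · by_cases h : i = j <;> simp [h]
  · intro k hk
    have := (ite_ne_right_iff.1 hk).1
    simp; omega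

theorem Cone.shift_comm (r : R) :
    Cone.diag 1 0 (1 : R) * Cone.const r = Cone.const r * Cone.diag 1 0 1 := by
  change _ * Cone.diag 0 0 r = Cone.diag 0 0 r * _
  ext i j
  rw [Cone.diag_zero_mul_entry, Cone.mul_diag_zero_entry]
  by_cases h : i + 1 = j <;> simp [h]

theorem Cone.shift'_comm (r : R) :
    Cone.diag 0 1 (1 : R) * Cone.const r = Cone.const r * Cone.diag 0 1 1 := by
  change _ * Cone.diag 0 0 r = Cone.diag 0 0 r * _
  ext i j
  rw [Cone.diag_zero_mul_entry, Cone.mul_diag_zero_entry]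
  by_cases h : i = j + 1 <;> simp [h]

/-- The matrix `e e₀₀` over the unitalization of `M_∞ R`. -/
noncomputable def cornerMat {ι : Type*} (e : Matrix ι ι R) : Matrix ι ι (Unital (finRing R)) :=
  e.map fun r => ⟨0, finSingle 0 0 r⟩

theorem cornerMat_mul {ι : Type*} [Fintype ι] (e f : Matrix ι ι R) :
    cornerMat e * cornerMat f = cornerMat (e * f) := by
  have add : ∀ r s : R, (⟨0, finSingle 0 0 (r + s)⟩ : Unital (finRing R)) =
      ⟨0, finSingle 0 0 r⟩ + ⟨0, finSingle 0 0 s⟩ := fun r s => by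
    refine Unital.ext (zero_add 0).symm (Subtype.ext ?_)
    change Cone.single 0 0 (r + s) = Cone.single 0 0 r + Cone.single 0 0 s
    ext k l
    by_cases h : k = 0 ∧ l = 0 <;> simp [Cone.entry_single, h]
  have mul : ∀ r s : R, (⟨0, finSingle 0 0 r⟩ : Unital (finRing R)) * ⟨0, finSingle 0 0 s⟩ =
      ⟨0, finSingle 0 0 (r * s)⟩ := fun r s => by
    refine Unital.ext (mul_zero 0) ?_
    rw [Unital.snd_mul, zero_smul, zero_smul, zero_add, zero_add]
    refine Subtype.ext ?_
    change Cone.single 0 0 r * Cone.single 0 0 s = Cone.single 0 0 (r * s)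
    ext k l
    rw [Cone.single_mul_entry, Cone.entry_single, Cone.entry_single]
    by_cases h : k = 0 <;> by_cases h' : l = 0 <;> simp [h, h']
  have zero : (⟨0, finSingle 0 0 (0 : R)⟩ : Unital (finRing R)) = 0 := by
    have := add 0 0
    rw [add_zero] at this
    exact left_eq_add.1 this
  let φ : R →+ Unital (finRing R) :=
    { toFun := fun r => ⟨0, finSingle 0 0 r⟩
      map_zero' := zero
      map_add' := add }
  ext1 i j
  rw [Matrix.mul_apply]
  change _ = φ ((e * f) i j)
  rw [Matrix.mul_apply, map_sum]
  exact Finset.sum_congr rfl fun k _ => mul _ _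

theorem cornerMat_idem {ι : Type*} [Fintype ι] {e : Matrix ι ι R} (he : e * e = e) :
    cornerMat e * cornerMat e = cornerMat e := by rw [cornerMat_mul, he]

/-- Over `Γ R` the unit `1 - e + eα` lifts to `x` with right inverse `y = 1 - e + eα*`, and the
defect is `1 - y x = e(1 - α*α) = e e₀₀`. The column `(x, 1 - y x)` and the row `(y, 1 - y x)`
therefore compute the index, and their product is `1 ⊕ e e₀₀`. -/
theorem index_shiftHom {n : ℕ} {e : Matrix (Fin n) (Fin n) R} (he : e * e = e) :
    ((coneExt R).index (shiftHom (K0.mk e he)) : K0 (Unital (finRing R))) =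
      K0.mk (cornerMat e) (cornerMat_idem he) := by
  rw [K0.mk_fin, shiftHom_cls, UExt.coe_index_cls]
  let c := e.map (Cone.const (R := R))
  have hc : c * c = c := by rw [← Matrix.map_mul, he]
  let D : Matrix (Fin n) (Fin n) (Cone R) := Matrix.diagonal fun _ => Cone.diag 1 0 1
  let D' : Matrix (Fin n) (Fin n) (Cone R) := Matrix.diagonal fun _ => Cone.diag 0 1 1
  have cD : D * c = c * D := by
    ext1 i j
    rw [Matrix.diagonal_mul, Matrix.mul_diagonal]
    exact Cone.shift_comm _
  have cD' : D' * c = c * D' := by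
    ext1 i j
    rw [Matrix.diagonal_mul, Matrix.mul_diagonal]
    exact Cone.shift'_comm _
  have DD : D * D' = 1 := by
    rw [Matrix.diagonal_mul_diagonal, Cone.shift_mul, Matrix.diagonal_one]
  let x := 1 - c + c * D
  let y := 1 - c + c * D'
  have xy : x * y = 1 := one_sub_add_mul hc cD DD
  have yx : 1 - y * x = c * (1 - D' * D) := by
    have h1 : (1 - c) * (1 - c) = 1 - c := one_sub_idem hc
    have h2 : (1 - c) * (c * D) = 0 := by rw [← mul_assoc, sub_mul, hc]; simp
    have h3 : c * D' * (1 - c) = 0 := by rw [mul_sub, mul_assoc c D' c, cD', ← mul_assoc, hc]; simp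
    have h4 : c * D' * (c * D) = c * (D' * D) := by
      rw [mul_assoc, ← mul_assoc D', cD', mul_assoc c D' D, ← mul_assoc, hc]
    simp only [x, y]
    rw [add_mul, mul_add, mul_add, h1, h2, h3, h4]
    noncomm_ring
  have hz : (1 - y * x) * (1 - y * x) = 1 - y * x :=
    one_sub_idem (by rw [mul_assoc, ← mul_assoc x, xy, one_mul])
  have hxz : x * (1 - y * x) = 0 := by rw [mul_sub, ← mul_assoc, xy]; simp
  have hzy : (1 - y * x) * y = 0 := by rw [sub_mul, mul_assoc, xy]; simp
  have hxp : x.map (coneExt R).proj = (shiftUnit e he : Matrix (Fin n) (Fin n) (Susp R)) := by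
    simp only [x]
    rw [Matrix.map_add _ (map_add _), Matrix.map_sub _ (map_sub _), Matrix.map_mul,
      Matrix.map_one _ (map_zero _) (map_one _), shiftUnit_val, Matrix.diagonal_map (map_zero _)]
    rfl
  have hyp : y.map (coneExt R).proj = (↑(shiftUnit e he)⁻¹ : Matrix (Fin n) (Fin n) (Susp R)) := by
    change _ = 1 - e.map Susp.const + e.map Susp.const * Matrix.diagonal fun _ => Susp.shift' R
    simp only [y]
    rw [Matrix.map_add _ (map_add _), Matrix.map_sub _ (map_sub _), Matrix.map_mul,
      Matrix.map_one _ (map_zero _) (map_one _), Matrix.diagonal_map (map_zero _)]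
    rfl
  have hzp : (1 - y * x).map (coneExt R).proj = 0 := by
    rw [Matrix.map_sub _ (map_sub _), Matrix.map_mul, hxp, hyp, Units.inv_mul,
      Matrix.map_one _ (map_zero _) (map_one _), sub_self]
  have d : (coneExt R).IsDatum (shiftUnit e he) (Matrix.fromRows x (1 - y * x))
      (Matrix.fromCols y (1 - y * x)) (colOne (Fin n) ℤ) (rowOne (Fin n) ℤ) := by
    refine ⟨?_, rowOne_mul_colOne, ?_, ?_⟩
    · rw [Matrix.fromCols_mul_fromRows, hz, add_sub_cancel]
    · rw [colOne_map]
      ext i j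
      rcases i with i | i
      · have := congrFun (congrFun hxp i) j
        simpa [colOne, Matrix.mul_apply, Matrix.one_apply] using this
      · have := congrFun (congrFun hzp i) j
        simpa [colOne, Matrix.mul_apply] using this
    · rw [rowOne_map]
      ext i j
      rcases j with j | j
      · have := congrFun (congrFun hyp i) j
        simpa [rowOne, Matrix.mul_apply, Matrix.one_apply] using this
      · have := congrFun (congrFun hzp i) j
        simpa [rowOne, Matrix.mul_apply] using this
  rw [UExt.indexFun_eq d, UExt.IsDatum.cls, sub_eq_iff_eq_add', ← K0.mk_sum]
  refine K0.mk_congr ?_ _ _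
  refine UExt.pull_eq ?_ ?_ (d.agree d)
  · rw [colOne_mul_rowOne, pMat, Matrix.fromBlocks_map, Matrix.map_one _ (map_zero _) (map_one _),
      Matrix.map_zero _ (map_zero _)]
    rfl
  · rw [Matrix.fromRows_mul_fromCols, xy, hxz, hzy, hz, yx, Matrix.fromBlocks_map,
      Matrix.map_one _ (map_zero _) (map_one _), Matrix.map_zero _ (map_zero _)]
    congr 1
    have : 1 - D' * D = Matrix.diagonal fun _ => Cone.single 0 0 1 := by
      rw [Matrix.diagonal_mul_diagonal, ← Cone.one_sub_shift, ← Matrix.diagonal_one,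
        Matrix.diagonal_sub]
    rw [this]
    ext1 i j
    rw [Matrix.mul_diagonal]
    change (coneExt R).toMid ⟨0, finSingle 0 0 (e i j)⟩ = Cone.diag 0 0 (e i j) * _
    rw [UExt.toMid_apply, Int.cast_zero, zero_add]
    change Cone.single 0 0 (e i j) = _
    ext k l
    rw [Cone.diag_zero_mul_entry, Cone.entry_single, Cone.entry_single]
    simp

end ConeExt

end HomotopyK

namespace HomotopyK

/-! ### Bijectivity of `K₀ R → K₁ Σ R` -/

section Truncation

variable {R : Type u} [Ring R]

/-- The entry of the finite part of an element of the unitalization of `M_∞ R`. -/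
noncomputable def sndEntry (k l : ℕ) : Unital (finRing R) →+ R where
  toFun x := x.snd.1.entry k l
  map_zero' := rfl
  map_add' _ _ := rfl

theorem sndEntry_apply (k l : ℕ) (x : Unital (finRing R)) :
    sndEntry k l x = x.snd.1.entry k l := rfl

theorem unital_fin_ext {x y : Unital (finRing R)} (h : x.fst = y.fst)
    (h' : ∀ k l, sndEntry k l x = sndEntry k l y) : x = y :=
  Unital.ext h (Subtype.ext (Cone.ext h'))

theorem sndEntry_mul (k l : ℕ) (x y : Unital (finRing R)) :
    sndEntry k l (x * y) = x.fst * sndEntry k l y + y.fst * sndEntry k l x +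
      (x.snd.1 * y.snd.1).entry k l := by
  let φ : finRing R →+ R :=
    { toFun := fun z => z.1.entry k l
      map_zero' := rfl
      map_add' := fun _ _ => rfl }
  have h : ∀ (n : ℤ) (z : finRing R), (n • z).1.entry k l = n * z.1.entry k l := fun n z =>
    (map_zsmul φ n z).trans (zsmul_eq_mul _ _)
  change (x.fst • y.snd + y.fst • x.snd + x.snd * y.snd).1.entry k l = _
  change (x.fst • y.snd).1.entry k l + (y.fst • x.snd).1.entry k l + _ = _
  rw [h, h]
  rfl

/-- All entries are supported in the square `[0, m) × [0, m)`. -/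
def SupportedBelow {ι κ : Type*} (m : ℕ) (X : Matrix ι κ (Unital (finRing R))) : Prop :=
  ∀ i j k l, sndEntry k l (X i j) ≠ 0 → k < m ∧ l < m

theorem SupportedBelow.mono {ι κ : Type*} {m n : ℕ} (h : m ≤ n)
    {X : Matrix ι κ (Unital (finRing R))} (hX : SupportedBelow m X) : SupportedBelow n X :=
  fun i j k l hk => ⟨(hX i j k l hk).1.trans_le h, (hX i j k l hk).2.trans_le h⟩

theorem SupportedBelow.blocks {ι κ : Type*} {m : ℕ} {X : Matrix ι ι (Unital (finRing R))}
    {Y : Matrix κ κ (Unital (finRing R))} (hX : SupportedBelow m X) (hY : SupportedBelow m Y) :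
    SupportedBelow m (Matrix.fromBlocks X 0 0 Y) := by
  rintro (i | i) (j | j) k l h
  · exact hX i j k l h
  · exact absurd rfl h
  · exact absurd rfl h
  · exact hY i j k l h

theorem SupportedBelow.exists {ι κ : Type*} [Finite ι] [Finite κ]
    (X : Matrix ι κ (Unital (finRing R))) : ∃ m, SupportedBelow m X := by
  have h : (⋃ i, ⋃ j, {q : ℕ × ℕ | (X i j).snd.1.entry q.1 q.2 ≠ 0}).Finite :=
    Set.finite_iUnion fun i => Set.finite_iUnion fun j => mem_finIdeal.1 (X i j).snd.2
  obtain ⟨q, hq⟩ := h.bddAbove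
  refine ⟨q.1 + q.2 + 1, fun i j k l hk => ?_⟩
  have : (k, l) ≤ q := hq (by
    rw [Set.mem_iUnion]
    refine ⟨i, Set.mem_iUnion.2 ⟨j, hk⟩⟩)
  have h1 : k ≤ q.1 := this.1
  have h2 : l ≤ q.2 := this.2
  omega

/-- The `(k, l)` entry of the matrix `n + a`. -/
noncomputable def truncEntry (k l : ℕ) : Unital (finRing R) →+ R where
  toFun x := (if k = l then (x.fst : R) else 0) + sndEntry k l x
  map_zero' := by simp
  map_add' x y := by
    by_cases h : k = l
    · simp only [h, if_true, Unital.fst_add, Int.cast_add, map_add]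
      abel
    · simp [h]

theorem truncEntry_apply (k l : ℕ) (x : Unital (finRing R)) :
    truncEntry k l x = (if k = l then (x.fst : R) else 0) + sndEntry k l x := rfl

/-- The truncation of a matrix over the unitalization of `M_∞ R`. -/
noncomputable def truncMat {ι κ : Type*} (m : ℕ) (X : Matrix ι κ (Unital (finRing R))) :
    Matrix (ι × Fin m) (κ × Fin m) R :=
  Matrix.of fun p q => truncEntry p.2 q.2 (X p.1 q.1)

/-- Truncation is not multiplicative in general. It becomes so when the finite part of the left
factor lives in the first `m` coordinates, since indices beyond `m` then contribute nothing to the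
truncated product. -/
theorem truncMat_mul {ι κ μ : Type*} [Fintype κ] {m : ℕ} {X : Matrix ι κ (Unital (finRing R))}
    (hX : SupportedBelow m X) (Y : Matrix κ μ (Unital (finRing R))) :
    truncMat m (X * Y) = truncMat m X * truncMat m Y := by
  ext ⟨i, a⟩ ⟨j, b⟩
  rw [Matrix.mul_apply, Fintype.sum_prod_type]
  change truncEntry a b ((X * Y) i j) = ∑ k, ∑ c : Fin m, truncEntry a c (X i k) *
    truncEntry c b (Y k j)
  rw [Matrix.mul_apply, map_sum]
  refine Finset.sum_congr rfl fun k _ => ?_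
  have h1 : ((X i k).snd.1 * (Y k j).snd.1).entry a b =
      ∑ c : Fin m, sndEntry a c (X i k) * sndEntry c b (Y k j) := by
    rw [Cone.entry_mul_row (s := Finset.range m) _ _ _ _
      (fun c hc => Finset.mem_range.2 (hX i k a c hc).2), Finset.sum_range]
    rfl
  have h2 : ∀ c : Fin m, ((a : ℕ) = c) ↔ a = c := fun c => Fin.val_inj
  have h3 : ∀ c : Fin m, ((c : ℕ) = b) ↔ c = b := fun c => Fin.val_inj
  simp only [truncEntry_apply, sndEntry_mul, h1, add_mul, mul_add, Finset.sum_add_distrib, h2, h3,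
    ite_mul, mul_ite, zero_mul, mul_zero, Finset.sum_ite_eq, Finset.sum_ite_eq', Finset.mem_univ,
    if_true, Unital.fst_mul, Int.cast_mul]
  rw [(Int.cast_commute (Y k j).fst (sndEntry a b (X i k))).eq]
  by_cases h : a = b
  · simp only [h, if_true]
    abel
  · simp only [h, if_false]
    abel

theorem truncEntry_cornerMat (r : R) (k l : ℕ) :
    truncEntry k l (⟨0, finSingle 0 0 r⟩ : Unital (finRing R)) =
      if k = 0 ∧ l = 0 then r else 0 := by
  rw [truncEntry_apply, Int.cast_zero, ite_self, zero_add]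
  rfl

section

variable {ι κ : Type*}

theorem MvN.truncMat_cornerMat [Fintype ι] (m : ℕ) {e : Matrix ι ι R} (he : e * e = e) :
    MvN (truncMat (m + 1) (cornerMat e)) e := by
  refine ⟨Matrix.of fun p j => if p.2 = 0 then e p.1 j else 0,
    Matrix.of fun i q => if q.2 = 0 then e i q.1 else 0, ?_, ?_⟩
  · ext ⟨i, a⟩ ⟨j, b⟩
    rw [Matrix.mul_apply]
    change _ = truncEntry a b (⟨0, finSingle 0 0 (e i j)⟩ : Unital (finRing R))
    rw [truncEntry_cornerMat]
    conv_rhs => rw [← he, Matrix.mul_apply]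
    by_cases ha : a = 0 <;> by_cases hb : b = 0 <;> simp [ha, hb]
  · ext i j
    rw [Matrix.mul_apply, Fintype.sum_prod_type]
    conv_rhs => rw [← he, Matrix.mul_apply]
    refine Finset.sum_congr rfl fun k _ => ?_
    simp

theorem truncMat_idem [Fintype ι] {m : ℕ} {X : Matrix ι ι (Unital (finRing R))} (hX : SupportedBelow m X)
    (h : X * X = X) : truncMat m X * truncMat m X = truncMat m X := by
  rw [← truncMat_mul hX, h]

theorem cornerMat_supported (m : ℕ) (e : Matrix ι ι R) : SupportedBelow (m + 1) (cornerMat e) := by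
  intro i j k l h
  have := (ite_ne_right_iff.1 h).1
  omega

theorem one_supported [DecidableEq κ] (m : ℕ) :
    SupportedBelow m (1 : Matrix κ κ (Unital (finRing R))) := by
  intro i j k l h
  by_cases hij : i = j
  · subst hij
    rw [Matrix.one_apply_eq] at h
    exact absurd rfl h
  · rw [Matrix.one_apply_ne hij] at h
    exact absurd rfl h

theorem MvN.truncMat_blocks [Fintype ι] [Fintype κ] [DecidableEq κ] (m : ℕ) {e : Matrix ι ι R} (he : e * e = e) :
    MvN (truncMat (m + 1) (Matrix.fromBlocks (cornerMat e) 0 0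
      (1 : Matrix κ κ (Unital (finRing R)))))
      (Matrix.fromBlocks e 0 0 (truncMat (m + 1) (1 : Matrix κ κ (Unital (finRing R))))) := by
  have h1 := truncMat_idem (cornerMat_supported m e) (cornerMat_idem he)
  have h2 := truncMat_idem (one_supported (m + 1))
    (one_mul (1 : Matrix κ κ (Unital (finRing R))))
  have h3 := fromBlocks_idem h1 h2
  have h4 : truncMat (m + 1) (Matrix.fromBlocks (cornerMat e) 0 0
      (1 : Matrix κ κ (Unital (finRing R)))) =
      (Matrix.fromBlocks (truncMat (m + 1) (cornerMat e)) 0 0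
        (truncMat (m + 1) (1 : Matrix κ κ (Unital (finRing R))))).submatrix
        (Equiv.sumProdDistrib ι κ (Fin (m + 1))) (Equiv.sumProdDistrib ι κ (Fin (m + 1))) := by
    ext ⟨i, a⟩ ⟨j, b⟩
    rcases i with i | i <;> rcases j with j | j
    · rfl
    · exact map_zero (truncEntry (R := R) a b)
    · exact map_zero (truncEntry (R := R) a b)
    · rfl
  refine (MvN.of_submatrix h3 _ h4).trans ?_ (fromBlocks_idem he h2)
    ((MvN.truncMat_cornerMat m he).blocks (MvN.refl h2))
  rw [h4, Matrix.submatrix_mul_equiv, h3]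

end

/-- The index map turns equal shift classes into equal corner classes over the unitalization of `M_∞
R`. The two matrices witnessing that equality have finite parts supported in a common square, so
their truncations are an equivalence over `R` between the original idempotents, both stabilized by
the same summand. -/
theorem shiftHom_injective : Function.Injective (shiftHom (R := R)) := by
  rw [injective_iff_map_eq_zero]
  intro ξ hξ
  obtain ⟨n, e, he, k, rfl⟩ := K0.mk_surjective ξ
  have i1 : (1 : Matrix (Fin k) (Fin k) R) * 1 = 1 := one_mul 1
  rw [map_sub, sub_eq_zero] at hξ
  have h1 : K0.mk (cornerMat e) (cornerMat_idem he) =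
      K0.mk (cornerMat (1 : Matrix (Fin k) (Fin k) R)) (cornerMat_idem i1) := by
    rw [← index_shiftHom he, hξ, index_shiftHom i1]
  obtain ⟨j, α, β, h2, h3⟩ := K0.exists_of_mk_eq h1
  obtain ⟨m₁, hα⟩ := SupportedBelow.exists α
  obtain ⟨m₂, hβ⟩ := SupportedBelow.exists β
  -- The extra `1` keeps the corner position `(0, 0)` inside the square.
  have hα' : SupportedBelow (m₁ + m₂ + 1) α := hα.mono (by omega)
  have hβ' : SupportedBelow (m₁ + m₂ + 1) β := hβ.mono (by omega)
  have h4 : MvN (truncMat (m₁ + m₂ + 1) (Matrix.fromBlocks (cornerMat e) 0 0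
      (1 : Matrix (Fin j) (Fin j) (Unital (finRing R)))))
      (truncMat (m₁ + m₂ + 1) (Matrix.fromBlocks (cornerMat (1 : Matrix (Fin k) (Fin k) R)) 0 0
      (1 : Matrix (Fin j) (Fin j) (Unital (finRing R))))) :=
    ⟨truncMat _ α, truncMat _ β, by rw [← truncMat_mul hα', h2], by
      rw [← truncMat_mul hβ', h3]⟩
  have o := truncMat_idem (one_supported (m₁ + m₂ + 1))
    (one_mul (1 : Matrix (Fin j) (Fin j) (Unital (finRing R))))
  have b1 := fromBlocks_idem he o
  have b2 := fromBlocks_idem i1 o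
  have i0 := truncMat_idem ((cornerMat_supported (m₁ + m₂) e).blocks (one_supported (κ := Fin j) _))
    (fromBlocks_idem (cornerMat_idem he) (one_mul _))
  have h5 := MvN.mk_eq (he := b1) (hf := b2) ((MvN.truncMat_blocks _ he).symm.trans b1 b2
    (h4.trans i0 b2 (MvN.truncMat_blocks _ i1)))
  rw [K0.mk_sum he o, K0.mk_sum i1 o] at h5
  rw [sub_eq_zero]
  exact add_right_cancel h5

/-- The projection onto the first `m` coordinates. -/
noncomputable def Cone.truncProj (R : Type u) [Ring R] (m : ℕ) : Cone R :=
  Cone.of (fun k l => if k = l ∧ k < m then 1 else 0) (by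
    refine IsCone.of_inj ?_ ?_ ?_
    · refine (Set.toFinite {1, 0}).subset ?_
      rintro _ ⟨k, l, rfl⟩
      by_cases h : k = l ∧ k < m
      · exact Or.inl (if_pos h)
      · exact Or.inr (if_neg h)
    · intro k l l' h h'
      exact (ite_ne_right_iff.1 h).1.1.symm.trans (ite_ne_right_iff.1 h').1.1
    · intro k k' l h h'
      exact (ite_ne_right_iff.1 h).1.1.trans (ite_ne_right_iff.1 h').1.1.symm)

theorem Cone.entry_truncProj (m k l : ℕ) :
    (Cone.truncProj R m).entry k l = if k = l ∧ k < m then 1 else 0 := rfl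

theorem Cone.truncProj_mul_entry (m : ℕ) (a : Cone R) (k l : ℕ) :
    (Cone.truncProj R m * a).entry k l = if k < m then a.entry k l else 0 := by
  rw [Cone.entry_mul_row (s := {k})]
  · by_cases h : k < m <;> simp [Cone.entry_truncProj, h]
  · intro j hj
    simpa using (ite_ne_right_iff.1 hj).1.1.symm

theorem Cone.mul_truncProj_entry (m : ℕ) (a : Cone R) (k l : ℕ) :
    (a * Cone.truncProj R m).entry k l = if l < m then a.entry k l else 0 := by
  rw [Cone.entry_mul_col (s := {l})]
  · by_cases h : l < m <;> simp [Cone.entry_truncProj, h]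
  · intro j hj
    simpa using (ite_ne_right_iff.1 hj).1.1

/-- The projection onto the first `m` coordinates, in the unitalization of `M_∞ R`. -/
noncomputable def truncIdem (R : Type u) [Ring R] (m : ℕ) : Unital (finRing R) :=
  ⟨0, ⟨Cone.truncProj R m, by
    refine mem_finIdeal.2 (((Set.finite_Iio m).prod (Set.finite_Iio m)).subset ?_)
    rintro ⟨k, l⟩ h
    have h' := (ite_ne_right_iff.1 h).1
    exact ⟨h'.2, h'.1 ▸ h'.2⟩⟩⟩

theorem sndEntry_truncIdem (m k l : ℕ) :
    sndEntry k l (truncIdem R m) = if k = l ∧ k < m then 1 else 0 := rfl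

theorem sndEntry_truncIdem_mul {m : ℕ} {x : Unital (finRing R)}
    (hx : ∀ k l, sndEntry k l x ≠ 0 → k < m ∧ l < m) (k l : ℕ) :
    sndEntry k l (truncIdem R m * x) =
      (if k = l ∧ k < m then (x.fst : R) else 0) + sndEntry k l x := by
  rw [sndEntry_mul, sndEntry_truncIdem]
  change _ + _ + (Cone.truncProj R m * x.snd.1).entry k l = _
  rw [Cone.truncProj_mul_entry, ← sndEntry_apply]
  by_cases h : sndEntry k l x = 0
  · simp [h, truncIdem]
  · simp [(hx k l h).1, truncIdem]

theorem sndEntry_mul_truncIdem {m : ℕ} {x : Unital (finRing R)}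
    (hx : ∀ k l, sndEntry k l x ≠ 0 → k < m ∧ l < m) (k l : ℕ) :
    sndEntry k l (x * truncIdem R m) =
      (if k = l ∧ k < m then (x.fst : R) else 0) + sndEntry k l x := by
  rw [sndEntry_mul, sndEntry_truncIdem]
  change _ + _ + (x.snd.1 * Cone.truncProj R m).entry k l = _
  rw [Cone.mul_truncProj_entry, ← sndEntry_apply]
  by_cases h : sndEntry k l x = 0
  · simp [h, truncIdem]
  · simp [(hx k l h).2, truncIdem]

theorem truncIdem_comm {m : ℕ} {x : Unital (finRing R)}
    (hx : ∀ k l, sndEntry k l x ≠ 0 → k < m ∧ l < m) :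
    truncIdem R m * x = x * truncIdem R m :=
  unital_fin_ext (by simp [mul_comm]) fun k l => by
    rw [sndEntry_truncIdem_mul hx, sndEntry_mul_truncIdem hx]

theorem truncIdem_idem (m : ℕ) : truncIdem R m * truncIdem R m = truncIdem R m :=
  unital_fin_ext rfl fun k l => by
    rw [sndEntry_mul_truncIdem fun k l h => by
      have h' := (ite_ne_right_iff.1 h).1
      exact ⟨h'.2, h'.1 ▸ h'.2⟩]
    simp [truncIdem]

/-- Outside the first `m` coordinates such an `x` acts as its scalar part. -/
theorem sub_mul_truncIdem {m : ℕ} {x : Unital (finRing R)}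
    (hx : ∀ k l, sndEntry k l x ≠ 0 → k < m ∧ l < m) :
    x - x * truncIdem R m = (x.fst : Unital (finRing R)) * (1 - truncIdem R m) := by
  rw [mul_sub, mul_one]
  refine unital_fin_ext ?_ fun k l => ?_
  · simp [truncIdem]
  · rw [map_sub, map_sub, sndEntry_mul_truncIdem hx, sndEntry_mul_truncIdem fun k l h => absurd rfl h]
    change _ = (0 : R) - (_ + 0)
    rw [Unital.fst_intCast]
    abel

theorem sum_finSingle_mul (m : ℕ) :
    ∑ c : Fin m, (⟨0, finSingle c 0 1⟩ : Unital (finRing R)) * ⟨0, finSingle 0 c 1⟩ =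
      truncIdem R m := by
  refine unital_fin_ext ?_ fun k l => ?_
  · change augm _ (∑ c : Fin m, _) = 0
    rw [map_sum]
    exact Finset.sum_eq_zero fun c _ => mul_zero 0
  · rw [map_sum, sndEntry_truncIdem]
    have h : ∀ c : Fin m, sndEntry k l ((⟨0, finSingle c 0 1⟩ : Unital (finRing R)) *
        ⟨0, finSingle 0 c 1⟩) = if k = c ∧ l = c then 1 else 0 := fun c => by
      rw [sndEntry_mul]
      change ((0 : ℤ) : R) * _ + ((0 : ℤ) : R) * _ +
        (Cone.single c 0 1 * Cone.single 0 c (1 : R)).entry k l = _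
      rw [Cone.single_mul_entry, Cone.entry_single]
      by_cases h : k = c <;> by_cases h' : l = c <;> simp [h, h']
    simp only [h]
    by_cases hk : k < m
    · rw [Finset.sum_eq_single (⟨k, hk⟩ : Fin m)]
      · simp [hk, eq_comm]
      · intro c _ hc
        refine if_neg fun h => hc (Fin.ext h.1.symm)
      · simp
    · rw [if_neg fun h => hk h.2]
      exact Finset.sum_eq_zero fun c _ =>
        if_neg fun h : k = (c : ℕ) ∧ l = (c : ℕ) => hk (h.1 ▸ c.2)

theorem finSingle_mul_mul (a b : ℕ) (x : Unital (finRing R)) :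
    (⟨0, finSingle 0 a 1⟩ : Unital (finRing R)) * x * ⟨0, finSingle b 0 1⟩ =
      ⟨0, finSingle 0 0 (truncEntry a b x)⟩ := by
  rw [mul_assoc]
  refine unital_fin_ext (by simp) fun k l => ?_
  have h1 : ∀ i j, sndEntry i j (x * (⟨0, finSingle b 0 1⟩ : Unital (finRing R))) =
      if j = 0 then (if i = b then (x.fst : R) else 0) + sndEntry i b x else 0 := fun i j => by
    rw [sndEntry_mul]
    change _ * (Cone.single b 0 (1 : R)).entry i j + ((0 : ℤ) : R) * _ +
      (x.snd.1 * Cone.single b 0 (1 : R)).entry i j = _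
    rw [Cone.mul_single_entry, Cone.entry_single, ← sndEntry_apply]
    by_cases hi : i = b <;> by_cases hj : j = 0 <;> simp [hi, hj]
  rw [sndEntry_mul]
  change ((0 : ℤ) : R) * _ + ((x.fst * 0 : ℤ) : R) * _ +
    (Cone.single 0 a (1 : R) * (x * (⟨0, finSingle b 0 1⟩ : Unital (finRing R))).snd.1).entry k l =
    (Cone.single 0 0 (truncEntry a b x)).entry k l
  rw [Cone.single_mul_entry, ← sndEntry_apply, h1, Cone.entry_single, truncEntry_apply]
  by_cases hk : k = 0 <;> by_cases hl : l = 0 <;> simp [hk, hl, h1]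

variable {ι : Type*} [Fintype ι] [DecidableEq ι]

/-- The products `e_{c,0} e_{0,c}` for `c < m` sum to the projection onto the first `m` coordinates,
whereas `e_{0,a} q e_{b,0}` moves the `(a, b)` entry of `q` to the corner `(0, 0)`. -/
theorem MvN.truncMat_equiv {m : ℕ} {q : Matrix ι ι (Unital (finRing R))} (hq : q * q = q) :
    MvN (q * (Matrix.diagonal fun _ => truncIdem R m) * q) (cornerMat (truncMat m q)) := by
  refine ⟨Matrix.of fun i p => q i p.1 * ⟨0, finSingle p.2 0 1⟩,
    Matrix.of fun p j => ⟨0, finSingle 0 p.2 1⟩ * q p.1 j, ?_, ?_⟩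
  · ext1 i j
    rw [Matrix.mul_apply, Fintype.sum_prod_type, Matrix.mul_apply]
    refine Finset.sum_congr rfl fun k _ => ?_
    rw [Matrix.mul_diagonal, ← sum_finSingle_mul, Finset.mul_sum, Finset.sum_mul]
    refine Finset.sum_congr rfl fun c _ => ?_
    simp only [Matrix.of_apply, mul_assoc]
  · ext1 ⟨i, a⟩ ⟨j, b⟩
    rw [Matrix.mul_apply]
    have : ∀ k, (Matrix.of fun (p : ι × Fin m) j => (⟨0, finSingle 0 p.2 1⟩ : Unital (finRing R)) *
        q p.1 j) (i, a) k * (Matrix.of fun i (p : ι × Fin m) => q i p.1 * ⟨0, finSingle p.2 0 1⟩)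
          k (j, b) = ⟨0, finSingle 0 a 1⟩ * (q i k * q k j) * ⟨0, finSingle b 0 1⟩ := fun k => by
      simp only [Matrix.of_apply, mul_assoc]
    simp only [this]
    rw [← Finset.sum_mul, ← Finset.mul_sum, ← Matrix.mul_apply, hq]
    exact finSingle_mul_mul _ _ _

/-- The projection `D` onto the first `m` coordinates commutes with `q`, so `q = q D + q (1 - D)` is
an orthogonal decomposition. The first term is equivalent to the corner of the truncation; the
second, `z`, depends only on the augmentation of `q`. -/
theorem K0.mk_eq_trunc {m : ℕ} {q : Matrix ι ι (Unital (finRing R))} (hq : q * q = q)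
    (hm : SupportedBelow m q) {z : Matrix ι ι (Unital (finRing R))}
    (hz : z = Matrix.of fun i j => ((q i j).fst : Unital (finRing R)) * (1 - truncIdem R m)) :
    ∃ h : z * z = z, K0.mk q hq =
      K0.mk (cornerMat (truncMat m q)) (cornerMat_idem (truncMat_idem hm hq)) + K0.mk z h := by
  let D : Matrix ι ι (Unital (finRing R)) := Matrix.diagonal fun _ => truncIdem R m
  have hD : D * D = D := by rw [Matrix.diagonal_mul_diagonal, truncIdem_idem]
  have hc : D * q = q * D := by
    ext1 i j
    rw [Matrix.diagonal_mul, Matrix.mul_diagonal, truncIdem_comm (hm i j)]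
  have h1 : q * D * q = q * D := by rw [Matrix.mul_assoc, hc, ← Matrix.mul_assoc, hq]
  have h2 : q * D * (q * D) = q * D := by rw [← Matrix.mul_assoc, h1, Matrix.mul_assoc, hD]
  have h3 : z = q - q * D := by
    ext1 i j
    rw [hz, Matrix.sub_apply, Matrix.mul_diagonal, sub_mul_truncIdem (hm i j)]
    rfl
  have h4 : q * (q * D) = q * D := by rw [← Matrix.mul_assoc, hq]
  have h5 : (q - q * D) * (q - q * D) = q - q * D := by
    rw [Matrix.sub_mul, Matrix.mul_sub, Matrix.mul_sub, hq, h4, h1, h2, sub_self, sub_zero]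
  subst h3
  refine ⟨h5, ?_⟩
  have h6 := MvN.mk_eq (he := by rw [h1, h2]) (hf := cornerMat_idem (truncMat_idem hm hq))
    (MvN.truncMat_equiv (m := m) hq)
  rw [← h6, K0.mk_congr h1 _ h2, ← K0.mk_add_of_orthogonal h2 h5
    (by rw [Matrix.mul_sub, h1, h2, sub_self]) (by rw [Matrix.sub_mul, h4, h2, sub_self])
    (by rw [add_sub_cancel, hq])]
  exact K0.mk_congr (add_sub_cancel _ _).symm _ _

theorem index_shiftHom_mk {e : Matrix ι ι R} (he : e * e = e) :
    ((coneExt R).index (shiftHom (K0.mk e he)) : K0 (Unital (finRing R))) =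
      K0.mk (cornerMat e) (cornerMat_idem he) := by
  have h1 : e.submatrix (Fintype.equivFin ι).symm (Fintype.equivFin ι).symm *
      e.submatrix (Fintype.equivFin ι).symm (Fintype.equivFin ι).symm =
      e.submatrix (Fintype.equivFin ι).symm (Fintype.equivFin ι).symm := by
    rw [Matrix.submatrix_mul_equiv, he]
  rw [← K0.mk_submatrix he (Fintype.equivFin ι).symm h1, index_shiftHom]
  exact K0.mk_submatrix (cornerMat_idem he) _ (cornerMat_idem h1)

/-- It is enough to match indices, because the kernel of the index map is the image of `K₁ (Γ R) =
0`. The index of `x` is `[q] - [p]` with `q` and `p` of the same augmentation; their parts outside a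
large square coincide and cancel, and the corner classes left over are indices of shift classes. -/
theorem shiftHom_surjective : Function.Surjective (shiftHom (R := R)) := by
  intro x
  suffices h : ∃ ξ, (coneExt R).index (shiftHom ξ) = (coneExt R).index x by
    obtain ⟨ξ, hξ⟩ := h
    rw [← sub_eq_zero, ← map_sub] at hξ
    obtain ⟨y, hy⟩ := (coneExt R).exists_of_index_eq_zero hξ
    rw [K1.cone_eq_zero y, map_zero] at hy
    exact ⟨ξ, sub_eq_zero.1 hy.symm⟩
  obtain ⟨n, g, rfl⟩ := K1.exists_cls x
  let q := (coneExt R).indexMat g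
  let p := pMat (Fin n) (Unital (finRing R))
  have hq : q * q = q := UExt.indexMat_idem g
  have hp : p * p = p := pMat_idem
  obtain ⟨m₁, hm₁⟩ := SupportedBelow.exists q
  obtain ⟨m₂, hm₂⟩ := SupportedBelow.exists p
  have hmq : SupportedBelow (m₁ + m₂) q := hm₁.mono (by omega)
  have hmp : SupportedBelow (m₁ + m₂) p := hm₂.mono (by omega)
  have hpq : q.map (augm (finRing R)) = p.map (augm (finRing R)) := by
    change _ = (pMat (Fin n) (Unital (finRing R))).map (augm (finRing R))
    rw [pMat, Matrix.fromBlocks_map, Matrix.map_one _ (map_zero _) (map_one _),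
      Matrix.map_zero _ (map_zero _)]
    exact (coneExt R).pull_augm _ _
  have hpq' : ∀ i j, (q i j).fst = (p i j).fst := fun i j => congrFun (congrFun hpq i) j
  obtain ⟨h₁, hq'⟩ := K0.mk_eq_trunc hq hmq rfl
  obtain ⟨h₂, hp'⟩ := K0.mk_eq_trunc hp hmp rfl
  refine ⟨K0.mk _ (truncMat_idem hmq hq) - K0.mk _ (truncMat_idem hmp hp), Subtype.ext ?_⟩
  rw [map_sub, map_sub, AddSubgroup.coe_sub, index_shiftHom_mk, index_shiftHom_mk, K1.mk_fin,
    UExt.coe_index_cls, UExt.indexFun]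
  change _ = K0.mk q hq - K0.mk p hp
  rw [hq', hp', K0.mk_congr (f := Matrix.of fun i j => ((p i j).fst : Unital (finRing R)) *
    (1 - truncIdem R (m₁ + m₂))) (by ext1 i j; simp only [Matrix.of_apply, hpq']) h₁ h₂]
  abel

end Truncation

end HomotopyK

namespace HomotopyK

/-! ### The homomorphism `[e] ↦ [1 - e + e t]` -/

section Beta

variable {R : Type u} {S : Type v} {T : Type w} [Ring R] [Ring S] [Ring T]

/-- The unit `1 - e + e t` attached to an idempotent `e` and a unit `t` commuting with `e`. -/
def idemUnit {M : Type*} [Ring M] (e : M) (t : Mˣ) (he : e * e = e) (ht : t * e = e * t) : Mˣ where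
  val := 1 - e + e * t
  inv := 1 - e + e * ↑t⁻¹
  val_inv := one_sub_add_mul he ht t.mul_inv
  inv_val := one_sub_add_mul he (by
    rw [Units.inv_mul_eq_iff_eq_mul, ← mul_assoc, ht, mul_assoc, t.mul_inv, mul_one]) t.inv_mul

theorem map_idem {ι : Type*} [Fintype ι] (c : R →+* S) {e : Matrix ι ι R} (he : e * e = e) :
    e.map c * e.map c = e.map c := by rw [← Matrix.map_mul, he]

variable (ι : Type*) [Fintype ι] [DecidableEq ι]

/-- The invertible scalar matrix attached to a unit. -/
def diagUnit (t : Sˣ) : (Matrix ι ι S)ˣ where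
  val := Matrix.diagonal fun _ => (t : S)
  inv := Matrix.diagonal fun _ => (↑t⁻¹ : S)
  val_inv := by rw [Matrix.diagonal_mul_diagonal, t.mul_inv, Matrix.diagonal_one]
  inv_val := by rw [Matrix.diagonal_mul_diagonal, t.inv_mul, Matrix.diagonal_one]

theorem diagUnit_val (t : Sˣ) :
    (diagUnit ι t : Matrix ι ι S) = Matrix.diagonal fun _ => (t : S) := rfl

variable {ι}

theorem diagUnit_comm (c : R →+* S) (t : Sˣ) (ht : ∀ r, t * c r = c r * t) (e : Matrix ι ι R) :
    (diagUnit ι t : Matrix ι ι S) * e.map c = e.map c * diagUnit ι t := by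
  ext i j
  rw [diagUnit_val, Matrix.diagonal_mul, Matrix.mul_diagonal]
  exact ht _

/-- The invertible matrix `1 - e + e t` over `S` attached to an idempotent matrix `e` over `R`. -/
def betaUnit (c : R →+* S) (t : Sˣ) (ht : ∀ r, t * c r = c r * t) (e : Matrix ι ι R)
    (he : e * e = e) : (Matrix ι ι S)ˣ :=
  idemUnit (e.map c) (diagUnit ι t) (map_idem c he) (diagUnit_comm c t ht e)

theorem betaUnit_val (c : R →+* S) (t : Sˣ) (ht : ∀ r, t * c r = c r * t) (e : Matrix ι ι R)
    (he : e * e = e) : (betaUnit c t ht e he : Matrix ι ι S) =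
      1 - e.map c + e.map c * Matrix.diagonal fun _ => (t : S) := rfl

variable (c : R →+* S) (t : Sˣ) (ht : ∀ r, t * c r = c r * t)

theorem betaUnit_blocks {κ : Type*} [Fintype κ] [DecidableEq κ] (e : Matrix ι ι R) (he : e * e = e)
    (f : Matrix κ κ R) (hf : f * f = f) :
    betaUnit c t ht (Matrix.fromBlocks e 0 0 f) (fromBlocks_idem he hf) =
      UExt.unitsBlocks (betaUnit c t ht e he) (betaUnit c t ht f hf) := by
  ext i j
  rw [betaUnit_val, UExt.unitsBlocks_val, betaUnit_val, betaUnit_val]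
  rcases i with i | i <;> rcases j with j | j <;> simp [Matrix.mul_diagonal, Matrix.one_apply]

theorem betaUnit_zero (h : (0 : Matrix ι ι R) * 0 = 0) : betaUnit c t ht (0 : Matrix ι ι R) h = 1 := by
  ext1
  rw [betaUnit_val]
  simp

theorem mk_betaUnit_submatrix {κ : Type*} [Fintype κ] [DecidableEq κ] (e : Matrix ι ι R)
    (he : e * e = e) (σ : κ ≃ ι) (h : e.submatrix σ σ * e.submatrix σ σ = e.submatrix σ σ) :
    K1.mk (betaUnit c t ht (e.submatrix σ σ) h) = K1.mk (betaUnit c t ht e he) := by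
  rw [← K1.mk_reindex σ]
  refine K1.mk_congr ?_
  rw [unitsReindex_val, betaUnit_val, betaUnit_val]
  ext i j
  simp [Matrix.mul_diagonal, Matrix.one_apply]

theorem mk_betaUnit_dsum {n m : ℕ} (e : Matrix (Fin n) (Fin n) R) (he : e * e = e)
    (f : Matrix (Fin m) (Fin m) R) (hf : f * f = f) (h : dsum e f * dsum e f = dsum e f) :
    K1.mk (betaUnit c t ht (dsum e f) h) =
      K1.mk (betaUnit c t ht e he) + K1.mk (betaUnit c t ht f hf) := by
  rw [← K1.mk_blocks, ← betaUnit_blocks]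
  exact mk_betaUnit_submatrix c t ht _ _ _ h

theorem betaUnit_conj (e : Matrix ι ι R) (he : e * e = e) (g : (Matrix ι ι R)ˣ)
    (h : g * e * (↑g⁻¹ : Matrix ι ι R) * (g * e * (↑g⁻¹ : Matrix ι ι R)) =
      g * e * (↑g⁻¹ : Matrix ι ι R)) :
    betaUnit c t ht _ h = Units.map c.mapMatrix.toMonoidHom g * betaUnit c t ht e he *
      (Units.map c.mapMatrix.toMonoidHom g)⁻¹ := by
  ext1
  rw [Units.val_mul, Units.val_mul, betaUnit_val, betaUnit_val, ← map_inv]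
  change _ = (g : Matrix ι ι R).map c * _ * (↑g⁻¹ : Matrix ι ι R).map c
  rw [Matrix.map_mul, Matrix.map_mul]
  have h1 : (g : Matrix ι ι R).map c * (↑g⁻¹ : Matrix ι ι R).map c = 1 := by
    rw [← Matrix.map_mul, g.mul_inv, Matrix.map_one _ (map_zero _) (map_one _)]
  have h2 := diagUnit_comm c t ht (↑g⁻¹ : Matrix ι ι R)
  rw [diagUnit_val] at h2
  rw [mul_assoc _ _ (Matrix.diagonal _), ← h2, mul_add, mul_sub, mul_one, add_mul, sub_mul, h1]
  simp only [mul_assoc]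

/-- The homomorphism `K₀ R → K₁ S`, `[e] ↦ [1 - e + e t]`, attached to a ring homomorphism
`c : R → S` and a unit `t` of `S` commuting with the image of `c`. -/
noncomputable def beta : K0 R →+ K1 S :=
  K0.lift (fun x => K1.mk (betaUnit c t ht x.mat x.idem))
    (fun x g => by
      rw [← K1.mk_conj (betaUnit c t ht x.mat x.idem) (Units.map c.mapMatrix.toMonoidHom g),
        ← betaUnit_conj]
      rfl)
    (fun x m => (mk_betaUnit_dsum c t ht x.mat x.idem 0 (zero_mul 0) _).trans (by
      rw [betaUnit_zero, K1.mk_one, add_zero]))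
    (fun x y => mk_betaUnit_dsum c t ht x.mat x.idem y.mat y.idem _)

theorem beta_mk (e : Matrix ι ι R) (he : e * e = e) :
    beta c t ht (K0.mk e he) = K1.mk (betaUnit c t ht e he) :=
  (K0.lift_cls ..).trans (mk_betaUnit_submatrix c t ht e he _ _)

theorem beta_cls (x : IdemMat R) :
    beta c t ht (K0.cls x) = K1.mk (betaUnit c t ht x.mat x.idem) := K0.lift_cls ..

theorem map_beta (φ : S →+* T) (c' : R →+* T) (t' : Tˣ) (ht' : ∀ r, t' * c' r = c' r * t')
    (hc : ∀ r, φ (c r) = c' r) (hφ : φ t = t') (x : K0 R) :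
    K1.map φ (beta c t ht x) = beta c' t' ht' x := by
  have : (K1.map φ).comp (beta c t ht) = beta c' t' ht' := by
    refine K0.hom_ext fun x => ?_
    rw [AddMonoidHom.comp_apply, beta_cls, beta_cls, K1.map_mk]
    refine K1.mk_congr ?_
    change (1 - x.mat.map c + x.mat.map c * Matrix.diagonal fun _ => (t : S)).map φ = _
    rw [betaUnit_val]
    ext i j
    simp [Matrix.mul_diagonal, Matrix.one_apply, hc, hφ, apply_ite φ]
  exact DFunLike.congr_fun this x

/-- The unit `α` of `Σ R`. -/
noncomputable def Susp.shiftU (R : Type u) [Ring R] : (Susp R)ˣ :=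
  ⟨Susp.shift R, Susp.shift' R, Susp.shift_mul_shift', Susp.shift'_mul_shift⟩

theorem Susp.shiftU_comm (r : R) :
    (Susp.shiftU R : Susp R) * Susp.const r = Susp.const r * Susp.shiftU R := Susp.shift_comm r

/-- With `shiftHom` placed in the family `beta`, the naturality `map_beta` compares it with the
class of `1 - e + eT` over Laurent polynomials. -/
theorem shiftHom_eq_beta (x : K0 R) :
    shiftHom x = beta Susp.const (Susp.shiftU R) Susp.shiftU_comm x := by
  have : shiftHom (R := R) = beta Susp.const (Susp.shiftU R) Susp.shiftU_comm := by
    refine K0.hom_ext fun x => ?_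
    rw [shiftHom_cls, beta_cls, ← K1.mk_fin]
    exact K1.mk_congr rfl
  rw [this]

end Beta

end HomotopyK

section

namespace HomotopyK

open LaurentPolynomial

/-! ### Homomorphisms out of Laurent polynomials and candidate generators of `K₁` -/

section LaurentEval

variable {R : Type u} {S : Type v} {T' : Type w} [Ring R] [Ring S] [Ring T']

/-- The ring homomorphism `R[T, T⁻¹] → S` extending `c : R → S` and sending `T` to a unit which
commutes with the image of `c`. -/
noncomputable def laurentEval (c : R →+* S) (t : Sˣ) (ht : ∀ r, t * c r = c r * t) :
    R[T;T⁻¹] →+* S :=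
  AddMonoidAlgebra.liftNCRingHom c ((Units.coeHom S).comp (zpowersHom Sˣ t)) fun r n =>
    (Commute.units_zpow_right (show Commute (c r) t from (ht r).symm) n.toAdd)

theorem laurentEval_C_mul_T (c : R →+* S) (t : Sˣ) (ht : ∀ r, t * c r = c r * t) (r : R) (n : ℤ) :
    laurentEval c t ht (C r * T n) = c r * ↑(t ^ n) := by
  rw [← single_eq_C_mul_T]
  exact AddMonoidAlgebra.liftNC_single _ _ _ _

@[simp] theorem laurentEval_C (c : R →+* S) (t : Sˣ) (ht : ∀ r, t * c r = c r * t) (r : R) :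
    laurentEval c t ht (C r) = c r := by
  have := laurentEval_C_mul_T c t ht r 0
  simpa using this

@[simp] theorem laurentEval_T (c : R →+* S) (t : Sˣ) (ht : ∀ r, t * c r = c r * t) (n : ℤ) :
    laurentEval c t ht (T n) = ↑(t ^ n) := by
  have := laurentEval_C_mul_T c t ht 1 n
  simpa using this

theorem laurent_hom_ext {f g : R[T;T⁻¹] →+* S} (hC : ∀ r, f (C r) = g (C r))
    (hT : f (T 1) = g (T 1)) : f = g := by
  have h1 : ∀ n : ℤ, f (T n) = g (T n) := by
    have h2 : ∀ n : ℕ, f (T n) = g (T n) := fun n => by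
      have := T_pow (R := R) 1 n
      rw [mul_one] at this
      rw [← this, map_pow, map_pow, hT]
    intro n
    obtain ⟨n, rfl | rfl⟩ := n.eq_nat_or_neg
    · exact h2 n
    · refine left_inv_eq_right_inv (a := f (T n)) ?_ ?_
      · rw [← map_mul, ← T_add, neg_add_cancel, T_zero, map_one]
      · rw [h2, ← map_mul, ← T_add, add_neg_cancel, T_zero, map_one]
  refine RingHom.ext fun x => ?_
  induction x using LaurentPolynomial.induction_on' with
  | add p q hp hq => rw [map_add, map_add, hp, hq]
  | C_mul_T n a => rw [map_mul, map_mul, hC, h1]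

variable (R)

/-- The unit `T` of `R[T, T⁻¹]`. -/
noncomputable def laurentT : R[T;T⁻¹]ˣ where
  val := T 1
  inv := T (-1)
  val_inv := by rw [← T_add]; rfl
  inv_val := by rw [← T_add]; rfl

theorem laurentT_val : (laurentT R : R[T;T⁻¹]) = T 1 := rfl

theorem laurentT_comm (r : R) : (laurentT R : R[T;T⁻¹]) * C r = C r * laurentT R := T_mul 1 _

/-- Evaluation of Laurent polynomials at `1`. -/
noncomputable def laurentOne : R[T;T⁻¹] →+* R := laurentEval (RingHom.id R) 1 fun r => by simp

/-- The embedding `R[X] → R[T, T⁻¹]`, `X ↦ T⁻¹`. -/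
noncomputable def toLaurentNeg : Polynomial R →+* R[T;T⁻¹] :=
  Polynomial.eval₂RingHom' C (T (-1)) fun _ => (commute_T _ _).symm

/-- The subgroup of `K₁ R[T, T⁻¹]` generated by the images of `K₀ R`, `K₁ R[T]`, `K₁ R[T⁻¹]`. -/
noncomputable def laurentGen : AddSubgroup (K1 R[T;T⁻¹]) :=
  (beta C (laurentT R) (laurentT_comm R)).range ⊔
    ((K1.map (Polynomial.toLaurent (R := R))).range ⊔ (K1.map (toLaurentNeg R)).range)

variable {R}

theorem beta_mem_laurentGen (x : K0 R) :
    beta C (laurentT R) (laurentT_comm R) x ∈ laurentGen R :=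
  AddSubgroup.mem_sup_left ⟨x, rfl⟩

theorem map_toLaurent_mem (x : K1 (Polynomial R)) :
    K1.map (Polynomial.toLaurent (R := R)) x ∈ laurentGen R :=
  AddSubgroup.mem_sup_right (AddSubgroup.mem_sup_left ⟨x, rfl⟩)

theorem map_toLaurentNeg_mem (x : K1 (Polynomial R)) :
    K1.map (toLaurentNeg R) x ∈ laurentGen R :=
  AddSubgroup.mem_sup_right (AddSubgroup.mem_sup_right ⟨x, rfl⟩)

theorem map_C_mem (x : K1 R) : K1.map (C : R →+* R[T;T⁻¹]) x ∈ laurentGen R := by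
  have h : (C : R →+* R[T;T⁻¹]) = (Polynomial.toLaurent (R := R)).comp Polynomial.C := by
    ext1 r
    exact (Polynomial.toLaurent_C r).symm
  rw [h, K1.map_comp]
  exact map_toLaurent_mem _

end LaurentEval

/-! ### Idempotents from nilpotency of `b (1 - b)` -/

section Nilpotent

variable {M : Type*} [Ring M]

/-- The polynomial `p = 1 - (1 - X^k)^k` is divisible by `X^k` and `1 - p` is divisible by `(1 -
X)^k`, so `p` is idempotent modulo `(X (1 - X))^k`. Then `e = p(b)` separates the part where `1 - b`
is nilpotent from the part where `b` is. -/
theorem exists_idem_of_nilpotent {b : M} {k : ℕ} (hk : k ≠ 0) (hb : (b * (1 - b)) ^ k = 0) :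
    ∃ e : M, e * e = e ∧ b * e = e * b ∧ ((1 - e) * b) ^ k = 0 ∧ (e * (1 - b)) ^ k = 0 := by
  let p : Polynomial ℤ := 1 - (1 - Polynomial.X ^ k) ^ k
  let a : Polynomial ℤ →ₐ[ℤ] M := Polynomial.aeval b
  have hX : a Polynomial.X = b := Polynomial.aeval_X b
  have h0 : a ((Polynomial.X * (1 - Polynomial.X)) ^ k) = 0 := by
    rw [map_pow, map_mul, map_sub, map_one, hX, hb]
  have hz : ∀ q : Polynomial ℤ, (Polynomial.X * (1 - Polynomial.X)) ^ k ∣ q → a q = 0 := by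
    rintro _ ⟨q, rfl⟩
    rw [map_mul, h0, zero_mul]
  have h1 : (1 - Polynomial.X) ^ k ∣ 1 - p := by
    rw [sub_sub_cancel]
    refine pow_dvd_pow_of_dvd ?_ k
    have := sub_dvd_pow_sub_pow (1 : Polynomial ℤ) Polynomial.X k
    rwa [one_pow] at this
  have h2 : Polynomial.X ^ k ∣ p := by
    have := sub_dvd_pow_sub_pow (1 : Polynomial ℤ) (1 - Polynomial.X ^ k) k
    rwa [one_pow, sub_sub_cancel] at this
  refine ⟨a p, ?_, ?_, ?_, ?_⟩
  · rw [← sub_eq_zero, ← map_mul, ← map_sub, ← neg_eq_zero, ← map_neg]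
    refine hz _ ?_
    rw [mul_pow, show -(p * p - p) = p * (1 - p) by ring]
    exact mul_dvd_mul h2 h1
  · rw [← hX, ← map_mul, ← map_mul, mul_comm]
  · rw [← hX, ← map_one a, ← map_sub, ← map_mul, ← map_pow]
    refine hz _ ?_
    rw [mul_pow, mul_pow, mul_comm]
    exact mul_dvd_mul (h1.trans (dvd_pow_self _ hk)) dvd_rfl
  · rw [← hX, ← map_one a, ← map_sub, ← map_mul, ← map_pow]
    refine hz _ ?_
    rw [mul_pow, mul_pow]
    exact mul_dvd_mul (h2.trans (dvd_pow_self _ hk)) dvd_rfl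

/-- On the image of `e` one has `1 + b (t - 1) = t (1 + (1 - b)(t⁻¹ - 1))`; on that of `1 - e` the
second factor alone is `1 + b (t - 1)`. In the application the second factor is unipotent over
`R[T]` and the third over `R[T⁻¹]`. -/
theorem linear_factorization {b e t t' : M} (he : e * e = e) (hbe : b * e = e * b)
    (hte : t * e = e * t) (htb : t * b = b * t) (htt : t * t' = 1) :
    (1 - e + e * t) * (1 + (1 - e) * b * (t - 1)) * (1 + e * (1 - b) * (t' - 1)) =
      1 + b * (t - 1) := by
  have e2 : ∀ x, e * (e * x) = e * x := fun x => by rw [← mul_assoc, he]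
  have be2 : ∀ x, b * (e * x) = e * (b * x) := fun x => by rw [← mul_assoc, hbe, mul_assoc]
  have te2 : ∀ x, t * (e * x) = e * (t * x) := fun x => by rw [← mul_assoc, hte, mul_assoc]
  have tb2 : ∀ x, t * (b * x) = b * (t * x) := fun x => by rw [← mul_assoc, htb, mul_assoc]
  have h1 : (1 - e + e * t) * (1 + (1 - e) * b * (t - 1)) =
      1 - e + e * t + (1 - e) * b * (t - 1) := by
    simp only [mul_add, add_mul, mul_sub, sub_mul, mul_one, one_mul, mul_assoc, e2, te2, htb, tb2]
    abel
  have h2 : (1 - e + e * t + (1 - e) * b * (t - 1)) * e = e * t := by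
    simp only [add_mul, mul_sub, sub_mul, mul_one, one_mul, mul_assoc, he, e2, hbe, be2, hte]
    abel
  rw [h1, mul_add, mul_one, ← mul_assoc, ← mul_assoc, h2]
  simp only [mul_sub, sub_mul, mul_one, one_mul, mul_assoc, htb, htt]
  abel

end Nilpotent

end HomotopyK

end

section

namespace HomotopyK

open LaurentPolynomial

/-! ### Linear invertible Laurent matrices -/

section Higman

variable {R : Type u} [Ring R] {ι : Type} [Fintype ι] [DecidableEq ι]

theorem laurent_coeff_C_mul (r : R) (x : R[T;T⁻¹]) (i : ℤ) : (C r * x).coeff i = r * x.coeff i := by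
  rw [← single_eq_C, AddMonoidAlgebra.coeff_single_mul_apply, neg_zero, zero_add]

theorem laurent_coeff_mul_C (r : R) (x : R[T;T⁻¹]) (i : ℤ) : (x * C r).coeff i = x.coeff i * r := by
  rw [← single_eq_C, AddMonoidAlgebra.coeff_mul_single_apply, neg_zero, add_zero]

theorem laurent_coeff_T_mul (n : ℤ) (x : R[T;T⁻¹]) (i : ℤ) :
    (T n * x).coeff i = x.coeff (i - n) := by
  rw [T, AddMonoidAlgebra.coeff_single_mul_apply, one_mul, neg_add_eq_sub]

theorem laurent_coeff_C (r : R) (i : ℤ) : (C r : R[T;T⁻¹]).coeff i = if i = 0 then r else 0 := by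
  rw [← single_eq_C, AddMonoidAlgebra.coeff_single, Finsupp.single_apply]
  simp only [eq_comm]

/-- The matrix of the `i`-th coefficients. -/
def coeffMat (i : ℤ) (x : Matrix ι ι R[T;T⁻¹]) : Matrix ι ι R := x.map fun f => f.coeff i

theorem coeffMat_add (i : ℤ) (x y : Matrix ι ι R[T;T⁻¹]) :
    coeffMat i (x + y) = coeffMat i x + coeffMat i y := rfl

theorem coeffMat_map_C_mul (i : ℤ) (a : Matrix ι ι R) (x : Matrix ι ι R[T;T⁻¹]) :
    coeffMat i (a.map C * x) = a * coeffMat i x := by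
  ext j k
  simp only [coeffMat, Matrix.map_apply, Matrix.mul_apply, AddMonoidAlgebra.coeff_sum,
    Finsupp.coe_finsetSum, Finset.sum_apply, laurent_coeff_C_mul]

theorem coeffMat_mul_map_C (i : ℤ) (a : Matrix ι ι R) (x : Matrix ι ι R[T;T⁻¹]) :
    coeffMat i (x * a.map C) = coeffMat i x * a := by
  ext j k
  simp only [coeffMat, Matrix.map_apply, Matrix.mul_apply, AddMonoidAlgebra.coeff_sum,
    Finsupp.coe_finsetSum, Finset.sum_apply, laurent_coeff_mul_C]

theorem coeffMat_diag_mul (i : ℤ) (x : Matrix ι ι R[T;T⁻¹]) :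
    coeffMat i ((Matrix.diagonal fun _ => T 1) * x) = coeffMat (i - 1) x := by
  ext j k
  simp only [coeffMat, Matrix.map_apply, Matrix.diagonal_mul, laurent_coeff_T_mul]

theorem coeffMat_one (i : ℤ) :
    coeffMat i (1 : Matrix ι ι R[T;T⁻¹]) = if i = 0 then 1 else 0 := by
  have h1 := laurent_coeff_C (1 : R) i
  rw [map_one] at h1
  ext j k
  rw [coeffMat, Matrix.map_apply, Matrix.one_apply]
  by_cases hj : j = k
  · subst hj
    rw [if_pos rfl, h1]
    split_ifs <;> simp
  · rw [if_neg hj]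
    split_ifs <;> simp [hj]

theorem exists_coeffMat_eq_zero (x : Matrix ι ι R[T;T⁻¹]) :
    ∃ m : ℕ, ∀ i : ℤ, (m : ℤ) < |i| → coeffMat i x = 0 := by
  let s : Finset ℤ := Finset.univ.biUnion fun p : ι × ι => (x p.1 p.2).coeff.support
  refine ⟨s.sup Int.natAbs, fun i hi => ?_⟩
  ext j k
  by_contra h
  have hs : i ∈ s := Finset.mem_biUnion.2 ⟨(j, k), Finset.mem_univ _, Finsupp.mem_support_iff.2 h⟩
  have := Finset.le_sup (f := Int.natAbs) hs
  rw [Int.abs_eq_natAbs] at hi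
  omega

/-- If `1 + b (T - 1)` is invertible over `R[T, T⁻¹]` then `b (1 - b)` is nilpotent. -/
theorem nilpotent_of_linear_unit {b : Matrix ι ι R} {g : (Matrix ι ι R[T;T⁻¹])ˣ}
    (hg : (g : Matrix ι ι R[T;T⁻¹]) =
      1 + b.map C * ((Matrix.diagonal fun _ => T 1) - 1)) :
    ∃ k : ℕ, k ≠ 0 ∧ (b * (1 - b)) ^ k = 0 := by
  set t : Matrix ι ι R[T;T⁻¹] := Matrix.diagonal fun _ => T 1 with ht
  set y : Matrix ι ι R[T;T⁻¹] := ↑g⁻¹ with hy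
  have tb : t * b.map C = b.map C * t := diagUnit_comm C (laurentT R) (laurentT_comm R) b
  have hgb : (g : Matrix ι ι R[T;T⁻¹]) * b.map C = b.map C * g := by
    rw [hg]
    simp only [add_mul, mul_add, mul_sub, sub_mul, mul_one, one_mul, mul_assoc, tb]
  have hyb : y * b.map C = b.map C * y := by
    rw [hy, Units.inv_mul_eq_iff_eq_mul, ← mul_assoc, hgb, mul_assoc, g.mul_inv, mul_one]
  set h : ℤ → Matrix ι ι R := fun i => coeffMat i y with hh
  have hcomm : ∀ i, Commute b (h i) := fun i => by
    have := congrArg (coeffMat i) hyb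
    rw [coeffMat_mul_map_C, coeffMat_map_C_mul] at this
    exact this.symm
  -- Comparing coefficients in `g y = 1`, with `g = (1 - b) + b T`, gives a two-term recursion for
  -- the coefficients `h i` of the inverse `y`.
  have hrec : ∀ i, (1 - b) * h i + b * h (i - 1) = if i = 0 then 1 else 0 := fun i => by
    have h1 : (1 - b).map C * y + b.map C * (t * y) = 1 := by
      rw [← g.mul_inv, ← hy, hg, Matrix.map_sub C (map_sub C),
        Matrix.map_one C (map_zero C) (map_one C)]
      simp only [add_mul, mul_sub, sub_mul, mul_one, one_mul, mul_assoc]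
      abel
    have h2 := congrArg (coeffMat i) h1
    rw [coeffMat_add, coeffMat_map_C_mul, coeffMat_map_C_mul, coeffMat_diag_mul, coeffMat_one] at h2
    exact h2
  obtain ⟨m, hm⟩ := exists_coeffMat_eq_zero y
  have hb1 : Commute b (1 - b) := (Commute.one_right b).sub_right (Commute.refl b)
  -- The recursion run upwards expresses `b^k h 0` through `h k`, and run downwards from `-1` it
  -- expresses `(1 - b)^k h (-1)` through `h (-1 - k)`. Both vanish for large `k`, as `y` has
  -- finitely many coefficients.
  have hpos : ∀ k : ℕ, b ^ k * h 0 = (-1) ^ k * ((1 - b) ^ k * h k) := by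
    intro k
    induction k with
    | zero => simp
    | succ k ih =>
      have h1 := hrec (k + 1)
      rw [if_neg (by omega), add_sub_cancel_right, add_comm, add_eq_zero_iff_eq_neg] at h1
      rw [pow_succ' b, mul_assoc, ih]
      have h2 : b * ((-1) ^ k * ((1 - b) ^ k * h k)) = (-1) ^ k * ((1 - b) ^ k * (b * h k)) := by
        rw [← mul_assoc, ← mul_assoc, ← ((Commute.neg_one_left b).pow_left k).eq, mul_assoc,
          mul_assoc, ← mul_assoc b, (hb1.pow_right k).eq, mul_assoc]
      rw [h2, h1, pow_succ, pow_succ]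
      push_cast
      simp only [mul_neg, neg_mul, mul_one, mul_assoc]
  have hneg : ∀ k : ℕ, (1 - b) ^ k * h (-1) = (-1) ^ k * (b ^ k * h (-1 - k)) := by
    intro k
    induction k with
    | zero => simp
    | succ k ih =>
      have h1 := hrec (-1 - k)
      rw [if_neg (by omega), add_eq_zero_iff_eq_neg] at h1
      rw [pow_succ' (1 - b), mul_assoc, ih]
      have h2 : (1 - b) * ((-1) ^ k * (b ^ k * h (-1 - k))) =
          (-1) ^ k * (b ^ k * ((1 - b) * h (-1 - k))) := by
        rw [← mul_assoc, ← mul_assoc, ← ((Commute.neg_one_left (1 - b)).pow_left k).eq, mul_assoc,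
          mul_assoc, ← mul_assoc (1 - b), ← (hb1.pow_left k).eq, mul_assoc]
      rw [h2, h1, pow_succ, pow_succ, show (-1 - ((k + 1 : ℕ) : ℤ)) = -1 - k - 1 by push_cast; ring]
      simp only [mul_neg, neg_mul, mul_one, mul_assoc]
  have h0 : b ^ (m + 1) * h 0 = 0 := by
    rw [hpos, hh]
    dsimp only
    rw [hm _ (by rw [abs_of_nonneg (by omega)]; push_cast; omega), mul_zero, mul_zero]
  have h1 : (1 - b) ^ (m + 1) * h (-1) = 0 := by
    rw [hneg, hh]
    dsimp only
    rw [hm _ (by rw [abs_of_neg (by omega)]; push_cast; omega), mul_zero, mul_zero]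
  refine ⟨m + 1, by omega, ?_⟩
  have h2 := hrec 0
  rw [if_pos rfl, zero_sub] at h2
  -- At `0` the recursion reads `1 = (1 - b) h 0 + b h (-1)`. After multiplication by `b^(m+1) (1 -
  -- b)^(m+1)` each summand contains one of the vanishing products `h0`, `h1`.
  have h3 : (b * (1 - b)) ^ (m + 1) = (b * (1 - b)) ^ (m + 1) * ((1 - b) * h 0 + b * h (-1)) := by
    rw [h2, mul_one]
  rw [h3, hb1.mul_pow, mul_add]
  have e1 : b ^ (m + 1) * (1 - b) ^ (m + 1) * ((1 - b) * h 0) = 0 := by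
    rw [(hb1.pow_pow _ _).eq, ← mul_assoc, mul_assoc _ (b ^ (m + 1)), (hb1.pow_left _).eq,
      ← mul_assoc, mul_assoc, h0, mul_zero]
  have e2 : b ^ (m + 1) * (1 - b) ^ (m + 1) * (b * h (-1)) = 0 := by
    rw [← mul_assoc, mul_assoc _ _ b, ← (hb1.pow_right _).eq, mul_assoc, mul_assoc, h1, mul_zero,
      mul_zero]
  rw [e1, e2, add_zero]

theorem exists_unit_of_nilpotent {N : Matrix ι ι R} {k : ℕ} (hN : N ^ k = 0) :
    ∃ g : (Matrix ι ι (Polynomial R))ˣ, (g : Matrix ι ι (Polynomial R)) =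
      1 + N.map Polynomial.C * Matrix.diagonal fun _ => Polynomial.X - 1 := by
  have hc : Commute (N.map Polynomial.C)
      (Matrix.diagonal fun _ => (Polynomial.X - 1 : Polynomial R)) := by
    ext i j : 1
    rw [Matrix.diagonal_mul, Matrix.mul_diagonal]
    simp [mul_sub, sub_mul, Polynomial.X_mul_C]
  have h2 : N.map Polynomial.C ^ k = 0 := by
    rw [show N.map Polynomial.C = (Polynomial.C : R →+* Polynomial R).mapMatrix N from rfl,
      ← map_pow, hN, map_zero]
  have h1 : IsNilpotent (N.map Polynomial.C *
      Matrix.diagonal fun _ => (Polynomial.X - 1 : Polynomial R)) :=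
    ⟨k, by rw [hc.mul_pow, h2, zero_mul]⟩
  obtain ⟨g, hg⟩ := h1.isUnit_one_add
  exact ⟨g, hg⟩

/-- Invertibility forces `b (1 - b)` to be nilpotent, and the idempotent so obtained factors `g`
into `1 - e + eT`, a unipotent matrix over `R[T]` and one over `R[T⁻¹]`: one factor for each kind of
generator. -/
theorem mem_laurentGen_of_linear_one {b : Matrix ι ι R} {g : (Matrix ι ι R[T;T⁻¹])ˣ}
    (hg : (g : Matrix ι ι R[T;T⁻¹]) = 1 + b.map C * ((Matrix.diagonal fun _ => T 1) - 1)) :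
    K1.mk g ∈ laurentGen R := by
  obtain ⟨k, hk, hb⟩ := nilpotent_of_linear_unit hg
  obtain ⟨e, he, hbe, h1, h2⟩ := exists_idem_of_nilpotent hk hb
  obtain ⟨p, hp⟩ := exists_unit_of_nilpotent h1
  obtain ⟨q, hq⟩ := exists_unit_of_nilpotent h2
  have key : g = betaUnit C (laurentT R) (laurentT_comm R) e he *
      Units.map (Polynomial.toLaurent (R := R)).mapMatrix.toMonoidHom p *
      Units.map (toLaurentNeg R).mapMatrix.toMonoidHom q := by
    ext1
    set t : Matrix ι ι R[T;T⁻¹] := (diagUnit ι (laurentT R)).val with ht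
    set t' : Matrix ι ι R[T;T⁻¹] := (diagUnit ι (laurentT R)).inv with ht'
    have hP : (p : Matrix ι ι (Polynomial R)).map (Polynomial.toLaurent (R := R)) =
        1 + (1 - e.map C) * b.map C * (t - 1) := by
      rw [hp, Matrix.map_add _ (map_add _), Matrix.map_mul, Matrix.map_map,
        Matrix.map_one _ (map_zero _) (map_one _), Polynomial.toLaurent_comp_C, Matrix.map_mul,
        Matrix.map_sub _ (map_sub C), Matrix.map_one _ (map_zero C) (map_one C)]
      congr 2
      ext i j : 1
      by_cases hij : i = j
      · subst hij
        simp [ht, diagUnit_val, laurentT_val]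
      · simp [ht, diagUnit_val, hij]
    have hQ : (q : Matrix ι ι (Polynomial R)).map (toLaurentNeg R) =
        1 + e.map C * (1 - b.map C) * (t' - 1) := by
      rw [hq, Matrix.map_add _ (map_add _), Matrix.map_mul, Matrix.map_map,
        Matrix.map_one _ (map_zero _) (map_one _),
        show (⇑(toLaurentNeg R) ∘ ⇑Polynomial.C) = ⇑C from
          funext fun r => Polynomial.eval₂_C _ _, Matrix.map_mul,
        Matrix.map_sub _ (map_sub C), Matrix.map_one _ (map_zero C) (map_one C)]
      congr 2
      have hX : toLaurentNeg R Polynomial.X = T (-1) := Polynomial.eval₂_X _ _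
      have hv : t' = Matrix.diagonal fun _ => T (-1) := rfl
      ext i j : 1
      by_cases hij : i = j
      · subst hij
        simp [hv, hX]
      · simp [hv, hij]
    change _ = (betaUnit C (laurentT R) (laurentT_comm R) e he : Matrix ι ι R[T;T⁻¹]) *
      (p : Matrix ι ι (Polynomial R)).map (Polynomial.toLaurent (R := R)) *
      (q : Matrix ι ι (Polynomial R)).map (toLaurentNeg R)
    rw [hP, hQ, hg]
    exact (linear_factorization (map_idem C he) (by rw [← Matrix.map_mul, hbe, Matrix.map_mul])
      (diagUnit_comm C _ (laurentT_comm R) e) (diagUnit_comm C _ (laurentT_comm R) b)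
      (diagUnit ι (laurentT R)).mul_inv).symm
  rw [key, K1.mk_mul, K1.mk_mul, ← beta_mk, ← K1.map_mk, ← K1.map_mk]
  exact add_mem (add_mem (beta_mem_laurentGen _) (map_toLaurent_mem _)) (map_toLaurentNeg_mem _)

end Higman

end HomotopyK

end

section

namespace HomotopyK

open LaurentPolynomial

/-! ### Higman linearization -/

section Reduction

variable {R : Type u} [Ring R]

theorem laurentOne_C (r : R) : laurentOne R (C r) = r := laurentEval_C _ _ _ _

theorem laurentOne_T (n : ℤ) : laurentOne R (T n) = 1 := by
  rw [laurentOne, laurentEval_T, one_zpow, Units.val_one]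

/-- The value `a + b` of `g` at `T = 1` is invertible over `R`; dividing by it brings `g` to the
form `1 + b' (T - 1)`. -/
theorem mem_laurentGen_of_linear {ι : Type} [Fintype ι] [DecidableEq ι] {a b : Matrix ι ι R}
    {g : (Matrix ι ι R[T;T⁻¹])ˣ}
    (hg : (g : Matrix ι ι R[T;T⁻¹]) = a.map C + b.map C * Matrix.diagonal fun _ => T 1) :
    K1.mk g ∈ laurentGen R := by
  let s : (Matrix ι ι R)ˣ := Units.map (laurentOne R).mapMatrix.toMonoidHom g
  have hs : (s : Matrix ι ι R) = a + b := by
    change (g : Matrix ι ι R[T;T⁻¹]).map (laurentOne R) = _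
    rw [hg]
    ext i j
    simp [Matrix.mul_diagonal, laurentOne_C, laurentOne_T]
  let s' : (Matrix ι ι R[T;T⁻¹])ˣ := Units.map (C : R →+* R[T;T⁻¹]).mapMatrix.toMonoidHom s⁻¹
  have h1 : K1.mk (s' * g) ∈ laurentGen R := by
    refine mem_laurentGen_of_linear_one (b := (↑s⁻¹ : Matrix ι ι R) * b) ?_
    have h2 : a = s - b := by rw [hs, add_sub_cancel_right]
    change (↑s⁻¹ : Matrix ι ι R).map C * (g : Matrix ι ι R[T;T⁻¹]) = _
    rw [hg, h2, mul_add, ← Matrix.map_mul, mul_sub, s.inv_mul, Matrix.map_sub C (map_sub C),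
      Matrix.map_one C (map_zero C) (map_one C), ← mul_assoc, ← Matrix.map_mul]
    rw [mul_sub, mul_one]
    abel
  have h2 : K1.mk g = K1.mk (s' * g) - K1.map C (K1.mk s⁻¹) := by
    rw [K1.mk_mul, K1.map_mk]
    abel
  rw [h2]
  exact sub_mem h1 (map_C_mem _)

/-- Laurent polynomials with support in `[0, d]`. -/
def DegLE (d : ℕ) (x : R[T;T⁻¹]) : Prop := ∀ i, x.coeff i ≠ 0 → 0 ≤ i ∧ i ≤ d

theorem DegLE.linear {x : R[T;T⁻¹]} (h : DegLE 1 x) : x = C (x.coeff 0) + C (x.coeff 1) * T 1 := by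
  ext i
  rw [AddMonoidAlgebra.coeff_add, Finsupp.add_apply, T_mul 1 (C _) |>.symm, laurent_coeff_T_mul,
    laurent_coeff_C, laurent_coeff_C]
  by_cases h0 : i = 0
  · subst h0
    simp
  by_cases h1 : i = 1
  · subst h1
    simp
  · rw [if_neg h0, if_neg (by omega), add_zero]
    by_contra hx
    have := h i hx
    push_cast at this
    omega

/-- The quotient of a Laurent polynomial by `T`, discarding the constant term. -/
noncomputable def divT (x : R[T;T⁻¹]) : R[T;T⁻¹] := T (-1) * (x - C (x.coeff 0))

theorem add_T_mul_divT (x : R[T;T⁻¹]) : C (x.coeff 0) + T 1 * divT x = x := by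
  rw [divT, ← mul_assoc, ← T_add, add_neg_cancel, T_zero, one_mul, add_sub_cancel]

theorem coeff_divT (x : R[T;T⁻¹]) (i : ℤ) :
    (divT x).coeff i = if i = -1 then 0 else x.coeff (i + 1) := by
  rw [divT, laurent_coeff_T_mul, AddMonoidAlgebra.coeff_sub, Finsupp.sub_apply, laurent_coeff_C,
    sub_neg_eq_add]
  by_cases h : i = -1
  · subst h
    simp
  · rw [if_neg (by omega), if_neg h, sub_zero]

theorem DegLE.divT {d : ℕ} {x : R[T;T⁻¹]} (h : DegLE (d + 1) x) : DegLE d (divT x) := by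
  intro i hi
  rw [coeff_divT] at hi
  split_ifs at hi with h1
  · exact absurd rfl hi
  · have := h _ hi
    push_cast at this
    omega

theorem DegLE.C (d : ℕ) (r : R) : DegLE d (C r) := by
  intro i hi
  rw [laurent_coeff_C] at hi
  split_ifs at hi with h
  · omega
  · exact absurd rfl hi

theorem DegLE.T_one (d : ℕ) : DegLE (d + 1) (T 1 : R[T;T⁻¹]) := by
  intro i hi
  rw [T_apply] at hi
  split_ifs at hi with h
  · omega
  · exact absurd rfl hi

theorem DegLE.neg {d : ℕ} {x : R[T;T⁻¹]} (h : DegLE d x) : DegLE d (-x) := by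
  intro i hi
  refine h i fun h0 => hi ?_
  rw [AddMonoidAlgebra.coeff_neg, Finsupp.neg_apply, h0, neg_zero]

/-- Higman's trick: for `g = a + T q`, elementary operations turn `g ⊕ 1` into `[[a, T], [-q, 1]]`,
which has twice the size and degree lower by one. The induction ends in degree one, the degree of
the block `T`. -/
theorem mem_laurentGen_of_degLE (d : ℕ) {ι : Type} [Fintype ι] [DecidableEq ι]
    {g : (Matrix ι ι R[T;T⁻¹])ˣ} (hg : ∀ i j, DegLE (d + 1) ((g : Matrix ι ι R[T;T⁻¹]) i j)) :
    K1.mk g ∈ laurentGen R := by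
  induction d generalizing ι with
  | zero =>
    refine mem_laurentGen_of_linear (a := (g : Matrix ι ι R[T;T⁻¹]).map fun x => x.coeff 0)
      (b := (g : Matrix ι ι R[T;T⁻¹]).map fun x => x.coeff 1) ?_
    ext i j : 1
    rw [Matrix.add_apply, Matrix.mul_diagonal]
    exact (hg i j).linear
  | succ d ih =>
    let q : Matrix ι ι R[T;T⁻¹] := (g : Matrix ι ι R[T;T⁻¹]).map divT
    let a : Matrix ι ι R[T;T⁻¹] := (g : Matrix ι ι R[T;T⁻¹]).map fun x => C (x.coeff 0)
    let t : Matrix ι ι R[T;T⁻¹] := Matrix.diagonal fun _ => T 1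
    let G := upperUnit t * UExt.unitsBlocks g (1 : (Matrix ι ι R[T;T⁻¹])ˣ) * lowerUnit (-q)
    have h1 : K1.mk G = K1.mk g := by
      rw [K1.mk_mul, K1.mk_mul, K1.mk_upperUnit, K1.mk_lowerUnit, K1.mk_blocks, K1.mk_one]
      abel
    have h2 : (G : Matrix (ι ⊕ ι) (ι ⊕ ι) R[T;T⁻¹]) = Matrix.fromBlocks a t (-q) 1 := by
      change Matrix.fromBlocks 1 t 0 1 * Matrix.fromBlocks (g : Matrix ι ι R[T;T⁻¹]) 0 0 1 *
        Matrix.fromBlocks 1 0 (-q) 1 = _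
      have h3 : (g : Matrix ι ι R[T;T⁻¹]) - t * q = a := by
        rw [sub_eq_iff_eq_add]
        ext i j : 1
        rw [Matrix.add_apply, Matrix.diagonal_mul]
        exact (add_T_mul_divT _).symm
      simp [Matrix.fromBlocks_multiply, ← h3, sub_eq_add_neg]
    rw [← h1]
    refine ih fun i j => ?_
    rw [h2]
    rcases i with i | i <;> rcases j with j | j
    · exact DegLE.C _ _
    · change DegLE (d + 1) ((Matrix.diagonal fun _ => T 1 : Matrix ι ι R[T;T⁻¹]) i j)
      rw [Matrix.diagonal_apply]
      split_ifs
      · exact DegLE.T_one d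
      · rw [← map_zero (LaurentPolynomial.C : R →+* R[T;T⁻¹])]
        exact DegLE.C _ _
    · exact (hg i j).divT.neg
    · rw [Matrix.fromBlocks_apply₂₂, Matrix.one_apply]
      split_ifs
      · rw [← map_one (LaurentPolynomial.C : R →+* R[T;T⁻¹])]
        exact DegLE.C _ _
      · rw [← map_zero (LaurentPolynomial.C : R →+* R[T;T⁻¹])]
        exact DegLE.C _ _

theorem mk_diagUnit_laurentT (n : ℕ) : K1.mk (diagUnit (Fin n) (laurentT R)) =
    beta C (laurentT R) (laurentT_comm R) (K0.mk (1 : Matrix (Fin n) (Fin n) R) (one_mul 1)) := by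
  rw [beta_mk]
  refine K1.mk_congr ?_
  rw [betaUnit_val, Matrix.map_one C (map_zero C) (map_one C), one_mul, sub_self, zero_add]
  rfl

/-- `K₁ R[T, T⁻¹]` is generated by the images of `K₀ R`, `K₁ R[T]` and `K₁ R[T⁻¹]`. -/
theorem mem_laurentGen (x : K1 R[T;T⁻¹]) : x ∈ laurentGen R := by
  obtain ⟨n, g, rfl⟩ := K1.exists_cls x
  obtain ⟨m, hm⟩ := exists_coeffMat_eq_zero (g : Matrix (Fin n) (Fin n) R[T;T⁻¹])
  let D := diagUnit (Fin n) (laurentT R)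
  have hD : ∀ (k : ℕ) i j, ((D ^ k * g : (Matrix (Fin n) (Fin n) R[T;T⁻¹])ˣ) :
      Matrix (Fin n) (Fin n) R[T;T⁻¹]) i j = T k * (g : Matrix (Fin n) (Fin n) R[T;T⁻¹]) i j := by
    intro k i j
    induction k with
    | zero => simp
    | succ k ih =>
      rw [pow_succ', mul_assoc, Units.val_mul, diagUnit_val, Matrix.diagonal_mul, ih, laurentT_val,
        ← mul_assoc, ← T_add, add_comm]
      rfl
  -- Multiplication by `T^m` moves the exponents from `[-m, m]` to `[0, 2m]`. It changes the class
  -- by a multiple of that of the scalar matrix `T`, which is `beta` of an identity matrix.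
  have h1 : K1.mk (D ^ m * g) ∈ laurentGen R := by
    refine mem_laurentGen_of_degLE (2 * m) fun i j => ?_
    intro l hl
    rw [hD, laurent_coeff_T_mul] at hl
    have : ¬ (m : ℤ) < |l - m| := fun h => hl (congrFun (congrFun (hm _ h) i) j)
    rw [not_lt, abs_le] at this
    push_cast
    omega
  have h2 : ∀ k : ℕ, K1.mk (D ^ k) ∈ laurentGen R := by
    intro k
    induction k with
    | zero => rw [pow_zero, K1.mk_one]; exact zero_mem _
    | succ k ih =>
      rw [pow_succ, K1.mk_mul, mk_diagUnit_laurentT]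
      exact add_mem ih (beta_mem_laurentGen _)
  rw [K1.mk_mul] at h1
  exact (AddSubgroup.add_mem_cancel_left _ (h2 m)).1 h1

theorem exists_laurentGen (x : K1 R[T;T⁻¹]) : ∃ a b c,
    x = beta C (laurentT R) (laurentT_comm R) a + K1.map (Polynomial.toLaurent (R := R)) b +
      K1.map (toLaurentNeg R) c := by
  obtain ⟨_, ⟨a, rfl⟩, _, hy, rfl⟩ := AddSubgroup.mem_sup.1 (mem_laurentGen x)
  obtain ⟨_, ⟨b, rfl⟩, _, ⟨c, rfl⟩, rfl⟩ := AddSubgroup.mem_sup.1 hy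
  exact ⟨a, b, c, (add_assoc _ _ _).symm⟩

end Reduction

end HomotopyK

end

section

namespace HomotopyK

open LaurentPolynomial

/-! ### The homomorphism `R[T, T⁻¹] → Σ R` on `K₁` and on `K₀` -/

section Lambda

variable (R : Type u) [Ring R]

/-- The ring homomorphism `R[T, T⁻¹] → Σ R` sending `T` to `α`. -/
noncomputable def lam : R[T;T⁻¹] →+* Susp R :=
  laurentEval Susp.const (Susp.shiftU R) Susp.shiftU_comm

theorem lam_C (r : R) : lam R (C r) = Susp.const r := laurentEval_C _ _ _ _

theorem lam_T : lam R (T 1) = Susp.shift R := by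
  rw [lam, laurentEval_T, zpow_one]
  rfl

/-- The isomorphism `(Σ R)[T, T⁻¹] ≅ Σ (R[T, T⁻¹])`. -/
noncomputable def suspLaurent : (Susp R)[T;T⁻¹] ≃+* Susp R[T;T⁻¹] :=
  (coeffSusp R).swap (coeffLaurentU (Susp R)) (coeffLaurentU R) (coeffSusp R[T;T⁻¹])

/-- The transposition of the two suspension coordinates of `Σ Σ R`. -/
noncomputable def suspSwap : Susp (Susp R) ≃+* Susp (Susp R) :=
  (coeffSusp R).swap (coeffSusp (Susp R)) (coeffSusp R) (coeffSusp (Susp R))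

variable {R}

theorem laurentSmul_one (r : R) : (coeffLaurentU R).smul 1 r = C r := by
  rw [coeffLaurentU_smul, ← T_zero, laurentSmul_T, T_zero, mul_one]

theorem laurentSmul_T_one : (coeffLaurentU R).smul (T 1) 1 = T 1 := by
  rw [coeffLaurentU_smul, laurentSmul_T, map_one, one_mul]

theorem mapRingHom_smul {S : Type u} [Ring S] (f : R →+* S) (v : Susp ℤ) (r : R) :
    Susp.mapRingHom f ((coeffSusp R).smul v r) = (coeffSusp S).smul v (f r) :=
  Susp.map_smul (f : R →ₙ+* S) v r

theorem suspLaurent_C (s : Susp R) : suspLaurent R (C s) = Susp.mapRingHom C s := by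
  refine DFunLike.congr_fun ((coeffSusp R).addHom_ext
    (f := (suspLaurent R).toAddMonoidHom.comp (C : Susp R →+* (Susp R)[T;T⁻¹]).toAddMonoidHom)
    (g := (Susp.mapRingHom (C : R →+* R[T;T⁻¹])).toAddMonoidHom) fun v r => ?_) s
  change suspLaurent R (C _) = Susp.mapRingHom C _
  rw [← laurentSmul_one, suspLaurent, Coeff.swap_smul, mapRingHom_smul, laurentSmul_one]

theorem suspLaurent_T : suspLaurent R (T 1) = Susp.const (T 1) := by
  have h : (1 : Susp R) = (coeffSusp R).smul 1 1 := by rw [coeffSusp_one_smul, map_one]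
  rw [← laurentSmul_T_one, h, suspLaurent, Coeff.swap_smul, coeffSusp_one_smul, laurentSmul_T_one]

theorem suspSwap_map_const (s : Susp R) :
    suspSwap R (Susp.mapRingHom Susp.const s) = Susp.const s := by
  refine DFunLike.congr_fun ((coeffSusp R).addHom_ext
    (f := (suspSwap R).toAddMonoidHom.comp (Susp.mapRingHom (Susp.const (R := R))).toAddMonoidHom)
    (g := (Susp.const (R := Susp R)).toAddMonoidHom) fun v r => ?_) s
  change suspSwap R (Susp.mapRingHom Susp.const _) = Susp.const _
  rw [mapRingHom_smul, ← coeffSusp_one_smul r, suspSwap, Coeff.swap_smul, coeffSusp_one_smul]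

theorem suspSwap_const_shift : suspSwap R (Susp.const (Susp.shift R)) = Susp.shift (Susp R) := by
  have h : (1 : Susp R) = (coeffSusp R).smul 1 1 := by rw [coeffSusp_one_smul, map_one]
  rw [← coeffSusp_one_smul, ← coeffSusp_shift_smul, suspSwap, Coeff.swap_smul, ← h,
    coeffSusp_shift_smul]

theorem mapRingHom_const {S : Type u} [Ring S] (f : R →+* S) (r : R) :
    Susp.mapRingHom f (Susp.const r) = Susp.const (f r) := Susp.mapRingHom_diag f 0 0 r

/-- The left side sends `T` to the shift in the outer suspension coordinate, whereas the suspension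
of `lam R` produces the shift in the inner one; the transposition `suspSwap` accounts for the
difference. -/
theorem lam_susp : lam (Susp R) = ((suspSwap R : Susp (Susp R) →+* Susp (Susp R)).comp
    (Susp.mapRingHom (lam R))).comp (suspLaurent R : (Susp R)[T;T⁻¹] →+* Susp R[T;T⁻¹]) := by
  refine laurent_hom_ext (fun s => ?_) ?_
  · change lam (Susp R) (C s) = suspSwap R (Susp.mapRingHom (lam R) (suspLaurent R (C s)))
    rw [lam_C, suspLaurent_C, ← suspSwap_map_const]
    congr 1
    obtain ⟨a, rfl⟩ := Susp.mk_surjective s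
    refine congrArg Susp.mk ?_
    ext i j
    exact (lam_C R _).symm
  · change lam (Susp R) (T 1) = suspSwap R (Susp.mapRingHom (lam R) (suspLaurent R (T 1)))
    rw [lam_T, suspLaurent_T, mapRingHom_const, lam_T, suspSwap_const_shift]

theorem K1.map_bijective {S : Type v} [Ring S] (e : R ≃+* S) :
    Function.Bijective (K1.map (e : R →+* S)) := by
  refine Function.bijective_iff_has_inverse.2 ⟨K1.map (e.symm : S →+* R), fun x => ?_, fun x => ?_⟩
  · rw [← AddMonoidHom.comp_apply, ← K1.map_comp, RingEquiv.symm_comp, K1.map_id_apply]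
  · rw [← AddMonoidHom.comp_apply, ← K1.map_comp, RingEquiv.comp_symm, K1.map_id_apply]

theorem K1.map_lam_beta (a : K0 R) :
    K1.map (lam R) (beta C (laurentT R) (laurentT_comm R) a) = shiftHom a := by
  rw [shiftHom_eq_beta]
  exact map_beta C _ (laurentT_comm R) (lam R) _ _ Susp.shiftU_comm (lam_C R) (lam_T R) a

theorem shiftHom_map {S : Type u} [Ring S] (f : R →+* S) (x : K0 R) :
    shiftHom (K0.map f x) = K1.map (Susp.mapRingHom f) (shiftHom x) :=
  (DFunLike.congr_fun (shiftHom_natural f) x).symm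

/-- Through `shiftHom`, the effect of `lam (Susp R)` on `K₁` is that of `lam R` on `K₀`. Facts about
`K₁`, valid over every ring, thereby descend to `K₀`. -/
theorem K1.map_lam_susp (z : K0 R[T;T⁻¹]) {x : K1 (Susp R)[T;T⁻¹]}
    (hx : K1.map (suspLaurent R : (Susp R)[T;T⁻¹] →+* Susp R[T;T⁻¹]) x = shiftHom z) :
    K1.map (lam (Susp R)) x =
      K1.map (suspSwap R : Susp (Susp R) →+* Susp (Susp R)) (shiftHom (K0.map (lam R) z)) := by
  rw [lam_susp, K1.map_comp, K1.map_comp, AddMonoidHom.comp_apply, AddMonoidHom.comp_apply, hx,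
    shiftHom_map]

/-- Over `Σ R` the composite of `beta` with `λ` is `shiftHom`, which is onto; `K1.map_lam_susp`
transports this surjectivity from `K₁` to `K₀`. -/
theorem K0.map_lam_surjective : Function.Surjective (K0.map (lam R)) := by
  intro y
  obtain ⟨y', hy'⟩ := shiftHom_surjective (R := Susp R)
    (K1.map (suspSwap R : Susp (Susp R) →+* Susp (Susp R)) (shiftHom y))
  set x := beta C (laurentT (Susp R)) (laurentT_comm (Susp R)) y' with hx
  obtain ⟨z, hz⟩ := shiftHom_surjective (R := R[T;T⁻¹])
    (K1.map (suspLaurent R : (Susp R)[T;T⁻¹] →+* Susp R[T;T⁻¹]) x)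
  refine ⟨z, shiftHom_injective ((K1.map_bijective (suspSwap R)).1 ?_)⟩
  rw [← K1.map_lam_susp z hz.symm, hx, K1.map_lam_beta, hy']

/-- A polynomial variable need not go to a unit, so `X ↦ α` is already defined with values in the
cone `Γ R`, whose `K₁` vanishes. The same applies to `α*` and the inverse variable. -/
theorem K1.map_lam_toLaurent (x : K1 (Polynomial R)) :
    K1.map ((lam R).comp (Polynomial.toLaurent (R := R))) x = 0 := by
  let f : Polynomial R →+* Cone R := Polynomial.eval₂RingHom' Cone.const (Cone.diag 1 0 1)
    fun r => (Cone.shift_comm r).symm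
  have h : (lam R).comp (Polynomial.toLaurent (R := R)) = (coneExt R).proj.comp f := by
    refine Polynomial.ringHom_ext (fun r => ?_) ?_
    · change lam R (Polynomial.toLaurent (Polynomial.C r)) =
        (coneExt R).proj (Polynomial.eval₂ _ _ (Polynomial.C r))
      rw [Polynomial.toLaurent_C, lam_C, Polynomial.eval₂_C, coneExt_proj_const]
    · change lam R (Polynomial.toLaurent Polynomial.X) =
        (coneExt R).proj (Polynomial.eval₂ _ _ Polynomial.X)
      rw [Polynomial.toLaurent_X, lam_T, Polynomial.eval₂_X]
      rfl
  rw [h, K1.map_comp, AddMonoidHom.comp_apply, K1.cone_eq_zero (K1.map f x), _root_.map_zero]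

theorem lam_T_neg : lam R (T (-1)) = Susp.shift' R := by
  rw [lam, laurentEval_T, zpow_neg_one]
  rfl

theorem toLaurentNeg_C (r : R) : toLaurentNeg R (Polynomial.C r) = C r := Polynomial.eval₂_C _ _

theorem toLaurentNeg_X : toLaurentNeg R Polynomial.X = T (-1) := Polynomial.eval₂_X _ _

theorem K1.map_lam_toLaurentNeg (x : K1 (Polynomial R)) :
    K1.map ((lam R).comp (toLaurentNeg R)) x = 0 := by
  let f : Polynomial R →+* Cone R := Polynomial.eval₂RingHom' Cone.const (Cone.diag 0 1 1)
    fun r => (Cone.shift'_comm r).symm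
  have h : (lam R).comp (toLaurentNeg R) = (coneExt R).proj.comp f := by
    refine Polynomial.ringHom_ext (fun r => ?_) ?_
    · change lam R (toLaurentNeg R (Polynomial.C r)) =
        (coneExt R).proj (Polynomial.eval₂ _ _ (Polynomial.C r))
      rw [toLaurentNeg_C, lam_C, Polynomial.eval₂_C, coneExt_proj_const]
    · change lam R (toLaurentNeg R Polynomial.X) =
        (coneExt R).proj (Polynomial.eval₂ _ _ Polynomial.X)
      rw [toLaurentNeg_X, lam_T_neg, Polynomial.eval₂_X]
      rfl
  rw [h, K1.map_comp, AddMonoidHom.comp_apply, K1.cone_eq_zero (K1.map f x), _root_.map_zero]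

variable (R) in
/-- The homomorphism `(Σ R)[X] → Σ (R[X])`. -/
noncomputable def suspPoly : Polynomial (Susp R) →+* Susp (Polynomial R) :=
  Polynomial.eval₂RingHom' (Susp.mapRingHom Polynomial.C) (Susp.const Polynomial.X) fun s => by
    obtain ⟨a, rfl⟩ := Susp.mk_surjective s
    change Susp.mk _ * Susp.mk _ = Susp.mk _ * Susp.mk _
    rw [← map_mul, ← map_mul]
    congr 1
    refine Cone.ext fun i j => ?_
    rw [Cone.diag_zero_mul_entry, Cone.mul_diag_zero_entry]
    exact (Polynomial.X_mul_C (a.entry i j)).symm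

/-- Classes over `(Σ R)[X]` are pushed into `Σ (R[X])` and read there as elements of `K₀ R[X]` by
surjectivity of `shiftHom`. For this `suspPoly` only has to be a homomorphism. -/
theorem suspPoly_comp (f : Polynomial R →+* R[T;T⁻¹]) (g : Polynomial (Susp R) →+* (Susp R)[T;T⁻¹])
    (hf : ∀ r, f (Polynomial.C r) = C r) (hg : ∀ r, g (Polynomial.C r) = C r)
    (hX : suspLaurent R (g Polynomial.X) = Susp.const (f Polynomial.X)) (b : K1 (Polynomial (Susp R))) :
    ∃ c : K0 (Polynomial R),
      K1.map (suspLaurent R : (Susp R)[T;T⁻¹] →+* Susp R[T;T⁻¹]) (K1.map g b) =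
        shiftHom (K0.map f c) := by
  have h : (suspLaurent R : (Susp R)[T;T⁻¹] →+* Susp R[T;T⁻¹]).comp g =
      (Susp.mapRingHom f).comp (suspPoly R) := by
    refine Polynomial.ringHom_ext (fun s => ?_) ?_
    · change suspLaurent R (g (Polynomial.C s)) =
        Susp.mapRingHom f (Polynomial.eval₂ _ _ (Polynomial.C s))
      rw [hg, suspLaurent_C, Polynomial.eval₂_C]
      obtain ⟨a, rfl⟩ := Susp.mk_surjective s
      refine congrArg Susp.mk ?_
      exact Cone.ext fun i j => (hf _).symm
    · change suspLaurent R (g Polynomial.X) =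
        Susp.mapRingHom f (Polynomial.eval₂ _ _ Polynomial.X)
      rw [hX, Polynomial.eval₂_X, mapRingHom_const]
  obtain ⟨c, hc⟩ := shiftHom_surjective (K1.map (suspPoly R) b)
  refine ⟨c, ?_⟩
  rw [shiftHom_map, hc, ← AddMonoidHom.comp_apply, ← AddMonoidHom.comp_apply, ← K1.map_comp,
    ← K1.map_comp, h]

theorem suspLaurent_T_neg : suspLaurent R (T (-1)) = Susp.const (T (-1)) := by
  refine left_inv_eq_right_inv (a := suspLaurent R (T 1)) ?_ ?_
  · rw [← map_mul, ← T_add, neg_add_cancel, T_zero, map_one]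
  · rw [suspLaurent_T, ← map_mul, ← T_add, add_neg_cancel, T_zero, map_one]

/-- The class `z` is transported to `K₁` of `(Σ R)[T, T⁻¹]` and decomposed into generators. There
`λ` kills the two polynomial parts and is injective on the `beta` parameter, which must therefore
vanish; the polynomial parts then return to `K₀` of polynomial rings over `R`. -/
theorem K0.exists_of_map_lam_eq_zero {z : K0 R[T;T⁻¹]} (hz : K0.map (lam R) z = 0) :
    ∃ a b, z = K0.map (Polynomial.toLaurent (R := R)) a + K0.map (toLaurentNeg R) b := by
  obtain ⟨x, hx⟩ := (K1.map_bijective (suspLaurent R)).2 (shiftHom z)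
  have h1 := K1.map_lam_susp z hx
  rw [hz, _root_.map_zero, _root_.map_zero] at h1
  obtain ⟨a, b, c, rfl⟩ := exists_laurentGen x
  have h2 := K1.map_lam_toLaurent b
  have h3 := K1.map_lam_toLaurentNeg c
  rw [K1.map_comp, AddMonoidHom.comp_apply] at h2 h3
  rw [_root_.map_add, _root_.map_add, h2, h3, add_zero, add_zero, K1.map_lam_beta] at h1
  have ha : a = 0 := shiftHom_injective (h1.trans (_root_.map_zero _).symm)
  obtain ⟨b', hb⟩ := suspPoly_comp (Polynomial.toLaurent (R := R)) Polynomial.toLaurent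
    Polynomial.toLaurent_C Polynomial.toLaurent_C
    (by rw [Polynomial.toLaurent_X, Polynomial.toLaurent_X, suspLaurent_T]) b
  obtain ⟨c', hc⟩ := suspPoly_comp (toLaurentNeg R) (toLaurentNeg (Susp R))
    toLaurentNeg_C toLaurentNeg_C
    (by rw [toLaurentNeg_X, toLaurentNeg_X, suspLaurent_T_neg]) c
  refine ⟨b', c', shiftHom_injective ?_⟩
  rw [← hx, ha, _root_.map_zero, zero_add, _root_.map_add, hb, hc, _root_.map_add]

end Lambda

end HomotopyK

end

section

namespace HomotopyK

open LaurentPolynomial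

/-! ### Split extensions: from unitalizations to nonunital rings -/

namespace UExt

variable {I B C I' B' C' : Type u} [NonUnitalRing I] [Ring B] [Ring C] [NonUnitalRing I'] [Ring B']
  [Ring C']

theorem map_toMid_injective (E : UExt I B C) (s : C →+* B) (hs : ∀ c, E.proj (s c) = c)
    {x y : K0nu I} (h : K0.map E.toMid x = K0.map E.toMid (y : K0 (Unital I))) : x = y := by
  rw [← sub_eq_zero]
  refine Subtype.ext (E.eq_zero_of_split s hs (x - y).2 ?_)
  change K0.map E.toMid ((x : K0 (Unital I)) - y) = 0
  rw [map_sub, h, sub_self]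

/-- Subtracting the part induced from `C` by the section puts any class of `B` into the kernel of
the projection, where split excision applies. -/
theorem exists_sub_split (E : UExt I B C) (s : C →+* B) (hs : ∀ c, E.proj (s c) = c) (η : K0 B) :
    ∃ ξ : K0nu I, K0.map E.toMid ξ = η - K0.map s (K0.map E.proj η) := by
  refine E.exists_of_split s hs ?_
  have h : E.proj.comp s = RingHom.id C := RingHom.ext hs
  rw [map_sub, ← AddMonoidHom.comp_apply (K0.map E.proj) (K0.map s), ← K0.map_comp, h, K0.map_id,
    AddMonoidHom.id_apply, sub_self]

/-- The composite `Ĩ → B → C` factors through the augmentation to `ℤ`. -/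
theorem map_proj_map_toMid (E : UExt I B C) (ξ : K0nu I) : K0.map E.proj (K0.map E.toMid ξ) = 0 := by
  have h : E.proj.comp E.toMid = (Int.castRingHom C).comp (augm I) :=
    RingHom.ext fun x => E.proj_toMid x
  rw [← AddMonoidHom.comp_apply, ← K0.map_comp, h, K0.map_comp, AddMonoidHom.comp_apply,
    show K0.map (augm I) ξ = 0 from ξ.2, _root_.map_zero]

theorem map_toMid_natural (E : UExt I B C) (E' : UExt I' B' C') (i : I →ₙ+* I') (b : B →+* B')
    (h : ∀ x, E'.incl (i x) = b (E.incl x)) (ξ : K0nu I) :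
    K0.map b (K0.map E.toMid ξ) = K0.map E'.toMid (K0nu.map i ξ) := by
  rw [K0nu.coe_map, ← AddMonoidHom.comp_apply, ← AddMonoidHom.comp_apply, ← K0.map_comp,
    ← K0.map_comp]
  congr 2
  refine RingHom.ext fun x => ?_
  rw [RingHom.comp_apply, RingHom.comp_apply, toMid_apply, toMid_apply, map_add, map_intCast,
    Unital.fst_map, Unital.snd_map, h]

end UExt

namespace Coeff

variable {V : Type v} {A : Type u} {X : Type w} [Ring V] [NonUnitalRing A] [NonUnitalRing X]

/-- The map `a ↦ 1 • a`. -/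
def const (c : Coeff V A X) : A →ₙ+* X where
  toFun a := c.smul 1 a
  map_mul' a b := by rw [c.smul_mul_smul, one_mul]
  map_zero' := map_zero _
  map_add' a b := map_add _ a b

theorem const_apply (c : Coeff V A X) (a : A) : c.const a = c.smul 1 a := rfl

/-- The map `v • a ↦ φ v • a` induced by a ring homomorphism `V → ℤ`. -/
noncomputable def eval (c : Coeff V A X) (φ : V →+* ℤ) : X →ₙ+* A :=
  c.hom ((smulAddHom ℤ A).comp φ.toAddMonoidHom) fun v w a b => by
    simp [smul_mul_smul_comm]

theorem eval_smul (c : Coeff V A X) (φ : V →+* ℤ) (v : V) (a : A) :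
    c.eval φ (c.smul v a) = φ v • a := by
  rw [eval, hom_smul]
  rfl

theorem eval_const (c : Coeff V A X) (φ : V →+* ℤ) (a : A) : c.eval φ (c.const a) = a := by
  rw [const_apply, eval_smul, map_one, one_smul]

end Coeff

section SplitExtensions

variable (A : Type u) [NonUnitalRing A]

/-- The extension `0 → A → A → 0 → 0`. -/
def idExt : Ext A A PUnit.{u + 1} where
  incl := NonUnitalRingHom.id A
  proj := 0
  incl_injective := fun _ _ h => h
  proj_surjective := fun _ => ⟨0, rfl⟩
  exact := fun a => ⟨fun _ => ⟨a, rfl⟩, fun _ => rfl⟩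

/-- The inclusion `ℤ → Ã`, with `ℤ` presented as the unitalization of the zero ring. -/
abbrev unitSec : Unital PUnit.{u + 1} →+* Unital A := Unital.map 0

/-- The augmentation `Ã → ℤ`, with `ℤ` presented as the unitalization of the zero ring. -/
abbrev unitAug : Unital A →+* Unital PUnit.{u + 1} := Unital.map 0

theorem unitAug_unitSec (c : Unital PUnit.{u + 1}) : unitAug A (unitSec A c) = c := by
  ext
  rw [Unital.fst_map, Unital.fst_map]

variable {A} in
theorem unitAug_eq_zero {a : Unital A} : unitAug A a = 0 ↔ a.fst = 0 :=
  ⟨fun h => congrArg Unital.fst h, fun h => Unital.ext h rfl⟩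

/-- The split extension `0 → A[t, t⁻¹] → Ã[t, t⁻¹] → ℤ[t, t⁻¹] → 0`. -/
noncomputable def laurentExt :
    UExt (laurentRing A) (Unital A)[T;T⁻¹] (Unital PUnit.{u + 1})[T;T⁻¹] where
  incl := NonUnitalSubringClass.subtype (laurentRing A)
  proj := AddMonoidAlgebra.mapRingHom ℤ (unitAug A)
  incl_injective := Subtype.val_injective
  proj_surjective f := by
    refine ⟨AddMonoidAlgebra.mapRingHom ℤ (unitSec A) f, ?_⟩
    refine LaurentPolynomial.ext fun i => ?_
    rw [AddMonoidAlgebra.coeff_mapRingHom, AddMonoidAlgebra.coeff_mapRingHom, unitAug_unitSec]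
  exact f := by
    constructor
    · intro h
      refine ⟨⟨f, fun i => unitAug_eq_zero.1 ?_⟩, rfl⟩
      rw [← AddMonoidAlgebra.coeff_mapRingHom, h]
      rfl
    · rintro ⟨f, rfl⟩
      refine LaurentPolynomial.ext fun i => ?_
      rw [AddMonoidAlgebra.coeff_mapRingHom]
      exact unitAug_eq_zero.2 (f.2 i)

theorem laurentExt_split (f : (Unital PUnit.{u + 1})[T;T⁻¹]) :
    (laurentExt A).proj (AddMonoidAlgebra.mapRingHom ℤ (unitSec A) f) = f := by
  refine LaurentPolynomial.ext fun i => ?_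
  change (AddMonoidAlgebra.mapRingHom ℤ (unitAug A) _).coeff i = _
  rw [AddMonoidAlgebra.coeff_mapRingHom, AddMonoidAlgebra.coeff_mapRingHom, unitAug_unitSec]

/-- The split extension `0 → A[t] → Ã[t] → ℤ[t] → 0`. -/
noncomputable def polyExt :
    UExt (polyRing A) (Polynomial (Unital A)) (Polynomial (Unital PUnit.{u + 1})) where
  incl := NonUnitalSubringClass.subtype (polyRing A)
  proj := Polynomial.mapRingHom (unitAug A)
  incl_injective := Subtype.val_injective
  proj_surjective f := by
    refine ⟨Polynomial.mapRingHom (unitSec A) f, ?_⟩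
    ext i
    simp [unitAug_unitSec]
  exact f := by
    constructor
    · intro h
      refine ⟨⟨f, fun i => unitAug_eq_zero.1 ?_⟩, rfl⟩
      rw [← Polynomial.coeff_map, ← Polynomial.coe_mapRingHom, h, Polynomial.coeff_zero]
    · rintro ⟨f, rfl⟩
      refine Polynomial.ext fun i => ?_
      rw [Polynomial.coe_mapRingHom, Polynomial.coeff_map]
      exact unitAug_eq_zero.2 (f.2 i)

theorem polyExt_split (f : Polynomial (Unital PUnit.{u + 1})) :
    (polyExt A).proj (Polynomial.mapRingHom (unitSec A) f) = f := by
  refine Polynomial.ext fun i => ?_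
  change (Polynomial.mapRingHom (unitAug A) _).coeff i = _
  rw [Polynomial.coe_mapRingHom, Polynomial.coe_mapRingHom, Polynomial.coeff_map,
    Polynomial.coeff_map, unitAug_unitSec]

/-- The split extension `0 → Σ A → Σ Ã → Σ ℤ → 0`. -/
noncomputable def suspExt : UExt (Susp A) (Susp (Unital A)) (Susp (Unital PUnit.{u + 1})) :=
  (idExt A).unitize.susp

theorem suspExt_incl (x : Susp A) : (suspExt A).incl x = Susp.map (Unital.inr A) x := rfl

theorem suspExt_split (x : Susp (Unital PUnit.{u + 1})) :
    (suspExt A).proj (Susp.mapRingHom (unitSec A) x) = x := by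
  obtain ⟨a, rfl⟩ := Susp.mk_surjective x
  refine congrArg Susp.mk ?_
  exact Cone.ext fun i j => unitAug_unitSec A _

/-- The split extension `0 → P A → A[t] → A → 0`, with projection `ev₀`. -/
noncomputable def pathExt : Ext (pathRing A) (polyRing A) A where
  incl := NonUnitalSubring.inclusion fun _ h => h.1
  proj := (coeffPoly A).eval Polynomial.constantCoeff
  incl_injective f g h := Subtype.ext (congrArg (fun x => x.1) h)
  proj_surjective a := ⟨_, (coeffPoly A).eval_const _ a⟩
  exact f := by
    -- The projection is defined through the pairing; on an actual polynomial it reads off the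
    -- constant coefficient.
    have h : ∀ f, (coeffPoly A).eval Polynomial.constantCoeff f = (f.1.coeff 0).snd := by
      have : ((coeffPoly A).eval Polynomial.constantCoeff).toAddMonoidHom =
          (Unital.sndHom A).comp ((Polynomial.lcoeff (Unital A) 0).toAddMonoidHom.comp
            (polyRing A).toAddSubgroup.subtype) := by
        refine (coeffPoly A).addHom_ext fun v a => ?_
        change (coeffPoly A).eval Polynomial.constantCoeff _ = (((coeffPoly A).smul v a).1.coeff 0).snd
        rw [Coeff.eval_smul, coeffPoly_smul_val, coeff_polySmul]
        rfl
      exact fun f => DFunLike.congr_fun this f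
    rw [h]
    constructor
    · intro h0
      exact ⟨⟨f.1, f.2, Unital.ext (f.2 0) h0⟩, rfl⟩
    · rintro ⟨g, rfl⟩
      exact congrArg Unital.snd g.2.2

end SplitExtensions

end HomotopyK

end

section

namespace HomotopyK

open LaurentPolynomial

/-! ### The homomorphisms `ev₁` and `λ` with nonunital coefficients -/

section LaurentHoms

variable {R : Type u} [Ring R]

theorem laurentSmul_eq_mul (f : ℤ[T;T⁻¹]) (r : R) :
    laurentSmul R f r = laurentSmul R f 1 * C r := by
  rw [← laurentSmul_one, coeffLaurentU_smul, laurentSmul_mul, mul_one, one_mul]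

theorem laurentSmul_one_comm (f : ℤ[T;T⁻¹]) (r : R) :
    C r * laurentSmul R f 1 = laurentSmul R f 1 * C r := by
  rw [← laurentSmul_one, coeffLaurentU_smul, laurentSmul_mul, laurentSmul_mul, mul_one, one_mul,
    one_mul, mul_one]

theorem coeffSusp_smul_eq_mul (v : Susp ℤ) (r : R) :
    (coeffSusp R).smul v r = (coeffSusp R).smul v 1 * Susp.const r := by
  rw [← coeffSusp_one_smul, (coeffSusp R).smul_mul_smul, mul_one, one_mul]

variable (R) in
/-- The ring homomorphism `ℤ[T, T⁻¹] → R[T, T⁻¹]`. -/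
noncomputable def laurentUnit : ℤ[T;T⁻¹] →+* R[T;T⁻¹] where
  toFun f := laurentSmul R f 1
  map_one' := by rw [← coeffLaurentU_smul, laurentSmul_one, map_one]
  map_mul' f g := by rw [laurentSmul_mul, mul_one]
  map_zero' := by rw [map_zero]; rfl
  map_add' f g := by rw [map_add]; rfl

variable (R) in
/-- The ring homomorphism `Σ ℤ → Σ R`. -/
noncomputable def suspUnit : Susp ℤ →+* Susp R where
  toFun v := (coeffSusp R).smul v 1
  map_one' := by rw [coeffSusp_one_smul, map_one]
  map_mul' f g := by rw [(coeffSusp R).smul_mul_smul, mul_one]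
  map_zero' := by rw [map_zero]; rfl
  map_add' f g := by rw [map_add]; rfl

/-- A constant factor `r` splits off on both sides, which leaves the case `r = 1`; there both sides
are ring homomorphisms on `ℤ[T, T⁻¹]` that agree at `T`. -/
theorem lam_laurentSmul (f : ℤ[T;T⁻¹]) (r : R) :
    lam R (laurentSmul R f r) = (coeffSusp R).smul (lam ℤ f) r := by
  have h : (lam R).comp (laurentUnit R) = (suspUnit R).comp (lam ℤ) := by
    refine laurent_hom_ext (fun n => ?_) ?_
    · have := RingHom.ext_int (((lam R).comp (laurentUnit R)).comp C)
        (((suspUnit R).comp (lam ℤ)).comp C)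
      exact DFunLike.congr_fun this n
    · change lam R (laurentSmul R (T 1) 1) = (coeffSusp R).smul (lam ℤ (T 1)) 1
      rw [laurentSmul_T, map_one, one_mul, lam_T, lam_T, coeffSusp_shift_smul]
  rw [laurentSmul_eq_mul, coeffSusp_smul_eq_mul, map_mul, lam_C]
  congr 1
  exact DFunLike.congr_fun h f

variable (R) in
/-- The ring homomorphism `R[X] → R[T, T⁻¹]` sending `X` to an integral Laurent polynomial. -/
noncomputable def polyEval (p : ℤ[T;T⁻¹]) : Polynomial R →+* R[T;T⁻¹] :=
  Polynomial.eval₂RingHom' C (laurentSmul R p 1) fun r => laurentSmul_one_comm p r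

theorem polyEval_C (p : ℤ[T;T⁻¹]) (r : R) : polyEval R p (Polynomial.C r) = C r :=
  Polynomial.eval₂_C _ _

theorem polyEval_X (p : ℤ[T;T⁻¹]) : polyEval R p Polynomial.X = laurentSmul R p 1 :=
  Polynomial.eval₂_X _ _

theorem polyEval_map_int (p : ℤ[T;T⁻¹]) (f : Polynomial ℤ) :
    polyEval R p (f.map (Int.castRingHom R)) = laurentSmul R (Polynomial.aeval p f) 1 := by
  have h : (polyEval R p).comp (Polynomial.mapRingHom (Int.castRingHom R)) =
      (laurentUnit R).comp (Polynomial.aeval p : Polynomial ℤ →ₐ[ℤ] ℤ[T;T⁻¹]).toRingHom := by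
    refine Polynomial.ringHom_ext' (RingHom.ext_int _ _) ?_
    change polyEval R p (Polynomial.mapRingHom _ Polynomial.X) =
      laurentSmul R (Polynomial.aeval p Polynomial.X) 1
    rw [Polynomial.coe_mapRingHom, Polynomial.map_X, polyEval_X, Polynomial.aeval_X]
  exact DFunLike.congr_fun h f

variable (R) in
/-- The substitution `X ↦ X + 1`. -/
noncomputable def polyShift : Polynomial R →+* Polynomial R :=
  Polynomial.eval₂RingHom' Polynomial.C (Polynomial.X + 1) fun r => by
    rw [Commute, SemiconjBy, mul_add, add_mul, Polynomial.X_mul_C, mul_one, one_mul]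

/-- Writing `T = 1 + p` with `p = T - 1` expresses the variable through an element that vanishes at
`1`. Evaluation at `1` of Laurent polynomials then corresponds to evaluation at `0` of polynomials,
as the homotopy argument requires. -/
theorem toLaurent_eq_polyEval : (Polynomial.toLaurent (R := R)) =
    (polyEval R (T 1 - 1)).comp (polyShift R) := by
  refine Polynomial.ringHom_ext (fun r => ?_) ?_
  · change _ = polyEval R _ (Polynomial.eval₂ _ _ (Polynomial.C r))
    rw [Polynomial.eval₂_C, polyEval_C, Polynomial.toLaurent_C]
  · change _ = polyEval R _ (Polynomial.eval₂ _ _ Polynomial.X)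
    rw [Polynomial.eval₂_X, map_add, polyEval_X, Polynomial.toLaurent_X, map_one (polyEval R _)]
    change _ = laurentUnit R (T 1 - 1) + 1
    rw [map_sub, map_one, sub_add_cancel]
    change _ = laurentSmul R (T 1) 1
    rw [laurentSmul_T, map_one, one_mul]

theorem toLaurentNeg_eq_polyEval : toLaurentNeg R =
    (polyEval R (T (-1) - 1)).comp (polyShift R) := by
  refine Polynomial.ringHom_ext (fun r => ?_) ?_
  · change _ = polyEval R _ (Polynomial.eval₂ _ _ (Polynomial.C r))
    rw [Polynomial.eval₂_C, polyEval_C, toLaurentNeg_C]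
  · change _ = polyEval R _ (Polynomial.eval₂ _ _ Polynomial.X)
    rw [Polynomial.eval₂_X, map_add, polyEval_X, toLaurentNeg_X, map_one (polyEval R _)]
    change _ = laurentUnit R (T (-1) - 1) + 1
    rw [map_sub, map_one, sub_add_cancel]
    change _ = laurentSmul R (T (-1)) 1
    rw [laurentSmul_T, map_one, one_mul]

variable (A : Type u) [NonUnitalRing A]

/-- The ring homomorphism `A[t, t⁻¹] → Σ A`, `t ↦ α`. -/
noncomputable def lamHom : laurentRing A →ₙ+* Susp A :=
  (coeffLaurent A).map (coeffSusp A) (lam ℤ : ℤ[T;T⁻¹] →ₙ+* Susp ℤ) (NonUnitalRingHom.id A)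

/-- Evaluation at `1`, from `A[t, t⁻¹]` to `A`. -/
noncomputable def evHom : laurentRing A →ₙ+* A := (coeffLaurent A).eval (laurentOne ℤ)

/-- The homomorphism `A[t] → A[t, t⁻¹]`, `t ↦ p`. -/
noncomputable def polyHom (p : ℤ[T;T⁻¹]) : polyRing A →ₙ+* laurentRing A :=
  (coeffPoly A).map (coeffLaurent A)
    ((Polynomial.aeval p : Polynomial ℤ →ₐ[ℤ] ℤ[T;T⁻¹]) : Polynomial ℤ →ₙ+* ℤ[T;T⁻¹])
    (NonUnitalRingHom.id A)

variable {A}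

theorem lamHom_smul (f : ℤ[T;T⁻¹]) (a : A) :
    lamHom A ((coeffLaurent A).smul f a) = (coeffSusp A).smul (lam ℤ f) a :=
  Coeff.map_smul _ _ _ _ _ _

theorem evHom_smul (f : ℤ[T;T⁻¹]) (a : A) :
    evHom A ((coeffLaurent A).smul f a) = laurentOne ℤ f • a := Coeff.eval_smul _ _ _ _

theorem polyHom_smul (p : ℤ[T;T⁻¹]) (f : Polynomial ℤ) (a : A) :
    polyHom A p ((coeffPoly A).smul f a) = (coeffLaurent A).smul (Polynomial.aeval p f) a :=
  Coeff.map_smul _ _ _ _ _ _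

theorem suspExt_incl_lamHom (x : laurentRing A) :
    (suspExt A).incl (lamHom A x) = lam (Unital A) ((laurentExt A).incl x) := by
  refine DFunLike.congr_fun ((coeffLaurent A).addHom_ext
    (f := ((suspExt A).incl.comp (lamHom A)).toAddMonoidHom)
    (g := ((lam (Unital A) : _ →ₙ+* _).comp (laurentExt A).incl).toAddMonoidHom) fun f a => ?_) x
  change (suspExt A).incl (lamHom A _) = lam (Unital A) (((coeffLaurent A).smul f a).1)
  rw [lamHom_smul, suspExt_incl, Susp.map_smul, coeffLaurent_smul_val, lam_laurentSmul]

theorem laurentExt_incl_polyHom (p : ℤ[T;T⁻¹]) (x : polyRing A) :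
    (laurentExt A).incl (polyHom A p x) = polyEval (Unital A) p ((polyExt A).incl x) := by
  refine DFunLike.congr_fun ((coeffPoly A).addHom_ext
    (f := ((laurentExt A).incl.comp (polyHom A p)).toAddMonoidHom)
    (g := ((polyEval (Unital A) p : _ →ₙ+* _).comp (polyExt A).incl).toAddMonoidHom)
    fun f a => ?_) x
  change (polyHom A p _).1 = polyEval (Unital A) p (((coeffPoly A).smul f a).1)
  rw [polyHom_smul, coeffLaurent_smul_val, coeffPoly_smul_val, polySmul_apply, map_mul,
    polyEval_map_int, polyEval_C, laurentSmul_eq_mul]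

theorem suspExt_incl_const (a : A) :
    (suspExt A).incl ((coeffSusp A).const a) = Susp.const ((idExt A).unitize.incl a) := by
  rw [Coeff.const_apply, suspExt_incl, Susp.map_smul, coeffSusp_one_smul]
  rfl

/-- Constant diagonal matrices lift to the cone, whose `K₀` vanishes. -/
theorem K0.map_const_eq_zero (x : K0 R) : K0.map (Susp.const (R := R)) x = 0 := by
  have h : Susp.const (R := R) = (coneExt R).proj.comp Cone.const := RingHom.ext fun r => rfl
  rw [h, K0.map_comp, AddMonoidHom.comp_apply, K0.cone_eq_zero (K0.map Cone.const x),
    _root_.map_zero]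

theorem K0nu.map_suspConst (x : K0nu A) : K0nu.map (coeffSusp A).const x = 0 := by
  refine (suspExt A).map_toMid_injective (Susp.mapRingHom (unitSec A)) (suspExt_split A) ?_
  have h := (idExt A).unitize.map_toMid_natural (suspExt A) (coeffSusp A).const Susp.const
    suspExt_incl_const x
  rw [K0.map_const_eq_zero] at h
  rw [← h]
  exact (_root_.map_zero _).symm

theorem lamHom_const : (lamHom A).comp (coeffLaurent A).const = (coeffSusp A).const := by
  ext1 a
  change lamHom A ((coeffLaurent A).smul 1 a) = (coeffSusp A).smul 1 a
  rw [lamHom_smul, map_one]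

theorem evHom_const : (evHom A).comp (coeffLaurent A).const = NonUnitalRingHom.id A := by
  ext1 a
  change evHom A ((coeffLaurent A).smul 1 a) = a
  rw [evHom_smul, map_one, one_smul]

theorem K0nu.map_comp_apply {B D : Type u} [NonUnitalRing B] [NonUnitalRing D] (g : B →ₙ+* D)
    (f : A →ₙ+* B) (x : K0nu A) : K0nu.map g (K0nu.map f x) = K0nu.map (g.comp f) x :=
  (DFunLike.congr_fun (K0nu.map_comp g f) x).symm

/-- `(ev₁, λ) : K₀ A[t, t⁻¹] → K₀ A × K₀ Σ A` is surjective. -/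
theorem exists_evHom_lamHom (x : K0nu A) (y : K0nu (Susp A)) :
    ∃ z : K0nu (laurentRing A), K0nu.map (evHom A) z = x ∧ K0nu.map (lamHom A) z = y := by
  obtain ⟨z₀, hz₀⟩ := K0.map_lam_surjective (K0.map (suspExt A).toMid (y : K0 (Unital (Susp A))))
  obtain ⟨z, hz⟩ := (laurentExt A).exists_sub_split _ (laurentExt_split A) z₀
  have h1 : K0nu.map (lamHom A) z = y := by
    refine (suspExt A).map_toMid_injective (Susp.mapRingHom (unitSec A)) (suspExt_split A) ?_
    -- `h2` and `h3` say that `λ` commutes with the augmentations and with the sections. Hence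
    -- removing the integral part of `z₀` changes its image under `λ` by the integral part of `y`,
    -- which is zero.
    have h2 : (lam (Unital PUnit.{u + 1})).comp (laurentExt A).proj =
        (suspExt A).proj.comp (lam (Unital A)) := by
      refine laurent_hom_ext (fun r => ?_) ?_
      · change lam _ (AddMonoidAlgebra.mapRingHom ℤ (unitAug A) (.single 0 r)) =
          Susp.mapRingHom (unitAug A) (lam (Unital A) (C r))
        rw [AddMonoidAlgebra.mapRingHom_single, single_eq_C, lam_C, lam_C, mapRingHom_const]
      · change lam _ (AddMonoidAlgebra.mapRingHom ℤ (unitAug A) (.single 1 1)) =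
          Susp.mapRingHom (unitAug A) (lam (Unital A) (T 1))
        rw [AddMonoidAlgebra.mapRingHom_single, map_one]
        change lam _ (T 1) = _
        rw [lam_T, lam_T]
        exact ((Susp.mapRingHom_diag (unitAug A) 1 0 1).trans (by rw [map_one]; rfl)).symm
    have h3 : (lam (Unital A)).comp (AddMonoidAlgebra.mapRingHom ℤ (unitSec A)) =
        (Susp.mapRingHom (unitSec A)).comp (lam (Unital PUnit.{u + 1})) := by
      refine laurent_hom_ext (fun r => ?_) ?_
      · change lam _ (AddMonoidAlgebra.mapRingHom ℤ (unitSec A) (.single 0 r)) =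
          Susp.mapRingHom (unitSec A) (lam _ (C r))
        rw [AddMonoidAlgebra.mapRingHom_single, single_eq_C, lam_C, lam_C, mapRingHom_const]
      · change lam _ (AddMonoidAlgebra.mapRingHom ℤ (unitSec A) (.single 1 1)) =
          Susp.mapRingHom (unitSec A) (lam _ (T 1))
        rw [AddMonoidAlgebra.mapRingHom_single, map_one]
        change lam _ (T 1) = _
        rw [lam_T, lam_T]
        exact ((Susp.mapRingHom_diag (unitSec A) 1 0 1).trans (by rw [map_one]; rfl)).symm
    rw [← (laurentExt A).map_toMid_natural (suspExt A) _ _ suspExt_incl_lamHom, hz, _root_.map_sub,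
      hz₀, ← AddMonoidHom.comp_apply (K0.map (lam (Unital A))), ← K0.map_comp, h3, K0.map_comp,
      AddMonoidHom.comp_apply, ← AddMonoidHom.comp_apply (K0.map (lam (Unital PUnit.{u + 1}))),
      ← K0.map_comp, h2, K0.map_comp, AddMonoidHom.comp_apply, hz₀, UExt.map_proj_map_toMid,
      _root_.map_zero, sub_zero]
  -- Constants adjust the value under `ev₁` at will and are invisible to `λ`.
  refine ⟨z + K0nu.map (coeffLaurent A).const (x - K0nu.map (evHom A) z), ?_, ?_⟩
  · rw [map_add, K0nu.map_comp_apply, evHom_const, K0nu.map_id, AddMonoidHom.id_apply,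
      add_sub_cancel]
  · rw [map_add, K0nu.map_comp_apply, lamHom_const, K0nu.map_suspConst, add_zero, h1]

end LaurentHoms

end HomotopyK

end

section

namespace HomotopyK

open LaurentPolynomial

/-! ### Polynomial homotopies and the kernel of `(ev₁, λ)` -/

section Homotopy

variable {A : Type u} [NonUnitalRing A] {Y : Type w}

/-- The biadditive map `ℤ[X] × A → Y` with prescribed values at the powers of `X`. -/
noncomputable def polyFamily [AddCommGroup Y] (b : ℕ → A →+ Y) : Polynomial ℤ →+ A →+ Y :=
  (Polynomial.lsum fun k => LinearMap.toSpanSingleton ℤ (A →+ Y) (b k)).toAddMonoidHom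

theorem polyFamily_monomial [AddCommGroup Y] (b : ℕ → A →+ Y) (k : ℕ) (n : ℤ) :
    polyFamily b (Polynomial.monomial k n) = n • b k := by
  change Polynomial.sum _ _ = _
  rw [Polynomial.sum_monomial_index _ _ (by simp)]
  rfl

theorem polyFamily_mul [NonUnitalRing Y] (b : ℕ → A →+ Y)
    (hb : ∀ k l x y, b k x * b l y = b (k + l) (x * y)) (f g : Polynomial ℤ) (x y : A) :
    polyFamily b f x * polyFamily b g y = polyFamily b (f * g) (x * y) := by
  induction f using Polynomial.induction_on' with
  | add f f' hf hf' => simp only [map_add, AddMonoidHom.add_apply, add_mul, hf, hf']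
  | monomial k n =>
    induction g using Polynomial.induction_on' with
    | add g g' hg hg' => simp only [map_add, AddMonoidHom.add_apply, mul_add, hg, hg']
    | monomial l m =>
      rw [Polynomial.monomial_mul_monomial, polyFamily_monomial, polyFamily_monomial,
        polyFamily_monomial, AddMonoidHom.smul_apply, AddMonoidHom.smul_apply,
        AddMonoidHom.smul_apply, smul_mul_smul_comm, hb]

theorem polyRing.addHom_ext [AddCommGroup Y] {f g : polyRing A →+ Y}
    (h : ∀ k a, f ((coeffPoly A).smul (Polynomial.X ^ k) a) =
      g ((coeffPoly A).smul (Polynomial.X ^ k) a)) : f = g := by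
  refine (coeffPoly A).addHom_ext fun v a => ?_
  induction v using Polynomial.induction_on' with
  | add p q hp hq => simp only [map_add, AddMonoidHom.add_apply, hp, hq]
  | monomial k n =>
    have : (coeffPoly A).smul (Polynomial.monomial k n) a =
        n • (coeffPoly A).smul (Polynomial.X ^ k) a := by
      rw [← AddMonoidHom.smul_apply, ← map_zsmul, Polynomial.X_pow_eq_monomial,
        Polynomial.smul_monomial, smul_eq_mul, mul_one]
    rw [this, map_zsmul, map_zsmul, h]

theorem polyRing.hom_ext [NonUnitalRing Y] {f g : polyRing A →ₙ+* Y}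
    (h : ∀ k a, f ((coeffPoly A).smul (Polynomial.X ^ k) a) =
      g ((coeffPoly A).smul (Polynomial.X ^ k) a)) : f = g :=
  NonUnitalRingHom.ext fun x =>
    DFunLike.congr_fun (polyRing.addHom_ext (f := f.toAddMonoidHom) (g := g.toAddMonoidHom) h) x

variable (A) in
/-- The homotopy `A[s] → A[t, t⁻¹][x]`, `s ↦ x p`. -/
noncomputable def polyHomotopy (p : ℤ[T;T⁻¹]) : polyRing A →ₙ+* polyRing (laurentRing A) :=
  (coeffPoly A).hom
    (polyFamily fun k => ((coeffPoly (laurentRing A)).smul (Polynomial.X ^ k)).comp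
      ((coeffLaurent A).smul (p ^ k)))
    (polyFamily_mul _ fun k l x y => by
      simp only [AddMonoidHom.comp_apply, Coeff.smul_mul_smul, pow_add])

theorem polyHomotopy_smul (p : ℤ[T;T⁻¹]) (k : ℕ) (a : A) :
    polyHomotopy A p ((coeffPoly A).smul (Polynomial.X ^ k) a) =
      (coeffPoly (laurentRing A)).smul (Polynomial.X ^ k) ((coeffLaurent A).smul (p ^ k) a) := by
  rw [polyHomotopy, Coeff.hom_smul, Polynomial.X_pow_eq_monomial, polyFamily_monomial, one_smul,
    Polynomial.X_pow_eq_monomial]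
  rfl

variable (A) in
/-- Evaluation at `0`. -/
noncomputable def evZero : polyRing A →ₙ+* A := (coeffPoly A).eval Polynomial.constantCoeff

variable (A) in
/-- Evaluation at `1`. -/
noncomputable def evOne : polyRing A →ₙ+* A := (coeffPoly A).eval (Polynomial.evalRingHom 1)

theorem evZero_smul (f : Polynomial ℤ) (a : A) :
    evZero A ((coeffPoly A).smul f a) = f.coeff 0 • a := Coeff.eval_smul _ _ _ _

theorem evOne_smul (f : Polynomial ℤ) (a : A) :
    evOne A ((coeffPoly A).smul f a) = f.eval 1 • a := Coeff.eval_smul _ _ _ _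

theorem evZero_polyHomotopy (p : ℤ[T;T⁻¹]) :
    (evZero (laurentRing A)).comp (polyHomotopy A p) = (coeffLaurent A).const.comp (evZero A) := by
  refine polyRing.hom_ext fun k a => ?_
  change evZero _ (polyHomotopy A p _) = (coeffLaurent A).smul 1 (evZero A _)
  rw [polyHomotopy_smul, evZero_smul, evZero_smul, Polynomial.coeff_X_pow]
  split_ifs with h
  · rw [← h, pow_zero, one_smul, one_smul]
  · rw [zero_smul, zero_smul, map_zero]

theorem evOne_polyHomotopy (p : ℤ[T;T⁻¹]) :
    (evOne (laurentRing A)).comp (polyHomotopy A p) = polyHom A p := by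
  refine polyRing.hom_ext fun k a => ?_
  change evOne _ (polyHomotopy A p _) = _
  rw [polyHomotopy_smul, evOne_smul, polyHom_smul, Polynomial.eval_pow, Polynomial.eval_X, one_pow,
    one_smul, map_pow (Polynomial.aeval p), Polynomial.aeval_X]

/-- Evaluation at `1` on `P A` is factored through `A[t]`, where the homotopies take their values.
-/
theorem loopExt_proj_eq : (loopExt A).proj = (evOne A).comp (pathExt A).incl := by
  refine (coeffPath A).hom_ext fun f a => ?_
  rw [loopExt_proj_smul]
  exact (evOne_smul f.1 a).symm

theorem evZero_const : (evZero A).comp (coeffPoly A).const = NonUnitalRingHom.id A := by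
  ext1 a
  change evZero A ((coeffPoly A).smul 1 a) = a
  rw [evZero_smul, Polynomial.coeff_one_zero, one_smul]

theorem evOne_const : (evOne A).comp (coeffPoly A).const = NonUnitalRingHom.id A := by
  ext1 a
  change evOne A ((coeffPoly A).smul 1 a) = a
  rw [evOne_smul, Polynomial.eval_one, one_smul]

/-- The homotopy `s ↦ x p` joins evaluation at `0` followed by constants, at `x = 0`, to the
substitution `s ↦ p`, at `x = 1`. Subtracting the constant path gives a class killed by `ev₀`, which
comes from the path ring by split excision; at `x = 1` it becomes the required difference. -/
theorem exists_path_polyHom (p : ℤ[T;T⁻¹]) (a : K0nu (polyRing A)) :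
    ∃ w, K0nu.map (loopExt (laurentRing A)).proj w =
      K0nu.map (polyHom A p) a - K0nu.map (coeffLaurent A).const (K0nu.map (evZero A) a) := by
  let c := K0nu.map (coeffLaurent A).const (K0nu.map (evZero A) a)
  obtain ⟨w, hw⟩ := (pathExt (laurentRing A)).exists_map_incl (coeffPoly (laurentRing A)).const
    (fun x => DFunLike.congr_fun evZero_const x)
    (y := K0nu.map (polyHomotopy A p) a - K0nu.map (coeffPoly (laurentRing A)).const c) (by
      change K0nu.map (evZero _) _ = 0
      rw [map_sub, K0nu.map_comp_apply, K0nu.map_comp_apply, evZero_polyHomotopy, evZero_const,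
        K0nu.map_id, AddMonoidHom.id_apply, ← K0nu.map_comp_apply, sub_self])
  refine ⟨w, ?_⟩
  rw [loopExt_proj_eq, ← K0nu.map_comp_apply, hw, map_sub, K0nu.map_comp_apply,
    K0nu.map_comp_apply, evOne_polyHomotopy, evOne_const, K0nu.map_id, AddMonoidHom.id_apply]

theorem evHom_polyHom (p : ℤ[T;T⁻¹]) (hp : laurentOne ℤ p = 0) :
    (evHom A).comp (polyHom A p) = evZero A := by
  refine polyRing.hom_ext fun k a => ?_
  change evHom A (polyHom A p _) = _
  rw [polyHom_smul, evHom_smul, evZero_smul, Polynomial.coeff_X_pow,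
    map_pow (Polynomial.aeval p), Polynomial.aeval_X, map_pow (laurentOne ℤ), hp]
  split_ifs with h
  · rw [← h, pow_zero]
  · rw [zero_pow (Ne.symm h)]

theorem mapRingHom_polyEval {R S : Type u} [Ring R] [Ring S] (f : R →+* S) (p : ℤ[T;T⁻¹]) :
    (AddMonoidAlgebra.mapRingHom ℤ f).comp (polyEval R p) =
      (polyEval S p).comp (Polynomial.mapRingHom f) := by
  refine Polynomial.ringHom_ext (fun r => ?_) ?_
  · rw [RingHom.comp_apply, RingHom.comp_apply, polyEval_C, Polynomial.coe_mapRingHom,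
      Polynomial.map_C, polyEval_C, ← single_eq_C, AddMonoidAlgebra.mapRingHom_single, single_eq_C]
  · rw [RingHom.comp_apply, RingHom.comp_apply, polyEval_X, Polynomial.coe_mapRingHom,
      Polynomial.map_X, polyEval_X]
    refine LaurentPolynomial.ext fun i => ?_
    rw [AddMonoidAlgebra.coeff_mapRingHom, coeff_laurentSmul, coeff_laurentSmul, map_zsmul, map_one]

/-- Since `p` has integral coefficients, substituting it commutes with the augmentations and
sections of the coefficients. Removing the integral part before or after the substitution is
therefore the same. -/
theorem exists_polyHom_sub (p : ℤ[T;T⁻¹]) (a : K0 (Polynomial (Unital A))) :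
    ∃ x : K0nu (polyRing A), K0.map (laurentExt A).toMid (K0nu.map (polyHom A p) x) =
      K0.map (polyEval (Unital A) p) a - K0.map (AddMonoidAlgebra.mapRingHom ℤ (unitSec A))
        (K0.map (laurentExt A).proj (K0.map (polyEval (Unital A) p) a)) := by
  obtain ⟨x, hx⟩ := (polyExt A).exists_sub_split _ (polyExt_split A) a
  refine ⟨x, ?_⟩
  rw [← (polyExt A).map_toMid_natural (laurentExt A) _ _ (laurentExt_incl_polyHom p), hx,
    _root_.map_sub, ← AddMonoidHom.comp_apply, ← AddMonoidHom.comp_apply, ← K0.map_comp,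
    ← K0.map_comp, ← AddMonoidHom.comp_apply, ← AddMonoidHom.comp_apply, ← K0.map_comp,
    ← K0.map_comp, RingHom.comp_assoc]
  change _ = _ - K0.map ((AddMonoidAlgebra.mapRingHom ℤ (unitSec A)).comp
    (((AddMonoidAlgebra.mapRingHom ℤ (unitAug A))).comp (polyEval (Unital A) p))) a
  rw [mapRingHom_polyEval, ← RingHom.comp_assoc, ← RingHom.comp_assoc, mapRingHom_polyEval]
  rfl

/-- The kernel of `(ev₁, λ) : K₀ A[t, t⁻¹] → K₀ A × K₀ Σ A` consists of classes which lift along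
`ev₁ : P A[t, t⁻¹] → A[t, t⁻¹]`. -/
theorem exists_path_of_evHom_lamHom (z : K0nu (laurentRing A)) (h1 : K0nu.map (evHom A) z = 0)
    (h2 : K0nu.map (lamHom A) z = 0) : ∃ w, K0nu.map (loopExt (laurentRing A)).proj w = z := by
  have h3 : K0.map (lam (Unital A)) (K0.map (laurentExt A).toMid (z : K0 (Unital (laurentRing A)))) = 0 := by
    rw [(laurentExt A).map_toMid_natural (suspExt A) _ _ suspExt_incl_lamHom, h2]
    exact _root_.map_zero _
  obtain ⟨a, b, hab⟩ := K0.exists_of_map_lam_eq_zero h3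
  rw [toLaurent_eq_polyEval, toLaurentNeg_eq_polyEval, K0.map_comp, K0.map_comp,
    AddMonoidHom.comp_apply, AddMonoidHom.comp_apply] at hab
  obtain ⟨x, hx⟩ := exists_polyHom_sub (T 1 - 1) (K0.map (polyShift (Unital A)) a)
  obtain ⟨y, hy⟩ := exists_polyHom_sub (T (-1) - 1) (K0.map (polyShift (Unital A)) b)
  -- The class `z` of the nonunital ring has no integral part, so discarding the integral parts of
  -- the two polynomial contributions does not alter their sum.
  have h4 : z = K0nu.map (polyHom A (T 1 - 1)) x + K0nu.map (polyHom A (T (-1) - 1)) y := by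
    refine (laurentExt A).map_toMid_injective _ (laurentExt_split A) ?_
    have h5 := (laurentExt A).map_proj_map_toMid z
    change _ = K0.map (laurentExt A).toMid ((K0nu.map (polyHom A (T 1 - 1)) x : K0 _) +
      (K0nu.map (polyHom A (T (-1) - 1)) y : K0 _))
    rw [hab, _root_.map_add] at h5
    rw [_root_.map_add, hx, hy, hab, sub_add_sub_comm, ← _root_.map_add, h5, _root_.map_zero,
      sub_zero]
  obtain ⟨v, hv⟩ := exists_path_polyHom (T 1 - 1) x
  obtain ⟨w, hw⟩ := exists_path_polyHom (T (-1) - 1) y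
  refine ⟨v + w, ?_⟩
  -- Both substituted elements vanish at `1`, so the hypothesis on `ev₁` says that the values of `x`
  -- and `y` at `0` add up to zero. These values are the correction terms in `hv` and `hw`.
  rw [h4, map_add, K0nu.map_comp_apply, K0nu.map_comp_apply,
    evHom_polyHom _ (by rw [map_sub, laurentOne_T, map_one, sub_self]),
    evHom_polyHom _ (by rw [map_sub, laurentOne_T, map_one, sub_self])] at h1
  rw [map_add, hv, hw, sub_add_sub_comm, ← map_add (K0nu.map (coeffLaurent A).const), h1,
    _root_.map_zero, sub_zero, ← h4]

end Homotopy

end HomotopyK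

end

section

namespace HomotopyK

open LaurentPolynomial

/-! ### Stability of `Y ← Y[t, t⁻¹] → Σ Y` under suspension and loops -/

section Triples

variable {V : Type v} [NonUnitalRing V] {Y L S FY FL FS : Type u} [NonUnitalRing Y]
  [NonUnitalRing L] [NonUnitalRing S] [NonUnitalRing FY] [NonUnitalRing FL] [NonUnitalRing FS]

/-- Transport of a pairing along an isomorphism of the coefficient ring. -/
noncomputable def Coeff.congr (c : Coeff V Y FY) (σ : L ≃+* Y) : Coeff V L FY :=
  c.retract ((AddMonoidHom.compHom' (σ : L →+ Y)).comp c.smul)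
    (fun v w a b => by
      change c.smul v (σ a) * c.smul w (σ b) = c.smul (v * w) (σ (a * b))
      rw [c.smul_mul_smul, map_mul σ])
    (AddMonoidHom.id V) (AddMonoidHom.id V) (σ : L →+ Y) (σ.symm : Y →+ L) (AddMonoidHom.id FY)
    (AddMonoidHom.id FY) (fun _ => rfl) σ.symm_apply_apply (fun _ => rfl) (fun _ _ => rfl)
    (fun v a => by
      change c.smul v a = c.smul v (σ (σ.symm a))
      rw [σ.apply_symm_apply])

theorem Coeff.congr_smul (c : Coeff V Y FY) (σ : L ≃+* Y) (v : V) (x : L) :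
    (c.congr σ).smul v x = c.smul v (σ x) := rfl

/-- A pair of homomorphisms `Y ← L → S` isomorphic to `Y ← Y[t, t⁻¹] → Σ Y`. -/
def IsTriple (e : L →ₙ+* Y) (l : L →ₙ+* S) : Prop :=
  ∃ (c : L ≃+* laurentRing Y) (c' : S ≃+* Susp Y),
    (∀ x, evHom Y (c x) = e x) ∧ ∀ x, lamHom Y (c x) = c' (l x)

theorem isTriple_self : IsTriple (evHom Y) (lamHom Y) :=
  ⟨RingEquiv.refl _, RingEquiv.refl _, fun _ => rfl, fun _ => rfl⟩

/-- Tensoring with `V` commutes with Laurent polynomials and with the suspension by exchange of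
tensor factors, and compatibility with `ev₁` and `λ` is checked on the generators `v • (f • y)`. The
results on `K₀` thus apply after any number of suspensions and loops. -/
theorem IsTriple.of_coeff {e : L →ₙ+* Y} {l : L →ₙ+* S} (h : IsTriple e l) (gY : Coeff V Y FY)
    (gL : Coeff V L FL) (gS : Coeff V S FS) {e' : FL →ₙ+* FY} {l' : FL →ₙ+* FS}
    (he : ∀ v x, e' (gL.smul v x) = gY.smul v (e x))
    (hl : ∀ v x, l' (gL.smul v x) = gS.smul v (l x)) : IsTriple e' l' := by
  obtain ⟨c, c', h1, h2⟩ := h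
  let d := (coeffLaurent Y).swap (gL.congr c.symm) gY (coeffLaurent FY)
  let d' := (coeffSusp Y).swap (gS.congr c'.symm) gY (coeffSusp FY)
  refine ⟨d, d', fun x => ?_, fun x => ?_⟩
  · refine DFunLike.congr_fun (Coeff.hom_ext₂ (coeffLaurent Y) (gL.congr c.symm)
      (f := (evHom FY).comp (d : FL →ₙ+* laurentRing FY)) (g := e') fun v f y => ?_) x
    change evHom FY (d _) = _
    rw [Coeff.swap_smul, evHom_smul, Coeff.congr_smul, he, ← h1, c.apply_symm_apply, evHom_smul,
      map_zsmul]
  · refine DFunLike.congr_fun (Coeff.hom_ext₂ (coeffLaurent Y) (gL.congr c.symm)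
      (f := (lamHom FY).comp (d : FL →ₙ+* laurentRing FY))
      (g := (d' : FS →ₙ+* Susp FY).comp l') fun v f y => ?_) x
    change lamHom FY (d _) = d' (l' _)
    have h3 : l (c.symm ((coeffLaurent Y).smul f y)) =
        c'.symm ((coeffSusp Y).smul (lam ℤ f) y) := by
      rw [← lamHom_smul, ← c.apply_symm_apply ((coeffLaurent Y).smul f y), h2,
        c'.symm_apply_apply, c.apply_symm_apply]
    rw [Coeff.swap_smul, lamHom_smul, Coeff.congr_smul, hl, h3, ← Coeff.congr_smul gS c'.symm,
      Coeff.swap_smul]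

theorem IsTriple.susp {e : L →ₙ+* Y} {l : L →ₙ+* S} (h : IsTriple e l) :
    IsTriple (Susp.map e) (Susp.map l) :=
  h.of_coeff (coeffSusp Y) (coeffSusp L) (coeffSusp S) (Susp.map_smul e) (Susp.map_smul l)

theorem IsTriple.loop {e : L →ₙ+* Y} {l : L →ₙ+* S} (h : IsTriple e l) :
    IsTriple (loopRing.map e) (loopRing.map l) :=
  h.of_coeff (coeffLoop Y) (coeffLoop L) (coeffLoop S) (loopRing.map_smul e) (loopRing.map_smul l)

theorem K0nu.map_symm_map (c : L ≃+* Y) (x : K0nu L) :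
    K0nu.map (c.symm : Y →ₙ+* L) (K0nu.map (c : L →ₙ+* Y) x) = x := by
  rw [K0nu.map_comp_apply, show (c.symm : Y →ₙ+* L).comp (c : L →ₙ+* Y) = NonUnitalRingHom.id L from
    NonUnitalRingHom.ext c.symm_apply_apply, K0nu.map_id, AddMonoidHom.id_apply]

theorem IsTriple.exists_map {e : L →ₙ+* Y} {l : L →ₙ+* S} (h : IsTriple e l) (x : K0nu Y)
    (y : K0nu S) : ∃ z, K0nu.map e z = x ∧ K0nu.map l z = y := by
  obtain ⟨c, c', h1, h2⟩ := h
  obtain ⟨z, hx, hy⟩ := exists_evHom_lamHom x (K0nu.map (c' : S →ₙ+* Susp Y) y)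
  refine ⟨K0nu.map (c.symm : laurentRing Y →ₙ+* L) z, ?_, ?_⟩
  · rw [← hx, K0nu.map_comp_apply]
    congr 2
    refine NonUnitalRingHom.ext fun x => ?_
    exact (h1 _).symm.trans (congrArg _ (c.apply_symm_apply x))
  · rw [← K0nu.map_symm_map c' (K0nu.map l _), K0nu.map_comp_apply _ l, K0nu.map_comp_apply _ _ z,
      ← K0nu.map_symm_map c' y, ← hy]
    congr 3
    refine NonUnitalRingHom.ext fun x => ?_
    exact (h2 _).symm.trans (congrArg _ (c.apply_symm_apply x))

theorem IsTriple.exists_path {e : L →ₙ+* Y} {l : L →ₙ+* S} (h : IsTriple e l) {z : K0nu L}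
    (he : K0nu.map e z = 0) (hl : K0nu.map l z = 0) :
    ∃ w, K0nu.map (loopExt L).proj w = z := by
  obtain ⟨c, c', h1, h2⟩ := h
  obtain ⟨w, hw⟩ := exists_path_of_evHom_lamHom (K0nu.map (c : L →ₙ+* laurentRing Y) z)
    (by
      rw [K0nu.map_comp_apply, ← he]
      congr 2
      exact NonUnitalRingHom.ext h1)
    (by
      rw [K0nu.map_comp_apply, show (lamHom Y).comp (c : L →ₙ+* laurentRing Y) = (c' : S →ₙ+* Susp Y).comp l from
        NonUnitalRingHom.ext h2, ← K0nu.map_comp_apply, hl, map_zero])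
  refine ⟨K0nu.map (pathRing.map (c.symm : laurentRing Y →ₙ+* L)) w, ?_⟩
  rw [K0nu.map_comp_apply, show (loopExt L).proj.comp (pathRing.map (c.symm : laurentRing Y →ₙ+* L)) =
    (c.symm : laurentRing Y →ₙ+* L).comp (loopExt (laurentRing Y)).proj from
      NonUnitalRingHom.ext (loopExt_proj_natural _), ← K0nu.map_comp_apply, hw, K0nu.map_symm_map]

end Triples

/-! ### Comparison of paths in a suspension with suspended paths -/

section PathLift

variable {I B C : Type u} [NonUnitalRing I] [NonUnitalRing B] [NonUnitalRing C]

theorem pathRing_susp_proj (x : pathRing (Susp C)) :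
    Susp.map (loopExt C).proj (Coeff.swapHom (coeffSusp C) (coeffPath (Susp C)) (coeffPath C)
      (coeffSusp (pathRing C)) x) = (loopExt (Susp C)).proj x := by
  refine DFunLike.congr_fun (Coeff.hom_ext₂ (coeffSusp C) (coeffPath (Susp C))
    (f := (Susp.map (loopExt C).proj).comp (Coeff.swapHom (coeffSusp C) (coeffPath (Susp C))
      (coeffPath C) (coeffSusp (pathRing C)))) (g := (loopExt (Susp C)).proj) fun f v c => ?_) x
  rw [NonUnitalRingHom.comp_apply, Coeff.swapHom_smul, Susp.map_smul, loopExt_proj_smul,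
    loopExt_proj_smul, map_zsmul]

/-- Exchange of tensor factors maps `P Σ C` to `Σ P C` over `Σ C`; it is followed by the suspension
of the given lift. -/
theorem Ext.exists_pathLift_susp (E : Ext I B C)
    (h : ∃ ρ : pathRing C →ₙ+* B, E.proj.comp ρ = (loopExt C).proj) :
    ∃ ρ : pathRing (Susp C) →ₙ+* Susp B, E.susp.proj.comp ρ = (loopExt (Susp C)).proj := by
  obtain ⟨ρ, hρ⟩ := h
  refine ⟨(Susp.map ρ).comp (Coeff.swapHom (coeffSusp C) (coeffPath (Susp C)) (coeffPath C)
    (coeffSusp (pathRing C))), NonUnitalRingHom.ext fun x => ?_⟩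
  refine Eq.trans ?_ (pathRing_susp_proj x)
  change (Susp.map E.proj) (Susp.map ρ _) = _
  rw [← hρ, Susp.map_comp]
  rfl

/-- The kernel classes are lifted to `P Σᵖ A`, while the connecting map in `KH` belongs to the
extension by `Σᵖ P A`. A homomorphism between the two over `Σᵖ A` shows that such classes have zero
boundary. -/
theorem exists_pathLift_suspLoopExt (A : Rng.{u}) (p : ℕ) :
    ∃ ρ : pathRing ((iter Rng.susp p).obj A) →ₙ+* (iter Rng.susp p).obj ⟨pathRing A⟩,
      (suspLoopExt A p).proj.comp ρ = (loopExt ((iter Rng.susp p).obj A)).proj := by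
  induction p with
  | zero => exact ⟨NonUnitalRingHom.id _, rfl⟩
  | succ p ih => exact (suspLoopExt A p).exists_pathLift_susp ih

theorem suspLoopExt_bdry_eq_zero (A : Rng.{u}) (p : ℕ)
    (w : K0nu (pathRing ((iter Rng.susp p).obj A))) :
    (suspLoopExt A p).bdry (K0nu.map (loopExt ((iter Rng.susp p).obj A)).proj w) = 0 := by
  obtain ⟨ρ, hρ⟩ := exists_pathLift_suspLoopExt A p
  rw [← hρ, ← K0nu.map_comp_apply]
  exact Ext.bdry_map_proj _ _

end PathLift

/-! ### Split exact sequences under suspension and loops -/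

section Split

variable {V : Type v} [NonUnitalRing V] {I B C FI FB FC : Type u} [NonUnitalRing I]
  [NonUnitalRing B] [NonUnitalRing C] [NonUnitalRing FI] [NonUnitalRing FB] [NonUnitalRing FC]

/-- Split exactness of `0 → I → B → C → 0`. -/
def IsSplit (i : I →ₙ+* B) (p : B →ₙ+* C) (s : C →ₙ+* B) : Prop :=
  (∀ c, p (s c) = c) ∧ ∃ r : B →+ I, (∀ x, r (i x) = x) ∧ ∀ b, i (r b) + s (p b) = b

/-- The retraction `r` is only additive, yet it can be tensored with `V`; expressing exactness
through `r` makes it stable under all functors of this form. -/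
theorem IsSplit.of_coeff {i : I →ₙ+* B} {p : B →ₙ+* C} {s : C →ₙ+* B} (h : IsSplit i p s)
    (gI : Coeff V I FI) (gB : Coeff V B FB) (gC : Coeff V C FC) {i' : FI →ₙ+* FB}
    {p' : FB →ₙ+* FC} {s' : FC →ₙ+* FB} (hi : ∀ v x, i' (gI.smul v x) = gB.smul v (i x))
    (hp : ∀ v x, p' (gB.smul v x) = gC.smul v (p x))
    (hs : ∀ v x, s' (gC.smul v x) = gB.smul v (s x)) : IsSplit i' p' s' := by
  obtain ⟨h1, r, h2, h3⟩ := h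
  refine ⟨fun c => ?_, gB.addMap gI (AddMonoidHom.id V) r, fun x => ?_, fun b => ?_⟩
  · exact DFunLike.congr_fun (gC.hom_ext (f := p'.comp s') (g := NonUnitalRingHom.id FC) fun v c => by
      rw [NonUnitalRingHom.comp_apply, hs, hp, h1]; rfl) c
  · exact DFunLike.congr_fun (gI.addHom_ext
      (f := (gB.addMap gI (AddMonoidHom.id V) r).comp i'.toAddMonoidHom)
      (g := AddMonoidHom.id FI) fun v x => by
        change gB.addMap gI (AddMonoidHom.id V) r (i' _) = gI.smul v x
        rw [hi, Coeff.addMap_smul, h2]; rfl) x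
  · exact DFunLike.congr_fun (gB.addHom_ext
      (f := i'.toAddMonoidHom.comp (gB.addMap gI (AddMonoidHom.id V) r) +
        (s'.comp p').toAddMonoidHom)
      (g := AddMonoidHom.id FB) fun v x => by
        change i' (gB.addMap gI (AddMonoidHom.id V) r _) + s' (p' _) = gB.smul v x
        rw [Coeff.addMap_smul, hi, hp, hs, AddMonoidHom.id_apply, ← map_add, h3]) b

theorem IsSplit.susp {i : I →ₙ+* B} {p : B →ₙ+* C} {s : C →ₙ+* B} (h : IsSplit i p s) :
    IsSplit (Susp.map i) (Susp.map p) (Susp.map s) :=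
  h.of_coeff (coeffSusp I) (coeffSusp B) (coeffSusp C) (Susp.map_smul i) (Susp.map_smul p)
    (Susp.map_smul s)

theorem IsSplit.loop {i : I →ₙ+* B} {p : B →ₙ+* C} {s : C →ₙ+* B} (h : IsSplit i p s) :
    IsSplit (loopRing.map i) (loopRing.map p) (loopRing.map s) :=
  h.of_coeff (coeffLoop I) (coeffLoop B) (coeffLoop C) (loopRing.map_smul i) (loopRing.map_smul p)
    (loopRing.map_smul s)

/-- The extension underlying a split extension. -/
def IsSplit.ext {i : I →ₙ+* B} {p : B →ₙ+* C} {s : C →ₙ+* B} (h : IsSplit i p s) : Ext I B C where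
  incl := i
  proj := p
  incl_injective x y hxy := by
    obtain ⟨-, r, h2, -⟩ := h
    rw [← h2 x, hxy, h2]
  proj_surjective c := ⟨s c, h.1 c⟩
  exact b := by
    obtain ⟨h1, r, h2, h3⟩ := h
    constructor
    · intro hb
      refine ⟨r b, ?_⟩
      have := h3 b
      rwa [hb, map_zero, add_zero] at this
    · rintro ⟨x, rfl⟩
      have := h3 (i x)
      rw [h2, add_eq_left] at this
      rw [← h1 (p (i x)), this, map_zero]

theorem IsSplit.map_injective {i : I →ₙ+* B} {p : B →ₙ+* C} {s : C →ₙ+* B} (h : IsSplit i p s) :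
    Function.Injective (K0nu.map i) := h.ext.map_incl_injective s h.1

theorem IsSplit.exists_map {i : I →ₙ+* B} {p : B →ₙ+* C} {s : C →ₙ+* B} (h : IsSplit i p s)
    {y : K0nu B} (hy : K0nu.map p y = 0) : ∃ x, K0nu.map i x = y :=
  h.ext.exists_map_incl s h.1 hy

theorem IsSplit.map_comp_eq_zero {i : I →ₙ+* B} {p : B →ₙ+* C} {s : C →ₙ+* B} (h : IsSplit i p s) :
    p.comp i = 0 :=
  NonUnitalRingHom.ext fun x => (h.ext.exact _).2 ⟨x, rfl⟩

end Split

/-! ### The split sequence `σA → A[t, t⁻¹] → A` -/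

section Sigma

open TensorProduct

variable (A : Type u) [NonUnitalRing A]

/-- `σ A = σ ⊗ A`. -/
noncomputable def coeffSigma : Coeff sigmaRing A (Rng.sigma.obj ⟨A⟩) where
  smul := AddMonoidHom.mk' (fun f => (TensorProduct.mk ℤ sigmaRing A f).toAddMonoidHom)
    fun f g => by ext a; exact TensorProduct.add_tmul f g a
  smul_mul_smul f g a b := by
    change (f ⊗ₜ[ℤ] a) * (g ⊗ₜ[ℤ] b) = (f * g) ⊗ₜ[ℤ] (a * b)
    simp
  bijective := by
    have h : ∀ x, (liftAddHom (AddMonoidHom.mk' (fun f : sigmaRing =>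
        (TensorProduct.mk ℤ sigmaRing A f).toAddMonoidHom)
          fun f g => by ext a; exact TensorProduct.add_tmul f g a) (fun r v a => by simp) :
            sigmaRing ⊗[ℤ] A →+ sigmaRing ⊗[ℤ] A) x = x := fun x => by
      induction x with
      | zero => rw [map_zero]
      | add x y hx hy => rw [map_add, hx, hy]
      | tmul f a => rfl
    exact ⟨fun x y hxy => by rw [← h x, ← h y]; exact hxy, fun x => ⟨x, h x⟩⟩

theorem laurentOne_eq_eval₂ (f : ℤ[T;T⁻¹]) :
    LaurentPolynomial.eval₂ (RingHom.id ℤ) 1 f = laurentOne ℤ f := by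
  refine DFunLike.congr_fun (laurent_hom_ext (f := LaurentPolynomial.eval₂ (RingHom.id ℤ) 1)
    (g := laurentOne ℤ) (fun r => ?_) ?_) f
  · rw [eval₂_C, laurentOne_C]; rfl
  · rw [eval₂_T, laurentOne_T]; simp

theorem mem_sigmaRing {f : ℤ[T;T⁻¹]} : f ∈ sigmaRing ↔ laurentOne ℤ f = 0 := by
  rw [← laurentOne_eq_eval₂]; rfl

/-- The inclusion `σ A → A[t, t⁻¹]`. -/
noncomputable def sigmaIncl : Rng.sigma.obj ⟨A⟩ →ₙ+* laurentRing A :=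
  (coeffSigma A).map (coeffLaurent A) (NonUnitalSubringClass.subtype sigmaRing)
    (NonUnitalRingHom.id A)

variable {A}

theorem sigmaIncl_smul (f : sigmaRing) (a : A) :
    sigmaIncl A ((coeffSigma A).smul f a) = (coeffLaurent A).smul f.1 a :=
  Coeff.map_smul _ _ _ _ f a

/-- The projection of `ℤ[t, t⁻¹]` onto `σ`. -/
noncomputable def sigmaRetract : ℤ[T;T⁻¹] →+ sigmaRing :=
  AddMonoidHom.mk' (fun f => ⟨f - C (laurentOne ℤ f), mem_sigmaRing.2 (by
    rw [map_sub, laurentOne_C, sub_self])⟩) fun f g => Subtype.ext (by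
      change _ = f - C (laurentOne ℤ f) + (g - C (laurentOne ℤ g))
      change f + g - C (laurentOne ℤ (f + g)) = _
      rw [map_add (laurentOne ℤ), map_add C]
      abel)

/-- The additive retraction subtracts from a Laurent polynomial its value at `1`, and the section
includes the constants; every identity is checked on elements `f • a`. -/
theorem isSplit_sigma : IsSplit (sigmaIncl A) (evHom A) (coeffLaurent A).const := by
  refine ⟨fun a => DFunLike.congr_fun evHom_const a,
    (coeffLaurent A).addMap (coeffSigma A) sigmaRetract (AddMonoidHom.id A), fun x => ?_,
    fun b => ?_⟩
  · refine DFunLike.congr_fun ((coeffSigma A).addHom_ext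
      (f := ((coeffLaurent A).addMap (coeffSigma A) sigmaRetract (AddMonoidHom.id A)).comp
        (sigmaIncl A).toAddMonoidHom) (g := AddMonoidHom.id _) fun f a => ?_) x
    change (coeffLaurent A).addMap (coeffSigma A) _ _ (sigmaIncl A _) = (coeffSigma A).smul f a
    rw [sigmaIncl_smul, Coeff.addMap_smul, AddMonoidHom.id_apply]
    congr 2
    refine Subtype.ext ?_
    change f.1 - C (laurentOne ℤ f.1) = f.1
    rw [mem_sigmaRing.1 f.2, map_zero, sub_zero]
  · refine DFunLike.congr_fun ((coeffLaurent A).addHom_ext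
      (f := (sigmaIncl A).toAddMonoidHom.comp
        ((coeffLaurent A).addMap (coeffSigma A) sigmaRetract (AddMonoidHom.id A)) +
        ((coeffLaurent A).const.comp (evHom A)).toAddMonoidHom)
      (g := AddMonoidHom.id _) fun f a => ?_) b
    change sigmaIncl A ((coeffLaurent A).addMap (coeffSigma A) _ _ _) +
      (coeffLaurent A).smul 1 (evHom A _) = (coeffLaurent A).smul f a
    rw [Coeff.addMap_smul, sigmaIncl_smul, evHom_smul, map_zsmul,
      ← AddMonoidHom.smul_apply, ← map_zsmul, AddMonoidHom.id_apply, ← AddMonoidHom.add_apply,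
      ← map_add]
    congr 2
    change f - C (laurentOne ℤ f) + _ = f
    have : (laurentOne ℤ f) • (1 : ℤ[T;T⁻¹]) = C (laurentOne ℤ f) := by
      rw [smul_eq_C_mul, mul_one]
    rw [this, sub_add_cancel]

end Sigma

end HomotopyK

end

section

namespace HomotopyK

open Limits

/-! ### Sequential colimits of functors to abelian groups -/

section Sequences

variable {C : Type u} [Category.{v} C] [HasColimitsOfShape ℕ C]

/-- The `α` and `β` interleave the two sequences. Each induces a map of colimits, and a composite of
the two is a transition map at every stage, hence the identity in the colimit. -/
theorem nonempty_colimit_iso (F F' : ℕ ⥤ C) (α : ∀ k, F.obj k ⟶ F'.obj k)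
    (β : ∀ k, F'.obj k ⟶ F.obj (k + 1))
    (h1 : ∀ k, α k ≫ β k = F.map (homOfLE (k.le_add_right 1)))
    (h2 : ∀ k, β k ≫ α (k + 1) = F'.map (homOfLE (k.le_add_right 1))) :
    Nonempty (colimit F ≅ colimit F') := by
  let a : F ⟶ F' := NatTrans.ofSequence α fun k => by rw [← h1, ← h2, Category.assoc]
  let b : F' ⟶ (Functor.const ℕ).obj (colimit F) :=
    NatTrans.ofSequence (fun k => β k ≫ colimit.ι F (k + 1)) fun k => by
      rw [← h2, Category.assoc, reassoc_of% h1 (k + 1), colimit.w]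
      exact (Category.comp_id _).symm
  have ha : ∀ k, a.app k = α k := fun _ => rfl
  have hb : ∀ k, b.app k = β k ≫ colimit.ι F (k + 1) := fun _ => rfl
  refine ⟨⟨colimMap a, colimit.desc F' ⟨_, b⟩, ?_, ?_⟩⟩
  · refine colimit.hom_ext fun k => ?_
    rw [ι_colimMap_assoc, colimit.ι_desc, ha]
    change α k ≫ b.app k = _
    rw [hb, reassoc_of% h1 k, colimit.w, Category.comp_id]
  · refine colimit.hom_ext fun k => ?_
    rw [colimit.ι_desc_assoc]
    change b.app k ≫ _ = _
    rw [hb, Category.assoc, ι_colimMap, ha, reassoc_of% h2 k, colimit.w, Category.comp_id]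

theorem nonempty_colimit_iso_of_isIso (F F' : ℕ ⥤ C) (α : ∀ k, F.obj k ⟶ F'.obj k)
    [∀ k, IsIso (α k)]
    (h : ∀ k, F.map (homOfLE (k.le_add_right 1)) ≫ α (k + 1) =
      α k ≫ F'.map (homOfLE (k.le_add_right 1))) : Nonempty (colimit F ≅ colimit F') :=
  nonempty_colimit_iso F F' α (fun k => inv (α k) ≫ F.map (homOfLE (k.le_add_right 1)))
    (fun k => by rw [IsIso.hom_inv_id_assoc]) fun k => by
      rw [Category.assoc, h, IsIso.inv_hom_id_assoc]

end Sequences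

section Elements

instance : PreservesColimitsOfShape ℕ (forget AddCommGrpCat.{u}) :=
  -- The index category `ℕ` lives in universe `0`, so preservation of filtered colimits is first
  -- brought down to that size.
  have := preservesFilteredColimitsOfSize_shrink.{0, u, 0, u} (forget AddCommGrpCat.{u})
  PreservesFilteredColimitsOfSize.preserves_filtered_colimits ℕ

variable (D : ℕ ⥤ (Rng.{u} ⥤ AddCommGrpCat.{u})) (A : Rng.{u})

theorem colimit_exists_rep (x : (colimit D).obj A) :
    ∃ (k : ℕ) (z : (D.obj k).obj A), ((colimit.ι D k).app A) z = x :=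
  Concrete.isColimit_exists_rep (D ⋙ (evaluation _ _).obj A)
    (isColimitOfPreserves ((evaluation _ _).obj A) (colimit.isColimit D)) x

variable {D A}

theorem colimit_map_rep {k m : ℕ} (h : k ≤ m) (z : (D.obj k).obj A) :
    ((colimit.ι D m).app A) (((D.map (homOfLE h)).app A) z) = ((colimit.ι D k).app A) z := by
  rw [← ConcreteCategory.comp_apply, ← NatTrans.comp_app, colimit.w]

/-- Vanishing is recorded at all later stages, so that two such conclusions can be combined at a
common one. -/
theorem colimit_eq_zero {k : ℕ} {z : (D.obj k).obj A} (h : ((colimit.ι D k).app A) z = 0) :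
    ∃ (m : ℕ) (hm : k ≤ m), ∀ n (hn : m ≤ n), ((D.map (homOfLE (hm.trans hn))).app A) z = 0 := by
  obtain ⟨m, f, g, hfg⟩ := Concrete.isColimit_exists_of_rep_eq (D ⋙ (evaluation _ _).obj A)
    (isColimitOfPreserves ((evaluation _ _).obj A) (colimit.isColimit D)) z
    (0 : (D.obj k).obj A) (h.trans (map_zero ((colimit.ι D k).app A).hom).symm)
  refine ⟨m, leOfHom f, fun n hn => ?_⟩
  rw [show homOfLE ((leOfHom f).trans hn) = f ≫ homOfLE hn from Subsingleton.elim _ _, D.map_comp,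
    NatTrans.comp_app, ConcreteCategory.comp_apply]
  have : ((D.map f).app A) z = 0 := hfg.trans (map_zero ((D.map g).app A).hom)
  rw [this]
  exact map_zero ((D.map _).app A).hom

theorem nonempty_iso_biprod {P Q R : Rng.{u} ⥤ AddCommGrpCat.{u}} (f : P ⟶ Q) (g : P ⟶ R)
    (h0 : ∀ A (x : P.obj A), f.app A x = 0 → g.app A x = 0 → x = 0)
    (h : ∀ A (y : Q.obj A) (z : R.obj A), ∃ x, f.app A x = y ∧ g.app A x = z) :
    Nonempty (P ≅ Q ⊞ R) := by
  have hf : ∀ A x, (biprod.fst : Q ⊞ R ⟶ Q).app A ((biprod.lift f g).app A x) = f.app A x :=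
    fun A x => by rw [← ConcreteCategory.comp_apply, ← NatTrans.comp_app, biprod.lift_fst]
  have hg : ∀ A x, (biprod.snd : Q ⊞ R ⟶ R).app A ((biprod.lift f g).app A x) = g.app A x :=
    fun A x => by rw [← ConcreteCategory.comp_apply, ← NatTrans.comp_app, biprod.lift_snd]
  have ht : ∀ A (v : (Q ⊞ R).obj A), v = (biprod.inl : Q ⟶ Q ⊞ R).app A
      ((biprod.fst : Q ⊞ R ⟶ Q).app A v) + (biprod.inr : R ⟶ Q ⊞ R).app A
      ((biprod.snd : Q ⊞ R ⟶ R).app A v) := fun A v =>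
    (ConcreteCategory.congr_hom (NatTrans.congr_app (biprod.total (X := Q) (Y := R)) A) v).symm
  have : IsIso (biprod.lift f g) := by
    rw [NatTrans.isIso_iff_isIso_app]
    intro A
    rw [ConcreteCategory.isIso_iff_bijective]
    constructor
    · refine (injective_iff_map_eq_zero ((biprod.lift f g).app A).hom).2 fun x hx => ?_
      refine h0 A x ?_ ?_
      · rw [← hf]
        exact (congrArg _ hx).trans (map_zero ((biprod.fst : Q ⊞ R ⟶ Q).app A).hom)
      · rw [← hg]
        exact (congrArg _ hx).trans (map_zero ((biprod.snd : Q ⊞ R ⟶ R).app A).hom)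
    · intro v
      obtain ⟨x, hx, hx'⟩ := h A ((biprod.fst : Q ⊞ R ⟶ Q).app A v)
        ((biprod.snd : Q ⊞ R ⟶ R).app A v)
      refine ⟨x, ?_⟩
      rw [ht A v, ht A ((biprod.lift f g).app A x), hf, hg, hx, hx']
  exact ⟨asIso (biprod.lift f g)⟩

end Elements

end HomotopyK

end

section

namespace HomotopyK

open Limits

/-! ### The natural transformations `ev₁`, `λ` and the inclusion of `σ` -/

section Transformations

/-- Evaluation at `1`, as a natural transformation. -/
noncomputable def evNat : Rng.laurent.{u} ⟶ 𝟭 _ where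
  app A := evHom A
  naturality A B f := (coeffLaurent A).hom_ext
    (f := (evHom B).comp (laurentRing.map (Rng.hom f))) (g := (Rng.hom f).comp (evHom A))
    fun v a => by
      rw [NonUnitalRingHom.comp_apply, NonUnitalRingHom.comp_apply, laurentRing.map_smul,
        evHom_smul, evHom_smul, map_zsmul]

/-- The map `A[t, t⁻¹] → Σ A`, as a natural transformation. -/
noncomputable def lamNat : Rng.laurent.{u} ⟶ Rng.susp where
  app A := lamHom A
  naturality A B f := (coeffLaurent A).hom_ext
    (f := (lamHom B).comp (laurentRing.map (Rng.hom f)))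
    (g := (Susp.map (Rng.hom f)).comp (lamHom A)) fun v a => by
      rw [NonUnitalRingHom.comp_apply, NonUnitalRingHom.comp_apply, laurentRing.map_smul,
        lamHom_smul, lamHom_smul, Susp.map_smul]

/-- The inclusion `σ A → A[t, t⁻¹]`, as a natural transformation. -/
noncomputable def sigmaNat : Rng.sigma.{u} ⟶ Rng.laurent where
  app A := sigmaIncl A
  naturality A B f := (coeffSigma A).hom_ext
    (f := (sigmaIncl B).comp (Rng.hom (Rng.sigma.map f)))
    (g := (laurentRing.map (Rng.hom f)).comp (sigmaIncl A)) fun v a => by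
      rw [NonUnitalRingHom.comp_apply, NonUnitalRingHom.comp_apply, sigmaIncl_smul,
        laurentRing.map_smul]
      exact sigmaIncl_smul v (Rng.hom f a)

variable {Y L S : Rng.{u}}

theorem IsTriple.iter {e : L ⟶ Y} {l : L ⟶ S} (h : IsTriple (Rng.hom e) (Rng.hom l))
    (i j : ℕ) : IsTriple (Rng.hom ((iter Rng.susp j).map ((iter Rng.loop i).map e)))
      (Rng.hom ((iter Rng.susp j).map ((iter Rng.loop i).map l))) := by
  have h1 : IsTriple (Rng.hom ((HomotopyK.iter Rng.loop i).map e))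
      (Rng.hom ((HomotopyK.iter Rng.loop i).map l)) := by
    induction i with
    | zero => exact h
    | succ i ih => exact ih.loop
  induction j with
  | zero => exact h1
  | succ j ih => exact ih.susp

theorem IsSplit.iter {p : L ⟶ Y} {i : S ⟶ L} {s : Y ⟶ L}
    (h : IsSplit (Rng.hom i) (Rng.hom p) (Rng.hom s)) (m j : ℕ) :
    IsSplit (Rng.hom ((iter Rng.susp j).map ((iter Rng.loop m).map i)))
      (Rng.hom ((iter Rng.susp j).map ((iter Rng.loop m).map p)))
      (Rng.hom ((iter Rng.susp j).map ((iter Rng.loop m).map s))) := by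
  have h1 : IsSplit (Rng.hom ((HomotopyK.iter Rng.loop m).map i))
      (Rng.hom ((HomotopyK.iter Rng.loop m).map p))
      (Rng.hom ((HomotopyK.iter Rng.loop m).map s)) := by
    induction m with
    | zero => exact h
    | succ i ih => exact ih.loop
  induction j with
  | zero => exact h1
  | succ j ih => exact ih.susp

end Transformations

/-! ### Bijectivity of `(ev₁, λ)` in the colimit -/

section Stages

/-- The functor `A ↦ K₋ⱼ Ωⁱ A`. -/
noncomputable def stage (i j : ℕ) : Rng.{u} ⥤ AddCommGrpCat.{u} := iter Rng.loop i ⋙ negK j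

/-- The connecting map `K₋ⱼ Ωⁱ A → K₋ⱼ₋₁ Ωⁱ⁺¹ A`. -/
noncomputable def stageBdry (i j : ℕ) : stage.{u} i j ⟶ stage (i + 1) (j + 1) :=
  Functor.whiskerLeft (iter Rng.loop i) (bdry j)

/-- The sequence of functors `A ↦ K₋ⱼ Ωⁱ A` and connecting maps, for `(i, j) = (a + k, b + k)`. -/
noncomputable def loopSeq (a b : ℕ) : ℕ ⥤ (Rng.{u} ⥤ AddCommGrpCat.{u}) :=
  Functor.ofSequence (X := fun k : ℕ => stage (a + k) (b + k))
    (fun k => stageBdry (a + k) (b + k))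

theorem loopSeq_map_succ (a b k : ℕ) : (loopSeq.{u} a b).map (homOfLE (k.le_add_right 1)) =
    stageBdry (a + k) (b + k) :=
  Functor.ofSequence_map_homOfLE_succ _ k

variable (a b : ℕ) {A B : Rng.{u}}

theorem colimit_map_ι (D : ℕ ⥤ (Rng.{u} ⥤ AddCommGrpCat.{u})) (f : A ⟶ B) {k : ℕ}
    (z : (D.obj k).obj A) : (colimit D).map f ((colimit.ι D k).app A z) =
      (colimit.ι D k).app B ((D.obj k).map f z) := by
  rw [← ConcreteCategory.comp_apply, ← ConcreteCategory.comp_apply, NatTrans.naturality]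

theorem map_app_map (D : ℕ ⥤ (Rng.{u} ⥤ AddCommGrpCat.{u})) (f : A ⟶ B) {k m : ℕ} (h : k ⟶ m)
    (z : (D.obj k).obj A) : (D.map h).app B ((D.obj k).map f z) =
      (D.obj m).map f ((D.map h).app A z) := by
  rw [← ConcreteCategory.comp_apply, ← ConcreteCategory.comp_apply, NatTrans.naturality]

theorem exists_colimit_laurent (x : (colimit (loopSeq.{u} a b)).obj A)
    (y : (colimit (loopSeq.{u} a b)).obj (Rng.susp.obj A)) :
    ∃ z : (colimit (loopSeq.{u} a b)).obj (Rng.laurent.obj A),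
      (colimit (loopSeq.{u} a b)).map (evNat.app A) z = x ∧
      (colimit (loopSeq.{u} a b)).map (lamNat.app A) z = y := by
  obtain ⟨k, x, rfl⟩ := colimit_exists_rep _ A x
  obtain ⟨l, y, rfl⟩ := colimit_exists_rep _ (Rng.susp.obj A) y
  rw [← colimit_map_rep (le_max_left k l) x, ← colimit_map_rep (le_max_right k l) y]
  obtain ⟨z, h1, h2⟩ := ((isTriple_self (Y := A)).iter (e := evNat.app A) (l := lamNat.app A)
    (a + max k l) (b + max k l)).exists_map
    (((loopSeq.{u} a b).map (homOfLE (le_max_left k l))).app A x)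
    (((loopSeq.{u} a b).map (homOfLE (le_max_right k l))).app (Rng.susp.obj A) y)
  refine ⟨(colimit.ι (loopSeq.{u} a b) (max k l)).app (Rng.laurent.obj A) z, ?_, ?_⟩
  · exact (colimit_map_ι _ _ _).trans
      (congrArg ((colimit.ι (loopSeq.{u} a b) (max k l)).app A) h1)
  · exact (colimit_map_ι _ _ _).trans
      (congrArg ((colimit.ι (loopSeq.{u} a b) (max k l)).app (Rng.susp.obj A)) h2)

variable {a b}

/-- At a single stage the kernel of `(ev₁, λ)` need not vanish, but its classes lift to paths and
die under the next connecting map. This is where the colimit is indispensable. -/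
theorem colimit_laurent_eq_zero (x : (colimit (loopSeq.{u} a b)).obj (Rng.laurent.obj A))
    (he : (colimit (loopSeq.{u} a b)).map (evNat.app A) x = 0)
    (hl : (colimit (loopSeq.{u} a b)).map (lamNat.app A) x = 0) : x = 0 := by
  obtain ⟨k, z, rfl⟩ := colimit_exists_rep _ _ x
  rw [colimit_map_ι] at he hl
  obtain ⟨m, hm, he⟩ := colimit_eq_zero he
  obtain ⟨n, hn, hl⟩ := colimit_eq_zero hl
  have he := he _ (le_max_left m n)
  have hl := hl _ (le_max_right m n)
  rw [map_app_map] at he hl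
  have h := hm.trans (le_max_left m n)
  obtain ⟨w, hw⟩ := ((isTriple_self (Y := A)).iter (e := evNat.app A) (l := lamNat.app A)
    (a + max m n) (b + max m n)).exists_path
    (z := ((loopSeq.{u} a b).map (homOfLE h)).app (Rng.laurent.obj A) z) he hl
  have h1 := suspLoopExt_bdry_eq_zero ((iter Rng.loop (a + max m n)).obj (Rng.laurent.obj A))
    (b + max m n) w
  have h2 : ((loopSeq.{u} a b).map (homOfLE ((max m n).le_add_right 1))).app (Rng.laurent.obj A)
      (((loopSeq.{u} a b).map (homOfLE h)).app (Rng.laurent.obj A) z) = 0 := by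
    rw [loopSeq_map_succ]
    exact (congrArg _ hw.symm).trans h1
  rw [← colimit_map_rep h z, ← colimit_map_rep ((max m n).le_add_right 1), h2]
  exact map_zero ((colimit.ι (loopSeq.{u} a b) _).app (Rng.laurent.obj A)).hom

theorem isSplit_sigmaNat (i j : ℕ) :
    IsSplit (Rng.hom ((iter Rng.susp j).map ((iter Rng.loop i).map (sigmaNat.app A))))
      (Rng.hom ((iter Rng.susp j).map ((iter Rng.loop i).map (evNat.app A))))
      (Rng.hom ((iter Rng.susp j).map ((iter Rng.loop i).map
        (Y := Rng.laurent.obj A) (coeffLaurent A).const))) :=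
  (isSplit_sigma (A := A)).iter (p := evNat.app A) (i := sigmaNat.app A)
    (s := (coeffLaurent A).const) i j

theorem ev_sigma_eq_zero (x : (colimit (loopSeq.{u} a b)).obj (Rng.sigma.obj A)) :
    (colimit (loopSeq.{u} a b)).map (evNat.app A)
      ((colimit (loopSeq.{u} a b)).map (sigmaNat.app A) x) = 0 := by
  obtain ⟨k, z, rfl⟩ := colimit_exists_rep _ _ x
  rw [colimit_map_ι, colimit_map_ι]
  have h : ((loopSeq.{u} a b).obj k).map (evNat.app A)
      (((loopSeq.{u} a b).obj k).map (sigmaNat.app A) z) = 0 := by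
    refine (K0nu.map_comp_apply _ _ _).trans ((DFunLike.congr_fun (congrArg K0nu.map
      (isSplit_sigmaNat (A := A) (a + k) (b + k)).map_comp_eq_zero) z).trans ?_)
    rw [K0nu.map_zero]
    rfl
  rw [h]
  exact map_zero ((colimit.ι (loopSeq.{u} a b) k).app A).hom

theorem colimit_sigma_eq_zero (x : (colimit (loopSeq.{u} a b)).obj (Rng.sigma.obj A))
    (h : (colimit (loopSeq.{u} a b)).map (sigmaNat.app A) x = 0) : x = 0 := by
  obtain ⟨k, z, rfl⟩ := colimit_exists_rep _ _ x
  rw [colimit_map_ι] at h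
  obtain ⟨m, hm, h⟩ := colimit_eq_zero h
  have h := h m le_rfl
  rw [map_app_map] at h
  rw [← colimit_map_rep hm z, (injective_iff_map_eq_zero (K0nu.map _)).1
    (isSplit_sigmaNat (A := A) (a + m) (b + m)).map_injective _ h]
  exact map_zero ((colimit.ι (loopSeq.{u} a b) m).app (Rng.sigma.obj A)).hom

theorem exists_colimit_sigma (y : (colimit (loopSeq.{u} a b)).obj (Rng.laurent.obj A))
    (h : (colimit (loopSeq.{u} a b)).map (evNat.app A) y = 0) :
    ∃ x, (colimit (loopSeq.{u} a b)).map (sigmaNat.app A) x = y := by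
  obtain ⟨k, z, rfl⟩ := colimit_exists_rep _ _ y
  rw [colimit_map_ι] at h
  obtain ⟨m, hm, h⟩ := colimit_eq_zero h
  have h := h m le_rfl
  rw [map_app_map] at h
  obtain ⟨x, hx⟩ := (isSplit_sigmaNat (A := A) (a + m) (b + m)).exists_map h
  refine ⟨(colimit.ι (loopSeq.{u} a b) m).app (Rng.sigma.obj A) x, ?_⟩
  rw [← colimit_map_rep hm z]
  exact (colimit_map_ι _ _ _).trans
    (congrArg ((colimit.ι (loopSeq.{u} a b) m).app (Rng.laurent.obj A)) hx)

variable (a b)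

theorem nonempty_laurent_iso :
    Nonempty (Rng.laurent.{u} ⋙ colimit (loopSeq.{u} a b) ≅
      colimit (loopSeq.{u} a b) ⊞ (Rng.susp ⋙ colimit (loopSeq.{u} a b))) :=
  nonempty_iso_biprod (Functor.whiskerRight evNat (colimit (loopSeq.{u} a b)))
    (Functor.whiskerRight lamNat (colimit (loopSeq.{u} a b)))
    (fun _ x => colimit_laurent_eq_zero x) fun _ x y => exists_colimit_laurent a b x y

/-- Split exactness identifies the contribution of `σA` with the kernel of `ev₁`, and the
bijectivity of `(ev₁, λ)` makes `λ` an isomorphism on that kernel. -/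
theorem nonempty_sigma_iso :
    Nonempty (Rng.sigma.{u} ⋙ colimit (loopSeq.{u} a b) ≅ Rng.susp ⋙ colimit (loopSeq.{u} a b)) := by
  have : IsIso (Functor.whiskerRight (sigmaNat ≫ lamNat) (colimit (loopSeq.{u} a b))) := by
    rw [NatTrans.isIso_iff_isIso_app]
    intro A
    rw [ConcreteCategory.isIso_iff_bijective]
    have h : ∀ x, (Functor.whiskerRight (sigmaNat ≫ lamNat) (colimit (loopSeq.{u} a b))).app A x =
        (colimit (loopSeq.{u} a b)).map (lamNat.app A)
          ((colimit (loopSeq.{u} a b)).map (sigmaNat.app A) x) := fun x => by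
      rw [← ConcreteCategory.comp_apply, ← Functor.map_comp]
      rfl
    constructor
    · refine (injective_iff_map_eq_zero
        ((Functor.whiskerRight (sigmaNat ≫ lamNat) (colimit (loopSeq.{u} a b))).app A).hom).2
          fun x hx => colimit_sigma_eq_zero x (colimit_laurent_eq_zero _ (ev_sigma_eq_zero x) ?_)
      exact (h x).symm.trans hx
    · intro y
      obtain ⟨z, h1, h2⟩ := exists_colimit_laurent a b (0 : (colimit (loopSeq.{u} a b)).obj A) y
      obtain ⟨x, rfl⟩ := exists_colimit_sigma z h1
      exact ⟨x, (h x).trans h2⟩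
  exact ⟨asIso (Functor.whiskerRight (sigmaNat ≫ lamNat) (colimit (loopSeq.{u} a b)))⟩

end Stages

end HomotopyK

end

section

namespace HomotopyK

open Limits

/-! ### Interchange of suspension with loops and paths -/

section LoopSusp

/-- The isomorphism `Ω Σ A ≅ Σ Ω A`. -/
noncomputable def loopSuspEquiv (A : Type u) [NonUnitalRing A] :
    loopRing (Susp A) ≃+* Susp (loopRing A) :=
  (coeffSusp A).swap (coeffLoop (Susp A)) (coeffLoop A) (coeffSusp (loopRing A))

/-- The isomorphism `P Σ A ≅ Σ P A`. -/
noncomputable def pathSuspEquiv (A : Type u) [NonUnitalRing A] :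
    pathRing (Susp A) ≃+* Susp (pathRing A) :=
  (coeffSusp A).swap (coeffPath (Susp A)) (coeffPath A) (coeffSusp (pathRing A))

theorem loopSuspEquiv_natural {A B : Type u} [NonUnitalRing A] [NonUnitalRing B] (f : A →ₙ+* B)
    (x : loopRing (Susp A)) : loopSuspEquiv B (loopRing.map (Susp.map f) x) =
      Susp.map (loopRing.map f) (loopSuspEquiv A x) := by
  refine DFunLike.congr_fun (Coeff.hom_ext₂ (coeffSusp A) (coeffLoop (Susp A))
    (f := ((loopSuspEquiv B : _ →ₙ+* Susp (loopRing B))).comp (loopRing.map (Susp.map f)))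
    (g := (Susp.map (loopRing.map f)).comp (loopSuspEquiv A : _ →ₙ+* Susp (loopRing A)))
      fun v w a => ?_) x
  change (coeffSusp B).swap (coeffLoop (Susp B)) (coeffLoop B) (coeffSusp (loopRing B))
    (loopRing.map (Susp.map f) _) = Susp.map (loopRing.map f)
      ((coeffSusp A).swap (coeffLoop (Susp A)) (coeffLoop A) (coeffSusp (loopRing A)) _)
  rw [loopRing.map_smul, Susp.map_smul, Coeff.swap_smul, Coeff.swap_smul, Susp.map_smul,
    loopRing.map_smul]

variable {A : Type u} [NonUnitalRing A]

/-- Together with `susp_proj_pathSuspEquiv` this identifies the loop extension of `Σ A` with the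
suspension of that of `A`. -/
theorem susp_incl_loopSuspEquiv (x : loopRing (Susp A)) :
    Susp.map (loopExt A).incl (loopSuspEquiv A x) =
      pathSuspEquiv A ((loopExt (Susp A)).incl x) := by
  refine DFunLike.congr_fun (Coeff.hom_ext₂ (coeffSusp A) (coeffLoop (Susp A))
    (f := (Susp.map (loopExt A).incl).comp (loopSuspEquiv A : _ →ₙ+* Susp (loopRing A)))
    (g := (pathSuspEquiv A : _ →ₙ+* Susp (pathRing A)).comp (loopExt (Susp A)).incl)
      fun v w a => ?_) x
  change Susp.map (loopExt A).incl
      ((coeffSusp A).swap (coeffLoop (Susp A)) (coeffLoop A) (coeffSusp (loopRing A)) _) =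
    (coeffSusp A).swap (coeffPath (Susp A)) (coeffPath A) (coeffSusp (pathRing A))
      ((loopExt (Susp A)).incl _)
  rw [loopExt_incl_smul, Coeff.swap_smul, Coeff.swap_smul, Susp.map_smul, loopExt_incl_smul]

theorem susp_proj_pathSuspEquiv (x : pathRing (Susp A)) :
    Susp.map (loopExt A).proj (pathSuspEquiv A x) = (loopExt (Susp A)).proj x :=
  pathRing_susp_proj x

end LoopSusp

/-! ### Suspension lowers the degree of `KH` by one -/

section Shift

/-- The isomorphism `Ω Σ ≅ Σ Ω` of functors. -/
noncomputable def loopSuspIso : Rng.susp.{u} ⋙ Rng.loop ≅ Rng.loop ⋙ Rng.susp :=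
  NatIso.ofComponents (fun A =>
    { hom := (loopSuspEquiv A : loopRing (Susp A) →ₙ+* Susp (loopRing A))
      inv := ((loopSuspEquiv A).symm : Susp (loopRing A) →ₙ+* loopRing (Susp A))
      hom_inv_id := NonUnitalRingHom.ext (loopSuspEquiv A).symm_apply_apply
      inv_hom_id := NonUnitalRingHom.ext (loopSuspEquiv A).apply_symm_apply })
    fun f => NonUnitalRingHom.ext (loopSuspEquiv_natural (Rng.hom f))

/-- The map `P Σ A → Σ P A`. -/
noncomputable def pathSuspMap (A : Rng.{u}) :
    (⟨pathRing (Susp A)⟩ : Rng.{u}) ⟶ Rng.susp.obj ⟨pathRing A⟩ :=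
  (pathSuspEquiv A : pathRing (Susp A) →ₙ+* Susp (pathRing A))

/-- The isomorphism `Ωⁱ Σ ≅ Σ Ωⁱ`. -/
noncomputable def iterLoopSuspIso :
    (i : ℕ) → (Rng.susp.{u} ⋙ iter Rng.loop i ≅ iter Rng.loop i ⋙ Rng.susp)
  | 0 => NatIso.ofComponents (fun _ => Iso.refl _)
  | i + 1 => Functor.isoWhiskerRight (iterLoopSuspIso i) Rng.loop ≪≫
      Functor.isoWhiskerLeft (iter Rng.loop i) loopSuspIso

/-- The isomorphism `Σʲ Σ ≅ Σ Σʲ`. -/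
noncomputable def iterSuspIso :
    (j : ℕ) → (Rng.susp.{u} ⋙ iter Rng.susp j ≅ iter Rng.susp j ⋙ Rng.susp)
  | 0 => NatIso.ofComponents (fun _ => Iso.refl _)
  | j + 1 => Functor.isoWhiskerRight (iterSuspIso j) Rng.susp

/-- The map `Σʲ X → Σʲ⁺¹ Y` induced by `X → Σ Y`. -/
noncomputable def suspUp (j : ℕ) {X Y : Rng.{u}} (f : X ⟶ Rng.susp.obj Y) :
    (iter Rng.susp j).obj X ⟶ (iter Rng.susp (j + 1)).obj Y :=
  (iter Rng.susp j).map f ≫ (iterSuspIso j).hom.app Y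

theorem suspUp_succ (j : ℕ) {X Y : Rng.{u}} (f : X ⟶ Rng.susp.obj Y) :
    suspUp (j + 1) f = Rng.susp.map (suspUp j f) :=
  (Rng.susp.map_comp _ _).symm

theorem suspUp_zero {X Y : Rng.{u}} (f : X ⟶ Rng.susp.obj Y) : suspUp 0 f = f :=
  Category.comp_id f

variable {Z Z' : Rng.{u}} (f : Z ⟶ Rng.susp.obj Z')

theorem suspLoopExt_incl_suspUp : (j : ℕ) → ∀ x, (suspLoopExt Z' (j + 1)).incl
    (Rng.hom (suspUp j (Rng.loop.map f ≫ loopSuspIso.hom.app Z')) x) =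
      Rng.hom (suspUp j (pathMap f ≫ pathSuspMap Z')) ((suspLoopExt Z j).incl x)
  | 0, x => by
    rw [suspUp_zero, suspUp_zero]
    exact (susp_incl_loopSuspEquiv (loopRing.map (Rng.hom f) x)).trans
      (congrArg (pathSuspEquiv Z') (loopExt_incl_natural (Rng.hom f) x))
  | j + 1, x => by
    rw [suspUp_succ, suspUp_succ]
    exact Ext.susp_incl_natural (suspLoopExt Z j) (suspLoopExt Z' (j + 1)) _ _
      (suspLoopExt_incl_suspUp j) x

theorem suspLoopExt_proj_suspUp : (j : ℕ) → ∀ x, (suspLoopExt Z' (j + 1)).proj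
    (Rng.hom (suspUp j (pathMap f ≫ pathSuspMap Z')) x) =
      Rng.hom (suspUp j f) ((suspLoopExt Z j).proj x)
  | 0, x => by
    rw [suspUp_zero, suspUp_zero]
    exact (susp_proj_pathSuspEquiv (pathRing.map (Rng.hom f) x)).trans
      (loopExt_proj_natural (Rng.hom f) x)
  | j + 1, x => by
    rw [suspUp_succ, suspUp_succ]
    exact Ext.susp_proj_natural (suspLoopExt Z j) (suspLoopExt Z' (j + 1)) _ _
      (suspLoopExt_proj_suspUp j) x

/-- This is naturality of the connecting map for a morphism of extensions. The additional suspension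
enters as the innermost one, through `Ω Σ ≅ Σ Ω` and `P Σ → Σ P`; no two suspensions are transposed,
so no sign appears. -/
theorem map_suspUp_bdry (j : ℕ) (x : K0nu ((iter Rng.susp j).obj Z)) :
    K0nu.map (Rng.hom (suspUp (j + 1) (Rng.loop.map f ≫ loopSuspIso.hom.app Z')))
      ((suspLoopExt Z j).bdry x) =
      (suspLoopExt Z' (j + 1)).bdry (K0nu.map (Rng.hom (suspUp j f)) x) := by
  rw [suspUp_succ]
  exact DFunLike.congr_fun ((suspLoopExt Z j).bdry_natural (suspLoopExt Z' (j + 1)) _ _ _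
    (suspLoopExt_incl_suspUp f j) (suspLoopExt_proj_suspUp f j)) x

/-- The isomorphism `K₋ⱼ Ωⁱ Σ ≅ K₋ⱼ₋₁ Ωⁱ`. -/
noncomputable def stageIso (i j : ℕ) : Rng.susp.{u} ⋙ stage i j ≅ stage i (j + 1) :=
  Functor.isoWhiskerRight (iterLoopSuspIso i) (negK j) ≪≫
    Functor.isoWhiskerLeft (iter Rng.loop i) (Functor.isoWhiskerRight (iterSuspIso j) Rng.K0)

theorem stageIso_apply (i j : ℕ) (A : Rng.{u})
    (x : K0nu ((iter Rng.susp j).obj ((iter Rng.loop i).obj (Rng.susp.obj A)))) :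
    (stageIso i j).hom.app A x =
      K0nu.map (Rng.hom (suspUp j ((iterLoopSuspIso i).hom.app A))) x :=
  K0nu.map_comp_apply _ _ _

theorem iterLoopSuspIso_succ (i : ℕ) (A : Rng.{u}) : (iterLoopSuspIso (i + 1)).hom.app A =
    Rng.loop.map ((iterLoopSuspIso i).hom.app A) ≫ loopSuspIso.hom.app ((iter Rng.loop i).obj A) :=
  rfl

theorem stageBdry_apply (i j : ℕ) (A : Rng.{u})
    (x : K0nu ((iter Rng.susp j).obj ((iter Rng.loop i).obj A))) :
    (stageBdry i j).app A x = (suspLoopExt ((iter Rng.loop i).obj A) j).bdry x := rfl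

theorem stageIso_natural_apply (i j : ℕ) (A : Rng.{u})
    (x : K0nu ((iter Rng.susp j).obj ((iter Rng.loop i).obj (Rng.susp.obj A)))) :
    (stageIso (i + 1) (j + 1)).hom.app A ((stageBdry i j).app (Rng.susp.obj A) x) =
      (stageBdry i (j + 1)).app A ((stageIso i j).hom.app A x) := by
  have h1 := stageIso_apply (i + 1) (j + 1) A
    ((suspLoopExt ((iter Rng.loop i).obj (Rng.susp.obj A)) j).bdry x)
  rw [iterLoopSuspIso_succ] at h1
  have h2 := map_suspUp_bdry ((iterLoopSuspIso i).hom.app A) j x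
  have h3 := stageBdry_apply i (j + 1) A
    (K0nu.map (Rng.hom (suspUp j ((iterLoopSuspIso i).hom.app A))) x)
  rw [stageBdry_apply, stageIso_apply i j]
  exact h1.trans (h2.trans h3.symm)

theorem stageIso_natural (i j : ℕ) :
    Functor.whiskerLeft Rng.susp.{u} (stageBdry i j) ≫ (stageIso (i + 1) (j + 1)).hom =
      (stageIso i j).hom ≫ stageBdry i (j + 1) :=
  NatTrans.ext (funext fun A => AddCommGrpCat.hom_ext (AddMonoidHom.ext
    fun x => stageIso_natural_apply i j A x))

/-- Sums such as `b + 1 + k` and `b + k + 1` index equal stages; the connecting maps commute with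
the resulting identifications. -/
theorem comp_eqToHom_succ {C : Type u} [Category.{v} C] (X : ℕ → ℕ → C)
    (δ : ∀ i j, X i j ⟶ X (i + 1) (j + 1)) {i i' j j' : ℕ} (hi : i = i') (hj : j = j') :
    δ i j ≫ eqToHom (congrArg₂ X (congrArg Nat.succ hi) (congrArg Nat.succ hj)) =
      eqToHom (congrArg₂ X hi hj) ≫ δ i' j' := by
  subst hi hj
  rw [eqToHom_refl, eqToHom_refl, Category.id_comp, Category.comp_id]

/-- The isomorphism `K₋ⱼ Ωⁱ Σ ≅ K₋ⱼ₋₁ Ωⁱ` in the sequence of `(a, b)`. -/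
noncomputable def loopSeqIso (a b k : ℕ) :
    Rng.susp.{u} ⋙ stage (a + k) (b + k) ≅ stage (a + k) (b + 1 + k) :=
  stageIso (a + k) (b + k) ≪≫ eqToIso (congrArg₂ stage rfl (Nat.add_right_comm b k 1))

theorem loopSeqIso_natural (a b k : ℕ) :
    Functor.whiskerLeft Rng.susp.{u} (stageBdry (a + k) (b + k)) ≫ (loopSeqIso a b (k + 1)).hom =
      (loopSeqIso a b k).hom ≫ stageBdry (a + k) (b + 1 + k) := by
  have h := comp_eqToHom_succ stage.{u} stageBdry (Eq.refl (a + k)) (Nat.add_right_comm b k 1)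
  have h1 : (loopSeqIso.{u} a b (k + 1)).hom = (stageIso (a + k + 1) (b + k + 1)).hom ≫
    eqToHom (congrArg₂ stage rfl (congrArg Nat.succ (Nat.add_right_comm b k 1))) := rfl
  have h2 : (loopSeqIso.{u} a b k).hom = (stageIso (a + k) (b + k)).hom ≫
    eqToHom (congrArg₂ stage rfl (Nat.add_right_comm b k 1)) := rfl
  rw [h1, h2, Category.assoc, ← h, ← Category.assoc, stageIso_natural, Category.assoc]

theorem nonempty_susp_colimit_iso (a b : ℕ) : Nonempty
    (Rng.susp.{u} ⋙ colimit (loopSeq.{u} a b) ≅ colimit (loopSeq.{u} a (b + 1))) := by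
  let W := (Functor.whiskeringLeft _ _ AddCommGrpCat.{u}).obj Rng.susp.{u}
  have e := preservesColimitIso W (loopSeq.{u} a b)
  have hi : ∀ k, IsIso (loopSeqIso.{u} a b k).hom := fun _ => inferInstance
  obtain ⟨e'⟩ := @nonempty_colimit_iso_of_isIso _ _ _ (loopSeq.{u} a b ⋙ W)
    (loopSeq.{u} a (b + 1)) (fun k => (loopSeqIso a b k).hom) hi fun k => by
      rw [loopSeq_map_succ, Functor.comp_map, loopSeq_map_succ]
      exact loopSeqIso_natural a b k
  exact ⟨e ≪≫ e'⟩

/-- Dropping the first term does not change the colimit: the connecting maps and the identifications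
of stages interleave the two sequences. -/
theorem nonempty_colimit_succ_iso (a b : ℕ) : Nonempty
    (colimit (loopSeq.{u} a b) ≅ colimit (loopSeq.{u} (a + 1) (b + 1))) := by
  have h : ∀ k, stage.{u} (a + k + 1) (b + k + 1) = stage (a + 1 + k) (b + 1 + k) := fun k =>
    congrArg₂ stage (Nat.add_right_comm a k 1) (Nat.add_right_comm b k 1)
  refine nonempty_colimit_iso (loopSeq.{u} a b) (loopSeq.{u} (a + 1) (b + 1))
    (fun k => stageBdry (a + k) (b + k) ≫ eqToHom (h k)) (fun k => eqToHom (h k).symm)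
    (fun k => ?_) fun k => ?_
  · rw [loopSeq_map_succ]
    refine (Category.assoc _ _ _).trans ?_
    exact (congrArg (stageBdry (a + k) (b + k) ≫ ·) (eqToHom_trans (h k) (h k).symm)).trans
      (Category.comp_id _)
  · rw [loopSeq_map_succ]
    have h1 := comp_eqToHom_succ stage.{u} stageBdry (Nat.add_right_comm a k 1)
      (Nat.add_right_comm b k 1)
    refine (congrArg (eqToHom (h k).symm ≫ ·) h1).trans ?_
    rw [eqToHom_trans_assoc, eqToHom_refl, Category.id_comp]

theorem KH_eq_colimit (n : ℤ) : KH.{u} n = colimit (loopSeq.{u} n.toNat (-n).toNat) := rfl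

/-- For `n ≤ 0` one more suspension gives exactly the sequence defining `KHₙ₋₁`. For `n > 0` it
gives the sequence starting at `(n, 1)`, which is the one defining `KHₙ₋₁`, starting at `(n - 1,
0)`, without its first term. -/
theorem nonempty_susp_KH_iso (n : ℤ) : Nonempty (Rng.susp.{u} ⋙ KH.{u} n ≅ KH.{u} (n - 1)) := by
  rw [KH_eq_colimit, KH_eq_colimit]
  obtain ⟨e⟩ := nonempty_susp_colimit_iso.{u} n.toNat (-n).toNat
  rcases le_or_gt n 0 with h | h
  · rw [show (n - 1).toNat = n.toNat by omega, show (-(n - 1)).toNat = (-n).toNat + 1 by omega]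
    exact ⟨e⟩
  · obtain ⟨e'⟩ := nonempty_colimit_succ_iso.{u} (n - 1).toNat (-n).toNat
    rw [show (-(n - 1)).toNat = (-n).toNat by omega]
    rw [show (n - 1).toNat + 1 = n.toNat by omega] at e'
    exact ⟨e ≪≫ e'.symm⟩

end Shift

end HomotopyK

end

/-! ### The fundamental theorem -/

theorem mainTheorem8 (n : ℤ) :
    Nonempty (HomotopyK.Rng.sigma.{u} ⋙ HomotopyK.KH.{u} n ≅ HomotopyK.KH.{u} (n - 1)) ∧
    Nonempty (HomotopyK.Rng.laurent.{u} ⋙ HomotopyK.KH.{u} n ≅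
      HomotopyK.KH.{u} n ⊞ HomotopyK.KH.{u} (n - 1)) := by
  obtain ⟨e⟩ := HomotopyK.nonempty_susp_KH_iso.{u} n
  obtain ⟨e₁⟩ := HomotopyK.nonempty_sigma_iso.{u} n.toNat (-n).toNat
  obtain ⟨e₂⟩ := HomotopyK.nonempty_laurent_iso.{u} n.toNat (-n).toNat
  exact ⟨⟨e₁ ≪≫ e⟩, ⟨e₂ ≪≫ Limits.biprod.mapIso (Iso.refl _) e⟩⟩
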